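/- Let $G=(V,E)$ be a finite simple graph with $n\ge 1$ vertices. A path decomposition of $G$ is a sequence of $2n$ nodes $(p_1,t_1),\dots,(p_{2n},t_{2n})$ with $p_j\in V$, $t_j\in\{+1,-1\}$, in which every vertex $v$ occurs exactly twice, first with $t_j=+1$ ($v$ is introduced) and later with $t_j=-1$ ($v$ is forgotten), and such that the two ends of every edge lie together in some bag; here the bags are $B_0=\emptyset$, $B_j=B_{j-1}\cup\{p_j\}$ if $t_j=+1$, and $B_j=B_{j-1}\setminus\{p_j\}$ if $t_j=-1$. Its width is $\max_j |B_j|-1$, and the path-width of $G$ is the minimum width of a path decomposition of $G$. There is an algorithm which, given $G$ (by adjacency lists), an integer $k\ge 0$, and a path decomposition $P$ of $G$ of width $\ell$, where $\ell=2^{O(k)}$, decides in time $2^{O(\ell k)}\,n$ whether the path-width of $G$ is at most $k$, and, if so, outputs within the same time bound a path decomposition of $G$ of width at most $k$. In detail: there is one word-RAM program such that for every $c$ there is a $C$ such that for all $n\ge1$, $k\ge0$ and all inputs $G,k,P$ with $\ell\le c\,2^{ck}$, the program halts with the correct output after at most $T=C\,2^{C\ell k}\,n$ unit-cost steps, and no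 number larger than $T+k$ occurs in the computation (that is, machine words of $O(\ell k+\log n+\log (k+2))$ bits suffice). -/

import Mathlib

/-! ### Path decompositions

A path decomposition of a graph on the vertices `0, …, n - 1` is given by its sequence of introduce
and forget nodes. -/

/-- A node `(p, t)`: the vertex `p` is introduced if `t = true`, and forgotten if `t = false`. -/
abbrev Node (n : ℕ) : Type := Fin n × Bool

/-- The effect of a node on the current bag. -/
def Node.apply {n : ℕ} (B : Finset (Fin n)) (x : Node n) : Finset (Fin n) :=
  if x.2 then insert x.1 B else B.erase x.1

/-- The bag `B_j` of the `j`-th node (`1 ≤ j ≤ P.length`); `B_0` is empty. -/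
def bag {n : ℕ} (P : List (Node n)) (j : ℕ) : Finset (Fin n) :=
  (P.take j).foldl Node.apply ∅

/-- `P` is a path decomposition of `G`: every vertex occurs exactly twice in `P`, first being
introduced and later being forgotten (so `P` has `2 n` nodes), and the ends of every edge occur
together in some bag. -/
structure IsPathDecomposition {n : ℕ} (G : SimpleGraph (Fin n)) (P : List (Node n)) : Prop where
  occurrences : ∀ v : Fin n, P.filter (fun x => x.1 = v) = [(v, true), (v, false)]
  edges : ∀ u v : Fin n, G.Adj u v → ∃ j : ℕ, u ∈ bag P j ∧ v ∈ bag P j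

/-- The width of a path decomposition: the largest bag size minus one
(for `n ≥ 1` the largest bag is not empty). -/
def width {n : ℕ} (P : List (Node n)) : ℕ :=
  (Finset.range (P.length + 1)).sup (fun j => (bag P j).card) - 1

/-- The path-width: the minimum width of a path decomposition. -/
noncomputable def pathWidth {n : ℕ} (G : SimpleGraph (Fin n)) : ℕ :=
  sInf {w : ℕ | ∃ P : List (Node n), IsPathDecomposition G P ∧ width P = w}

/-! ### Random access machines

Programs of a word RAM in structured form. A state consists of registers and of arrays, which are
addressed indirectly; a program names only finitely many of them. Every operation takes unit time,
and a number occurring in a computation must not exceed the largest machine word `W`. -/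

namespace RAM

/-- A state: `reg i` is the contents of register `i`, and `mem a i` is entry `i` of array `a`. -/
structure State where
  reg : ℕ → ℕ
  mem : ℕ → ℕ → ℕ

/-- The arithmetic operations and comparisons. -/
inductive Op
  | add | sub | mul | div | mod | lt | eq

/-- The value of an operation (subtraction is truncated at `0`; comparisons give `0` or `1`). -/
def Op.eval : Op → ℕ → ℕ → ℕ
  | .add, x, y => x + y
  | .sub, x, y => x - y
  | .mul, x, y => x * y
  | .div, x, y => x / y
  | .mod, x, y => x % y
  | .lt, x, y => if x < y then 1 else 0
  | .eq, x, y => if x = y then 1 else 0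

/-- Expressions: constants, registers, array entries, operations. -/
inductive Expr
  | lit (c : ℕ)
  | reg (i : ℕ)
  | cell (a : ℕ) (idx : Expr)
  | op (o : Op) (e₁ e₂ : Expr)

/-- The value of an expression. -/
def Expr.eval (s : State) : Expr → ℕ
  | .lit c => c
  | .reg i => s.reg i
  | .cell a idx => s.mem a (idx.eval s)
  | .op o e₁ e₂ => o.eval (e₁.eval s) (e₂.eval s)

/-- The time for evaluating an expression: one step for each constant, each register access,
each array access and each operation. -/
def Expr.cost : Expr → ℕ
  | .lit _ => 1
  | .reg _ => 1
  | .cell _ idx => idx.cost + 1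
  | .op _ e₁ e₂ => e₁.cost + e₂.cost + 1

/-- All numbers that occur in the evaluation of the expression are at most `W`. -/
def Expr.Fits (W : ℕ) (s : State) : Expr → Prop
  | .lit c => c ≤ W
  | .reg i => s.reg i ≤ W
  | .cell a idx => idx.Fits W s ∧ s.mem a (idx.eval s) ≤ W
  | .op o e₁ e₂ => e₁.Fits W s ∧ e₂.Fits W s ∧ o.eval (e₁.eval s) (e₂.eval s) ≤ W

/-- Programs. A condition counts as true if its value is not `0`. -/
inductive Program
  | skip
  | setReg (i : ℕ) (e : Expr)
  | setCell (a : ℕ) (idx e : Expr)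
  | seq (p q : Program)
  | cond (e : Expr) (p q : Program)
  | loop (e : Expr) (p : Program)

/-- `Exec W p s t s'`: on a machine with largest word `W`, the program `p` started in state `s`
halts after exactly `t` steps in state `s'`, without ever exceeding the word size. Here
`loop e p` repeats `p` as long as `e` is true. -/
inductive Exec (W : ℕ) : Program → State → ℕ → State → Prop
  | skip (s : State) : Exec W .skip s 1 s
  | setReg (s : State) (i : ℕ) (e : Expr) (he : e.Fits W s) :
      Exec W (.setReg i e) s (e.cost + 1) ⟨Function.update s.reg i (e.eval s), s.mem⟩
  | setCell (s : State) (a : ℕ) (idx e : Expr) (hi : idx.Fits W s) (he : e.Fits W s) :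
      Exec W (.setCell a idx e) s (idx.cost + e.cost + 1)
        ⟨s.reg, Function.update s.mem a (Function.update (s.mem a) (idx.eval s) (e.eval s))⟩
  | seq {p q : Program} {s s₁ s₂ : State} {t₁ t₂ : ℕ}
      (h₁ : Exec W p s t₁ s₁) (h₂ : Exec W q s₁ t₂ s₂) : Exec W (.seq p q) s (t₁ + t₂) s₂
  | condTrue {e : Expr} {p q : Program} {s s₁ : State} {t : ℕ} (he : e.Fits W s)
      (h0 : e.eval s ≠ 0) (h : Exec W p s t s₁) : Exec W (.cond e p q) s (e.cost + 1 + t) s₁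
  | condFalse {e : Expr} {p q : Program} {s s₁ : State} {t : ℕ} (he : e.Fits W s)
      (h0 : e.eval s = 0) (h : Exec W q s t s₁) : Exec W (.cond e p q) s (e.cost + 1 + t) s₁
  | loopTrue {e : Expr} {p : Program} {s s₁ s₂ : State} {t₁ t₂ : ℕ} (he : e.Fits W s)
      (h0 : e.eval s ≠ 0) (h₁ : Exec W p s t₁ s₁) (h₂ : Exec W (.loop e p) s₁ t₂ s₂) :
      Exec W (.loop e p) s (e.cost + 1 + t₁ + t₂) s₂
  | loopFalse {e : Expr} {p : Program} {s : State} (he : e.Fits W s) (h0 : e.eval s = 0) :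
      Exec W (.loop e p) s (e.cost + 1) s

end RAM

/-! ### Input and output -/

/-- `nbrs v` lists the neighbours of `v`, without repetition and in an arbitrary order. -/
def IsAdjacencyLists {n : ℕ} (G : SimpleGraph (Fin n)) (nbrs : Fin n → List (Fin n)) : Prop :=
  ∀ v : Fin n, (nbrs v).Nodup ∧ ∀ w : Fin n, w ∈ nbrs v ↔ G.Adj v w

/-- The adjacency lists, concatenated. -/
def adjacencyArray {n : ℕ} (nbrs : Fin n → List (Fin n)) : List ℕ :=
  (List.ofFn nbrs).flatten.map (fun w => (w : ℕ))

/-- The positions in the concatenation where the list of vertex `0, …, n - 1` begins, and, as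
entry `n`, the total length. -/
def startArray {n : ℕ} (nbrs : Fin n → List (Fin n)) : List ℕ :=
  (List.range (n + 1)).map (fun v => ((List.ofFn nbrs).take v).flatten.length)

/-- The vertices `p_1, …, p_{2n}` of the nodes. -/
def vertexArray {n : ℕ} (P : List (Node n)) : List ℕ := P.map (fun x => (x.1 : ℕ))

/-- The types of the nodes: `1` for an introduce node, `0` for a forget node. -/
def typeArray {n : ℕ} (P : List (Node n)) : List ℕ := P.map (fun x => if x.2 then 1 else 0)

/-- The bag sizes `w_1 + 1, …, w_{2n} + 1` of the nodes. -/
def sizeArray {n : ℕ} (P : List (Node n)) : List ℕ :=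
  (List.range P.length).map (fun j => (bag P (j + 1)).card)

/-- The initial state: `n` and `k` in the registers `0` and `1`, the graph in the arrays `0` and
`1`, the path decomposition in the arrays `2`, `3` and `4`, and zeros everywhere else. -/
def inputState {n : ℕ} (nbrs : Fin n → List (Fin n)) (k : ℕ) (P : List (Node n)) : RAM.State where
  reg
    | 0 => n
    | 1 => k
    | _ => 0
  mem
    | 0 => fun i => (startArray nbrs).getD i 0
    | 1 => fun i => (adjacencyArray nbrs).getD i 0
    | 2 => fun i => (vertexArray P).getD i 0
    | 3 => fun i => (typeArray P).getD i 0
    | 4 => fun i => (sizeArray P).getD i 0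
    | _ => fun _ => 0

/-- Array `a` begins with the list `l`. -/
def RAM.State.Holds (s : RAM.State) (a : ℕ) (l : List ℕ) : Prop :=
  ∀ i : ℕ, i < l.length → s.mem a i = l.getD i 0

/-- The path decomposition `P` is written in the arrays `5`, `6` and `7`. -/
def Outputs {n : ℕ} (s : RAM.State) (P : List (Node n)) : Prop :=
  s.Holds 5 (vertexArray P) ∧ s.Holds 6 (typeArray P) ∧ s.Holds 7 (sizeArray P)

/-- The bound `2 ^ O(ℓ k) * n`, with the implied constant `C`. -/
def timeBound (C ℓ k n : ℕ) : ℕ := C * 2 ^ (C * (ℓ * k)) * n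

/-! The algorithm is dynamic programming along the given decomposition `P`, organised as a
reachability search. Suppose that `Q` is a path decomposition of width at most `k`, and restrict it
to the vertices introduced by the first `j` nodes of `P`. A vertex introduced later has neighbours
among these only in the current bag of `P` (`mem_bag_of_adj`). So all that matters about the
restriction is its sequence of bag sizes, with the places marked where the vertices of the current
bag enter and leave. Such a sequence may moreover be replaced by any sequence which dominates it and
is dominated by it: domination (`Dom`) means that the two can be traversed in parallel, the first
never exceeding the second and the marked events being passed together. It is transitive
(`Dom.trans`).

Compression. Between two marked events the sizes form a sequence of integers in `0, …, k + 1`.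
Values lying between two given values of the sequence can be dropped (`equi_drop`), which leaves a
zigzag that first widens up to the extreme values and then narrows. Two counters, of which one is
current, trace this zigzag with `O(k)` letters `inc`, `dec`, `swap` (`exists_shrinking_walk`,
`exists_walk`). With bags of `P` of size at most `m = ℓ + 1` there are at most `2 m` marked events,
so every restriction is described by a word of `O(ℓ k)` letters of five kinds, together with a slot
number, at most `m`, for each event (`exists_word`). There are `6 ^ O(ℓ k) * (m + 1) ^ O(m)` such
descriptions, and this is `2 ^ O(ℓ k)` because `log ℓ = O(k)`.

The machine. In pass `j` a nondeterministic machine reads a word for the vertices seen so far,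
letter by letter, and writes a guessed word for the next stage, comparing only the current counters
of the two words: the old size, plus one while the new vertex is present, must not exceed the new
size, and the new size must not exceed `k + 1`. A neighbour of the new vertex must not leave before
that vertex enters, nor enter after it has left. A configuration consists of twelve numbers, it has
boundedly many successors, and there are `2 ^ O(ℓ k) * n` configurations. They are explored
exhaustively from the initial one, and a configuration in which all passes are done is accepting.

Completeness (`exists_accepting_run`): the restrictions of `Q` for consecutive `j` dominate each
other appropriately (`dom_introduce`, `gapSeq_forget`); by transitivity so do their words, and
`Dom.run` turns this domination into a pass. Soundness (`Sound.step`, `Sound.isPathDecomposition`):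
a run can be accompanied by a list of events in which every letter of the words has an entry. Each
move changes this list locally, the counters always bound the true bags, and at the end the list
spells a path decomposition of width at most `k`.

The output is found by following predecessors from an accepting configuration and repeating the
moves on a doubly threaded linked list, in constant time each. The programs are verified with a
Hoare logic that counts steps; word sizes are controlled by tracking the degree in `n` of every
stored number and bounding the rest by powers of a parameter `X`. -/

/-! ### A logic for word RAM programs -/

namespace RAM

/-- Degree (in `n`) of the numbers that may occur in a register. -/
def regDeg (i : ℕ) : ℕ := if i = 0 ∨ (60 ≤ i ∧ i < 80) ∨ i = 100 ∨ i = 120 then 1 else 0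

/-- Degree (in `n`) of the numbers that may occur in an array. -/
def memDeg (a : ℕ) : ℕ :=
  if a < 3 ∨ a = 5 ∨ (11 ≤ a ∧ a < 16) ∨ a = 17 ∨ a = 40 then 1 else 0

/-- Degree (in `n`) of the value of an expression. -/
def Expr.deg : Expr → ℕ
  | .lit _ => 0
  | .reg i => regDeg i
  | .cell a _ => memDeg a
  | .op .mul a b => a.deg + b.deg
  | .op .add a b => max a.deg b.deg
  | .op .lt _ _ => 0
  | .op .eq _ _ => 0
  | .op .sub a _ => a.deg
  | .op .div a _ => a.deg
  | .op .mod a _ => a.deg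

/-- All subexpressions have degree at most one, and constants are small. -/
def Expr.linear : Expr → Bool
  | .lit c => c ≤ 16
  | .reg _ => true
  | .cell _ e => e.linear && e.deg ≤ 1
  | .op o a b => a.linear && b.linear && a.deg ≤ 1 && b.deg ≤ 1 && (Expr.op o a b).deg ≤ 1

/-- The syntactic condition under which the word size is respected automatically. -/
def Expr.tame (e : Expr) : Bool := e.linear && e.deg ≤ 1 && e.cost ≤ 200

def Program.tame : Program → Bool
  | .skip => true
  | .setReg _ e => e.tame
  | .setCell _ i e => i.tame && e.tame
  | .seq p q => p.tame && q.tame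
  | .cond e p q => e.tame && p.tame && q.tame
  | .loop e p => e.tame && p.tame

def Program.writesReg : Program → ℕ → Bool
  | .skip, _ => false
  | .setReg j _, i => i == j
  | .setCell _ _ _, _ => false
  | .seq p q, i => p.writesReg i || q.writesReg i
  | .cond _ p q, i => p.writesReg i || q.writesReg i
  | .loop _ p, i => p.writesReg i

def Program.writesMem : Program → ℕ → Bool
  | .skip, _ => false
  | .setReg _ _, _ => false
  | .setCell b _ _, a => a == b
  | .seq p q, i => p.writesMem i || q.writesMem i
  | .cond _ p q, i => p.writesMem i || q.writesMem i
  | .loop _ p, i => p.writesMem i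

/-- A bound for the running time of a program without loops. -/
def Program.cost : Program → ℕ
  | .skip => 1
  | .setReg _ e => e.cost + 1
  | .setCell _ i e => i.cost + e.cost + 1
  | .seq p q => p.cost + q.cost
  | .cond e p q => e.cost + 1 + max p.cost q.cost
  | .loop e p => e.cost + 1 + p.cost

/-- All registers and array entries are bounded according to their degree. -/
structure Bdd (n X : ℕ) (s : State) : Prop where
  reg : ∀ i, s.reg i ≤ n ^ regDeg i * X
  mem : ∀ a i, s.mem a i ≤ n ^ memDeg a * X

/-- The word size `W` suffices for tame expressions in states bounded by `n` and `X`. -/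
structure Roomy (n X W : ℕ) : Prop where
  one_le : 1 ≤ n
  le_X : 16 ≤ X
  le_W : n * X ^ 200 ≤ W

/-- The registers and arrays which `p` does not write are the same in both states. -/
structure Frame (p : Program) (s s' : State) : Prop where
  reg : ∀ i, p.writesReg i = false → s'.reg i = s.reg i
  mem : ∀ a, p.writesMem a = false → s'.mem a = s.mem a

theorem Expr.one_le_cost (e : Expr) : 1 ≤ e.cost := by
  cases e <;> simp [Expr.cost]

/-- Each unit of cost pays for one factor `X`. Constants are at most `16 ≤ X`; a sum at most doubles
the larger bound, which the factor for the operation itself absorbs; only products add degrees in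
`n`. -/
theorem Expr.eval_le {n X : ℕ} (hn : 1 ≤ n) (hX : 16 ≤ X) {s : State} (e : Expr)
    (hr : ∀ i, s.reg i ≤ n ^ regDeg i * X) (hm : ∀ a i, s.mem a i ≤ n ^ memDeg a * X)
    (he : e.linear) : e.eval s ≤ n ^ e.deg * X ^ e.cost := by
  have hX0 : 0 < X := by omega
  induction e with
  | lit c =>
    simp only [Expr.linear, decide_eq_true_eq] at he
    simp only [Expr.eval, Expr.deg, Expr.cost]; simp; omega
  | reg i => simpa [Expr.eval, Expr.deg, Expr.cost] using hr i
  | cell a e ih =>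
    refine (hm a _).trans ?_
    simp only [Expr.deg, Expr.cost]
    exact Nat.mul_le_mul_left _ (Nat.le_self_pow (by omega) X)
  | op o a b iha ihb =>
    simp only [Expr.linear, Bool.and_eq_true, decide_eq_true_eq] at he
    have h1 := iha he.1.1.1.1
    have h2 := ihb he.1.1.1.2
    have ca := a.one_le_cost
    have cb := b.one_le_cost
    have hmono : ∀ {d d' c c' : ℕ}, d ≤ d' → c ≤ c' → n ^ d * X ^ c ≤ n ^ d' * X ^ c' :=
      fun hd hc => Nat.mul_le_mul (Nat.pow_le_pow_right hn hd) (Nat.pow_le_pow_right hX0 hc)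
    have hone : ∀ d c, 1 ≤ n ^ d * X ^ c := fun d c => Nat.mul_pos (by positivity) (by positivity)
    cases o <;> simp only [Expr.eval, Op.eval, Expr.deg, Expr.cost]
    · have h1' : a.eval s ≤ n ^ max a.deg b.deg * X ^ (a.cost + b.cost) :=
        h1.trans (hmono (le_max_left _ _) (by omega))
      have h2' : b.eval s ≤ n ^ max a.deg b.deg * X ^ (a.cost + b.cost) :=
        h2.trans (hmono (le_max_right _ _) (by omega))
      rw [pow_succ]
      calc _ ≤ n ^ max a.deg b.deg * X ^ (a.cost + b.cost) * 2 := by omega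
        _ ≤ n ^ max a.deg b.deg * X ^ (a.cost + b.cost) * X := Nat.mul_le_mul_left _ (by omega)
        _ = _ := by ring
    · exact (Nat.sub_le _ _).trans (h1.trans (hmono le_rfl (by omega)))
    · calc _ ≤ (n ^ a.deg * X ^ a.cost) * (n ^ b.deg * X ^ b.cost) := Nat.mul_le_mul h1 h2
        _ = n ^ (a.deg + b.deg) * X ^ (a.cost + b.cost) := by ring
        _ ≤ _ := hmono le_rfl (by omega)
    · exact (Nat.div_le_self _ _).trans (h1.trans (hmono le_rfl (by omega)))
    · exact (Nat.mod_le _ _).trans (h1.trans (hmono le_rfl (by omega)))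
    · split_ifs <;> [exact hone 0 _; exact Nat.zero_le _]
    · split_ifs <;> [exact hone 0 _; exact Nat.zero_le _]

/-- Every subexpression inherits degree at most one and cost at most `200`, so its value is at most
`n * X ^ 200`, whatever the expression computes. -/
theorem Expr.linear.fits {n X W : ℕ} (h : Roomy n X W) {s : State} (hs : Bdd n X s) (e : Expr)
    (he : e.linear) (hd : e.deg ≤ 1) (hc : e.cost ≤ 200) : e.Fits W s := by
  have key : ∀ e : Expr, e.linear → e.deg ≤ 1 → e.cost ≤ 200 → e.eval s ≤ W := by
    intro e he hd hc
    refine (e.eval_le h.one_le h.le_X hs.reg hs.mem he).trans (le_trans ?_ h.le_W)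
    refine Nat.mul_le_mul ?_ (Nat.pow_le_pow_right (by have := h.le_X; omega) hc)
    calc n ^ e.deg ≤ n ^ 1 := Nat.pow_le_pow_right h.one_le hd
      _ = n := pow_one n
  induction e with
  | lit c => exact key _ he hd hc
  | reg i => exact key (.reg i) he hd hc
  | cell a e ih =>
    have he' := he
    simp only [Expr.linear, Bool.and_eq_true, decide_eq_true_eq] at he'
    simp only [Expr.cost] at hc
    exact ⟨ih he'.1 he'.2 (by omega), key (.cell a e) he hd (by simp [Expr.cost]; omega)⟩
  | op o a b iha ihb =>
    have he' := he
    simp only [Expr.linear, Bool.and_eq_true, decide_eq_true_eq] at he'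
    simp only [Expr.cost] at hc
    exact ⟨iha he'.1.1.1.1 he'.1.1.2 (by omega), ihb he'.1.1.1.2 he'.1.2 (by omega),
      key (.op o a b) he hd (by simp [Expr.cost]; omega)⟩

theorem Expr.tame.fits {n X W : ℕ} (h : Roomy n X W) {s : State} (hs : Bdd n X s) {e : Expr}
    (he : e.tame) : e.Fits W s := by
  simp only [Expr.tame, Bool.and_eq_true, decide_eq_true_eq] at he
  exact Expr.linear.fits h hs e he.1.1 he.1.2 he.2

theorem Frame.refl (p : Program) (s : State) : Frame p s s := ⟨fun _ _ => rfl, fun _ _ => rfl⟩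

theorem Exec.frame {W : ℕ} {p : Program} {s s' : State} {t : ℕ} (h : Exec W p s t s') :
    Frame p s s' := by
  induction h with
  | skip => exact Frame.refl _ _
  | setReg s i e he =>
    refine ⟨fun j hj => ?_, fun _ _ => rfl⟩
    have hj' : j ≠ i := by simpa [Program.writesReg] using hj
    simp [Function.update_of_ne hj']
  | setCell s a idx e hi he =>
    refine ⟨fun _ _ => rfl, fun j hj => ?_⟩
    have hj' : j ≠ a := by simpa [Program.writesMem] using hj
    simp [Function.update_of_ne hj']
  | seq h₁ h₂ ih₁ ih₂ =>
    refine ⟨fun i hi => ?_, fun i hi => ?_⟩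
    · simp only [Program.writesReg, Bool.or_eq_false_iff] at hi
      rw [ih₂.reg i hi.2, ih₁.reg i hi.1]
    · simp only [Program.writesMem, Bool.or_eq_false_iff] at hi
      rw [ih₂.mem i hi.2, ih₁.mem i hi.1]
  | condTrue he h0 h ih =>
    refine ⟨fun i hi => ?_, fun i hi => ?_⟩
    · simp only [Program.writesReg, Bool.or_eq_false_iff] at hi
      exact ih.reg i hi.1
    · simp only [Program.writesMem, Bool.or_eq_false_iff] at hi
      exact ih.mem i hi.1
  | condFalse he h0 h ih =>
    refine ⟨fun i hi => ?_, fun i hi => ?_⟩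
    · simp only [Program.writesReg, Bool.or_eq_false_iff] at hi
      exact ih.reg i hi.2
    · simp only [Program.writesMem, Bool.or_eq_false_iff] at hi
      exact ih.mem i hi.2
  | loopTrue he h0 h₁ h₂ ih₁ ih₂ =>
    refine ⟨fun i hi => ?_, fun i hi => ?_⟩
    · rw [ih₂.reg i hi, ih₁.reg i hi]
    · rw [ih₂.mem i hi, ih₁.mem i hi]
  | loopFalse => exact Frame.refl _ _

/-- From the bounded state `s`, the program `p` runs for at most `T` steps to a bounded state
satisfying `Q`. -/
def Runs (n X W : ℕ) (p : Program) (s : State) (T : ℕ) (Q : State → Prop) : Prop :=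
  Bdd n X s → ∃ t s', Exec W p s t s' ∧ t ≤ T ∧ Bdd n X s' ∧ Frame p s s' ∧ Q s'

/-- The weakest precondition for programs without loops. -/
def wp (n X : ℕ) : Program → (State → Prop) → State → Prop
  | .skip, Q, s => Q s
  | .setReg i e, Q, s =>
    e.eval s ≤ n ^ regDeg i * X ∧ Q ⟨Function.update s.reg i (e.eval s), s.mem⟩
  | .setCell a idx e, Q, s => e.eval s ≤ n ^ memDeg a * X ∧
    Q ⟨s.reg, Function.update s.mem a (Function.update (s.mem a) (idx.eval s) (e.eval s))⟩
  | .seq p q, Q, s => wp n X p (wp n X q Q) s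
  | .cond e p q, Q, s => (e.eval s ≠ 0 → wp n X p Q s) ∧ (e.eval s = 0 → wp n X q Q s)
  | .loop _ _, _, _ => False

/-! ### Proof rules for correctness, running time and word size. -/

variable {n X W : ℕ} {p q : Program} {s : State} {Q Q' : State → Prop}

theorem wp.mono (h : wp n X p Q s) (hQ : ∀ s', Q s' → Q' s') : wp n X p Q' s := by
  induction p generalizing s Q Q' with
  | skip => exact hQ _ h
  | setReg i e => exact ⟨h.1, hQ _ h.2⟩
  | setCell a i e => exact ⟨h.1, hQ _ h.2⟩
  | seq p q ihp ihq => exact ihp h fun s' hs' => ihq hs' hQ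
  | cond e p q ihp ihq => exact ⟨fun h0 => ihp (h.1 h0) hQ, fun h0 => ihq (h.2 h0) hQ⟩
  | loop e p => exact h.elim

/-- For tame programs the word size takes care of itself; what remains to be checked in `wp` is that
each stored value respects the bound of its register or array. The time is the syntactic cost. -/
theorem Runs.of_wp (h : Roomy n X W) (hp : p.tame) (hwp : wp n X p Q s) :
    Runs n X W p s p.cost Q := by
  intro hs
  suffices ∃ t s', Exec W p s t s' ∧ t ≤ p.cost ∧ Bdd n X s' ∧ Q s' by
    obtain ⟨t, s', h1, h2, h3, h4⟩ := this
    exact ⟨t, s', h1, h2, h3, h1.frame, h4⟩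
  induction p generalizing s Q with
  | skip => exact ⟨_, _, Exec.skip s, le_rfl, hs, hwp⟩
  | setReg i e =>
    refine ⟨_, _, Exec.setReg s i e (Expr.tame.fits h hs hp), le_rfl, ⟨fun j => ?_, hs.mem⟩, hwp.2⟩
    by_cases hj : j = i
    · subst hj; simpa using hwp.1
    · simpa [Function.update_of_ne hj] using hs.reg j
  | setCell a i e =>
    simp only [Program.tame, Bool.and_eq_true] at hp
    refine ⟨_, _, Exec.setCell s a i e (Expr.tame.fits h hs hp.1) (Expr.tame.fits h hs hp.2), le_rfl,
      ⟨hs.reg, fun b j => ?_⟩, hwp.2⟩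
    by_cases hb : b = a
    · subst hb
      by_cases hj : j = i.eval s
      · subst hj; simpa using hwp.1
      · simpa [Function.update_of_ne hj] using hs.mem b j
    · simpa [Function.update_of_ne hb] using hs.mem b j
  | seq p q ihp ihq =>
    simp only [Program.tame, Bool.and_eq_true] at hp
    obtain ⟨t₁, s₁, h1, h2, h3, h4⟩ := ihp hp.1 hwp hs
    obtain ⟨t₂, s₂, k1, k2, k3, k4⟩ := ihq hp.2 h4 h3
    exact ⟨_, _, Exec.seq h1 k1, by simp only [Program.cost]; omega, k3, k4⟩
  | cond e p q ihp ihq =>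
    simp only [Program.tame, Bool.and_eq_true] at hp
    by_cases h0 : e.eval s = 0
    · obtain ⟨t₁, s₁, h1, h2, h3, h4⟩ := ihq hp.2 (hwp.2 h0) hs
      refine ⟨_, _, Exec.condFalse (Expr.tame.fits h hs hp.1.1) h0 h1, ?_, h3, h4⟩
      simp only [Program.cost]; have := le_max_right p.cost q.cost; omega
    · obtain ⟨t₁, s₁, h1, h2, h3, h4⟩ := ihp hp.1.2 (hwp.1 h0) hs
      refine ⟨_, _, Exec.condTrue (Expr.tame.fits h hs hp.1.1) h0 h1, ?_, h3, h4⟩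
      simp only [Program.cost]; have := le_max_left p.cost q.cost; omega
  | loop e p => exact hwp.elim

theorem Runs.mono {T T' : ℕ} (h : Runs n X W p s T Q) (hT : T ≤ T')
    (hQ : ∀ s', Frame p s s' → Bdd n X s' → Q s' → Q' s') : Runs n X W p s T' Q' := by
  intro hs
  obtain ⟨t, s', h1, h2, h3, h4, h5⟩ := h hs
  exact ⟨t, s', h1, h2.trans hT, h3, h4, hQ s' h4 h3 h5⟩

theorem Runs.seq {T₁ T₂ : ℕ} (h : Runs n X W p s T₁ fun s₁ => Runs n X W q s₁ T₂ Q) :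
    Runs n X W (.seq p q) s (T₁ + T₂) Q := by
  intro hs
  obtain ⟨t₁, s₁, h1, h2, h3, h4, h5⟩ := h hs
  obtain ⟨t₂, s₂, k1, k2, k3, k4, k5⟩ := h5 h3
  have := Exec.seq h1 k1
  exact ⟨_, _, this, by omega, k3, this.frame, k5⟩

theorem Runs.cond {e : Expr} {T : ℕ} (h : Roomy n X W) (he : e.tame)
    (h1 : e.eval s ≠ 0 → Runs n X W p s T Q) (h2 : e.eval s = 0 → Runs n X W q s T Q) :
    Runs n X W (.cond e p q) s (e.cost + 1 + T) Q := by
  intro hs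
  by_cases h0 : e.eval s = 0
  · obtain ⟨t, s', k1, k2, k3, k4, k5⟩ := h2 h0 hs
    have := Exec.condFalse (p := p) (Expr.tame.fits h hs he) h0 k1
    exact ⟨_, _, this, by omega, k3, this.frame, k5⟩
  · obtain ⟨t, s', k1, k2, k3, k4, k5⟩ := h1 h0 hs
    have := Exec.condTrue (q := q) (Expr.tame.fits h hs he) h0 k1
    exact ⟨_, _, this, by omega, k3, this.frame, k5⟩

theorem Runs.loop {e : Expr} (h : Roomy n X W) (he : e.tame) (I : State → Prop) (Φ : State → ℕ)
    (hI : I s)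
    (hbody : ∀ s₁, Bdd n X s₁ → Frame p s s₁ → I s₁ → e.eval s₁ ≠ 0 →
      ∃ T, Runs n X W p s₁ T fun s₂ => I s₂ ∧ Φ s₂ + T + e.cost + 1 ≤ Φ s₁) :
    Runs n X W (.loop e p) s (Φ s + e.cost + 1) fun s₂ => I s₂ ∧ e.eval s₂ = 0 := by
  intro hs
  suffices ∀ N, ∀ s₁, Φ s₁ ≤ N → Bdd n X s₁ → Frame p s s₁ → I s₁ →
      ∃ t s', Exec W (.loop e p) s₁ t s' ∧ t ≤ Φ s₁ + e.cost + 1 ∧ Bdd n X s' ∧ I s' ∧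
        e.eval s' = 0 by
    obtain ⟨t, s', h1, h2, h3, h4, h5⟩ := this _ s le_rfl hs (Frame.refl _ _) hI
    exact ⟨t, s', h1, h2, h3, h1.frame, h4, h5⟩
  intro N
  induction N with
  | zero =>
    intro s₁ hN hs₁ hf hI₁
    by_cases h0 : e.eval s₁ = 0
    · exact ⟨_, _, Exec.loopFalse (Expr.tame.fits h hs₁ he) h0, by omega, hs₁, hI₁, h0⟩
    · obtain ⟨T, hT⟩ := hbody s₁ hs₁ hf hI₁ h0
      obtain ⟨t, s', k1, k2, k3, k4, k5, k6⟩ := hT hs₁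
      omega
  | succ N ih =>
    intro s₁ hN hs₁ hf hI₁
    by_cases h0 : e.eval s₁ = 0
    · exact ⟨_, _, Exec.loopFalse (Expr.tame.fits h hs₁ he) h0, by omega, hs₁, hI₁, h0⟩
    · obtain ⟨T, hT⟩ := hbody s₁ hs₁ hf hI₁ h0
      obtain ⟨t, s₂, k1, k2, k3, k4, k5, k6⟩ := hT hs₁
      have hf2 : Frame p s s₂ :=
        ⟨fun i hi => (k4.reg i hi).trans (hf.reg i hi), fun i hi => (k4.mem i hi).trans (hf.mem i hi)⟩
      obtain ⟨t', s', m1, m2, m3, m4, m5⟩ := ih s₂ (by omega) k3 hf2 k5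
      exact ⟨_, _, Exec.loopTrue (Expr.tame.fits h hs₁ he) h0 k1 m1, by omega, m3, m4, m5⟩

end RAM

/-! ### Basic facts about path decompositions -/

section PathDecomposition

variable {n : ℕ}

/-- The nodes of `L` that concern the vertex `v`. -/
def nodesOf (L : List (Node n)) (v : Fin n) : List (Node n) := L.filter (fun x => x.1 = v)

@[simp] theorem nodesOf_nil (v : Fin n) : nodesOf [] v = [] := rfl

@[simp] theorem nodesOf_append (A B : List (Node n)) (v : Fin n) :
    nodesOf (A ++ B) v = nodesOf A v ++ nodesOf B v := List.filter_append ..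

theorem nodesOf_cons (x : Node n) (L : List (Node n)) (v : Fin n) :
    nodesOf (x :: L) v = if x.1 = v then x :: nodesOf L v else nodesOf L v := by
  simp [nodesOf, List.filter_cons]

theorem mem_nodesOf {x : Node n} {L : List (Node n)} {v : Fin n} :
    x ∈ nodesOf L v ↔ x ∈ L ∧ x.1 = v := by simp [nodesOf]

/-- The bag after the nodes of `L`. -/
abbrev bagOf (L : List (Node n)) : Finset (Fin n) := L.foldl Node.apply ∅

/-- The vertices introduced by the first `j` nodes. -/
def seen (P : List (Node n)) (j : ℕ) : Set (Fin n) := {u | (u, true) ∈ P.take j}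

/-- A node sets the membership of its own vertex outright and touches no other, so only the last
node on `u` counts. -/
theorem mem_foldl_apply (B : Finset (Fin n)) (L : List (Node n)) (u : Fin n) :
    u ∈ L.foldl Node.apply B ↔
      (nodesOf L u).getLast? = some (u, true) ∨ (nodesOf L u = [] ∧ u ∈ B) := by
  induction L using List.reverseRecOn with
  | nil => simp
  | append_singleton L x ih =>
    rw [List.foldl_append, nodesOf_append]
    obtain ⟨w, b⟩ := x
    by_cases hw : w = u
    · subst hw
      cases b <;> simp [Node.apply, nodesOf_cons]
    · have : u ≠ w := fun h => hw h.symm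
      cases b <;> simp [Node.apply, hw, this, ih, nodesOf_cons]

theorem mem_bagOf (L : List (Node n)) (u : Fin n) :
    u ∈ bagOf L ↔ (nodesOf L u).getLast? = some (u, true) := by
  simp [bagOf, mem_foldl_apply]

theorem bag_succ (P : List (Node n)) (j : ℕ) (x : Node n) (h : P[j]? = some x) :
    bag P (j + 1) = Node.apply (bag P j) x := by
  simp [bag, List.take_add_one, h, List.foldl_append]

theorem append_cons_eq_pair {α : Type*} {A B : List α} {x p q : α} (h : A ++ x :: B = [p, q]) :
    (A = [] ∧ x = p ∧ B = [q]) ∨ (A = [p] ∧ x = q ∧ B = []) := by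
  match A with
  | [] => simp at h; exact Or.inl ⟨rfl, h.1, h.2⟩
  | [a] => simp at h; exact Or.inr ⟨by simp [h.1], h.2.1, h.2.2⟩
  | a :: b :: A' => simp at h

variable {G : SimpleGraph (Fin n)} {P : List (Node n)}

theorem IsPathDecomposition.nodesOf_eq (hP : IsPathDecomposition G P) (v : Fin n) :
    nodesOf P v = [(v, true), (v, false)] := hP.occurrences v

theorem take_drop_of_getElem? {α : Type*} {P : List α} {j : ℕ} {x : α} (h : P[j]? = some x) :
    P = P.take j ++ x :: P.drop (j + 1) := by
  obtain ⟨hj, rfl⟩ := List.getElem?_eq_some_iff.1 h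
  simp

theorem IsPathDecomposition.nodesOf_split (hP : IsPathDecomposition G P) {A B : List (Node n)}
    {v : Fin n} {b : Bool} (h : P = A ++ (v, b) :: B) :
    (b = true ∧ nodesOf A v = [] ∧ nodesOf B v = [(v, false)]) ∨
      (b = false ∧ nodesOf A v = [(v, true)] ∧ nodesOf B v = []) := by
  have h1 := hP.nodesOf_eq v
  rw [h, nodesOf_append, nodesOf_cons, if_pos rfl] at h1
  rcases append_cons_eq_pair h1 with ⟨h2, h3, h4⟩ | ⟨h2, h3, h4⟩
  · exact Or.inl ⟨by simpa using h3, h2, h4⟩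
  · exact Or.inr ⟨by simpa using h3, h2, h4⟩

/-- The first occurrence of a vertex is its introduction, so any occurrence among the first `j`
nodes implies an introduction there. -/
theorem mem_seen_iff (hP : IsPathDecomposition G P) (j : ℕ) (u : Fin n) :
    u ∈ seen P j ↔ nodesOf (P.take j) u ≠ [] := by
  constructor
  · intro h h0
    have : (u, true) ∈ nodesOf (P.take j) u := mem_nodesOf.2 ⟨h, rfl⟩
    simp [h0] at this
  · intro h
    have h1 := hP.nodesOf_eq u
    rw [← List.take_append_drop j P, nodesOf_append] at h1
    match h2 : nodesOf (P.take j) u, h with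
    | a :: l, _ =>
      rw [h2] at h1
      simp only [List.cons_append, List.cons.injEq] at h1
      have : a ∈ nodesOf (P.take j) u := by simp [h2]
      rw [h1.1] at this
      exact (mem_nodesOf.1 this).1

theorem bag_subset_seen {j : ℕ} {u : Fin n} (h : u ∈ bag P j) : u ∈ seen P j := by
  rw [bag, mem_bagOf] at h
  have := List.mem_of_mem_getLast? h
  exact (mem_nodesOf.1 this).1

theorem seen_succ_of_intro {j : ℕ} {v : Fin n} (h : P[j]? = some (v, true)) (u : Fin n) :
    u ∈ seen P (j + 1) ↔ u = v ∨ u ∈ seen P j := by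
  simp [seen, List.take_add_one, h, or_comm]

theorem seen_succ_of_forget {j : ℕ} {v : Fin n} (h : P[j]? = some (v, false)) (u : Fin n) :
    u ∈ seen P (j + 1) ↔ u ∈ seen P j := by
  simp [seen, List.take_add_one, h]

theorem not_mem_seen_of_intro (hP : IsPathDecomposition G P) {j : ℕ} {v : Fin n}
    (h : P[j]? = some (v, true)) : v ∉ seen P j := by
  rcases hP.nodesOf_split (take_drop_of_getElem? h) with h1 | h1
  · rw [mem_seen_iff hP]; simpa using h1.2.1
  · simp at h1

theorem mem_bag_of_forget (hP : IsPathDecomposition G P) {j : ℕ} {v : Fin n}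
    (h : P[j]? = some (v, false)) : v ∈ bag P j := by
  rcases hP.nodesOf_split (take_drop_of_getElem? h) with h1 | h1
  · simp at h1
  · rw [bag, mem_bagOf, h1.2.1]; rfl

theorem mem_seen_length (hP : IsPathDecomposition G P) (u : Fin n) : u ∈ seen P P.length := by
  rw [mem_seen_iff hP, List.take_length, hP.nodesOf_eq]; simp

/-- A common bag of `u` and `v` comes after the introduction of `v`. There `u` is still present, and
it was introduced before `v`, so it was not forgotten in between. Hence the edges of a new vertex
need only be compared with the present bag. -/
theorem mem_bag_of_adj (hP : IsPathDecomposition G P) {j : ℕ} {u v : Fin n}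
    (h : P[j]? = some (v, true)) (hu : u ∈ seen P j) (huv : G.Adj u v) : u ∈ bag P j := by
  obtain ⟨i, hui, hvi⟩ := hP.edges u v huv
  have hji : j < i := by
    by_contra hc
    have h1 := bag_subset_seen hvi
    exact not_mem_seen_of_intro hP h ((List.take_sublist_take_left (by omega)).subset h1)
  rw [bag, mem_bagOf] at hui ⊢
  have h1 := hP.nodesOf_eq u
  rw [mem_seen_iff hP] at hu
  have h2 : nodesOf (P.take i) u = nodesOf (P.take j) u ++ nodesOf ((P.take i).drop j) u := by
    rw [← nodesOf_append]
    congr 1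
    conv_lhs => rw [← List.take_append_drop j (P.take i)]
    rw [List.take_take, min_eq_left hji.le]
  rw [← List.take_append_drop i P, nodesOf_append] at h1
  rw [h2] at h1 hui
  generalize nodesOf (P.take j) u = A at *
  generalize nodesOf ((P.take i).drop j) u = B at *
  match A, B with
  | [], _ => exact absurd rfl hu
  | [a], _ => simp at h1 ⊢; exact h1.1
  -- Two nodes of `u` before position `j` would mean that `u` has been forgotten, contrary to its
  -- presence in bag `i`.
  | a :: b :: A', _ =>
    simp only [List.cons_append, List.cons.injEq, List.append_eq_nil_iff] at h1
    obtain ⟨rfl, rfl, ⟨rfl, rfl⟩, -⟩ := h1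
    simp at hui

theorem length_pathDecomposition (hP : IsPathDecomposition G P) : P.length = 2 * n := by
  have key : ∀ L : List (Node n), L.length = ∑ v : Fin n, (nodesOf L v).length := by
    intro L
    induction L with
    | nil => simp
    | cons x L ih =>
      have : ∀ v : Fin n, (nodesOf (x :: L) v).length
          = (nodesOf L v).length + if v = x.1 then 1 else 0 := by
        intro v
        by_cases h : x.1 = v
        · simp [nodesOf_cons, h]
        · have h' : ¬ v = x.1 := fun e => h e.symm
          simp [nodesOf_cons, h, h']
      simp only [this, Finset.sum_add_distrib, ← ih]
      simp
  rw [key]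
  have : ∀ v : Fin n, (nodesOf P v).length = 2 := fun v => by rw [hP.nodesOf_eq]; rfl
  simp [this]; omega

/-- `u` and `w` occur together in some bag of `L`. -/
def Covers (L : List (Node n)) (u w : Fin n) : Prop :=
  ∃ A B : List (Node n), L = A ++ B ∧ u ∈ bagOf A ∧ w ∈ bagOf A

theorem Covers.symm {L : List (Node n)} {u w : Fin n} (h : Covers L u w) : Covers L w u := by
  obtain ⟨A, B, h1, h2, h3⟩ := h
  exact ⟨A, B, h1, h3, h2⟩

theorem Covers.insert {L₁ L₂ : List (Node n)} {u w : Fin n} (x : Node n)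
    (h : Covers (L₁ ++ L₂) u w) (hu : x.1 ≠ u) (hw : x.1 ≠ w) : Covers (L₁ ++ x :: L₂) u w := by
  obtain ⟨A, B, h1, h2, h3⟩ := h
  rcases List.append_eq_append_iff.1 h1 with ⟨C, rfl, rfl⟩ | ⟨C, rfl, rfl⟩
  · refine ⟨L₁ ++ x :: C, B, by simp, ?_, ?_⟩
    · rw [mem_bagOf] at h2 ⊢; simpa [nodesOf_cons, hu] using h2
    · rw [mem_bagOf] at h3 ⊢; simpa [nodesOf_cons, hw] using h3
  · exact ⟨A, C ++ x :: L₂, by simp, h2, h3⟩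

theorem Covers.exists_bag {L : List (Node n)} {u w : Fin n} (h : Covers L u w) :
    ∃ j, u ∈ bag L j ∧ w ∈ bag L j := by
  obtain ⟨A, B, rfl, h2, h3⟩ := h
  exact ⟨A.length, by simpa [bag] using h2, by simpa [bag] using h3⟩

end PathDecomposition

/-! ### The nondeterministic machine -/

/-- Letters of the words describing partial decompositions: changes of the current counter, the
exchange of the two counters, and the introduction or the removal of the vertex in a slot. -/
inductive Tok
  | inc | dec | swap | ev (b : Bool) (s : ℕ)

/-- The current counter and the other counter. -/
abbrev Cursor : Type := ℕ × ℕ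

/-- An event sets both counters to the new size, so what follows it can be described independently
of what precedes it. -/
def Tok.app : Tok → Cursor → Cursor
  | .inc, c => (c.1 + 1, c.2)
  | .dec, c => (c.1 - 1, c.2)
  | .swap, c => (c.2, c.1)
  | .ev true _, c => (c.1 + 1, c.1 + 1)
  | .ev false _, c => (c.1 - 1, c.1 - 1)

/-- The data on which the machine works: the number of passes, the largest bag size allowed, and
for every pass its type, its slot, and the slots of the neighbours. -/
structure Env where
  N : ℕ
  K : ℕ
  typ : ℕ → ℕ
  slot : ℕ → ℕ
  nb : ℕ → ℕ → ℕ

/-- A configuration: in pass `j` the word `old` remains to be read and `new` has been written;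
`co` and `cn` are the cursors in the old and in the new word, and `ph` counts the events of the
present vertex which have been written. -/
structure AConf where
  j : ℕ
  old : List Tok
  new : List Tok
  co : Cursor
  cn : Cursor
  ph : ℕ

/-- In phase 1 the new vertex has entered and not yet left: it counts for the new sizes but not for
the old ones. -/
def act (ph : ℕ) : ℕ := if ph = 1 then 1 else 0

/-- The only comparison the machine ever makes between the two words. The counters are upper bounds
for bag sizes, so `E.K` plays the role of `k + 1`. -/
def AConf.Ok (E : Env) (a : AConf) : Prop := a.co.1 + act a.ph ≤ a.cn.1 ∧ a.cn.1 ≤ E.K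

/-- The moves of the machine. -/
inductive AStep (E : Env) : ℕ → AConf → AConf → Prop
  | drop {j old new co cn ph} (t : Tok) (hj : j < E.N)
      (ht : ∀ b s, t = .ev b s → E.typ j = 0 ∧ s = E.slot j)
      (ok : AConf.Ok E ⟨j, old, new, t.app co, cn, ph⟩) :
      AStep E 0 ⟨j, t :: old, new, co, cn, ph⟩ ⟨j, old, new, t.app co, cn, ph⟩
  | keep {j old new co cn ph} (b : Bool) (s : ℕ) (hj : j < E.N)
      (hs : ¬ (E.typ j = 0 ∧ s = E.slot j))
      -- A neighbour of the new vertex may neither enter after it has left nor leave before it has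
      -- entered; this is what forces a common bag.
      (hnb : E.nb j s ≠ 0 → (b = true → ph ≠ 2) ∧ (b = false → ph ≠ 0))
      (ok : AConf.Ok E ⟨j, old, new ++ [.ev b s], (Tok.ev b s).app co, (Tok.ev b s).app cn, ph⟩) :
      AStep E 1 ⟨j, .ev b s :: old, new, co, cn, ph⟩
        ⟨j, old, new ++ [.ev b s], (Tok.ev b s).app co, (Tok.ev b s).app cn, ph⟩
  | emit {j old new co cn ph} (r : ℕ) (t : Tok) (hj : j < E.N)
      (ht : (r = 2 ∧ t = .inc) ∨ (r = 3 ∧ t = .dec) ∨ (r = 4 ∧ t = .swap))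
      (ok : AConf.Ok E ⟨j, old, new ++ [t], co, t.app cn, ph⟩) :
      AStep E r ⟨j, old, new, co, cn, ph⟩ ⟨j, old, new ++ [t], co, t.app cn, ph⟩
  | emitEv {j old new co cn ph} (r : ℕ) (b : Bool) (hj : j < E.N) (hT : E.typ j = 1)
      (hr : (r = 5 ∧ b = true ∧ ph = 0) ∨ (r = 6 ∧ b = false ∧ ph = 1))
      (ok : AConf.Ok E
        ⟨j, old, new ++ [.ev b (E.slot j)], co, (Tok.ev b (E.slot j)).app cn, ph + 1⟩) :
      AStep E r ⟨j, old, new, co, cn, ph⟩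
        ⟨j, old, new ++ [.ev b (E.slot j)], co, (Tok.ev b (E.slot j)).app cn, ph + 1⟩
  | endPass {j new co cn ph} (hj : j < E.N) (hph : ph = 2 * E.typ j) :
      AStep E 7 ⟨j, [], new, co, cn, ph⟩ ⟨j + 1, new, [], (0, 0), (0, 0), 0⟩

/-- The machine data belong to the path decomposition `P` of `G`, with slots `sl`. -/
structure Compat {n : ℕ} (G : SimpleGraph (Fin n)) (P : List (Node n)) (sl : Fin n → ℕ)
    (E : Env) : Prop where
  N : E.N = P.length
  typ : ∀ j x, P[j]? = some x → E.typ j = if x.2 then 1 else 0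
  slot : ∀ j x, P[j]? = some x → E.slot j = sl x.1
  nb : ∀ j v, P[j]? = some (v, true) → ∀ u ∈ bag P j, (E.nb j (sl u) ≠ 0 ↔ G.Adj u v)
  nb_zero : ∀ j v, P[j]? = some (v, false) → ∀ u ∈ bag P j, E.nb j (sl u) = 0
  inj : ∀ j, ∀ u ∈ bag P j, ∀ w ∈ bag P j, sl u = sl w → u = w

/-! ### Soundness of the machine -/

section Soundness

variable {n : ℕ}

/-- An entry of the list of events constructed by a run: its identifier, the node of the path
decomposition (if it is not a dummy), and the letter of the word that it carries (if any). -/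
structure Entry (n : ℕ) where
  id : ℕ
  lab : Option (Node n)
  tok : Option Tok

abbrev labs (D : List (Entry n)) : List (Node n) := D.filterMap Entry.lab

abbrev toks (D : List (Entry n)) : List Tok := D.filterMap Entry.tok

/-- The effect of the moves on the list of events; `v` is the present vertex and `f` a fresh
identifier. -/
inductive DStep (v : Fin n) (f : ℕ) : ℕ → List (Entry n) → List (Entry n) →
    List (Entry n) → List (Entry n) → Prop
  | drop (D₁ pre post) (e : Entry n) (hpre : toks pre = []) (he : e.tok ≠ none) :
      DStep v f 0 D₁ (pre ++ e :: post) (D₁ ++ pre ++ [⟨e.id, e.lab, none⟩]) post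
  | keep (D₁ pre post) (e : Entry n) (hpre : toks pre = []) (he : e.tok ≠ none) :
      DStep v f 1 D₁ (pre ++ e :: post) (D₁ ++ pre ++ [e]) post
  | emit (D₁ D₂) (r : ℕ) (t : Tok) (hr : r = 2 ∨ r = 3 ∨ r = 4) :
      DStep v f r D₁ D₂ (D₁ ++ [⟨f, none, some t⟩]) D₂
  | emitEv (D₁ D₂) (r : ℕ) (b : Bool) (t : Tok) (hr : (r = 5 ∧ b = true) ∨ (r = 6 ∧ b = false)) :
      DStep v f r D₁ D₂ (D₁ ++ [⟨f, some (v, b), some t⟩]) D₂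
  | endPass (D₁ D₂) : DStep v f 7 D₁ D₂ [] (D₁ ++ D₂)

def applyLab (B : Finset (Fin n)) : Option (Node n) → Finset (Fin n)
  | none => B
  | some x => Node.apply B x

def applyTok (c : Cursor) : Option Tok → Cursor
  | none => c
  | some t => t.app c

/-- All bags along the list are at most as large as claimed by the cursor. -/
def Good (K : ℕ) : Finset (Fin n) → Cursor → List (Entry n) → Prop
  | _, _, [] => True
  | B, c, e :: l => (applyLab B e.lab).card ≤ (applyTok c e.tok).1 ∧ (applyTok c e.tok).1 ≤ K ∧
      Good K (applyLab B e.lab) (applyTok c e.tok) l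

abbrev runTok (c : Cursor) (l : List Tok) : Cursor := l.foldl (fun c t => t.app c) c

theorem labs_cons (e : Entry n) (l : List (Entry n)) :
    labs (e :: l) = (match e.lab with | none => labs l | some x => x :: labs l) := by
  rcases h : e.lab with _ | x <;> simp [labs, h]

theorem foldl_labs_cons (B : Finset (Fin n)) (e : Entry n) (l : List (Entry n)) :
    (labs (e :: l)).foldl Node.apply B = (labs l).foldl Node.apply (applyLab B e.lab) := by
  rcases h : e.lab with _ | x <;> simp [labs, h, applyLab]

theorem runTok_toks_cons (c : Cursor) (e : Entry n) (l : List (Entry n)) :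
    runTok c (toks (e :: l)) = runTok (applyTok c e.tok) (toks l) := by
  rcases h : e.tok with _ | x <;> simp [toks, runTok, h, applyTok]

theorem good_append {K : ℕ} {B : Finset (Fin n)} {c : Cursor} {l₁ l₂ : List (Entry n)} :
    Good K B c (l₁ ++ l₂) ↔ Good K B c l₁ ∧
      Good K ((labs l₁).foldl Node.apply B) (runTok c (toks l₁)) l₂ := by
  induction l₁ generalizing B c with
  | nil => simp [Good]
  | cons e l ih =>
    rw [List.cons_append, Good, Good, ih, foldl_labs_cons, runTok_toks_cons]
    tauto

theorem apply_union {B Z : Finset (Fin n)} {x : Node n} (h : x.1 ∉ Z) :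
    Node.apply (B ∪ Z) x = Node.apply B x ∪ Z := by
  obtain ⟨u, b⟩ := x
  cases b
  · simp only [Node.apply, Bool.false_eq_true, if_false]
    rw [Finset.erase_union_distrib, Finset.erase_eq_of_notMem h]
  · simp [Node.apply, Finset.insert_union]

theorem applyLab_union {B Z : Finset (Fin n)} {e : Entry n}
    (h : ∀ x, e.lab = some x → x.1 ∉ Z) : applyLab (B ∪ Z) e.lab = applyLab B e.lab ∪ Z := by
  rcases he : e.lab with _ | x
  · rfl
  · exact apply_union (h x he)

/-- A stretch of the old list without letters stays good when it is passed to the new list. -/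
theorem Good.transfer {K : ℕ} {B Z : Finset (Fin n)} {co cn : Cursor} {l : List (Entry n)} {d : ℕ}
    (h : Good K B co l) (hl : toks l = []) (hZ : ∀ x ∈ labs l, x.1 ∉ Z) (hd : Z.card ≤ d)
    (hc : co.1 + d ≤ cn.1) (hK : cn.1 ≤ K) :
    Good K (B ∪ Z) cn l ∧
      (labs l).foldl Node.apply (B ∪ Z) = (labs l).foldl Node.apply B ∪ Z := by
  induction l generalizing B with
  | nil => simp [Good]
  | cons e l ih =>
    have he : e.tok = none := by
      rcases h1 : e.tok with _ | t
      · rfl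
      · simp [toks, h1] at hl
    have hl' : toks l = [] := by simpa [toks, he] using hl
    have hZe : ∀ x, e.lab = some x → x.1 ∉ Z := fun x hx => hZ x (by simp [labs, hx])
    have hZl : ∀ x ∈ labs l, x.1 ∉ Z := by
      intro x hx
      apply hZ
      rw [labs_cons]
      split
      · exact hx
      · exact List.mem_cons_of_mem _ hx
    rw [Good] at h ⊢
    simp only [he, applyTok] at h ⊢
    obtain ⟨h1, h2, h3⟩ := h
    obtain ⟨k1, k2⟩ := ih h3 hl' hZl
    rw [foldl_labs_cons, foldl_labs_cons, applyLab_union hZe]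
    refine ⟨⟨?_, hK, k1⟩, k2⟩
    have := Finset.card_union_le (applyLab B e.lab) Z
    omega

theorem exists_of_toks_eq_cons {D : List (Entry n)} {t : Tok} {l : List Tok}
    (h : toks D = t :: l) : ∃ pre e post, D = pre ++ e :: post ∧ toks pre = [] ∧
      e.tok = some t ∧ toks post = l := by
  induction D with
  | nil => simp [toks] at h
  | cons a D ih =>
    rcases ha : a.tok with _ | t'
    · simp only [toks, List.filterMap_cons, ha] at h
      obtain ⟨pre, e, post, rfl, h1, h2, h3⟩ := ih h
      exact ⟨a :: pre, e, post, rfl, by simp [toks, ha] at h1 ⊢; exact h1, h2, h3⟩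
    · simp only [toks, List.filterMap_cons, ha, List.cons.injEq] at h
      exact ⟨[], a, D, rfl, rfl, by rw [ha, h.1], h.2⟩

/-- The vertex introduced by the next node, if any. -/
def newVertex (P : List (Node n)) (j : ℕ) : Finset (Fin n) :=
  Finset.univ.filter fun u => P[j]? = some (u, true)

theorem mem_newVertex {P : List (Node n)} {j : ℕ} {u : Fin n} :
    u ∈ newVertex P j ↔ P[j]? = some (u, true) := by simp [newVertex]

theorem card_newVertex_le (P : List (Node n)) (j : ℕ) : (newVertex P j).card ≤ 1 := by
  rw [Finset.card_le_one]
  intro a ha b hb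
  rw [mem_newVertex] at ha hb
  rw [ha] at hb
  simpa using hb

theorem Covers.append_right {L : List (Node n)} {u w : Fin n} (M : List (Node n))
    (h : Covers L u w) : Covers (L ++ M) u w := by
  obtain ⟨A, B, rfl, h2, h3⟩ := h
  exact ⟨A, B ++ M, by simp, h2, h3⟩

/-- The invariant relating a configuration to the list of events constructed so far. -/
structure Sound (G : SimpleGraph (Fin n)) (P : List (Node n)) (sl : Fin n → ℕ) (E : Env)
    (a : AConf) (D₁ D₂ : List (Entry n)) : Prop where
  old : a.old = toks D₂
  new : a.new = toks D₁
  ok : a.Ok E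
  ph_le : a.ph ≤ 2
  seen_eq : ∀ u ∈ seen P a.j, nodesOf (labs D₁ ++ labs D₂) u = [(u, true), (u, false)]
  new_eq : ∀ v, P[a.j]? = some (v, true) →
    nodesOf (labs D₂) v = [] ∧ nodesOf (labs D₁) v = [(v, true), (v, false)].take a.ph
  unseen_eq : ∀ u, u ∉ seen P a.j → P[a.j]? ≠ some (u, true) → nodesOf (labs D₁ ++ labs D₂) u = []
  -- Entries already passed carry letters for the next bag of `P`, entries still ahead for the
  -- present one.
  tok₁ : ∀ e ∈ D₁, ∀ b s, e.tok = some (.ev b s) →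
    ∃ u ∈ bag P (a.j + 1), e.lab = some (u, b) ∧ sl u = s
  lab₁ : ∀ e ∈ D₁, ∀ u b, e.lab = some (u, b) → u ∈ bag P (a.j + 1) → e.tok = some (.ev b (sl u))
  tok₂ : ∀ e ∈ D₂, ∀ b s, e.tok = some (.ev b s) →
    ∃ u ∈ bag P a.j, e.lab = some (u, b) ∧ sl u = s
  lab₂ : ∀ e ∈ D₂, ∀ u b, e.lab = some (u, b) → u ∈ bag P a.j → e.tok = some (.ev b (sl u))
  good₁ : Good E.K ∅ (0, 0) D₁
  cn_eq : runTok (0, 0) (toks D₁) = a.cn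
  -- `B` is the bag of the old vertices at the current position. The part ahead is judged by the old
  -- counter, as if the new vertex did not exist.
  good₂ : ∃ B, B.card ≤ a.co.1 ∧ Good E.K B a.co D₂ ∧ Disjoint (newVertex P a.j) B ∧
    bagOf (labs D₁) = B ∪ if a.ph = 1 then newVertex P a.j else ∅
  edges : ∀ u ∈ seen P a.j, ∀ w ∈ seen P a.j, G.Adj u w → Covers (labs D₁ ++ labs D₂) u w
  -- Before the new vertex enters, none of its neighbours has left; afterwards each of them has met
  -- it or has yet to enter.
  nbr : ∀ v, P[a.j]? = some (v, true) → ∀ u ∈ bag P a.j, G.Adj u v →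
    (a.ph = 0 → nodesOf (labs D₁) u ≠ [(u, true), (u, false)]) ∧
    (a.ph ≠ 0 → Covers (labs D₁) u v ∨ nodesOf (labs D₁) u = [])
  last : a.j = E.N → D₁ = []

/-! ### Every move preserves the soundness invariant. -/

section Step

variable {G : SimpleGraph (Fin n)} {P : List (Node n)} {sl : Fin n → ℕ} {E : Env}

theorem nodesOf_eq_nil_iff {L : List (Node n)} {u : Fin n} :
    nodesOf L u = [] ↔ ∀ b, (u, b) ∉ L := by
  rw [List.eq_nil_iff_forall_not_mem]
  simp only [mem_nodesOf]
  constructor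
  · intro h b hb; exact h _ ⟨hb, rfl⟩
  · rintro h ⟨w, b⟩ ⟨h1, rfl⟩; exact h b h1

theorem mem_labs {D : List (Entry n)} {x : Node n} : x ∈ labs D ↔ ∃ e ∈ D, e.lab = some x := by
  simp [labs]

theorem tok_eq_none_of_toks_eq_nil {D : List (Entry n)} (h : toks D = []) {e : Entry n}
    (he : e ∈ D) : e.tok = none := by
  simp only [toks, List.filterMap_eq_nil_iff] at h
  exact h e he

theorem Sound.not_mem_newVertex {a : AConf} {D₁ D₂ : List (Entry n)} (h : Sound G P sl E a D₁ D₂)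
    {x : Node n} (hx : x ∈ labs D₂) : x.1 ∉ newVertex P a.j := by
  intro hv
  have := (h.new_eq _ (mem_newVertex.1 hv)).1
  exact nodesOf_eq_nil_iff.1 this x.2 hx

/-- Reading a letter of the old word, which may be copied to the new word. -/
theorem Sound.advance {j : ℕ} {old new : List Tok} {co cn co' cn' : Cursor} {ph : ℕ} {t : Tok}
    {D₁ pre post : List (Entry n)} {e e' : Entry n}
    (h : Sound G P sl E ⟨j, t :: old, new, co, cn, ph⟩ D₁ (pre ++ e :: post))
    (hj : j < E.N) (hpre : toks pre = []) (het : e.tok = some t) (hpost : toks post = old)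
    (hco : co' = t.app co) (hcn : cn' = applyTok cn e'.tok) (hlab : e'.lab = e.lab)
    (ok : AConf.Ok E ⟨j, old, new ++ toks [e'], co', cn', ph⟩)
    (htok₁ : ∀ b s, e'.tok = some (.ev b s) →
      ∃ u ∈ bag P (j + 1), e'.lab = some (u, b) ∧ sl u = s)
    (hlab₁ : ∀ u b, e'.lab = some (u, b) → u ∈ bag P (j + 1) → e'.tok = some (.ev b (sl u)))
    (hbag : ∀ u ∈ bag P (j + 1), u ∈ bag P j ∨ P[j]? = some (u, true))
    (hev : ∀ u b v, e.lab = some (u, b) → u ∈ bag P j → P[j]? = some (v, true) → G.Adj u v →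
      (b = true → ph ≠ 2) ∧ (b = false → ph ≠ 0)) :
    Sound G P sl E ⟨j, old, new ++ toks [e'], co', cn', ph⟩ (D₁ ++ pre ++ [e']) post := by
  have hlabs : labs (D₁ ++ pre ++ [e']) ++ labs post = labs D₁ ++ labs (pre ++ e :: post) := by
    simp only [List.filterMap_append, labs, List.append_assoc]
    congr 2
    simp only [List.filterMap_cons, hlab, List.filterMap_nil]
    cases e.lab <;> rfl
  have hlabs₁ : labs (D₁ ++ pre ++ [e']) = labs D₁ ++ labs (pre ++ [e]) := by
    simp only [List.filterMap_append, labs, List.append_assoc]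
    congr 2
    simp only [List.filterMap_cons, hlab, List.filterMap_nil]
  have hlabs₂ : labs (pre ++ e :: post) = labs (pre ++ [e]) ++ labs post := by
    simp [labs, ← List.filterMap_append]
  -- Events of vertices in the present bag carry letters. So the letterless entries which are
  -- skipped contain only events of vertices already forgotten by `P`, and dummies.
  have hpre' : ∀ u ∈ bag P j, nodesOf (labs pre) u = [] := by
    intro u hu
    rw [nodesOf_eq_nil_iff]
    intro b hb
    obtain ⟨x, hx, hxl⟩ := mem_labs.1 hb
    have h1 := h.lab₂ x (by simp [hx]) u b hxl hu
    rw [tok_eq_none_of_toks_eq_nil hpre hx] at h1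
    simp at h1
  have hZ : ∀ x ∈ labs (pre ++ e :: post), x.1 ∉ newVertex P j :=
    fun x hx => h.not_mem_newVertex hx
  have htoks₁ : toks (D₁ ++ pre ++ [e']) = new ++ toks [e'] := by
    rw [toks, List.filterMap_append, List.filterMap_append, ← toks, ← toks, ← toks, hpre, ← h.new,
      List.append_nil]
  obtain ⟨B, -, hB1, hB2, hB3⟩ := h.good₂
  simp only at hB1 hB2 hB3
  -- `Z` is what the new vertex adds to the bags at this moment.
  set Z : Finset (Fin n) := if ph = 1 then newVertex P j else ∅ with hZdef
  have hZcard : Z.card ≤ act ph := by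
    rw [hZdef, act]
    split_ifs
    · exact card_newVertex_le P j
    · simp
  have hZmem : ∀ x ∈ labs (pre ++ e :: post), x.1 ∉ Z := by
    intro x hx hxZ
    rw [hZdef] at hxZ
    split_ifs at hxZ
    · exact hZ x hx hxZ
    · simp at hxZ
  rw [good_append, hpre] at hB1
  have hok := h.ok
  simp only [AConf.Ok] at hok ok
  -- The letterless entries are passed with the counters from before the move; only then does the
  -- letter of `e` take effect.
  obtain ⟨t1, t2⟩ := hB1.1.transfer (cn := cn) hpre
    (fun x hx => hZmem x (by simp only [labs, List.filterMap_append, List.mem_append]; exact Or.inl hx))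
    hZcard hok.1 hok.2
  have hB1' := hB1.2
  simp only [runTok, List.foldl_nil, Good, het, applyTok] at hB1'
  have hZe : ∀ x, e.lab = some x → x.1 ∉ Z := fun x hx =>
    hZmem x (mem_labs.2 ⟨e, by simp, hx⟩)
  refine
    { old := hpost.symm
      new := htoks₁.symm
      ok := ok
      ph_le := h.ph_le
      seen_eq := by rw [hlabs]; exact h.seen_eq
      new_eq := ?_
      unseen_eq := by rw [hlabs]; exact h.unseen_eq
      tok₁ := ?_
      lab₁ := ?_
      tok₂ := fun x hx => h.tok₂ x (by simp [hx])
      lab₂ := fun x hx => h.lab₂ x (by simp [hx])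
      good₁ := ?_
      cn_eq := ?_
      good₂ := ?_
      edges := by rw [hlabs]; exact h.edges
      nbr := ?_
      last := fun hj' => absurd hj' hj.ne }
  · intro v hv
    obtain ⟨h1, h2⟩ := h.new_eq v hv
    rw [hlabs₂, nodesOf_append, List.append_eq_nil_iff] at h1
    refine ⟨h1.2, ?_⟩
    rw [hlabs₁, nodesOf_append, h1.1, List.append_nil]
    exact h2
  · intro x hx b s hxt
    simp only [List.append_assoc, List.mem_append, List.mem_singleton] at hx
    rcases hx with hx | hx | rfl
    · exact h.tok₁ x hx b s hxt
    · rw [tok_eq_none_of_toks_eq_nil hpre hx] at hxt; simp at hxt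
    · exact htok₁ b s hxt
  · intro x hx u b hxl hu
    simp only [List.append_assoc, List.mem_append, List.mem_singleton] at hx
    rcases hx with hx | hx | rfl
    · exact h.lab₁ x hx u b hxl hu
    · rcases hbag u hu with h1 | h1
      · exact absurd (mem_labs.2 ⟨x, hx, hxl⟩) (nodesOf_eq_nil_iff.1 (hpre' u h1) b)
      · exact absurd (mem_newVertex.2 h1)
          (hZ (u, b) (mem_labs.2 ⟨x, by simp [hx], hxl⟩))
    · exact hlab₁ u b hxl hu
  · have hcn' := h.cn_eq
    have e1 : bagOf (labs (D₁ ++ pre)) = (labs pre).foldl Node.apply B ∪ Z := by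
      rw [bagOf, labs, List.filterMap_append, List.foldl_append]
      exact (congrArg (List.foldl Node.apply · (labs pre)) hB3).trans t2
    have e2 : runTok (0, 0) (toks (D₁ ++ pre)) = cn := by
      rw [toks, List.filterMap_append, ← toks, ← toks, hpre, List.append_nil]; exact hcn'
    rw [good_append, good_append]
    refine ⟨⟨h.good₁, ?_⟩, ?_⟩
    · have e3 : List.foldl Node.apply ∅ (labs D₁) = B ∪ Z := hB3
      rw [e3, hcn']
      exact t1
    · have e3 : List.foldl Node.apply ∅ (labs (D₁ ++ pre)) = _ := e1
      rw [e3, e2]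
      simp only [Good, hlab, applyLab_union hZe, ← hcn, and_true]
      refine ⟨?_, ok.2⟩
      have := Finset.card_union_le (applyLab ((labs pre).foldl Node.apply B) e.lab) Z
      rw [hco] at ok
      omega
  · rw [htoks₁, runTok, List.foldl_append]
    have hcn' : List.foldl (fun c (t : Tok) => t.app c) (0, 0) new = cn := by
      have := h.cn_eq; rwa [← h.new] at this
    rw [hcn', hcn]
    rcases he : e'.tok with _ | t' <;> simp [toks, he, applyTok]
  · refine ⟨applyLab ((labs pre).foldl Node.apply B) e.lab, ?_, ?_, ?_, ?_⟩
    · rw [hco]; exact hB1'.1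
    · rw [hco]; exact hB1'.2.2
    · rw [Finset.disjoint_left]
      intro u hu huB
      have h1 : nodesOf (labs (pre ++ [e])) u = [] := by
        have := (h.new_eq u (mem_newVertex.1 hu)).1
        rw [hlabs₂, nodesOf_append, List.append_eq_nil_iff] at this
        exact this.1
      have h2 : u ∈ (labs (pre ++ [e])).foldl Node.apply B := by
        rw [labs, List.filterMap_append, List.foldl_append, ← labs, ← labs, foldl_labs_cons]
        exact huB
      rw [mem_foldl_apply, h1] at h2
      simp only [List.getLast?_nil, reduceCtorEq, true_and, false_or] at h2
      exact Finset.disjoint_left.1 hB2 hu h2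
    · have e3 : List.foldl Node.apply ∅ (labs D₁) = B ∪ Z := hB3
      have e4 : labs (pre ++ [e]) = labs pre ++ labs [e] := List.filterMap_append
      rw [hlabs₁, bagOf, List.foldl_append, e4, List.foldl_append, e3, t2, foldl_labs_cons]
      exact applyLab_union hZe
  · intro v hv u hu huv
    obtain ⟨h1, h2⟩ := h.nbr v hv u hu huv
    simp only at h1 h2
    have h3 := h.seen_eq u (bag_subset_seen hu)
    have hpe : labs (pre ++ [e]) = labs pre ++ labs [e] := List.filterMap_append
    have hn : nodesOf (labs (D₁ ++ pre ++ [e'])) u = nodesOf (labs D₁) u ++ nodesOf (labs [e]) u := by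
      rw [hlabs₁, nodesOf_append, hpe, nodesOf_append, hpre' u hu, List.nil_append]
    rw [hn]
    rw [hlabs₂, hpe, nodesOf_append, nodesOf_append, nodesOf_append,
      hpre' u hu, List.nil_append] at h3
    by_cases hu1 : ∃ b, e.lab = some (u, b)
    · obtain ⟨b, hb⟩ := hu1
      obtain ⟨g1, g2⟩ := hev u b v hb hu hv huv
      have hl : labs [e] = [(u, b)] := by simp [labs, hb]
      rw [hl]
      rw [hl] at h3
      simp only [nodesOf_cons, if_true, nodesOf_nil] at h3 ⊢
      constructor
      -- If this event completed `u`, it would be the removal of `u`, which is not allowed before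
      -- the new vertex has entered.
      · intro hph heq
        have : b = false := by
          have := congrArg List.getLast? heq
          simpa using this
        exact g2 this hph
      · intro hph
        rcases h2 hph with h4 | h4
        · exact Or.inl (by rw [hlabs₁]; exact h4.append_right _)
        · left
          rw [h4] at h3
          simp only [List.nil_append, List.cons_append, List.cons.injEq] at h3
          have hb' : b = true := by simpa using h3.1
          -- An introduction of a neighbour after phase 0 can only happen in phase 1. Then the new
          -- vertex is present, so the two meet immediately after this event.
          have hph1 : ph = 1 := by
            have := h.ph_le; have := g1 hb'; simp only at *; omega
          refine ⟨labs (D₁ ++ pre ++ [e']), [], by rw [List.append_nil], ?_, ?_⟩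
          · rw [mem_bagOf, hn, h4, hl, hb']
            simp [nodesOf_cons]
          · obtain ⟨n1, n2⟩ := h.new_eq v hv
            rw [hlabs₂, nodesOf_append, List.append_eq_nil_iff] at n1
            rw [hlabs₁, mem_bagOf, nodesOf_append, n1.1, n2, hph1]
            rfl
    · have hl : nodesOf (labs [e]) u = [] := by
        rw [nodesOf_eq_nil_iff]
        intro b hb
        obtain ⟨x, hx, hxl⟩ := mem_labs.1 hb
        rw [List.mem_singleton] at hx
        exact hu1 ⟨b, hx ▸ hxl⟩
      rw [hl, List.append_nil, hlabs₁]
      exact ⟨h1, fun hph => (h2 hph).imp_left (Covers.append_right _)⟩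

/-- A dummy entry changes no bag, and the new counter remains above the old one plus `act ph`, hence
above the size of the bag. -/
theorem Sound.emit {j : ℕ} {old new : List Tok} {co cn : Cursor} {ph : ℕ} {t : Tok}
    {D₁ D₂ : List (Entry n)} (h : Sound G P sl E ⟨j, old, new, co, cn, ph⟩ D₁ D₂) (f : ℕ)
    (hj : j < E.N) (ht : ∀ b s, t ≠ .ev b s)
    (ok : AConf.Ok E ⟨j, old, new ++ [t], co, t.app cn, ph⟩) :
    Sound G P sl E ⟨j, old, new ++ [t], co, t.app cn, ph⟩ (D₁ ++ [⟨f, none, some t⟩]) D₂ := by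
  have hl : labs (D₁ ++ [(⟨f, none, some t⟩ : Entry n)]) = labs D₁ := by simp [labs]
  have ht1 : toks (D₁ ++ [(⟨f, none, some t⟩ : Entry n)]) = new ++ [t] := by
    have := h.new
    simp only at this
    rw [toks, List.filterMap_append, this]; simp
  obtain ⟨B, hB0, hB1, hB2, hB3⟩ := h.good₂
  have hcn : runTok (0, 0) (toks D₁) = cn := h.cn_eq
  refine
    { old := h.old
      new := ht1.symm
      ok := ok
      ph_le := h.ph_le
      seen_eq := by rw [hl]; exact h.seen_eq
      new_eq := by rw [hl]; exact h.new_eq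
      unseen_eq := by rw [hl]; exact h.unseen_eq
      tok₁ := ?_
      lab₁ := ?_
      tok₂ := h.tok₂
      lab₂ := h.lab₂
      good₁ := ?_
      cn_eq := ?_
      good₂ := ⟨B, hB0, hB1, hB2, by rw [hl]; exact hB3⟩
      edges := by rw [hl]; exact h.edges
      nbr := by rw [hl]; exact h.nbr
      last := fun hj' => absurd hj' hj.ne }
  · intro x hx b s hxt
    simp only [List.mem_append, List.mem_singleton] at hx
    rcases hx with hx | rfl
    · exact h.tok₁ x hx b s hxt
    · simp only [Option.some.injEq] at hxt
      exact absurd hxt (ht b s)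
  · intro x hx u b hxl hu
    simp only [List.mem_append, List.mem_singleton] at hx
    rcases hx with hx | rfl
    · exact h.lab₁ x hx u b hxl hu
    · simp at hxl
  · rw [good_append, hcn]
    refine ⟨h.good₁, ?_, ok.2, trivial⟩
    have e3 : List.foldl Node.apply ∅ (labs D₁) = _ := hB3
    have := ok.1
    simp only [applyLab, applyTok, e3] at this ⊢ hB0
    have h1 := Finset.card_union_le B (if ph = 1 then newVertex P j else ∅)
    have h2 : (if ph = 1 then newVertex P j else ∅).card ≤ act ph := by
      rw [act]
      split_ifs
      · exact card_newVertex_le P j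
      · simp
    omega
  · rw [ht1, runTok, List.foldl_append]
    have : new = toks D₁ := h.new
    rw [this]
    simp only [List.foldl_cons, List.foldl_nil]
    rw [← hcn]

/-- Inserting an event of `v` does not disturb pairs of other vertices. When `v` enters, a neighbour
that has entered has not yet left, by the phase 0 clause of the invariant, so it meets `v` right
there. -/
theorem Sound.emitEv {j : ℕ} {old new : List Tok} {co cn : Cursor} {ph : ℕ} {v : Fin n} {b : Bool}
    {D₁ D₂ : List (Entry n)} (hP : IsPathDecomposition G P)
    (h : Sound G P sl E ⟨j, old, new, co, cn, ph⟩ D₁ D₂) (f : ℕ)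
    (hj : j < E.N) (hv : P[j]? = some (v, true)) (hb : (b = true ∧ ph = 0) ∨ (b = false ∧ ph = 1))
    (ok : AConf.Ok E ⟨j, old, new ++ [.ev b (sl v)], co, (Tok.ev b (sl v)).app cn, ph + 1⟩) :
    Sound G P sl E ⟨j, old, new ++ [.ev b (sl v)], co, (Tok.ev b (sl v)).app cn, ph + 1⟩
      (D₁ ++ [⟨f, some (v, b), some (.ev b (sl v))⟩]) D₂ := by
  set t := Tok.ev b (sl v) with htdef
  have hl : labs (D₁ ++ [(⟨f, some (v, b), some t⟩ : Entry n)]) = labs D₁ ++ [(v, b)] := by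
    simp [labs]
  have ht1 : toks (D₁ ++ [(⟨f, some (v, b), some t⟩ : Entry n)]) = new ++ [t] := by
    have := h.new
    simp only at this
    rw [toks, List.filterMap_append, this]; simp
  obtain ⟨B, hB0, hB1, hB2, hB3⟩ := h.good₂
  have hcn : runTok (0, 0) (toks D₁) = cn := h.cn_eq
  have hnv : newVertex P j = {v} := by
    ext u; rw [mem_newVertex, hv]; simp [eq_comm]
  have hvs := not_mem_seen_of_intro hP hv
  have hvn : ∀ v', P[j]? = some (v', true) → v' = v := by
    intro v' hv'; rw [hv] at hv'; simpa using hv'.symm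
  obtain ⟨n1, n2⟩ := h.new_eq v hv
  simp only at n2
  have hne : ∀ u, u ≠ v → nodesOf (labs D₁ ++ [(v, b)]) u = nodesOf (labs D₁) u := by
    intro u hu
    simp [nodesOf_cons, hu.symm]
  have hsv : ∀ u, u ∈ seen P j → v ≠ u := fun u hu e => hvs (e ▸ hu)
  have hvB : v ∉ B := fun hB => Finset.disjoint_left.1 hB2 (mem_newVertex.2 hv) hB
  have hbag : Node.apply (bagOf (labs D₁)) (v, b) = B ∪ if ph + 1 = 1 then newVertex P j else ∅ := by
    rw [hB3]
    rcases hb with ⟨rfl, rfl⟩ | ⟨rfl, rfl⟩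
    · simp [Node.apply, hnv]
    · simp only [Node.apply, hnv]
      ext x; simp only [Bool.false_eq_true, if_false, if_true, Finset.mem_erase, Finset.mem_union,
        Finset.mem_singleton]
      by_cases hx : x = v
      · subst hx; simp [hvB]
      · simp [hx]
  refine
    { old := h.old
      new := ht1.symm
      ok := ok
      ph_le := by show ph + 1 ≤ 2; omega
      seen_eq := ?_
      new_eq := ?_
      unseen_eq := ?_
      tok₁ := ?_
      lab₁ := ?_
      tok₂ := h.tok₂
      lab₂ := h.lab₂
      good₁ := ?_
      cn_eq := ?_
      good₂ := ⟨B, hB0, hB1, hB2, by rw [hl, bagOf, List.foldl_append]; exact hbag⟩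
      edges := ?_
      nbr := ?_
      last := fun hj' => absurd hj' hj.ne }
  · intro u hu
    rw [hl, nodesOf_append, hne u (hsv u hu).symm, ← nodesOf_append]
    exact h.seen_eq u hu
  · intro v' hv'
    obtain rfl := hvn v' hv'
    refine ⟨n1, ?_⟩
    rw [hl, nodesOf_append, n2]
    rcases hb with ⟨rfl, rfl⟩ | ⟨rfl, rfl⟩ <;> simp [nodesOf_cons]
  · intro u hu hu'
    have hne' : u ≠ v := by
      rintro rfl; exact hu' hv
    rw [hl, nodesOf_append, hne u hne', ← nodesOf_append]
    exact h.unseen_eq u hu hu'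
  · intro x hx b' s hxt
    simp only [List.mem_append, List.mem_singleton] at hx
    rcases hx with hx | rfl
    · exact h.tok₁ x hx b' s hxt
    · simp only [Option.some.injEq, htdef, Tok.ev.injEq] at hxt
      refine ⟨v, ?_, by rw [hxt.1], hxt.2⟩
      rw [bag_succ P j _ hv]; simp [Node.apply]
  · intro x hx u b' hxl hu
    simp only [List.mem_append, List.mem_singleton] at hx
    rcases hx with hx | rfl
    · exact h.lab₁ x hx u b' hxl hu
    · simp only [Option.some.injEq, Prod.mk.injEq] at hxl
      rw [htdef, hxl.1, hxl.2]
  · rw [good_append, hcn]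
    refine ⟨h.good₁, ?_, ok.2, trivial⟩
    have := ok.1
    simp only [applyTok] at this ⊢ hB0
    show (Node.apply (bagOf (labs D₁)) (v, b)).card ≤ _
    rw [hbag]
    have h1 := Finset.card_union_le B (if ph + 1 = 1 then newVertex P j else ∅)
    have h2 : (if ph + 1 = 1 then newVertex P j else ∅).card ≤ act (ph + 1) := by
      rw [act]
      split_ifs
      · exact card_newVertex_le P j
      · simp
    omega
  · rw [ht1, runTok, List.foldl_append]
    have : new = toks D₁ := h.new
    rw [this]
    simp only [List.foldl_cons, List.foldl_nil]
    rw [← hcn]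
  · intro u hu w hw huw
    rw [hl, List.append_assoc]
    exact (h.edges u hu w hw huw).insert _ (hsv u hu) (hsv w hw)
  · intro v' hv' u hu huv
    obtain rfl := hvn v' hv'
    obtain ⟨h1, h2⟩ := h.nbr v' hv u hu huv
    have hus := bag_subset_seen hu
    refine ⟨fun h0 => absurd h0 (Nat.succ_ne_zero ph), fun _ => ?_⟩
    rw [hl, hne u (hsv u hus).symm]
    rcases hb with ⟨rfl, rfl⟩ | ⟨rfl, rfl⟩
    · have h3 := h.seen_eq u hus
      have h4 := h1 rfl
      rw [nodesOf_append] at h3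
      by_cases hD : nodesOf (labs D₁) u = []
      · exact Or.inr hD
      · left
        refine ⟨_, [], (List.append_nil _).symm, ?_, ?_⟩
        · rw [mem_bagOf, hne u (hsv u hus).symm]
          generalize nodesOf (labs D₁) u = A at *
          match A with
          | [] => exact absurd rfl hD
          | [x] => simp only [List.singleton_append, List.cons.injEq] at h3; rw [h3.1]; rfl
          | x :: y :: l =>
            simp only [List.cons_append, List.cons.injEq, List.append_eq_nil_iff] at h3
            exact absurd (by rw [h3.1, h3.2.1, h3.2.2.1]) h4
        · rw [mem_bagOf, nodesOf_append]
          simp [nodesOf_cons]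
    · rcases h2 (by simp) with h4 | h4
      · exact Or.inl (h4.append_right _)
      · exact Or.inr h4

/-- No letter is left, so all events of bag vertices lie in `D₁`. This rules out the alternative
that a neighbour of the new vertex has yet to enter, and all its edges to the bag are covered. By
`mem_bag_of_adj` it has no other edges to seen vertices. -/
theorem Sound.endPass {j : ℕ} {new : List Tok} {co cn : Cursor} {ph : ℕ} {x : Node n}
    {D₁ D₂ : List (Entry n)} (hP : IsPathDecomposition G P) (hj : P[j]? = some x)
    (h : Sound G P sl E ⟨j, [], new, co, cn, ph⟩ D₁ D₂) (hph : ph = 2 * if x.2 then 1 else 0) :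
    Sound G P sl E ⟨j + 1, new, [], (0, 0), (0, 0), 0⟩ [] (D₁ ++ D₂) := by
  have hD₂ : toks D₂ = [] := h.old.symm
  have hnone := fun e he => tok_eq_none_of_toks_eq_nil (e := e) hD₂ he
  have hlabs : labs [] ++ labs (D₁ ++ D₂) = labs D₁ ++ labs D₂ := List.filterMap_append
  have hbagD₂ : ∀ u ∈ bag P j, nodesOf (labs D₂) u = [] := by
    intro u hu
    rw [nodesOf_eq_nil_iff]
    intro b hb
    obtain ⟨e, he, hel⟩ := mem_labs.1 hb
    have := h.lab₂ e he u b hel hu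
    rw [hnone e he] at this
    simp at this
  have hph1 : ph ≠ 1 := by split_ifs at hph <;> omega
  have hseen : ∀ u, u ∈ seen P (j + 1) → u ∈ seen P j ∨ P[j]? = some (u, true) := by
    intro u hu
    obtain ⟨v, b⟩ := x
    cases b
    · exact Or.inl ((seen_succ_of_forget hj u).1 hu)
    · rcases (seen_succ_of_intro hj u).1 hu with rfl | h1
      · exact Or.inr hj
      · exact Or.inl h1
  have hnew : ∀ v, P[j]? = some (v, true) → ph = 2 := by
    intro v hv
    rw [hv] at hj
    simp only [Option.some.injEq] at hj
    rw [hph, ← hj]; rfl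
  have hall : ∀ u ∈ seen P (j + 1), nodesOf (labs D₁ ++ labs D₂) u = [(u, true), (u, false)] := by
    intro u hu
    rcases hseen u hu with h1 | h1
    · exact h.seen_eq u h1
    · obtain ⟨n1, n2⟩ := h.new_eq u h1
      rw [nodesOf_append, n1, n2]
      simp [hnew u h1]
  have hnbr : ∀ v, P[j]? = some (v, true) → ∀ u ∈ bag P j, G.Adj u v →
      Covers (labs D₁ ++ labs D₂) u v := by
    intro v hv u hu huv
    rcases (h.nbr v hv u hu huv).2 (by simp [hnew v hv]) with h1 | h1
    · exact h1.append_right _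
    · have h2 := h.seen_eq u (bag_subset_seen hu)
      rw [nodesOf_append, h1, hbagD₂ u hu] at h2
      simp at h2
  obtain ⟨B, hB0, hB1, hB2, hB3⟩ := h.good₂
  have hcn : runTok (0, 0) (toks D₁) = cn := h.cn_eq
  refine
    { old := ?_
      new := rfl
      ok := ⟨by simp [act], Nat.zero_le _⟩
      ph_le := Nat.zero_le _
      seen_eq := by rw [hlabs]; exact hall
      new_eq := ?_
      unseen_eq := ?_
      tok₁ := by simp
      lab₁ := by simp
      tok₂ := ?_
      lab₂ := ?_
      good₁ := trivial
      cn_eq := rfl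
      good₂ := ⟨∅, by simp, ?_, by simp, by simp [bagOf, labs]⟩
      edges := ?_
      nbr := ?_
      last := fun _ => rfl }
  · have := h.new
    simp only at this ⊢
    rw [toks, List.filterMap_append, ← toks, ← toks, hD₂, this, List.append_nil]
  · intro v hv
    refine ⟨?_, rfl⟩
    have h1 := h.unseen_eq v
    have h2 : v ∉ seen P (j + 1) := not_mem_seen_of_intro hP hv
    have h3 : nodesOf (labs D₁ ++ labs D₂) v = [] := by
      apply h1
      · intro h4
        exact h2 ((List.take_sublist_take_left (Nat.le_succ j)).subset h4)
      · intro h4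
        apply h2
        rw [seen_succ_of_intro h4]; exact Or.inl rfl
    have h4 : labs (D₁ ++ D₂) = labs D₁ ++ labs D₂ := List.filterMap_append
    rw [h4]; exact h3
  · intro u hu hu'
    rw [hlabs]
    apply h.unseen_eq u
    · intro h4
      exact hu ((List.take_sublist_take_left (Nat.le_succ j)).subset h4)
    · intro h4
      apply hu
      show u ∈ seen P (j + 1)
      rw [seen_succ_of_intro h4]; exact Or.inl rfl
  · intro e he b s het
    rcases List.mem_append.1 he with he | he
    · exact h.tok₁ e he b s het
    · rw [hnone e he] at het; simp at het
  · intro e he u b hel hu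
    rcases List.mem_append.1 he with he | he
    · exact h.lab₁ e he u b hel hu
    · exfalso
      have h1 : (u, b) ∈ labs D₂ := mem_labs.2 ⟨e, he, hel⟩
      by_cases hub : u ∈ bag P j
      · exact nodesOf_eq_nil_iff.1 (hbagD₂ u hub) b h1
      · have h2 : P[j]? = some (u, true) := by
          simp only at hu
          rw [bag_succ P j x hj] at hu
          obtain ⟨v, b'⟩ := x
          cases b'
          · simp [Node.apply, hub] at hu
          · simp only [Node.apply, if_true, Finset.mem_insert, hub, or_false] at hu
            rw [hj, hu]
        exact nodesOf_eq_nil_iff.1 (h.new_eq u h2).1 b h1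
  · rw [good_append, hcn]
    refine ⟨h.good₁, ?_⟩
    have e3 : List.foldl Node.apply ∅ (labs D₁) = _ := hB3
    simp only [hph1, if_false, Finset.union_empty] at e3
    rw [e3]
    have := (hB1.transfer (Z := ∅) (d := 0) (cn := cn) hD₂ (by simp) (by simp) (by
      have := h.ok.1; simp only at this ⊢; omega) h.ok.2).1
    simpa using this
  · intro u hu w hw huw
    rw [hlabs]
    rcases hseen u hu with h1 | h1 <;> rcases hseen w hw with h2 | h2
    · exact h.edges u h1 w h2 huw
    · exact hnbr w h2 u (mem_bag_of_adj hP h2 h1 huw) huw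
    · exact (hnbr u h1 w (mem_bag_of_adj hP h1 h2 huw.symm) huw.symm).symm
    · rw [h1] at h2
      simp only [Option.some.injEq, Prod.mk.injEq, and_true] at h2
      exact absurd huw (h2 ▸ G.loopless.irrefl u)
  · intro v hv u hu huv
    exact ⟨fun _ => by simp [labs], fun h0 => absurd rfl h0⟩

theorem Sound.init : Sound G P sl E ⟨0, [], [], (0, 0), (0, 0), 0⟩ [] [] where
  old := rfl
  new := rfl
  ok := ⟨by simp [act], Nat.zero_le _⟩
  ph_le := Nat.zero_le _
  seen_eq u hu := by simp [seen] at hu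
  new_eq v hv := ⟨rfl, rfl⟩
  unseen_eq u _ _ := rfl
  tok₁ := by simp
  lab₁ := by simp
  tok₂ := by simp
  lab₂ := by simp
  good₁ := trivial
  cn_eq := rfl
  good₂ := ⟨∅, by simp, trivial, by simp, by simp [bagOf, labs]⟩
  edges u hu := by simp [seen] at hu
  nbr v hv u hu := by simp [bag] at hu
  last _ := rfl

/-- Every move of the machine can be followed on the list of events. -/
theorem Sound.step (hP : IsPathDecomposition G P) (hE : Compat G P sl E) {r : ℕ} {a a' : AConf}
    {D₁ D₂ : List (Entry n)} {x : Node n} (h : Sound G P sl E a D₁ D₂) (hstep : AStep E r a a')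
    (f : ℕ) (hx : P[a.j]? = some x) :
    ∃ D₁' D₂', DStep x.1 f r D₁ D₂ D₁' D₂' ∧ Sound G P sl E a' D₁' D₂' := by
  have hbag : ∀ u ∈ bag P (a.j + 1), u ∈ bag P a.j ∨ P[a.j]? = some (u, true) := by
    intro u hu
    rw [bag_succ P _ x hx] at hu
    obtain ⟨v, b⟩ := x
    cases b
    · simp only [Node.apply, Bool.false_eq_true, if_false, Finset.mem_erase] at hu
      exact Or.inl hu.2
    · simp only [Node.apply, if_true, Finset.mem_insert] at hu
      rcases hu with rfl | hu
      · exact Or.inr hx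
      · exact Or.inl hu
  have htyp := hE.typ _ x hx
  have hslot := hE.slot _ x hx
  cases hstep with
  | @drop j old new co cn ph t hj ht ok =>
    obtain ⟨pre, e, post, rfl, h1, h2, h3⟩ := exists_of_toks_eq_cons h.old.symm
    refine ⟨_, _, DStep.drop D₁ pre post e h1 (by simp [h2]), ?_⟩
    have hmem : e ∈ pre ++ e :: post := by simp
    simp only at htyp hslot hbag hx
    have := h.advance (e' := ⟨e.id, e.lab, none⟩) (co' := t.app co) (cn' := cn) hj h1 h2 h3 rfl rfl rfl
      (by simpa [toks] using ok) (by simp) ?_ hbag ?_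
    · simpa [toks] using this
    -- A dropped event belongs to the vertex which `P` forgets now, because slots distinguish the
    -- vertices of a bag; so no vertex of the next bag loses its letter.
    · intro u b hub hu
      exfalso
      simp only at hub
      rcases hbag u hu with hu1 | hu1
      · have := h.lab₂ e hmem u b hub hu1
        rw [h2, Option.some.injEq] at this
        obtain ⟨g1, g2⟩ := ht b _ this
        rw [g1] at htyp
        have hx2 : x.2 = false := by
          by_contra hc; simp [hc] at htyp
        have hx' : P[j]? = some (x.1, false) := by rw [hx, ← hx2]
        have : u = x.1 := hE.inj j u hu1 x.1 (mem_bag_of_forget hP hx') (by rw [g2, hslot])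
        rw [bag_succ P _ _ hx', this] at hu
        simp [Node.apply] at hu
      · exact h.not_mem_newVertex (mem_labs.2 ⟨e, hmem, hub⟩) (mem_newVertex.2 hu1)
    · intro u b v hub hu hv _
      exfalso
      have := h.lab₂ e hmem u b hub hu
      rw [h2, Option.some.injEq] at this
      obtain ⟨g1, g2⟩ := ht b _ this
      rw [hx, Option.some.injEq] at hv
      simp [g1, hv] at htyp
  | @keep j old new co cn ph b s hj hs hnb ok =>
    obtain ⟨pre, e, post, rfl, h1, h2, h3⟩ := exists_of_toks_eq_cons h.old.symm
    refine ⟨_, _, DStep.keep D₁ pre post e h1 (by simp [h2]), ?_⟩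
    have hmem : e ∈ pre ++ e :: post := by simp
    simp only at htyp hslot hbag hx
    obtain ⟨w, hw, hwl, hws⟩ := h.tok₂ e hmem b s h2
    simp only at hw
    have := h.advance (e' := e) (co' := (Tok.ev b s).app co) (cn' := (Tok.ev b s).app cn) hj h1 h2 h3 rfl
      (by simp [h2, applyTok]) rfl (by simpa [toks, h2] using ok) ?_ ?_ hbag ?_
    · simpa [toks, h2] using this
    · intro b' s' hb'
      rw [h2, Option.some.injEq, Tok.ev.injEq] at hb'
      obtain ⟨rfl, rfl⟩ := hb'
      refine ⟨w, ?_, hwl, hws⟩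
      rw [bag_succ P _ x hx]
      obtain ⟨v, c⟩ := x
      cases c
      · simp only [Node.apply, Bool.false_eq_true, if_false, Finset.mem_erase]
        refine ⟨?_, hw⟩
        rintro rfl
        exact hs ⟨by simpa using htyp, by rw [hslot, ← hws]⟩
      · simp [Node.apply, hw]
    · intro u b' hub hu
      rw [hwl] at hub
      simp only [Option.some.injEq, Prod.mk.injEq] at hub
      rw [h2, ← hub.1, ← hub.2, hws]
    · intro u b' v hub hu hv huv
      rw [hwl] at hub
      simp only [Option.some.injEq, Prod.mk.injEq] at hub
      have := hnb (by rw [← hws, hub.1]; exact (hE.nb j v hv u hu).2 huv)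
      rw [← hub.2]; exact this
  | @emit j old new co cn ph r t hj ht ok =>
    refine ⟨_, _, DStep.emit D₁ D₂ r t (by tauto), h.emit f hj ?_ ok⟩
    rintro b s rfl
    simp at ht
  | @emitEv j old new co cn ph r b hj hT hr ok =>
    simp only at htyp hslot hx
    have hx2 : x.2 = true := by
      by_contra hc; simp [hc] at htyp; omega
    have hx' : P[j]? = some (x.1, true) := by rw [hx, ← hx2]
    rw [hslot] at ok ⊢
    exact ⟨_, _, DStep.emitEv D₁ D₂ r b _ (by tauto), h.emitEv hP f hj hx' (by tauto) ok⟩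
  | @endPass j new co cn ph hj hph =>
    refine ⟨_, _, DStep.endPass D₁ D₂, h.endPass hP hx ?_⟩
    rw [hph]; congr 1

theorem Good.card_le {K : ℕ} {B : Finset (Fin n)} {c : Cursor} {l : List (Entry n)}
    (h : Good K B c l) (hB : B.card ≤ K) (i : ℕ) :
    (((labs l).take i).foldl Node.apply B).card ≤ K := by
  induction l generalizing B c i with
  | nil => simpa [labs] using hB
  | cons e l ih =>
    obtain ⟨h1, h2, h3⟩ := h
    rcases he : e.lab with _ | x
    · have hl : labs (e :: l) = labs l := by simp [labs, he]
      rw [hl]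
      rw [he] at h3
      exact ih h3 hB i
    · have hl : labs (e :: l) = x :: labs l := by simp [labs, he]
      rw [hl]
      cases i with
      | zero => simpa using hB
      | succ i =>
        rw [List.take_succ_cons, List.foldl_cons]
        rw [he] at h1 h3
        exact ih h3 (h1.trans h2) i

/-- An accepting run yields a path decomposition of width at most `k`. -/
theorem Sound.isPathDecomposition (hP : IsPathDecomposition G P) (hE : Compat G P sl E) {a : AConf}
    {D₁ D₂ : List (Entry n)} (h : Sound G P sl E a D₁ D₂) (ha : a.j = E.N) :
    D₁ = [] ∧ IsPathDecomposition G (labs D₂) ∧ width (labs D₂) ≤ E.K - 1 := by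
  obtain rfl := h.last ha
  have hseen : ∀ u, u ∈ seen P a.j := by
    intro u; rw [ha, hE.N]; exact mem_seen_length hP u
  refine ⟨rfl, ⟨fun u => ?_, fun u w huw => ?_⟩, ?_⟩
  · have := h.seen_eq u (hseen u)
    simpa [labs, nodesOf] using this
  · have := h.edges u (hseen u) w (hseen w) huw
    exact Covers.exists_bag (by simpa [labs] using this)
  · refine Nat.sub_le_sub_right (Finset.sup_le fun i _ => ?_) 1
    obtain ⟨B, hB0, hB1, -, hB3⟩ := h.good₂
    have hB : B = ∅ := by
      have : bagOf (labs ([] : List (Entry n))) = ∅ := by simp [bagOf, labs]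
      rw [this] at hB3
      have := Finset.subset_union_left (s₁ := B) (s₂ := if a.ph = 1 then newVertex P a.j else ∅)
      rw [← hB3] at this
      exact Finset.subset_empty.1 this
    rw [hB] at hB1
    exact hB1.card_le (by simp) i

end Step

end Soundness

/-! ### Domination of sequences of bag sizes -/

section Domination

/-- A gap between two events: the event before it, if it concerns a vertex of the present bag, and
the size of the bag. -/
abbrev Gap : Type := Option (Bool × ℕ) × ℕ

/-- Sequences `A` and `B` can be traversed such that at all times the size in `A` is at most the size
in `B`, and common events are passed at the same time. In phases `0`, `1`, `2` the sequence `B`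
contains in addition the two events of slot `s`, which must not be separated from those of a slot
satisfying `nbr`. Phase `3` is plain domination. -/
inductive Dom (nbr : ℕ → Prop) (s : ℕ) : ℕ → List Gap → List Gap → Prop
  | last {ph a b} (hph : 2 ≤ ph) (h : a.2 + act ph ≤ b.2) : Dom nbr s ph [a] [b]
  | left {ph a a' as b bs} (h : a.2 + act ph ≤ b.2) (ha : a'.1 = none)
      (hd : Dom nbr s ph (a' :: as) (b :: bs)) : Dom nbr s ph (a :: a' :: as) (b :: bs)
  | right {ph a as b b' bs} (h : a.2 + act ph ≤ b.2) (hb : b'.1 = none)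
      (hd : Dom nbr s ph (a :: as) (b' :: bs)) : Dom nbr s ph (a :: as) (b :: b' :: bs)
  | both {ph a a' as b b' bs} (h : a.2 + act ph ≤ b.2) (hab : a'.1 = b'.1)
      (hok : ∀ c i, a'.1 = some (c, i) → nbr i → (c = true → ph ≠ 2) ∧ (c = false → ph ≠ 0))
      (hd : Dom nbr s ph (a' :: as) (b' :: bs)) : Dom nbr s ph (a :: a' :: as) (b :: b' :: bs)
  | new {ph a as b b' bs c} (h : a.2 + act ph ≤ b.2) (hb : b'.1 = some (c, s))
      (hph : (ph = 0 ∧ c = true) ∨ (ph = 1 ∧ c = false))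
      (hd : Dom nbr s (ph + 1) (a :: as) (b' :: bs)) : Dom nbr s ph (a :: as) (b :: b' :: bs)

variable {nbr : ℕ → Prop} {s : ℕ}

theorem Dom.head_le {ph a as b bs} (h : Dom nbr s ph (a :: as) (b :: bs)) :
    a.2 + act ph ≤ b.2 := by
  cases h <;> assumption

/-- Run both traversals at the pace of `B`. Moves of `A` or `C` alone are kept, joint moves compose,
and where `B` moves alone against `A` and alone against `C` nothing happens. One of the two
dominations is plain, and `act 3 = 0`, so the phases do not interfere. -/
theorem Dom.trans {N p q r : ℕ} {A B C : List Gap} (hN : A.length + B.length + C.length ≤ N)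
    (h₁ : Dom nbr s p A B) (h₂ : Dom nbr s q B C) (hr : (p = 3 ∧ r = q) ∨ (q = 3 ∧ r = p)) :
    Dom nbr s r A C := by
  induction N generalizing p q r A B C with
  | zero => cases h₁ <;> simp at hN
  | succ N ih =>
    have hact : act r = act p + act q := by
      rcases hr with ⟨rfl, rfl⟩ | ⟨rfl, rfl⟩ <;> simp [act]
    cases h₂ with
    | @right _ b bs c c' cs h2 hc hd2 =>
      cases A with
      | nil => cases h₁
      | cons a as =>
        have h1 := h₁.head_le
        exact .right (by omega) hc (ih (by simp only [List.length_cons] at hN ⊢; omega) h₁ hd2 hr)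
    | @new _ b bs c c' cs e h2 hc hph hd2 =>
      cases A with
      | nil => cases h₁
      | cons a as =>
        have h1 := h₁.head_le
        obtain ⟨rfl, rfl⟩ : p = 3 ∧ r = q := by omega
        exact .new (by omega) hc hph
          (ih (by simp only [List.length_cons] at hN ⊢; omega) h₁ hd2 (Or.inl ⟨rfl, rfl⟩))
    | @last _ b c hq h2 =>
      cases h₁ with
      | @last _ a _ hp h1 => exact .last (by omega) (by omega)
      | @left _ a a' as _ _ h1 ha hd1 =>
        exact .left (by omega) ha (ih (by simp only [List.length_cons] at hN ⊢; omega) hd1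
          (.last hq h2) hr)
    | @left _ b b' bs c cs h2 hb hd2 =>
      cases h₁ with
      | @left _ a a' as _ _ h1 ha hd1 =>
        exact .left (by omega) ha (ih (by simp only [List.length_cons] at hN ⊢; omega) hd1
          (.left h2 hb hd2) hr)
      | @right _ a as _ _ _ h1 _ hd1 =>
        exact ih (by simp only [List.length_cons] at hN ⊢; omega) hd1 hd2 hr
      | @both _ a a' as _ _ _ h1 hab hok hd1 =>
        exact .left (by omega) (hab.trans hb)
          (ih (by simp only [List.length_cons] at hN ⊢; omega) hd1 hd2 hr)
      | @new _ a as _ _ _ e h1 hb' hph hd1 => rw [hb] at hb'; simp at hb'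
    | @both _ b b' bs c c' cs h2 hbc hok2 hd2 =>
      cases h₁ with
      | @left _ a a' as _ _ h1 ha hd1 =>
        exact .left (by omega) ha (ih (by simp only [List.length_cons] at hN ⊢; omega) hd1
          (.both h2 hbc hok2 hd2) hr)
      | @right _ a as _ _ _ h1 hb hd1 =>
        exact .right (by omega) (hbc ▸ hb)
          (ih (by simp only [List.length_cons] at hN ⊢; omega) hd1 hd2 hr)
      | @both _ a a' as _ _ _ h1 hab hok hd1 =>
        refine .both (by omega) (hab.trans hbc) ?_
          (ih (by simp only [List.length_cons] at hN ⊢; omega) hd1 hd2 hr)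
        rcases hr with ⟨rfl, rfl⟩ | ⟨rfl, rfl⟩
        · rw [hab]; exact hok2
        · exact hok
      | @new _ a as _ _ _ e h1 hb' hph hd1 =>
        obtain ⟨rfl, rfl⟩ : q = 3 ∧ r = p := by omega
        exact .new (by omega) (hbc ▸ hb') hph
          (ih (by simp only [List.length_cons] at hN ⊢; omega) hd1 hd2 (Or.inr ⟨rfl, rfl⟩))

theorem Dom.refl (a : Gap) (as : List Gap) : Dom nbr s 3 (a :: as) (a :: as) := by
  induction as generalizing a with
  | nil => exact .last (by omega) (by simp [act])
  | cons b as ih => exact .both (by simp [act]) rfl (fun c i _ _ => ⟨by omega, by omega⟩) (ih b)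

theorem Dom.cons {a b a' b' as bs} (h : Dom nbr s 3 (a :: as) (b :: bs)) (ht : a.1 = b.1)
    (hl : a'.2 ≤ b'.2) : Dom nbr s 3 (a' :: a :: as) (b' :: b :: bs) :=
  .both (by simpa [act] using hl) ht (fun c i _ _ => ⟨by omega, by omega⟩) h

theorem Dom.append {A B a b as bs} (h : Dom nbr s 3 A B) (h' : Dom nbr s 3 (a :: as) (b :: bs))
    (ht : a.1 = b.1) : Dom nbr s 3 (A ++ a :: as) (B ++ b :: bs) := by
  generalize hp : 3 = p at h
  induction h with
  | @last ph x y hph h =>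
    subst hp
    exact h'.cons ht (by simpa [act] using h)
  | left h ha hd ih => exact .left h ha (ih hp)
  | right h ha hd ih => exact .right h ha (ih hp)
  | both h hab hok hd ih => exact .both h hab hok (ih hp)
  | new h hb hph hd ih => omega

theorem Dom.snoc_left {A B : List Gap} {x : Gap} (h : Dom nbr s 3 A B) (hx : x.1 = none)
    (hl : ∀ b ∈ B.getLast?, x.2 ≤ b.2) : Dom nbr s 3 (A ++ [x]) B := by
  generalize hp : 3 = p at h
  induction h with
  | @last ph a b hph h =>
    subst hp
    exact .left h hx (.last hph (by have := hl b (by simp); simpa [act] using this))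
  | left h ha hd ih => exact .left h ha (ih hl hp)
  | right h ha hd ih => exact .right h ha (ih (fun b hb => hl b (by simpa using hb)) hp)
  | both h hab hok hd ih => exact .both h hab hok (ih (fun b hb => hl b (by simpa using hb)) hp)
  | new h hb hph hd ih => omega

theorem Dom.snoc_right {A B : List Gap} {x : Gap} (h : Dom nbr s 3 A B) (hx : x.1 = none)
    (hl : ∀ a ∈ A.getLast?, a.2 ≤ x.2) : Dom nbr s 3 A (B ++ [x]) := by
  generalize hp : 3 = p at h
  induction h with
  | @last ph a b hph h =>
    subst hp
    exact .right h hx (.last hph (by have := hl a (by simp); simpa [act] using this))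
  | left h ha hd ih => exact .left h ha (ih (fun b hb => hl b (by simpa using hb)) hp)
  | right h ha hd ih => exact .right h ha (ih hl hp)
  | both h hab hok hd ih => exact .both h hab hok (ih (fun b hb => hl b (by simpa using hb)) hp)
  | new h hb hph hd ih => omega

/-- An event is recorded with the gap after it, so reversal makes sense only when there are no
events. -/
theorem Dom.reverse {A B : List Gap} (h : Dom nbr s 3 A B) (hA : ∀ a ∈ A, a.1 = none)
    (hB : ∀ b ∈ B, b.1 = none) : Dom nbr s 3 A.reverse B.reverse := by
  generalize hp : 3 = p at h
  induction h with
  | last hph h => subst hp; exact .last hph h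
  | @left ph a a' as b bs h ha hd ih =>
    subst hp
    rw [List.reverse_cons]
    refine (ih (fun x hx => hA x (List.mem_cons_of_mem _ hx)) hB rfl).snoc_left (hA a (by simp)) ?_
    simpa [act] using h
  | @right ph a as b b' bs h hb hd ih =>
    subst hp
    rw [List.reverse_cons (as := b' :: bs)]
    refine (ih hA (fun x hx => hB x (List.mem_cons_of_mem _ hx)) rfl).snoc_right (hB b (by simp)) ?_
    simpa [act] using h
  | @both ph a a' as b b' bs h hab hok hd ih =>
    subst hp
    rw [List.reverse_cons (as := b' :: bs), List.reverse_cons (as := a' :: as)]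
    refine (ih (fun x hx => hA x (List.mem_cons_of_mem _ hx))
      (fun x hx => hB x (List.mem_cons_of_mem _ hx)) rfl).append (.last (by omega) ?_) ?_
    · exact h
    · rw [hA a (by simp), hB b (by simp)]
  | new h hb hph hd ih => omega

/-- A tag is inspected only when its gap is entered, so the tag of the first gap plays no role. -/
theorem Dom.head_congr {p : ℕ} {a a' b b' : Gap} {as bs : List Gap}
    (h : Dom nbr s p (a :: as) (b :: bs)) (ha : a.2 = a'.2) (hb : b.2 = b'.2) :
    Dom nbr s p (a' :: as) (b' :: bs) := by
  generalize hN : as.length + bs.length = N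
  induction N generalizing p a a' b b' as bs with
  | zero =>
    cases h with
    | last hph h => exact .last hph (by omega)
    | _ => simp at hN
  | succ N ih =>
    cases h with
    | last hph h => simp at hN
    | left h h1 hd => exact .left (by omega) h1 (ih hd rfl hb (by simp at hN; omega))
    | right h h1 hd => exact .right (by omega) h1 (ih hd ha rfl (by simp at hN; omega))
    | both h h1 hok hd => exact .both (by omega) h1 hok hd
    | new h h1 hph hd => exact .new (by omega) h1 hph (ih hd ha rfl (by simp at hN; omega))

end Domination

/-! ### Sequences are equivalent to short walks of two counters -/

section Compression

/-- A sequence of sizes without events. -/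
abbrev plain (l : List ℕ) : List Gap := l.map fun x => (none, x)

/-- Mutual domination of sequences of sizes without events. -/
def Equi (a b : List ℕ) : Prop :=
  Dom (fun _ => False) 0 3 (plain a) (plain b) ∧ Dom (fun _ => False) 0 3 (plain b) (plain a)

theorem Equi.refl (a : ℕ) (l : List ℕ) : Equi (a :: l) (a :: l) := ⟨Dom.refl _ _, Dom.refl _ _⟩

theorem Equi.symm {a b : List ℕ} (h : Equi a b) : Equi b a := ⟨h.2, h.1⟩

theorem Equi.trans {a b c : List ℕ} (h : Equi a b) (h' : Equi b c) : Equi a c :=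
  ⟨Dom.trans le_rfl h.1 h'.1 (Or.inl ⟨rfl, rfl⟩), Dom.trans le_rfl h'.2 h.2 (Or.inl ⟨rfl, rfl⟩)⟩

theorem Equi.append {a b a' b' : List ℕ} {x y : ℕ} (h : Equi a b) (h' : Equi (x :: a') (y :: b')) :
    Equi (a ++ x :: a') (b ++ y :: b') := by
  constructor
  · have := h.1.append h'.1 rfl
    simpa [plain] using this
  · have := h.2.append h'.2 rfl
    simpa [plain] using this

theorem Equi.cons {a b : List ℕ} {x y : ℕ} (z : ℕ) (h : Equi (x :: a) (y :: b)) :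
    Equi (z :: x :: a) (z :: y :: b) := (Equi.refl z []).append h

theorem Equi.reverse {a b : List ℕ} (h : Equi a b) : Equi a.reverse b.reverse := by
  constructor
  · have := h.1.reverse (by simp [plain]) (by simp [plain])
    simpa [plain] using this
  · have := h.2.reverse (by simp [plain]) (by simp [plain])
    simpa [plain] using this

theorem dom_left_many {x b y : ℕ} {mid l bs : List ℕ} (hx : x ≤ b) (hmid : ∀ z ∈ mid, z ≤ b)
    (h : Dom (fun _ => False) 0 3 (plain (y :: l)) (plain (b :: bs))) :
    Dom (fun _ => False) 0 3 (plain (x :: mid ++ y :: l)) (plain (b :: bs)) := by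
  induction mid generalizing x with
  | nil => exact .left (by simpa [act] using hx) rfl h
  | cons z mid ih =>
    exact .left (by simpa [act] using hx) rfl
      (ih (hmid z (by simp)) (fun w hw => hmid w (List.mem_cons_of_mem _ hw)))

theorem dom_right_many {x b y : ℕ} {mid l bs : List ℕ} (hx : b ≤ x) (hmid : ∀ z ∈ mid, b ≤ z)
    (h : Dom (fun _ => False) 0 3 (plain (b :: bs)) (plain (y :: l))) :
    Dom (fun _ => False) 0 3 (plain (b :: bs)) (plain (x :: mid ++ y :: l)) := by
  induction mid generalizing x with
  | nil => exact .right (by simpa [act] using hx) rfl h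
  | cons z mid ih =>
    exact .right (by simpa [act] using hx) rfl
      (ih (hmid z (by simp)) (fun w hw => hmid w (List.mem_cons_of_mem _ hw)))

/-- Values between two values of a sequence can be dropped. -/
theorem equi_drop {x y : ℕ} {mid l : List ℕ}
    (h : ∀ z ∈ mid, min x y ≤ z ∧ z ≤ max x y) : Equi (x :: mid ++ y :: l) (x :: y :: l) := by
  have hr : Dom (fun _ => False) 0 3 (plain (y :: l)) (plain (y :: l)) := Dom.refl _ _
  -- To stay above, the short sequence waits at the larger of `x` and `y` while the other one runs
  -- through `mid`; to stay below, it waits at the smaller one.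
  rcases le_total x y with hxy | hxy
  · simp only [min_eq_left hxy, max_eq_right hxy] at h
    exact ⟨.right (by simp [act]) rfl (dom_left_many hxy (fun z hz => (h z hz).2) hr),
      dom_right_many le_rfl (fun z hz => (h z hz).1)
        (.left (by simpa [act] using hxy) rfl hr)⟩
  · simp only [min_eq_right hxy, max_eq_left hxy] at h
    exact ⟨dom_left_many le_rfl (fun z hz => (h z hz).2) (.right (by simpa [act] using hxy) rfl hr),
      .left (by simp [act]) rfl (dom_right_many hxy (fun z hz => (h z hz).1) hr)⟩

theorem equi_const {x : ℕ} {l : List ℕ} (h : ∀ z ∈ l, z = x) : Equi (x :: l) [x] := by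
  rcases List.eq_nil_or_concat l with rfl | ⟨m, y, rfl⟩
  · exact Equi.refl _ _
  · obtain rfl : y = x := h y (by simp)
    have h1 : Equi (y :: m ++ y :: []) (y :: y :: []) :=
      equi_drop (fun z hz => by have := h z (by simp [hz]); omega)
    have h2 : Equi [y, y] [y] :=
      ⟨.left (by simp [act]) rfl (Dom.refl _ _), .right (by simp [act]) rfl (Dom.refl _ _)⟩
    simpa using h1.trans h2

/-- The steps of the two counters. -/
def Adjacent (c d : Cursor) : Prop :=
  (d.1 = c.1 + 1 ∧ d.2 = c.2) ∨ (c.1 = d.1 + 1 ∧ d.2 = c.2) ∨ d = (c.2, c.1)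

theorem Adjacent.symm {c d : Cursor} (h : Adjacent c d) : Adjacent d c := by
  rcases h with ⟨h1, h2⟩ | ⟨h1, h2⟩ | rfl
  · exact Or.inr (Or.inl ⟨h1, h2.symm⟩)
  · exact Or.inl ⟨h1, h2.symm⟩
  · exact Or.inr (Or.inr rfl)

/-- A walk of the counters from `c` through the states `L` (without `c`) to `d`. -/
inductive Walk : Cursor → List Cursor → Cursor → Prop
  | nil (c) : Walk c [] c
  | cons {c d e L} (h : Adjacent c d) (hw : Walk d L e) : Walk c (d :: L) e

theorem Walk.append {c d e : Cursor} {L M : List Cursor} (h : Walk c L d) (h' : Walk d M e) :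
    Walk c (L ++ M) e := by
  induction h with
  | nil => exact h'
  | cons h hw ih => exact .cons h (ih h')

theorem Walk.reverse {c d : Cursor} {L : List Cursor} (h : Walk c L d) :
    ∃ M, Walk d M c ∧ d :: M = (c :: L).reverse := by
  induction h with
  | nil => exact ⟨[], .nil _, rfl⟩
  | @cons c d e L h hw ih =>
    obtain ⟨M, h1, h2⟩ := ih
    exact ⟨M ++ [c], h1.append (.cons h.symm (.nil _)), by
      rw [List.reverse_cons, ← h2]; rfl⟩

theorem walk_up (x y o : ℕ) (h : x ≤ y) :
    ∃ L, Walk (x, o) L (y, o) ∧ L.length = y - x ∧ ∀ c ∈ L, x ≤ c.1 ∧ c.1 ≤ y := by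
  obtain ⟨d, rfl⟩ := Nat.exists_eq_add_of_le h
  induction d with
  | zero => exact ⟨[], .nil _, by simp, by simp⟩
  | succ d ih =>
    obtain ⟨L, h1, h2, h3⟩ := ih (by omega)
    refine ⟨L ++ [(x + (d + 1), o)], h1.append (.cons (Or.inl ⟨rfl, rfl⟩) (.nil _)),
      by simp [h2], fun c hc => ?_⟩
    rcases List.mem_append.1 hc with hc | hc
    · have := h3 c hc; omega
    · rw [List.mem_singleton] at hc; subst hc; simp

theorem walk_down (x y o : ℕ) (h : x ≤ y) :
    ∃ L, Walk (y, o) L (x, o) ∧ L.length = y - x ∧ ∀ c ∈ L, x ≤ c.1 ∧ c.1 ≤ y := by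
  obtain ⟨d, rfl⟩ := Nat.exists_eq_add_of_le h
  induction d with
  | zero => exact ⟨[], .nil _, by simp, by simp⟩
  | succ d ih =>
    obtain ⟨L, h1, h2, h3⟩ := ih (by omega)
    refine ⟨(x + d, o) :: L, .cons (Or.inr (Or.inl ⟨rfl, rfl⟩)) h1,
      by simp [h2], fun c hc => ?_⟩
    rcases List.mem_cons.1 hc with rfl | hc
    · simp
    · have := h3 c hc; omega

theorem exists_last_split {x : ℕ} {l : List ℕ} (h : x ∈ l) : ∃ a b, l = a ++ x :: b ∧ x ∉ b := by
  obtain ⟨a, b, h1, h2⟩ := List.eq_append_cons_of_mem (List.mem_reverse.2 h)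
  refine ⟨b.reverse, a.reverse, ?_, by simpa using h2⟩
  rw [← List.reverse_reverse l, h1]; simp

/-- A sequence starting from one of its extreme values is equivalent to a short walk from its range. -/
theorem exists_shrinking_walk (d : ℕ) : ∀ lo hi : ℕ, hi = lo + d → ∀ l : List ℕ,
    (∀ z ∈ l, lo ≤ z ∧ z ≤ hi) →
    (lo ∈ hi :: l → ∃ L b, Walk (hi, lo) L (b, b) ∧ (hi :: l).getLast? = some b ∧
      L.length ≤ 2 * d ∧ Equi (hi :: l) (hi :: L.map Prod.fst)) ∧
    (hi ∈ lo :: l → ∃ L b, Walk (lo, hi) L (b, b) ∧ (lo :: l).getLast? = some b ∧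
      L.length ≤ 2 * d ∧ Equi (lo :: l) (lo :: L.map Prod.fst)) := by
  induction d with
  | zero =>
    intro lo hi hd l hl
    obtain rfl : hi = lo := by omega
    have hconst : ∀ z ∈ l, z = hi := fun z hz => by have := hl z hz; omega
    have hlast : (hi :: l).getLast? = some hi := by
      rw [List.getLast?_eq_some_getLast (by simp)]
      have : ∀ z ∈ hi :: l, z = hi := by
        intro z hz
        rcases List.mem_cons.1 hz with rfl | hz
        · rfl
        · exact hconst z hz
      rw [this _ (List.getLast_mem (by simp))]
    exact ⟨fun _ => ⟨[], hi, .nil _, hlast, by simp, equi_const hconst⟩,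
      fun _ => ⟨[], hi, .nil _, hlast, by simp, equi_const hconst⟩⟩
  | succ d ih =>
    intro lo hi hd l hl
    constructor
    · intro hlo
      have hlo' : lo ∈ l := by
        rcases List.mem_cons.1 hlo with h | h
        · omega
        · exact h
      -- Cut at the last occurrence of `lo`: everything between the initial `hi` and it can be
      -- dropped, and the remainder stays above `lo`.
      obtain ⟨mid, rest, rfl, hrest⟩ := exists_last_split hlo'
      have e1 : Equi (hi :: mid ++ lo :: rest) (hi :: lo :: rest) :=
        equi_drop (fun z hz => by have := hl z (by simp [hz]); omega)
      have hr : ∀ z ∈ rest, lo + 1 ≤ z ∧ z ≤ hi := by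
        intro z hz
        have := hl z (by simp [hz])
        have : z ≠ lo := fun h => hrest (h ▸ hz)
        omega
      -- If the remainder returns to `hi`, it needs the range from `lo + 1` to `hi`. A value `lo +
      -- 1` may be inserted after `lo`, since the next value is at least that; the counters are
      -- exchanged and the low one is raised. This costs two letters for one unit of the range.
      by_cases hhi : hi ∈ rest
      · obtain ⟨L, b, h1, h2, h3, h4⟩ :=
          (ih (lo + 1) hi (by omega) rest hr).2 (List.mem_cons_of_mem _ hhi)
        obtain ⟨r, rest, rfl⟩ := List.exists_cons_of_ne_nil (List.ne_nil_of_mem hhi)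
        have e2 : Equi (lo :: [lo + 1] ++ r :: rest) (lo :: r :: rest) :=
          equi_drop (fun z hz => by
            have := hr r (by simp); rw [List.mem_singleton] at hz; omega)
        refine ⟨(lo, hi) :: (lo + 1, hi) :: L, b,
          .cons (Or.inr (Or.inr rfl)) (.cons (Or.inl ⟨rfl, rfl⟩) h1), ?_, ?_, ?_⟩
        · rw [← h2]; simp [List.getLast?_append, List.getLast?_cons]
        · simp; omega
        · exact e1.trans ((e2.symm.cons hi).trans ((h4.cons lo).cons hi))
      -- Otherwise `hi` is finished: one step down from `hi` leaves the range from `lo` to `hi - 1`,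
      -- still starting from its upper end.
      · have hr' : ∀ z ∈ lo :: rest, lo ≤ z ∧ z ≤ hi - 1 := by
          intro z hz
          rcases List.mem_cons.1 hz with rfl | hz
          · omega
          · have := hr z hz
            have : z ≠ hi := fun h => hhi (h ▸ hz)
            omega
        obtain ⟨L, b, h1, h2, h3, h4⟩ := (ih lo (hi - 1) (by omega) (lo :: rest) hr').1 (by simp)
        have e2 : Equi (hi :: [hi - 1] ++ lo :: rest) (hi :: lo :: rest) :=
          equi_drop (fun z hz => by rw [List.mem_singleton] at hz; omega)
        refine ⟨(hi - 1, lo) :: L, b,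
          .cons (Or.inr (Or.inl ⟨by simp; omega, rfl⟩)) h1, ?_, ?_, ?_⟩
        · rw [← h2]; simp [List.getLast?_append, List.getLast?_cons]
        · simp; omega
        · exact e1.trans (e2.symm.trans (h4.cons hi))
    · intro hhi
      have hhi' : hi ∈ l := by
        rcases List.mem_cons.1 hhi with h | h
        · omega
        · exact h
      obtain ⟨mid, rest, rfl, hrest⟩ := exists_last_split hhi'
      have e1 : Equi (lo :: mid ++ hi :: rest) (lo :: hi :: rest) :=
        equi_drop (fun z hz => by have := hl z (by simp [hz]); omega)
      have hr : ∀ z ∈ rest, lo ≤ z ∧ z ≤ hi - 1 := by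
        intro z hz
        have := hl z (by simp [hz])
        have : z ≠ hi := fun h => hrest (h ▸ hz)
        omega
      by_cases hlo : lo ∈ rest
      · obtain ⟨L, b, h1, h2, h3, h4⟩ :=
          (ih lo (hi - 1) (by omega) rest hr).1 (List.mem_cons_of_mem _ hlo)
        obtain ⟨r, rest, rfl⟩ := List.exists_cons_of_ne_nil (List.ne_nil_of_mem hlo)
        have e2 : Equi (hi :: [hi - 1] ++ r :: rest) (hi :: r :: rest) :=
          equi_drop (fun z hz => by
            have := hr r (by simp); rw [List.mem_singleton] at hz; omega)
        refine ⟨(hi, lo) :: (hi - 1, lo) :: L, b,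
          .cons (Or.inr (Or.inr rfl)) (.cons (Or.inr (Or.inl ⟨by simp; omega, rfl⟩)) h1), ?_, ?_, ?_⟩
        · rw [← h2]; simp [List.getLast?_append, List.getLast?_cons]
        · simp; omega
        · exact e1.trans ((e2.symm.cons lo).trans ((h4.cons hi).cons lo))
      · have hr' : ∀ z ∈ hi :: rest, lo + 1 ≤ z ∧ z ≤ hi := by
          intro z hz
          rcases List.mem_cons.1 hz with rfl | hz
          · omega
          · have := hr z hz
            have : z ≠ lo := fun h => hlo (h ▸ hz)
            omega
        obtain ⟨L, b, h1, h2, h3, h4⟩ := (ih (lo + 1) hi (by omega) (hi :: rest) hr').2 (by simp)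
        have e2 : Equi (lo :: [lo + 1] ++ hi :: rest) (lo :: hi :: rest) :=
          equi_drop (fun z hz => by rw [List.mem_singleton] at hz; omega)
        refine ⟨(lo + 1, hi) :: L, b, .cons (Or.inl ⟨rfl, rfl⟩) h1, ?_, ?_, ?_⟩
        · rw [← h2]; simp [List.getLast?_append, List.getLast?_cons]
        · simp; omega
        · exact e1.trans (e2.symm.trans (h4.cons lo))

end Compression

/-! ### Short walks for arbitrary sequences, and short words for sequences with events. -/

section Compression

theorem Equi.context {x : ℕ} {l m : List ℕ} (A : List ℕ) (h : Equi (x :: l) (x :: m)) :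
    Equi (A ++ x :: l) (A ++ x :: m) := by
  cases A with
  | nil => exact h
  | cons a A => exact (Equi.refl a A).append h

theorem Walk.eq_concat {c d : Cursor} {L : List Cursor} (h : Walk c L d) :
    (L = [] ∧ c = d) ∨ ∃ L', L = L' ++ [d] := by
  induction h with
  | nil => exact Or.inl ⟨rfl, rfl⟩
  | @cons c d e L h hw ih =>
    right
    rcases ih with ⟨rfl, rfl⟩ | ⟨L', rfl⟩
    · exact ⟨[], rfl⟩
    · exact ⟨d :: L', rfl⟩

/-- Walks for the parts before and after two extreme values are joined. -/
theorem join_walks {x y o₁ o₂ a b : ℕ} {A mid C : List ℕ} {L₁ L₂ M : List Cursor}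
    (hxy : x ≠ y) (hmid : ∀ z ∈ mid, min x y ≤ z ∧ z ≤ max x y)
    (hM : Walk (x, o₁) M (y, o₂)) (hMb : ∀ c ∈ M, min x y ≤ c.1 ∧ c.1 ≤ max x y)
    (h₁ : Walk (x, o₁) L₁ (a, a)) (e₁ : Equi (x :: A.reverse) (x :: L₁.map Prod.fst))
    (h₂ : Walk (y, o₂) L₂ (b, b)) (e₂ : Equi (y :: C) (y :: L₂.map Prod.fst)) :
    ∃ L, Walk (a, a) L (b, b) ∧ L.length = L₁.length + M.length + L₂.length ∧
      Equi (A ++ x :: mid ++ y :: C) (a :: L.map Prod.fst) := by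
  obtain ⟨R, r1, r2⟩ := h₁.reverse
  refine ⟨R ++ M ++ L₂, (r1.append hM).append h₂, ?_, ?_⟩
  · have := congrArg List.length r2
    simp at this ⊢; omega
  · rcases hM.eq_concat with ⟨-, h⟩ | ⟨M', rfl⟩
    · exact absurd (congrArg Prod.fst h) hxy
    have e3 : Equi (A ++ x :: mid ++ y :: C) (A ++ x :: y :: C) := by
      have := (equi_drop (x := x) (y := y) (mid := mid) (l := C) hmid).context A
      simpa using this
    have e4 : Equi (A ++ x :: y :: C)
        ((L₁.map Prod.fst).reverse ++ x :: y :: L₂.map Prod.fst) := by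
      have := e₁.reverse.append e₂
      simpa using this
    have e5 := (equi_drop (x := x) (y := y) (mid := M'.map Prod.fst) (l := L₂.map Prod.fst) (by
      intro z hz
      obtain ⟨c, hc, rfl⟩ := List.mem_map.1 hz
      exact hMb c (by simp [hc]))).context (L₁.map Prod.fst).reverse
    have e6 := e3.trans (e4.trans e5.symm)
    have r3 : a :: R.map Prod.fst = (L₁.map Prod.fst).reverse ++ [x] := by
      have := congrArg (List.map Prod.fst) r2
      simpa using this
    convert e6 using 1
    simp only [List.map_append, List.map_cons, List.map_nil, ← List.cons_append, r3]
    simp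

/-- Cut at an occurrence of the minimum and one of the maximum. The part after them and the reversed
part before them both start from an extreme value, so each has a shrinking walk of length at most `2
* K`. Between the two extremes all values of the range are allowed, and `2 * K + 1` steps suffice to
bring both counters from where the first walk needs them to where the second does. -/
theorem exists_walk (a : ℕ) (l : List ℕ) (K : ℕ) (hK : ∀ z ∈ a :: l, z ≤ K) :
    ∃ L b, Walk (a, a) L (b, b) ∧ (a :: l).getLast? = some b ∧ L.length ≤ 6 * K + 4 ∧
      Equi (a :: l) (a :: L.map Prod.fst) := by
  have hne : (a :: l).toFinset.Nonempty := ⟨a, by simp⟩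
  obtain ⟨lo, hlo, hlo'⟩ := (a :: l).toFinset.exists_min_image id hne
  obtain ⟨hi, hhi, hhi'⟩ := (a :: l).toFinset.exists_max_image id hne
  simp only [List.mem_toFinset, id] at hlo hhi hlo' hhi'
  have hiK := hK hi hhi
  rcases eq_or_ne lo hi with rfl | hne'
  · have hc : ∀ z ∈ a :: l, z = lo := fun z hz => by
      have := hlo' z hz; have := hhi' z hz; omega
    refine ⟨[], a, .nil _, ?_, by simp, equi_const fun z hz => ?_⟩
    · rw [List.getLast?_eq_some_getLast (by simp), hc _ (List.getLast_mem (by simp)), hc a (by simp)]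
    · rw [hc z (List.mem_cons_of_mem _ hz), hc a (by simp)]
  -- the range of a list from a given extreme value
  have hmax : ∀ (m : List ℕ) (x : ℕ), ∃ y ∈ x :: m, ∀ z ∈ x :: m, z ≤ y := by
    intro m x
    obtain ⟨y, h1, h2⟩ := (x :: m).toFinset.exists_max_image id ⟨x, by simp⟩
    exact ⟨y, by simpa using h1, fun z hz => h2 z (by simpa using hz)⟩
  have hmin : ∀ (m : List ℕ) (x : ℕ), ∃ y ∈ x :: m, ∀ z ∈ x :: m, y ≤ z := by
    intro m x
    obtain ⟨y, h1, h2⟩ := (x :: m).toFinset.exists_min_image id ⟨x, by simp⟩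
    exact ⟨y, by simpa using h1, fun z hz => h2 z (by simpa using hz)⟩
  have low : ∀ m : List ℕ, (∀ z ∈ m, z ∈ a :: l) → ∃ o, lo ≤ o ∧ o ≤ hi ∧ ∃ L b,
      Walk (lo, o) L (b, b) ∧ (lo :: m).getLast? = some b ∧ L.length ≤ 2 * K ∧
      Equi (lo :: m) (lo :: L.map Prod.fst) := by
    intro m hm
    obtain ⟨o, h1, h2⟩ := hmax m lo
    have hlo2 := h2 lo (by simp)
    have ho : o ≤ hi := by
      rcases List.mem_cons.1 h1 with rfl | h
      · exact hhi' _ hlo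
      · exact hhi' _ (hm _ h)
    obtain ⟨L, b, k1, k2, k3, k4⟩ := (exists_shrinking_walk (o - lo) lo o (by omega) m (fun z hz =>
      ⟨hlo' z (hm z hz), h2 z (List.mem_cons_of_mem _ hz)⟩)).2 h1
    exact ⟨o, hlo2, ho, L, b, k1, k2, by omega, k4⟩
  have high : ∀ m : List ℕ, (∀ z ∈ m, z ∈ a :: l) → ∃ o, lo ≤ o ∧ o ≤ hi ∧ ∃ L b,
      Walk (hi, o) L (b, b) ∧ (hi :: m).getLast? = some b ∧ L.length ≤ 2 * K ∧
      Equi (hi :: m) (hi :: L.map Prod.fst) := by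
    intro m hm
    obtain ⟨o, h1, h2⟩ := hmin m hi
    have hhi2 := h2 hi (by simp)
    have ho : lo ≤ o := by
      rcases List.mem_cons.1 h1 with rfl | h
      · exact hlo' _ hhi
      · exact hlo' _ (hm _ h)
    obtain ⟨L, b, k1, k2, k3, k4⟩ := (exists_shrinking_walk (hi - o) o hi (by omega) m (fun z hz =>
      ⟨h2 z (List.mem_cons_of_mem _ hz), hhi' z (hm z hz)⟩)).1 h1
    exact ⟨o, ho, hhi2, L, b, k1, k2, by omega, k4⟩
  have hlohi := hlo' hi hhi
  obtain ⟨A, B, hAB⟩ := List.append_of_mem hlo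
  have hmem : hi ∈ A ∨ hi ∈ B := by
    rw [hAB] at hhi
    simp only [List.mem_append, List.mem_cons] at hhi
    rcases hhi with h | h | h
    · exact Or.inl h
    · exact absurd h.symm hne'
    · exact Or.inr h
  have hrev : ∀ (x b : ℕ) (D F : List ℕ), a :: l = D ++ x :: F →
      (x :: D.reverse).getLast? = some b → b = a := by
    intro x b D F h1 h2
    cases D with
    | nil => simp at h1 h2; rw [← h2, h1.1]
    | cons d D =>
      simp [List.getLast?_cons] at h1 h2; rw [← h2, h1.1]
  rcases hmem with hm | hm
  · obtain ⟨A, mid, rfl⟩ := List.append_of_mem hm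
    obtain ⟨o₁, p1, p2, L₁, b₁, q1, q2, q3, q4⟩ := high A.reverse (fun z hz => by
      rw [hAB]; simp at hz; simp [hz])
    obtain ⟨o₂, p3, p4, L₂, b, r1, r2, r3, r4⟩ := low B (fun z hz => by rw [hAB]; simp [hz])
    obtain rfl : b₁ = a := hrev hi b₁ A (mid ++ lo :: B) (by rw [hAB]; simp) q2
    obtain ⟨M₁, m1, m2, m3⟩ := walk_down o₂ hi o₁ p4
    obtain ⟨M₂, m4, m5, m6⟩ := walk_down lo o₁ o₂ p1
    have hmid : ∀ z ∈ mid, min hi lo ≤ z ∧ z ≤ max hi lo := by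
      intro z hz
      have hz' : z ∈ b₁ :: l := by rw [hAB]; simp [hz]
      have := hlo' z hz'; have := hhi' z hz'; omega
    -- The counter at `hi` goes down to `o₂`, the counters are exchanged, and the one at `o₁` goes
    -- down to `lo`.
    have hM : Walk (hi, o₁) (M₁ ++ (o₁, o₂) :: M₂) (lo, o₂) :=
      m1.append (.cons (Or.inr (Or.inr rfl)) m4)
    have hMb : ∀ c ∈ M₁ ++ (o₁, o₂) :: M₂, min hi lo ≤ c.1 ∧ c.1 ≤ max hi lo := by
      intro c hc
      simp only [List.mem_append, List.mem_cons] at hc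
      rcases hc with hc | rfl | hc
      · have := m3 c hc; omega
      · simp only; omega
      · have := m6 c hc; omega
    obtain ⟨L, t1, t2, t3⟩ := join_walks (A := A) (mid := mid) (C := B) hne'.symm hmid hM hMb q1 q4 r1 r4
    · refine ⟨L, b, t1, ?_, ?_, ?_⟩
      · rw [hAB, ← r2]; simp [List.getLast?_append, List.getLast?_cons]
      · simp at t2; omega
      · rw [hAB]; simpa using t3
  · obtain ⟨mid, C, rfl⟩ := List.append_of_mem hm
    obtain ⟨o₁, p1, p2, L₁, b₁, q1, q2, q3, q4⟩ := low A.reverse (fun z hz => by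
      rw [hAB]; simp at hz; simp [hz])
    obtain ⟨o₂, p3, p4, L₂, b, r1, r2, r3, r4⟩ := high C (fun z hz => by rw [hAB]; simp [hz])
    obtain rfl : b₁ = a := hrev lo b₁ A _ hAB q2
    obtain ⟨M₁, m1, m2, m3⟩ := walk_up lo o₂ o₁ p3
    obtain ⟨M₂, m4, m5, m6⟩ := walk_up o₁ hi o₂ p2
    have hmid : ∀ z ∈ mid, min lo hi ≤ z ∧ z ≤ max lo hi := by
      intro z hz
      have hz' : z ∈ b₁ :: l := by rw [hAB]; simp [hz]
      have := hlo' z hz'; have := hhi' z hz'; omega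
    -- The counter at `lo` goes up to `o₂`, the counters are exchanged, and the one at `o₁` goes up
    -- to `hi`.
    have hM : Walk (lo, o₁) (M₁ ++ (o₁, o₂) :: M₂) (hi, o₂) :=
      m1.append (.cons (Or.inr (Or.inr rfl)) m4)
    have hMb : ∀ c ∈ M₁ ++ (o₁, o₂) :: M₂, min lo hi ≤ c.1 ∧ c.1 ≤ max lo hi := by
      intro c hc
      simp only [List.mem_append, List.mem_cons] at hc
      rcases hc with hc | rfl | hc
      · have := m3 c hc; omega
      · simp only; omega
      · have := m6 c hc; omega
    obtain ⟨L, t1, t2, t3⟩ := join_walks (A := A) (mid := mid) (C := C) hne' hmid hM hMb q1 q4 r1 r4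
    · refine ⟨L, b, t1, ?_, ?_, ?_⟩
      · rw [hAB, ← r2]; simp [List.getLast?_append, List.getLast?_cons]
      · simp at t2; omega
      · rw [hAB]; simpa using t3

/-- The event of a letter. -/
def Tok.tag : Tok → Option (Bool × ℕ)
  | .ev b s => some (b, s)
  | _ => none

/-- The sequence of sizes described by a word. -/
def gapsOf : Cursor → List Tok → List Gap
  | _, [] => []
  | c, t :: w => (t.tag, (t.app c).1) :: gapsOf (t.app c) w

theorem gapsOf_append (c : Cursor) (w z : List Tok) :
    gapsOf c (w ++ z) = gapsOf c w ++ gapsOf (runTok c w) z := by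
  induction w generalizing c with
  | nil => rfl
  | cons t w ih => simp [gapsOf, ih, runTok]

theorem Walk.exists_word {c d : Cursor} {L : List Cursor} (h : Walk c L d) :
    ∃ w, gapsOf c w = plain (L.map Prod.fst) ∧ runTok c w = d ∧ w.length = L.length ∧
      w.filterMap Tok.tag = [] := by
  induction h with
  | nil => exact ⟨[], rfl, rfl, rfl, rfl⟩
  | @cons c d e L h hw ih =>
    obtain ⟨w, h1, h2, h3, h4⟩ := ih
    obtain ⟨t, ht, rfl⟩ : ∃ t : Tok, t.tag = none ∧ t.app c = d := by
      obtain ⟨d1, d2⟩ := d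
      rcases h with ⟨k1, k2⟩ | ⟨k1, k2⟩ | k
      · exact ⟨.inc, rfl, by simp at k1 k2; simp [Tok.app, k1, k2]⟩
      · exact ⟨.dec, rfl, by simp at k1 k2; simp [Tok.app, k1, k2]⟩
      · exact ⟨.swap, rfl, k.symm⟩
    exact ⟨t :: w, by simp [gapsOf, ht, h1, plain], by simpa [runTok] using h2, by simp [h3],
      by simp [ht, h4]⟩

/-- In phase 3 neither the neighbour condition nor the slot is ever consulted. -/
theorem Dom.change {nbr nbr' : ℕ → Prop} {s s' : ℕ} {A B : List Gap} (h : Dom nbr s 3 A B) :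
    Dom nbr' s' 3 A B := by
  generalize hp : 3 = p at h
  induction h with
  | last hph h => exact .last hph h
  | left h ha hd ih => exact .left h ha (ih hp)
  | right h ha hd ih => exact .right h ha (ih hp)
  | both h hab hok hd ih => exact .both h hab (fun c i _ _ => ⟨by omega, by omega⟩) (ih hp)
  | new h hb hph hd ih => omega

/-- The sizes before and after an event differ by one. -/
def Consistent (x y : Gap) : Prop :=
  ∀ b s, y.1 = some (b, s) → (b = true → y.2 = x.2 + 1) ∧ (b = false → x.2 = y.2 + 1)

/-- Every consistent sequence is equivalent to a short word. -/
theorem exists_word {nbr : ℕ → Prop} {s K N : ℕ} (h : Gap) (rest : List Gap) (hN : rest.length ≤ N)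
    (hK : ∀ g ∈ h :: rest, g.2 ≤ K) (hc : List.IsChain Consistent (h :: rest)) :
    ∃ w, Dom nbr s 3 (h :: rest) (h :: gapsOf (h.2, h.2) w) ∧
      Dom nbr s 3 (h :: gapsOf (h.2, h.2) w) (h :: rest) ∧
      w.length ≤ ((rest.filterMap Prod.fst).length + 1) * (6 * K + 5) ∧
      w.filterMap Tok.tag = rest.filterMap Prod.fst := by
  induction N generalizing h rest with
  | zero =>
    obtain rfl : rest = [] := List.eq_nil_of_length_eq_zero (by omega)
    exact ⟨[], Dom.refl _ _, Dom.refl _ _, by simp, rfl⟩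
  | succ N ih =>
    -- Compress the stretch before the first event, and treat the rest by induction.
    have hsplit := List.takeWhile_append_dropWhile (p := fun g : Gap => g.1.isNone) (l := rest)
    set us := rest.takeWhile (fun g : Gap => g.1.isNone) with hus
    have hus' : ∀ g ∈ us, g.1 = none := by
      intro g hg
      have := List.mem_takeWhile_imp hg
      simpa using this
    have hplain : us = plain (us.map Prod.snd) := by
      rw [plain, List.map_map]
      conv_lhs => rw [← List.map_id us]
      refine List.map_congr_left fun g hg => ?_
      ext1 <;> simp [hus' g hg]
    obtain ⟨L, b, w1, w2, w3, w4⟩ := exists_walk h.2 (us.map Prod.snd) K (by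
      intro z hz
      simp only [List.mem_cons, List.mem_map] at hz
      rcases hz with rfl | ⟨g, hg, rfl⟩
      · exact hK h (by simp)
      · exact hK g (by rw [← hsplit]; simp [hg]))
    obtain ⟨w, k1, k2, k3, k4⟩ := w1.exists_word
    have hD1 : Dom nbr s 3 (h :: us) (h :: gapsOf (h.2, h.2) w) := by
      rw [hplain, k1]; exact w4.1.change.head_congr rfl rfl
    have hD2 : Dom nbr s 3 (h :: gapsOf (h.2, h.2) w) (h :: us) := by
      rw [hplain, k1]; exact w4.2.change.head_congr rfl rfl
    have husn : us.filterMap Prod.fst = [] := List.filterMap_eq_nil_iff.2 hus'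
    rcases hd : rest.dropWhile (fun g : Gap => g.1.isNone) with _ | ⟨g, rest'⟩
    · rw [hd, List.append_nil] at hsplit
      refine ⟨w, by rw [← hsplit]; exact hD1, by rw [← hsplit]; exact hD2, ?_, ?_⟩
      · rw [← hsplit, husn]; simp; omega
      · rw [← hsplit, husn, k4]
    · rw [hd] at hsplit
      have hg : ¬ g.1.isNone := by
        have := List.head_dropWhile_not (fun g : Gap => g.1.isNone) (by rw [hd]; simp : rest.dropWhile (fun g : Gap => g.1.isNone) ≠ [])
        simpa only [hd, List.head_cons, Bool.not_eq_true] using this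
      obtain ⟨⟨c, i⟩, hci⟩ : ∃ e, g.1 = some e := by
        rcases h1 : g.1 with _ | e
        · simp [h1] at hg
        · exact ⟨e, rfl⟩
      have hmem : ∀ x ∈ g :: rest', x ∈ h :: rest := by
        intro x hx; rw [← hsplit]; simp only [List.mem_cons, List.mem_append] at hx ⊢; tauto
      have hc' : List.IsChain Consistent ((h :: us) ++ g :: rest') := by
        rw [← hsplit] at hc; exact hc
      rw [List.isChain_append] at hc'
      obtain ⟨-, hc2, hc3⟩ := hc'
      obtain ⟨z, z1, z2, z3, z4⟩ := ih g rest' (by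
        have := congrArg List.length hsplit; simp at this; omega)
        (fun x hx => hK x (hmem x hx)) hc2
      have hlastb : ∃ x ∈ (h :: us).getLast?, x.2 = b := by
        refine ⟨(h :: us).getLast (by simp), List.getLast_mem_getLast? _, ?_⟩
        have : (h.2 :: us.map Prod.snd) = (h :: us).map Prod.snd := rfl
        rw [this, List.getLast?_map, List.getLast?_eq_some_getLast (by simp)] at w2
        simpa using w2
      obtain ⟨x, hx1, hx2⟩ := hlastb
      have hcon := hc3 x hx1 g (by simp) c i hci
      -- The walk ends with both counters at `b`, the size just before the event. By consistency the
      -- event leads both to the size of `g`, which is where the word for the rest starts.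
      have happ : (Tok.ev c i).app (b, b) = (g.2, g.2) := by
        cases c
        · have := hcon.2 rfl; simp [Tok.app]; omega
        · have := hcon.1 rfl; simp [Tok.app]; omega
      have hgaps : h :: gapsOf (h.2, h.2) (w ++ .ev c i :: z)
          = (h :: gapsOf (h.2, h.2) w) ++ g :: gapsOf (g.2, g.2) z := by
        rw [gapsOf_append, k2, gapsOf, happ, List.cons_append]
        simp only [Tok.tag, ← hci]
      refine ⟨w ++ .ev c i :: z, ?_, ?_, ?_, ?_⟩
      · rw [hgaps, ← hsplit, ← List.cons_append]; exact hD1.append z1 rfl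
      · rw [hgaps, ← hsplit, ← List.cons_append]; exact hD2.append z2 rfl
      · rw [← hsplit, List.filterMap_append, husn]
        simp only [List.nil_append, List.filterMap_cons, hci, List.length_append, List.length_cons]
        -- The walk has at most `6 * K + 4` letters, and the event is one more.
        calc w.length + (z.length + 1) ≤ (6 * K + 5) +
              ((rest'.filterMap Prod.fst).length + 1) * (6 * K + 5) := by omega
          _ = _ := by ring
      · rw [← hsplit, List.filterMap_append, List.filterMap_append, husn, k4, List.filterMap_cons,
          List.filterMap_cons, hci, z4]
        rfl

end Compression

/-! ### Completeness of the machine -/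

section Completeness

/-- Bounds for the words that occur in configurations. -/
structure Short (L Lb S : ℕ) (w : List Tok) : Prop where
  length : w.length ≤ L
  tags : (w.filterMap Tok.tag).length ≤ Lb
  slot : ∀ b s, .ev b s ∈ w → s < S

theorem Short.sublist {L Lb S : ℕ} {w z : List Tok} (h : Short L Lb S w) (hz : z.Sublist w) :
    Short L Lb S z where
  length := hz.length_le.trans h.length
  tags := (hz.filterMap Tok.tag).length_le.trans h.tags
  slot b s hs := h.slot b s (hz.subset hs)

/-- Configurations within the bounds. -/
structure Fit (E : Env) (L Lb S : ℕ) (a : AConf) : Prop where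
  j : a.j ≤ E.N
  old : Short L Lb S a.old
  new : Short L Lb S a.new
  co : a.co.1 ≤ E.K ∧ a.co.2 ≤ E.K
  cn : a.cn.1 ≤ E.K ∧ a.cn.2 ≤ E.K
  ph : a.ph ≤ 2

/-- A move to a configuration within the bounds. -/
def Move (E : Env) (L Lb S : ℕ) (a a' : AConf) : Prop := ∃ r, AStep E r a a' ∧ Fit E L Lb S a'

theorem Tok.app_snd_le {t : Tok} {c : Cursor} {K : ℕ} (h1 : c.1 ≤ K) (h2 : c.2 ≤ K)
    (h : (t.app c).1 ≤ K) : (t.app c).2 ≤ K := by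
  match t with
  | .inc => exact h2
  | .dec => exact h2
  | .swap => exact h1
  | .ev true _ => exact h
  | .ev false _ => exact h

theorem Tok.tag_eq_some {t : Tok} {b : Bool} {s : ℕ} (h : t.tag = some (b, s)) : t = .ev b s := by
  cases t <;> simp [Tok.tag] at h
  rw [h.1, h.2]

open Classical in
/-- The event of the forgotten vertex is no longer marked. -/
noncomputable def unmark (E : Env) (j : ℕ) (g : Gap) : Gap :=
  if E.typ j = 0 ∧ ∃ b, g.1 = some (b, E.slot j) then (none, g.2) else g

theorem unmark_snd (E : Env) (j : ℕ) (g : Gap) : (unmark E j g).2 = g.2 := by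
  unfold unmark; split_ifs <;> rfl

theorem unmark_fst_eq_some {E : Env} {j : ℕ} {g : Gap} {b : Bool} {s : ℕ}
    (h : (unmark E j g).1 = some (b, s)) : g.1 = some (b, s) ∧ ¬ (E.typ j = 0 ∧ s = E.slot j) := by
  unfold unmark at h
  split_ifs at h with h1
  refine ⟨h, ?_⟩
  rintro ⟨h2, rfl⟩
  exact h1 ⟨h2, b, h⟩

theorem unmark_fst_eq_none {E : Env} {j : ℕ} {g : Gap} {b : Bool} {s : ℕ}
    (h : (unmark E j g).1 = none) (hg : g.1 = some (b, s)) : E.typ j = 0 ∧ s = E.slot j := by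
  unfold unmark at h
  split_ifs at h with h1
  · obtain ⟨h2, b', h3⟩ := h1
    rw [h3] at hg
    simp only [Option.some.injEq, Prod.mk.injEq] at hg
    exact ⟨h2, hg.2.symm⟩
  · rw [h] at hg; simp at hg

open Relation in
/-- Domination yields a pass of the machine. -/
theorem Dom.run {E : Env} {j L Lb S p : ℕ} {A B : List Gap} (hj : j < E.N)
    (h : Dom (fun i => E.nb j i ≠ 0) (E.slot j) p A B)
    (hp : (E.typ j = 1 ∧ p ≤ 2) ∨ (E.typ j = 0 ∧ p = 3)) :
    ∀ (w z new : List Tok) (co cn : Cursor) (τ τ' : Option (Bool × ℕ)),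
      A = (τ, co.1) :: (gapsOf co w).map (unmark E j) → B = (τ', cn.1) :: gapsOf cn z →
      (∀ g ∈ gapsOf cn z, g.2 ≤ E.K) → (p = 3 → ∀ b i, .ev b i ∈ w → E.nb j i = 0) →
      Short L Lb S w → Short L Lb S (new ++ z) → co.2 ≤ E.K → cn.1 ≤ E.K → cn.2 ≤ E.K →
      ∃ co' cn' : Cursor, ReflTransGen (Move E L Lb S)
        ⟨j, w, new, co, cn, if p = 3 then 0 else p⟩ ⟨j, [], new ++ z, co', cn', 2 * E.typ j⟩ := by
  generalize hn : A.length + B.length = n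
  induction n using Nat.strong_induction_on generalizing p A B with
  | _ n ih =>
  intro w z new co cn τ τ' hA hB hzK hnb hw hz hco hcn1 hcn2
  -- Plain domination is phase 3 of `Dom`; it is used in forget passes, during which the phase of
  -- the machine remains 0.
  have hph2 : (if p = 3 then 0 else p) ≤ 2 := by split_ifs <;> omega
  have hacte : act (if p = 3 then 0 else p) = act p := by split_ifs with h <;> simp [act, h]
  have hslots : Short L Lb S new := hz.sublist (List.sublist_append_left _ _)
  have hhead : co.1 + act p ≤ cn.1 := by
    rw [hA, hB] at h; exact h.head_le
  -- the three kinds of moves that do not change the phase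
  have drop : ∀ (t : Tok) (w' : List Tok), w = t :: w' → (unmark E j (t.tag, (t.app co).1)).1 = none →
      (t.app co).1 + act p ≤ cn.1 →
      Move E L Lb S ⟨j, w, new, co, cn, if p = 3 then 0 else p⟩
        ⟨j, w', new, t.app co, cn, if p = 3 then 0 else p⟩ := by
    rintro t w' rfl ht hle
    refine ⟨0, AStep.drop t hj ?_ ⟨?_, hcn1⟩, ?_⟩
    · rintro b s rfl
      exact unmark_fst_eq_none ht rfl
    · simp only [hacte]; exact hle
    · exact ⟨hj.le, hw.sublist (List.sublist_cons_self _ _), hslots,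
        ⟨by simp only; omega, Tok.app_snd_le (by omega) hco (by omega)⟩, ⟨hcn1, hcn2⟩, hph2⟩
  have emit : ∀ (t : Tok) (z' : List Tok), z = t :: z' → t.tag = none →
      co.1 + act p ≤ (t.app cn).1 →
      Move E L Lb S ⟨j, w, new, co, cn, if p = 3 then 0 else p⟩
        ⟨j, w, new ++ [t], co, t.app cn, if p = 3 then 0 else p⟩ := by
    rintro t z' rfl ht hle
    have htK : (t.app cn).1 ≤ E.K := hzK (t.tag, (t.app cn).1) (by simp [gapsOf])
    have ok : AConf.Ok E ⟨j, w, new ++ [t], co, t.app cn, if p = 3 then 0 else p⟩ := by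
      refine ⟨?_, htK⟩
      simp only [hacte]; exact hle
    have hfit : Fit E L Lb S ⟨j, w, new ++ [t], co, t.app cn, if p = 3 then 0 else p⟩ :=
      ⟨hj.le, hw, hz.sublist (by simp), ⟨by simp only; omega, hco⟩,
        ⟨htK, Tok.app_snd_le hcn1 hcn2 htK⟩, hph2⟩
    match t, ht with
    | .inc, _ => exact ⟨2, AStep.emit 2 _ hj (by simp) ok, hfit⟩
    | .dec, _ => exact ⟨3, AStep.emit 3 _ hj (by simp) ok, hfit⟩
    | .swap, _ => exact ⟨4, AStep.emit 4 _ hj (by simp) ok, hfit⟩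
  have keep : ∀ (b : Bool) (s : ℕ) (w' z' : List Tok), w = .ev b s :: w' → z = .ev b s :: z' →
      (unmark E j (some (b, s), ((Tok.ev b s).app co).1)).1 = some (b, s) →
      (E.nb j s ≠ 0 → (b = true → p ≠ 2) ∧ (b = false → p ≠ 0)) →
      ((Tok.ev b s).app co).1 + act p ≤ ((Tok.ev b s).app cn).1 →
      Move E L Lb S ⟨j, w, new, co, cn, if p = 3 then 0 else p⟩
        ⟨j, w', new ++ [.ev b s], (Tok.ev b s).app co, (Tok.ev b s).app cn,
          if p = 3 then 0 else p⟩ := by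
    rintro b s w' z' rfl rfl hu hok hle
    have htK : ((Tok.ev b s).app cn).1 ≤ E.K := hzK (some (b, s), _) (by simp [gapsOf, Tok.tag])
    refine ⟨1, AStep.keep b s hj (unmark_fst_eq_some hu).2 ?_ ⟨?_, htK⟩, ?_⟩
    · intro h0
      by_cases hp3 : p = 3
      · exact absurd (hnb hp3 b s (by simp)) h0
      · simp only [hp3, if_false]; exact hok h0
    · simp only [hacte]; exact hle
    · exact ⟨hj.le, hw.sublist (List.sublist_cons_self _ _), hz.sublist (by simp),
        ⟨by simp only; omega, Tok.app_snd_le (by omega) hco (by omega)⟩,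
        ⟨htK, Tok.app_snd_le hcn1 hcn2 htK⟩, hph2⟩
  have hzt : ∀ (t : Tok) z', z = t :: z' → (t.app cn).1 ≤ E.K ∧ (∀ g ∈ gapsOf (t.app cn) z', g.2 ≤ E.K) := by
    rintro t z' rfl
    exact ⟨hzK (t.tag, (t.app cn).1) (by simp [gapsOf]), fun g hg => hzK g (by simp [gapsOf, hg])⟩
  cases h with
  | last hph h =>
    have hw0 : w = [] := by
      cases w with
      | nil => rfl
      | cons t w => simp [gapsOf] at hA
    have hz0 : z = [] := by
      cases z with
      | nil => rfl
      | cons t w => simp [gapsOf] at hB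
    subst hw0 hz0
    have hpe : (if p = 3 then 0 else p) = 2 * E.typ j := by
      rcases hp with ⟨h1, h2⟩ | ⟨h1, h2⟩
      · rw [h1, if_neg (by omega)]; omega
      · rw [h1, if_pos h2]
    rw [hpe, List.append_nil]
    exact ⟨co, cn, ReflTransGen.refl⟩
  | @left _ a a' as b bs h ha hd =>
    cases w with
    | nil => simp [gapsOf] at hA
    | cons t w =>
      simp only [gapsOf, List.map_cons, List.cons.injEq] at hA
      obtain ⟨rfl, rfl, rfl⟩ := hA
      have hle := hd.head_le
      simp only [unmark_snd] at hle
      obtain ⟨co', cn', hr⟩ := ih _ (by simp only [List.length_cons] at hn ⊢; omega) hd hp rfl w z new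
        (t.app co) cn (unmark E j (t.tag, (t.app co).1)).1 τ'
        (by congr 1; ext1 <;> simp [unmark_snd]) hB hzK
        (fun h3 b i hbi => hnb h3 b i (List.mem_cons_of_mem _ hbi))
        (hw.sublist (List.sublist_cons_self _ _)) hz
        (Tok.app_snd_le (by omega) hco (by
          simp only [List.cons.injEq] at hB; rw [hB.1] at hle; simp only at hle; omega)) hcn1 hcn2
      simp only [List.cons.injEq] at hB
      rw [hB.1] at hle
      exact ⟨co', cn', ReflTransGen.head (drop t w rfl ha hle) hr⟩
  | @right _ a as b b' bs h hb hd =>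
    cases z with
    | nil => simp [gapsOf] at hB
    | cons t z =>
      simp only [gapsOf, List.cons.injEq] at hB
      obtain ⟨rfl, rfl, rfl⟩ := hB
      have hle := hd.head_le
      simp only [List.cons.injEq] at hA
      obtain ⟨rfl, rfl⟩ := hA
      obtain ⟨hz1, hz2⟩ := hzt t z rfl
      obtain ⟨co', cn', hr⟩ := ih _ (by simp only [List.length_cons] at hn ⊢; omega) hd hp rfl w z
        (new ++ [t]) co (t.app cn) τ t.tag rfl rfl hz2 hnb hw (by simpa using hz) hco hz1
        (Tok.app_snd_le hcn1 hcn2 hz1)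
      refine ⟨co', cn', ReflTransGen.head (emit t z rfl hb hle) ?_⟩
      simpa using hr
  | @both _ a a' as b b' bs h hab hok hd =>
    cases w with
    | nil => simp [gapsOf] at hA
    | cons t w =>
    cases z with
    | nil => simp [gapsOf] at hB
    | cons t' z =>
      simp only [gapsOf, List.map_cons, List.cons.injEq] at hA hB
      obtain ⟨rfl, rfl, rfl⟩ := hA
      obtain ⟨rfl, rfl, rfl⟩ := hB
      have hle := hd.head_le
      simp only [unmark_snd] at hle
      obtain ⟨hz1, hz2⟩ := hzt t' z rfl
      obtain ⟨co', cn', hr⟩ := ih _ (by simp only [List.length_cons] at hn ⊢; omega) hd hp rfl w z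
        (new ++ [t']) (t.app co) (t'.app cn) (unmark E j (t.tag, (t.app co).1)).1 t'.tag
        (by congr 1; ext1 <;> simp [unmark_snd]) rfl hz2
        (fun h3 b i hbi => hnb h3 b i (List.mem_cons_of_mem _ hbi))
        (hw.sublist (List.sublist_cons_self _ _)) (by simpa using hz)
        (Tok.app_snd_le (by omega) hco (by omega)) hz1 (Tok.app_snd_le hcn1 hcn2 hz1)
      have hr' : ReflTransGen (Move E L Lb S)
          ⟨j, w, new ++ [t'], t.app co, t'.app cn, if p = 3 then 0 else p⟩
          ⟨j, [], new ++ t' :: z, co', cn', 2 * E.typ j⟩ := by simpa using hr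
      rcases htag : t'.tag with _ | ⟨c, i⟩
      · rw [htag] at hab
        -- A joint step without event takes two moves of the machine. If the old size may change
        -- below the present new size, the old word goes first. Otherwise the old size is about to
        -- rise, and so is the new one, which therefore has room to go first.
        by_cases hlt : (t.app co).1 + act p ≤ cn.1
        · -- first the old word, then the new word
          obtain ⟨co'', cn'', hr2⟩ := ih ((unmark E j (t.tag, (t.app co).1) :: List.map (unmark E j) (gapsOf (t.app co) w)).length + (((τ', cn.1) : Gap) :: (t'.tag, (t'.app cn).1) :: gapsOf (t'.app cn) z).length)
            (by simp only [List.length_cons] at hn ⊢; omega)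
            (.right (by simpa [unmark_snd] using hlt) htag hd) hp rfl w (t' :: z) new
            (t.app co) cn (unmark E j (t.tag, (t.app co).1)).1 τ'
            (by congr 1; ext1 <;> simp [unmark_snd]) rfl hzK
            (fun h3 b i hbi => hnb h3 b i (List.mem_cons_of_mem _ hbi))
            (hw.sublist (List.sublist_cons_self _ _)) hz
            (Tok.app_snd_le (by omega) hco (by omega)) hcn1 hcn2
          exact ⟨co'', cn'', ReflTransGen.head (drop t w rfl hab hlt) hr2⟩
        · obtain ⟨co'', cn'', hr2⟩ := ih ((((τ, co.1) : Gap) :: unmark E j (t.tag, (t.app co).1) :: List.map (unmark E j) (gapsOf (t.app co) w)).length + (((t'.tag, (t'.app cn).1) : Gap) :: gapsOf (t'.app cn) z).length)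
            (by simp only [List.length_cons] at hn ⊢; omega)
            (.left (by simp only; omega) hab hd) hp rfl (t :: w) z
            (new ++ [t']) co (t'.app cn) τ t'.tag rfl rfl hz2 hnb hw (by simpa using hz) hco hz1
            (Tok.app_snd_le hcn1 hcn2 hz1)
          refine ⟨co'', cn'', ReflTransGen.head (emit t' z rfl htag (by omega)) ?_⟩
          simpa using hr2
      · obtain rfl := Tok.tag_eq_some htag
        rw [htag] at hab
        have h1 := (unmark_fst_eq_some hab).1
        obtain rfl := Tok.tag_eq_some h1
        exact ⟨co', cn', ReflTransGen.head (keep c i w z rfl rfl hab (hok c i hab) hle) hr'⟩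
  | @new _ a as b b' bs c h hb hph hd =>
    cases z with
    | nil => simp [gapsOf] at hB
    | cons t z =>
      simp only [gapsOf, List.cons.injEq] at hB
      obtain ⟨rfl, rfl, rfl⟩ := hB
      have hle := hd.head_le
      simp only [List.cons.injEq] at hA
      obtain ⟨rfl, rfl⟩ := hA
      obtain ⟨hz1, hz2⟩ := hzt t z rfl
      have hp1 : E.typ j = 1 := by omega
      obtain ⟨co', cn', hr⟩ := ih _ (by simp only [List.length_cons] at hn ⊢; omega) hd
        (Or.inl ⟨hp1, by omega⟩) rfl w z
        (new ++ [t]) co (t.app cn) τ t.tag rfl rfl hz2 (by omega) hw (by simpa using hz) hco hz1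
        (Tok.app_snd_le hcn1 hcn2 hz1)
      obtain rfl := Tok.tag_eq_some hb
      rw [if_neg (by omega)] at hr
      rw [if_neg (by omega)]
      have hfit : Fit E L Lb S
          ⟨j, w, new ++ [.ev c (E.slot j)], co, (Tok.ev c (E.slot j)).app cn, p + 1⟩ :=
        ⟨hj.le, hw, hz.sublist (by simp), ⟨by simp only; omega, hco⟩,
          ⟨hz1, Tok.app_snd_le hcn1 hcn2 hz1⟩, by simp only; omega⟩
      refine ⟨co', cn', ReflTransGen.head ⟨if c then 5 else 6,
        AStep.emitEv _ c hj hp1 ?_ ⟨hle, hz1⟩, hfit⟩ (by simpa using hr)⟩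
      rcases hph with ⟨rfl, rfl⟩ | ⟨rfl, rfl⟩ <;> simp

end Completeness

/-! ### From a path decomposition of small width to an accepting run. -/

section Completeness

variable {n : ℕ} {G : SimpleGraph (Fin n)} {P Q : List (Node n)} {sl : Fin n → ℕ} {E : Env}

open Classical in
/-- The sequence of the sizes of the bags restricted to `V`, where the events of the vertices in `A`
are marked. -/
noncomputable def gapSeq (V : Set (Fin n)) (A : Finset (Fin n)) (sl : Fin n → ℕ) :
    Finset (Fin n) → List (Node n) → List Gap
  | _, [] => []
  | B, x :: L =>
    if x.1 ∈ V then
      (if x.1 ∈ A then some (x.2, sl x.1) else none, (x.apply B).card) :: gapSeq V A sl (x.apply B) L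
    else gapSeq V A sl B L

/-- `B` is the bag after `M` restricted to `V`. -/
def IsRestriction (V : Set (Fin n)) (M : List (Node n)) (B : Finset (Fin n)) : Prop :=
  ∀ u, u ∈ B ↔ u ∈ V ∧ u ∈ bagOf M

theorem mem_apply {x : Node n} {B : Finset (Fin n)} {u : Fin n} :
    u ∈ x.apply B ↔ (if u = x.1 then x.2 = true else u ∈ B) := by
  obtain ⟨w, b⟩ := x
  cases b <;> simp only [Node.apply, Bool.false_eq_true, if_false, if_true, Finset.mem_erase,
    Finset.mem_insert] <;> split_ifs with h <;> simp [h]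

theorem bagOf_append_singleton (M : List (Node n)) (x : Node n) :
    bagOf (M ++ [x]) = x.apply (bagOf M) := by simp [bagOf, List.foldl_append]

theorem IsRestriction.apply {V : Set (Fin n)} {M : List (Node n)} {B : Finset (Fin n)}
    (h : IsRestriction V M B) {x : Node n} (hx : x.1 ∈ V) :
    IsRestriction V (M ++ [x]) (x.apply B) := by
  intro u
  rw [bagOf_append_singleton, mem_apply, mem_apply, h u]
  split_ifs with hu
  · subst hu; simp [hx]
  · rfl

theorem IsRestriction.skip {V : Set (Fin n)} {M : List (Node n)} {B : Finset (Fin n)}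
    (h : IsRestriction V M B) {x : Node n} (hx : x.1 ∉ V) : IsRestriction V (M ++ [x]) B := by
  intro u
  rw [bagOf_append_singleton, mem_apply, h u]
  split_ifs with hu
  · subst hu; simp [hx]
  · rfl

theorem gapSeq_le {K : ℕ} (hK : ∀ i, (bag Q i).card ≤ K) {V : Set (Fin n)} {A : Finset (Fin n)}
    {M L : List (Node n)} {B : Finset (Fin n)} (hQ : Q = M ++ L) (hB : IsRestriction V M B) :
    ∀ g ∈ gapSeq V A sl B L, g.2 ≤ K := by
  induction L generalizing M B with
  | nil => simp [gapSeq]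
  | cons x L ih =>
    intro g hg
    have hQ' : Q = (M ++ [x]) ++ L := by simp [hQ]
    unfold gapSeq at hg
    split_ifs at hg with hx hA
    all_goals first
      | exact ih hQ' (hB.skip hx) g hg
      | (rcases List.mem_cons.1 hg with rfl | hg
         · have h1 : bag Q (M.length + 1) = bagOf (M ++ [x]) := by
             rw [bag, hQ']; congr 1
             rw [List.take_left' (by simp)]
           refine le_trans (Finset.card_le_card fun u hu => ?_) (hK (M.length + 1))
           rw [h1]; exact ((hB.apply hx u).1 hu).2
         · exact ih hQ' (hB.apply hx) g hg)

theorem gapSeq_consistent (hQ : IsPathDecomposition G Q) {V : Set (Fin n)} {A : Finset (Fin n)}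
    {M L : List (Node n)} {B : Finset (Fin n)} {τ : Option (Bool × ℕ)} (hML : Q = M ++ L)
    (hB : IsRestriction V M B) : List.IsChain Consistent ((τ, B.card) :: gapSeq V A sl B L) := by
  induction L generalizing M B τ with
  | nil => simp [gapSeq]
  | cons x L ih =>
    have hQ' : Q = (M ++ [x]) ++ L := by simp [hML]
    obtain ⟨u, b⟩ := x
    unfold gapSeq
    by_cases hx : u ∈ V
    · rw [if_pos (show ((u, b) : Node n).1 ∈ V from hx), List.isChain_cons_cons]
      refine ⟨?_, ih hQ' (hB.apply hx)⟩
      intro c s hcs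
      simp only at hcs
      split_ifs at hcs with hA
      simp only [Option.some.injEq, Prod.mk.injEq] at hcs
      obtain ⟨rfl, rfl⟩ := hcs
      rcases hQ.nodesOf_split hML with ⟨rfl, h1, -⟩ | ⟨rfl, h1, -⟩
      · have : u ∉ B := by rw [hB u, mem_bagOf, h1]; simp
        simp [Node.apply, this]
      · have : u ∈ B := by rw [hB u, mem_bagOf, h1]; simp [hx]
        simp only [Bool.false_eq_true, false_implies, true_implies, true_and, Node.apply, if_false]
        rw [Finset.card_erase_of_mem this]
        have := Finset.card_pos.2 ⟨u, this⟩
        omega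
    · rw [if_neg (show ((u, b) : Node n).1 ∉ V from hx)]
      exact ih hQ' (hB.skip hx)

theorem gapSeq_tags {V : Set (Fin n)} {A B : Finset (Fin n)} (hAV : ∀ u ∈ A, u ∈ V)
    (L : List (Node n)) : (gapSeq V A sl B L).filterMap Prod.fst =
      (L.filter fun x => x.1 ∈ A).map fun x => (x.2, sl x.1) := by
  induction L generalizing B with
  | nil => rfl
  | cons x L ih =>
    unfold gapSeq
    by_cases hx : x.1 ∈ V
    · rw [if_pos hx]
      by_cases hA : x.1 ∈ A <;> simp [hA, ih]
    · have hA : x.1 ∉ A := fun h => hx (hAV _ h)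
      rw [if_neg hx]; simp [hA, ih]

theorem length_filter_mem (hQ : IsPathDecomposition G Q) (A : Finset (Fin n)) :
    (Q.filter fun x => x.1 ∈ A).length = 2 * A.card := by
  have key : ∀ L : List (Node n),
      (L.filter fun x => x.1 ∈ A).length = ∑ u ∈ A, (nodesOf L u).length := by
    intro L
    induction L with
    | nil => simp
    | cons x L ih =>
      have : ∀ v : Fin n, (nodesOf (x :: L) v).length
          = (nodesOf L v).length + if v = x.1 then 1 else 0 := by
        intro v
        by_cases h : x.1 = v
        · simp [nodesOf_cons, h]
        · have h' : ¬ v = x.1 := fun e => h e.symm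
          simp [nodesOf_cons, h, h']
      simp only [this, Finset.sum_add_distrib, ← ih, Finset.sum_ite_eq', List.filter_cons]
      by_cases hA : x.1 ∈ A <;> simp [hA]
  rw [key]
  simp [hQ.nodesOf_eq]; omega

/-- Vertices do not meet if one is forgotten before the other is introduced. -/
theorem not_adj_of_separated (hQ : IsPathDecomposition G Q) {M L : List (Node n)} {u v : Fin n}
    (h : Q = M ++ L) (hu : nodesOf M u = [(u, true), (u, false)]) (hv : nodesOf M v = []) :
    ¬ G.Adj u v := by
  intro huv
  obtain ⟨i, h1, h2⟩ := hQ.edges u v huv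
  rw [bag, mem_bagOf] at h1 h2
  rcases le_total i M.length with hi | hi
  · have : (Q.take i).Sublist M := by
      rw [h, List.take_append_of_le_length hi]; exact List.take_sublist _ _
    have h3 := this.filter (fun x => x.1 = v)
    change (nodesOf _ v).Sublist (nodesOf M v) at h3
    rw [hv, List.sublist_nil] at h3
    rw [h3] at h2; simp at h2
  · obtain ⟨R, hR⟩ : ∃ R, Q.take i = M ++ R := by
      rw [h, List.take_append, List.take_of_length_le hi]; exact ⟨_, rfl⟩
    have h3 := (List.take_sublist i Q).filter (fun x => x.1 = u)
    change (nodesOf _ u).Sublist (nodesOf Q u) at h3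
    have h4 := h3.length_le
    rw [hR, nodesOf_append, hu, hQ.nodesOf_eq] at h4
    rw [hR, nodesOf_append, hu] at h1
    have : nodesOf R u = [] := by
      apply List.eq_nil_of_length_eq_zero
      simp at h4; simp [h4]
    rw [this] at h1
    simp at h1

/-- Both sequences are read off the same `Q`, so they are traversed in parallel. They differ only at
the events of `v`, which are the `new` steps. A neighbour's event in a forbidden phase would
separate it from `v` in `Q`, contrary to `not_adj_of_separated`. -/
theorem dom_introduce (hQ : IsPathDecomposition G Q) (hP : IsPathDecomposition G P)
    (hE : Compat G P sl E) {j : ℕ} {v : Fin n} (hv : P[j]? = some (v, true)) {M L : List (Node n)}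
    {B B' : Finset (Fin n)} {τ τ' : Option (Bool × ℕ)} {ph : ℕ} (hML : Q = M ++ L) (hph2 : ph ≤ 2)
    (hph : nodesOf M v = [(v, true), (v, false)].take ph)
    (hB : IsRestriction (seen P j) M B) (hB' : IsRestriction (seen P (j + 1)) M B') :
    Dom (fun i => E.nb j i ≠ 0) (E.slot j) ph
      ((τ, B.card) :: gapSeq (seen P j) (bag P j) sl B L)
      ((τ', B'.card) :: gapSeq (seen P (j + 1)) (bag P (j + 1)) sl B' L) := by
  have hvs := not_mem_seen_of_intro hP hv
  have hslot : E.slot j = sl v := hE.slot j _ hv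
  have hcard : ∀ {M B B' ph}, ph ≤ 2 → nodesOf M v = [(v, true), (v, false)].take ph →
      IsRestriction (seen P j) M B → IsRestriction (seen P (j + 1)) M B' →
      B.card + act ph ≤ B'.card := by
    intro M B B' ph hph2 hph hB hB'
    have hsub : B ⊆ B' := by
      intro u hu
      rw [hB u] at hu
      rw [hB' u, seen_succ_of_intro hv]
      exact ⟨Or.inr hu.1, hu.2⟩
    by_cases h1 : ph = 1
    · subst h1
      have hvB : v ∉ B := fun h => hvs ((hB v).1 h).1
      have hvB' : v ∈ B' := by
        rw [hB' v, seen_succ_of_intro hv, mem_bagOf, hph]; simp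
      have := Finset.card_lt_card (Finset.ssubset_iff_subset_ne.2 ⟨hsub, fun h => hvB (h ▸ hvB')⟩)
      simpa [act] using this
    · simpa [act, h1] using Finset.card_le_card hsub
  induction L generalizing M B B' τ τ' ph with
  | nil =>
    refine .last ?_ (hcard hph2 hph hB hB')
    rw [List.append_nil] at hML
    rw [← hML, hQ.nodesOf_eq] at hph
    have := congrArg List.length hph
    simp at this
    omega
  | cons x L ih =>
    have hML' : Q = (M ++ [x]) ++ L := by simp [hML]
    obtain ⟨u, b⟩ := x
    by_cases huv : u = v
    · subst huv
      have hu : u ∈ seen P (j + 1) := (seen_succ_of_intro hv u).2 (Or.inl rfl)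
      unfold gapSeq
      rw [if_neg (show ((u, b) : Node n).1 ∉ seen P j from hvs),
        if_pos (show ((u, b) : Node n).1 ∈ seen P (j + 1) from hu)]
      have hA : u ∈ bag P (j + 1) := by rw [bag_succ P j _ hv]; simp [Node.apply]
      rw [if_pos (show ((u, b) : Node n).1 ∈ bag P (j + 1) from hA)]
      have hcase : (ph = 0 ∧ b = true) ∨ (ph = 1 ∧ b = false) := by
        rcases hQ.nodesOf_split hML with ⟨rfl, h1, -⟩ | ⟨rfl, h1, -⟩
        · left; refine ⟨?_, rfl⟩
          rw [h1] at hph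
          have := congrArg List.length hph
          simp at this; omega
        · right; refine ⟨?_, rfl⟩
          rw [h1] at hph
          have := congrArg List.length hph
          simp at this; omega
      refine .new (c := b) (hcard hph2 hph hB hB') (by simp [hslot]) hcase ?_
      refine ih hML' (by omega) ?_ (hB.skip hvs) (hB'.apply hu)
      rw [nodesOf_append, hph]
      rcases hcase with ⟨rfl, rfl⟩ | ⟨rfl, rfl⟩ <;> simp [nodesOf_cons]
    · have hph' : nodesOf (M ++ [(u, b)]) v = [(v, true), (v, false)].take ph := by
        rw [nodesOf_append, hph]; simp [nodesOf_cons, huv]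
      have hmem : u ∈ seen P (j + 1) ↔ u ∈ seen P j := by
        rw [seen_succ_of_intro hv]; simp [huv]
      have hbag : u ∈ bag P (j + 1) ↔ u ∈ bag P j := by
        rw [bag_succ P j _ hv]; simp [Node.apply, huv]
      unfold gapSeq
      by_cases hu : u ∈ seen P j
      · rw [if_pos (show ((u, b) : Node n).1 ∈ seen P j from hu),
          if_pos (show ((u, b) : Node n).1 ∈ seen P (j + 1) from hmem.2 hu)]
        refine .both (hcard hph2 hph hB hB') (by simp only [hbag]) ?_
          (ih hML' hph2 hph' (hB.apply hu) (hB'.apply (hmem.2 hu)))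
        intro c i hci hi
        simp only at hci
        split_ifs at hci with hA
        simp only [Option.some.injEq, Prod.mk.injEq] at hci
        obtain ⟨rfl, rfl⟩ := hci
        have hadj : G.Adj u v := (hE.nb j v hv u hA).1 hi
        constructor
        · rintro rfl rfl
          rcases hQ.nodesOf_split hML with ⟨-, h1, -⟩ | ⟨h0, -⟩
          · exact not_adj_of_separated hQ hML (by simpa using hph) h1 hadj.symm
          · simp at h0
        · rintro rfl rfl
          rcases hQ.nodesOf_split hML with ⟨h0, -⟩ | ⟨-, h1, -⟩
          · simp at h0
          · refine not_adj_of_separated hQ hML' ?_ (by simpa using hph') hadj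
            rw [nodesOf_append, h1]; simp [nodesOf_cons]
      · rw [if_neg (show ((u, b) : Node n).1 ∉ seen P j from hu),
          if_neg (show ((u, b) : Node n).1 ∉ seen P (j + 1) from fun h => hu (hmem.1 h))]
        exact ih hML' hph2 hph' (hB.skip hu) (hB'.skip fun h => hu (hmem.1 h))

/-- Forgetting adds no seen vertex, so the sizes are unchanged and only the events of `v` lose their
marks. Since slots are injective on the bag, `unmark` removes no other mark. -/
theorem gapSeq_forget (hP : IsPathDecomposition G P) (hE : Compat G P sl E) {j : ℕ} {v : Fin n}
    (hv : P[j]? = some (v, false)) (B : Finset (Fin n)) (L : List (Node n)) :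
    gapSeq (seen P (j + 1)) (bag P (j + 1)) sl B L
      = (gapSeq (seen P j) (bag P j) sl B L).map (unmark E j) := by
  have hslot : E.slot j = sl v := hE.slot j _ hv
  have htyp : E.typ j = 0 := by simpa using hE.typ j _ hv
  have hvb := mem_bag_of_forget hP hv
  induction L generalizing B with
  | nil => rfl
  | cons x L ih =>
    obtain ⟨u, b⟩ := x
    unfold gapSeq
    have hmem := seen_succ_of_forget hv u
    by_cases hu : u ∈ seen P j
    · rw [if_pos (show ((u, b) : Node n).1 ∈ seen P j from hu),
        if_pos (show ((u, b) : Node n).1 ∈ seen P (j + 1) from hmem.2 hu), List.map_cons, ih]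
      congr 1
      have hbag : u ∈ bag P (j + 1) ↔ u ≠ v ∧ u ∈ bag P j := by
        rw [bag_succ P j _ hv]; simp [Node.apply]
      by_cases hub : u ∈ bag P j
      · by_cases huv : u = v
        · subst huv
          simp [hbag, hub, unmark, htyp, hslot]
        · have : sl u ≠ sl v := fun h => huv (hE.inj j u hub v hvb h)
          simp [hbag, hub, huv, unmark, hslot, this]
      · simp [hbag, hub, unmark]
    · rw [if_neg (show ((u, b) : Node n).1 ∉ seen P j from hu),
        if_neg (show ((u, b) : Node n).1 ∉ seen P (j + 1) from fun h => hu (hmem.1 h))]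
      exact ih B

theorem gapsOf_le_of_dom {nbr : ℕ → Prop} {s p K : ℕ} {A B : List Gap} (h : Dom nbr s p A B)
    (hB : ∀ g ∈ B, g.2 ≤ K) : ∀ g ∈ A, g.2 ≤ K := by
  induction h with
  | last hph h =>
    intro g hg
    rw [List.mem_singleton] at hg
    subst hg
    exact (Nat.le_add_right _ _).trans (h.trans (hB _ (by simp)))
  | left h ha hd ih =>
    intro g hg
    rcases List.mem_cons.1 hg with rfl | hg
    · exact (Nat.le_add_right _ _).trans (h.trans (hB _ (by simp)))
    · exact ih hB g hg
  | right h hb hd ih => exact ih fun g hg => hB g (List.mem_cons_of_mem _ hg)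
  | both h hab hok hd ih =>
    intro g hg
    rcases List.mem_cons.1 hg with rfl | hg
    · exact (Nat.le_add_right _ _).trans (h.trans (hB _ (by simp)))
    · exact ih (fun g hg => hB g (List.mem_cons_of_mem _ hg)) g hg
  | new h hb hph hd ih => exact ih fun g hg => hB g (List.mem_cons_of_mem _ hg)

open Relation in
/-- If a path decomposition of width at most `k` exists, then the machine has an accepting run. -/
theorem exists_accepting_run (hP : IsPathDecomposition G P) (hE : Compat G P sl E)
    (hQ : IsPathDecomposition G Q) (hK : ∀ i, (bag Q i).card ≤ E.K) {m S L : ℕ}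
    (hm : ∀ j, (bag P j).card ≤ m) (hS : ∀ u, sl u < S) (hL : (2 * m + 1) * (6 * E.K + 5) ≤ L) :
    ∃ w, ReflTransGen (Move E L (2 * m) S) ⟨0, [], [], (0, 0), (0, 0), 0⟩
      ⟨E.N, w, [], (0, 0), (0, 0), 0⟩ := by
  have hres : ∀ j, IsRestriction (seen P j) ([] : List (Node n)) ∅ := by
    intro j u; simp [bagOf]
  -- a word for the restriction to the vertices seen so far
  have word : ∀ j, ∀ (nbr : ℕ → Prop) (s : ℕ), ∃ w,
      Dom nbr s 3 ((none, 0) :: gapSeq (seen P j) (bag P j) sl ∅ Q) ((none, 0) :: gapsOf (0, 0) w) ∧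
      Dom (fun _ => False) 0 3 ((none, 0) :: gapsOf (0, 0) w)
        ((none, 0) :: gapSeq (seen P j) (bag P j) sl ∅ Q) ∧ Short L (2 * m) S w ∧
      (∀ g ∈ gapsOf (0, 0) w, g.2 ≤ E.K) ∧ (∀ b i, .ev b i ∈ w → ∃ u ∈ bag P j, sl u = i) := by
    intro j nbr s
    have hle := gapSeq_le hK (V := seen P j) (A := bag P j) (sl := sl) (M := []) (L := Q) rfl (hres j)
    have hle' : ∀ g ∈ ((none, 0) : Gap) :: gapSeq (seen P j) (bag P j) sl ∅ Q, g.2 ≤ E.K := by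
      intro g hg
      rcases List.mem_cons.1 hg with rfl | hg
      · exact Nat.zero_le _
      · exact hle g hg
    obtain ⟨w, w1, w2, w3, w4⟩ := exists_word (nbr := nbr) (s := s) (none, 0)
      (gapSeq (seen P j) (bag P j) sl ∅ Q) le_rfl hle'
      (gapSeq_consistent hQ (M := []) rfl (hres j))
    have htags := gapSeq_tags (sl := sl) (B := ∅) (V := seen P j) (A := bag P j)
      (fun u hu => bag_subset_seen hu) Q
    have hlen : ((gapSeq (seen P j) (bag P j) sl ∅ Q).filterMap Prod.fst).length ≤ 2 * m := by
      rw [htags, List.length_map, length_filter_mem hQ]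
      have := hm j; omega
    have hslots : ∀ b i, .ev b i ∈ w → ∃ u ∈ bag P j, sl u = i := by
      intro b i hbi
      have : (b, i) ∈ w.filterMap Tok.tag := List.mem_filterMap.2 ⟨_, hbi, rfl⟩
      rw [w4, htags] at this
      simp only [List.mem_map, List.mem_filter, decide_eq_true_eq] at this
      obtain ⟨x, ⟨hx1, hx2⟩, hx3⟩ := this
      exact ⟨x.1, hx2, (congrArg Prod.snd hx3)⟩
    refine ⟨w, w1, w2.change, ⟨?_, by rw [w4]; exact hlen, ?_⟩, fun g hg =>
      gapsOf_le_of_dom w2 hle' g (List.mem_cons_of_mem _ hg), hslots⟩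
    · refine w3.trans (le_trans (Nat.mul_le_mul_right _ ?_) hL)
      omega
    · intro b i hbi
      obtain ⟨u, -, rfl⟩ := hslots b i hbi
      exact hS u
  suffices ∀ j ≤ E.N, ∃ w,
      Dom (fun _ => False) 0 3 ((none, 0) :: gapsOf (0, 0) w)
        ((none, 0) :: gapSeq (seen P j) (bag P j) sl ∅ Q) ∧ Short L (2 * m) S w ∧
      (∀ b i, .ev b i ∈ w → ∃ u ∈ bag P j, sl u = i) ∧
      ReflTransGen (Move E L (2 * m) S) ⟨0, [], [], (0, 0), (0, 0), 0⟩
        ⟨j, w, [], (0, 0), (0, 0), 0⟩ by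
    obtain ⟨w, -, -, -, h⟩ := this E.N le_rfl
    exact ⟨w, h⟩
  intro j hj
  induction j with
  | zero =>
    refine ⟨[], ?_, ⟨Nat.zero_le _, Nat.zero_le _, by simp⟩, by simp, ReflTransGen.refl⟩
    have h0 : ∀ R : List (Node n), gapSeq (seen P 0) (bag P 0) sl ∅ R = [] := by
      intro R
      induction R with
      | nil => rfl
      | cons x R ih =>
        unfold gapSeq
        rw [if_neg (by simp [seen]), ih]
    rw [h0]
    exact Dom.refl _ _
  | succ j ih =>
    obtain ⟨w, w1, w2, w3, w4⟩ := ih (by omega)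
    have hjP : j < P.length := by have := hE.N; omega
    obtain ⟨⟨v, b⟩, hx⟩ : ∃ x, P[j]? = some x := ⟨_, List.getElem?_eq_getElem hjP⟩
    obtain ⟨z, z1, z2, z3, z4, z5⟩ := word (j + 1) (fun i => E.nb j i ≠ 0) (E.slot j)
    have htyp := hE.typ j _ hx
    have pass : ∃ co' cn' : Cursor, ReflTransGen (Move E L (2 * m) S)
        ⟨j, w, [], (0, 0), (0, 0), 0⟩ ⟨j, [], z, co', cn', 2 * E.typ j⟩ := by
      cases b with
      | true =>
        have d1 := dom_introduce hQ hP hE hx (M := []) (L := Q) (B := ∅) (B' := ∅) (τ := none)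
          (τ' := none) (ph := 0) rfl (by omega) rfl (hres j) (hres (j + 1))
        -- The old word lies below the old restriction, which lies below the new restriction with
        -- the two additional events, which lies below the new word.
        have d2 := (Dom.trans le_rfl w1.change d1 (Or.inl ⟨rfl, rfl⟩)).trans le_rfl z1
          (Or.inr ⟨rfl, rfl⟩)
        have hunmark : ∀ l : List Gap, l.map (unmark E j) = l := by
          intro l
          conv_rhs => rw [← List.map_id l]
          refine List.map_congr_left fun g _ => ?_
          simp [unmark, htyp]
        obtain ⟨co', cn', h⟩ := Dom.run (L := L) (Lb := 2 * m) (S := S) (by omega) d2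
          (Or.inl ⟨by simpa using htyp, by omega⟩) w z [] (0, 0) (0, 0) none none
          (by rw [hunmark]) rfl z4 (by omega) w2 z3 (Nat.zero_le _) (Nat.zero_le _) (Nat.zero_le _)
        exact ⟨co', cn', by simpa using h⟩
      | false =>
        -- Unmarking on both sides preserves domination: equal tags have equal images, and nothing
        -- plain becomes marked.
        have hmap : ∀ {A B : List Gap}, Dom (fun _ => False) 0 3 A B →
            Dom (fun _ => False) 0 3 (A.map (unmark E j)) (B.map (unmark E j)) := by
          intro A B h
          generalize hp : 3 = p at h
          have h0 : ∀ {g : Gap}, g.1 = none → (unmark E j g).1 = none := by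
            intro g hg; unfold unmark; split_ifs <;> simp [hg]
          induction h with
          | last hph h => exact .last hph (by simpa [unmark_snd] using h)
          | left h ha hd ih => exact .left (by simpa [unmark_snd] using h) (h0 ha) (ih hp)
          | right h ha hd ih => exact .right (by simpa [unmark_snd] using h) (h0 ha) (ih hp)
          | both h hab hok hd ih =>
            refine .both (by simpa [unmark_snd] using h) ?_ (fun c i _ _ => ⟨by omega, by omega⟩)
              (ih hp)
            unfold unmark
            rw [hab]
            split_ifs <;> simp [hab]
          | new h hb hph hd ih => omega
        have d1 := hmap w1
        rw [List.map_cons, List.map_cons, ← gapSeq_forget hP hE hx] at d1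
        have hun : unmark E j (none, 0) = (none, 0) := by simp [unmark]
        rw [hun] at d1
        have d2 := Dom.trans le_rfl (d1.change (nbr' := fun i => E.nb j i ≠ 0) (s' := E.slot j)) z1
          (Or.inl ⟨rfl, rfl⟩)
        have hnb : 3 = 3 → ∀ c i, .ev c i ∈ w → E.nb j i = 0 := by
          intro _ c i hci
          obtain ⟨u, hu, rfl⟩ := w3 c i hci
          exact hE.nb_zero j v hx u hu
        obtain ⟨co', cn', h⟩ := Dom.run (L := L) (Lb := 2 * m) (S := S) (by omega) d2
          (Or.inr ⟨by simpa using htyp, rfl⟩) w z [] (0, 0) (0, 0) none none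
          rfl rfl z4 hnb w2 z3 (Nat.zero_le _) (Nat.zero_le _) (Nat.zero_le _)
        exact ⟨co', cn', by simpa using h⟩
    obtain ⟨co', cn', hpass⟩ := pass
    refine ⟨z, z2, z3, z5, w4.trans (hpass.trans (ReflTransGen.single ⟨7,
      AStep.endPass (by omega) rfl, ?_⟩))⟩
    exact ⟨hj, z3, ⟨Nat.zero_le _, Nat.zero_le _, by simp⟩, ⟨Nat.zero_le _, Nat.zero_le _⟩,
      ⟨Nat.zero_le _, Nat.zero_le _⟩, Nat.zero_le _⟩

end Completeness

/-! ### Numerical configurations -/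

namespace RAM

instance : Add Expr := ⟨.op .add⟩
instance : Sub Expr := ⟨.op .sub⟩
instance : Mul Expr := ⟨.op .mul⟩
instance : Div Expr := ⟨.op .div⟩
instance : Mod Expr := ⟨.op .mod⟩
instance (m : ℕ) : OfNat Expr m := ⟨.lit m⟩

abbrev Expr.lt (a b : Expr) : Expr := .op .lt a b
abbrev Expr.eq (a b : Expr) : Expr := .op .eq a b

section Eval

variable (s : State) (a b : Expr)

@[simp] theorem eval_add : (a + b).eval s = a.eval s + b.eval s := rfl
@[simp] theorem eval_sub : (a - b).eval s = a.eval s - b.eval s := rfl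
@[simp] theorem eval_mul : (a * b).eval s = a.eval s * b.eval s := rfl
@[simp] theorem eval_div : (a / b).eval s = a.eval s / b.eval s := rfl
@[simp] theorem eval_mod : (a % b).eval s = a.eval s % b.eval s := rfl
@[simp] theorem eval_lt : (Expr.lt a b).eval s = if a.eval s < b.eval s then 1 else 0 := rfl
@[simp] theorem eval_eq : (Expr.eq a b).eval s = if a.eval s = b.eval s then 1 else 0 := rfl
@[simp] theorem eval_lit (m : ℕ) : (Expr.lit m).eval s = m := rfl
@[simp] theorem eval_zero : (0 : Expr).eval s = 0 := rfl
@[simp] theorem eval_one : (1 : Expr).eval s = 1 := rfl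
@[simp] theorem eval_two : (2 : Expr).eval s = 2 := rfl
@[simp] theorem eval_six : (6 : Expr).eval s = 6 := rfl
@[simp] theorem eval_reg (i : ℕ) : (Expr.reg i).eval s = s.reg i := rfl
@[simp] theorem eval_cell (i : ℕ) : (Expr.cell i a).eval s = s.mem i (a.eval s) := rfl

end Eval

/-- A rule of a search: a condition and the new values of the fields, in terms of the fields in the
registers `100, …, 111` and of fixed data. The number `code` is only recorded. -/
structure Rule where
  code : ℕ
  guard : Expr
  upd : ℕ → Expr

/-- A configuration: twelve numbers. -/
abbrev Conf : Type := ℕ → ℕ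

/-- The meaning of the rules is defined in this hypothetical state, so that it does not depend on
the working registers of the search. -/
def put (z : State) (c : Conf) : State :=
  ⟨fun i => if 100 ≤ i ∧ i < 112 then c (i - 100) else z.reg i, z.mem⟩

def Rule.cand (z : State) (ρ : Rule) (c : Conf) : Conf :=
  fun i => if i < 12 then (ρ.upd i).eval (put z c) else 0

/-- Configurations within the limits. -/
structure Valid (z : State) (c : Conf) : Prop where
  zero : c 0 < 2 * z.reg 0 + 1
  succ : ∀ i < 11, c (i + 1) < z.reg 4
  rest : ∀ i, 12 ≤ i → c i = 0

def SStep (z : State) (ρ : Rule) (c c' : Conf) : Prop :=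
  ρ.guard.eval (put z c) ≠ 0 ∧ c' = ρ.cand z c ∧ Valid z c'

section Encoding

/-! #### Words as numbers -/

/-- No letter has digit `0`. Hence `0` encodes the empty word only, and the length of a word being
read need not be stored. -/
def digit : Tok → ℕ
  | .inc => 1
  | .dec => 2
  | .swap => 3
  | .ev true _ => 4
  | .ev false _ => 5

def digits : List Tok → ℕ
  | [] => 0
  | t :: w => digit t + 6 * digits w

/-- Slots form a separate numeral in base `S`, so only the few event letters cost a factor `S`;
digits in a base containing the slots would spoil the bound `2 ^ O(ℓ k)`. -/
def slots (S : ℕ) : List Tok → ℕ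
  | [] => 0
  | .ev _ s :: w => s + S * slots S w
  | _ :: w => slots S w

def events : List Tok → ℕ
  | [] => 0
  | .ev _ _ :: w => events w + 1
  | _ :: w => events w

/-- The old word is consumed at its least significant digit, while the new one grows at the most
significant end. This is why the power `6 ^ length` (and likewise `S ^ events`) is itself a field of
a configuration. -/
theorem digits_append (w : List Tok) (t : Tok) :
    digits (w ++ [t]) = digits w + 6 ^ w.length * digit t := by
  induction w with
  | nil => simp [digits]
  | cons x w ih => simp only [List.cons_append, digits, ih, List.length_cons]; ring

theorem slots_append_ev (S : ℕ) (w : List Tok) (b : Bool) (s : ℕ) :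
    slots S (w ++ [.ev b s]) = slots S w + S ^ events w * s := by
  induction w with
  | nil => simp [slots, events]
  | cons x w ih =>
    cases x <;> simp only [List.cons_append, slots, events, ih]
    ring

theorem events_append_ev (w : List Tok) (b : Bool) (s : ℕ) :
    events (w ++ [.ev b s]) = events w + 1 := by
  induction w with
  | nil => simp [events]
  | cons x w ih => cases x <;> simp [events, ih]

theorem slots_append (S : ℕ) (w : List Tok) {t : Tok} (ht : t.tag = none) :
    slots S (w ++ [t]) = slots S w := by
  induction w with
  | nil => cases t <;> simp [slots, Tok.tag] at ht ⊢
  | cons x w ih => cases x <;> simp [slots, ih]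

theorem events_append (w : List Tok) {t : Tok} (ht : t.tag = none) :
    events (w ++ [t]) = events w := by
  induction w with
  | nil => cases t <;> simp [events, Tok.tag] at ht ⊢
  | cons x w ih => cases x <;> simp [events, ih]

theorem one_le_digit (t : Tok) : 1 ≤ digit t := by
  match t with
  | .inc | .dec | .swap | .ev true _ | .ev false _ => simp [digit]

theorem digit_lt (t : Tok) : digit t < 6 := by
  match t with
  | .inc | .dec | .swap | .ev true _ | .ev false _ => simp [digit]

theorem digits_lt (w : List Tok) : digits w < 6 ^ w.length := by
  induction w with
  | nil => simp [digits]
  | cons t w ih => have := digit_lt t; simp only [digits, List.length_cons, pow_succ]; omega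

theorem digits_eq_zero {w : List Tok} : digits w = 0 ↔ w = [] := by
  cases w with
  | nil => simp [digits]
  | cons t w => have := one_le_digit t; simp [digits]; omega

theorem slots_lt {S : ℕ} {w : List Tok} (hw : ∀ b s, .ev b s ∈ w → s < S) :
    slots S w < S ^ events w := by
  induction w with
  | nil => simp [slots, events]
  | cons t w ih =>
    have ih := ih fun b s h => hw b s (by simp [h])
    cases t with
    | ev b s =>
      have h1 := hw b s (by simp)
      simp only [slots, events, pow_succ]
      calc s + S * slots S w < S + S * slots S w := by omega
        _ = S * (slots S w + 1) := by ring
        _ ≤ S * S ^ events w := Nat.mul_le_mul_left _ ih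
        _ = _ := by ring
    | _ => simpa [slots, events] using ih

theorem events_eq (w : List Tok) : events w = (w.filterMap Tok.tag).length := by
  induction w with
  | nil => rfl
  | cons t w ih => cases t <;> simp [events, ih, Tok.tag, List.filterMap_cons]

theorem cons_of_digits {w : List Tok} {d : ℕ} (h : digits w % 6 = d) (hd : 1 ≤ d) :
    ∃ t w', w = t :: w' ∧ digit t = d ∧ digits w / 6 = digits w' := by
  cases w with
  | nil => simp [digits] at h; omega
  | cons t w =>
    have := digit_lt t
    refine ⟨t, w, rfl, ?_, ?_⟩ <;> simp only [digits] at h ⊢ <;> omega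

/-- The numbers describing a configuration of the machine. -/
def enc (S : ℕ) (a : AConf) : Conf
  | 0 => a.j
  | 1 => digits a.old
  | 2 => slots S a.old
  | 3 => digits a.new
  | 4 => 6 ^ a.new.length
  | 5 => slots S a.new
  | 6 => S ^ events a.new
  | 7 => a.co.1
  | 8 => a.co.2
  | 9 => a.cn.1
  | 10 => a.cn.2
  | 11 => a.ph
  | _ => 0

def SlotsBelow (S : ℕ) (a : AConf) : Prop :=
  (∀ b s, Tok.ev b s ∈ a.old → s < S) ∧ ∀ b s, Tok.ev b s ∈ a.new → s < S

def envOf (z : State) : Env where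
  N := 2 * z.reg 0
  K := z.reg 5
  typ j := z.mem 3 j
  slot j := z.mem 8 (z.mem 2 j)
  nb j s := z.mem 9 (j * z.reg 3 + s)

theorem SlotsBelow.step {z : State} {S r : ℕ} {a a' : AConf} (h : SlotsBelow S a)
    (hS : ∀ v, z.mem 8 v < S) (hs : AStep (envOf z) r a a') : SlotsBelow S a' := by
  obtain ⟨h1, h2⟩ := h
  cases hs with
  | drop t => exact ⟨fun b s hb => h1 b s (List.mem_cons_of_mem _ hb), h2⟩
  | keep b s =>
    refine ⟨fun b s hb => h1 b s (List.mem_cons_of_mem _ hb), fun b' s' hb => ?_⟩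
    rcases List.mem_append.1 hb with hb | hb
    · exact h2 _ _ hb
    · obtain ⟨rfl, rfl⟩ : b' = b ∧ s' = s := by simpa using hb
      exact h1 b' s' (List.mem_cons_self ..)
  | emit r t _ ht =>
    refine ⟨h1, fun b' s' hb => ?_⟩
    rcases List.mem_append.1 hb with hb | hb
    · exact h2 _ _ hb
    · rcases ht with ⟨_, rfl⟩ | ⟨_, rfl⟩ | ⟨_, rfl⟩ <;> simp at hb
  | emitEv r b =>
    refine ⟨h1, fun b' s' hb => ?_⟩
    rcases List.mem_append.1 hb with hb | hb
    · exact h2 _ _ hb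
    · obtain ⟨rfl, rfl⟩ : b' = b ∧ s' = _ := by simpa using hb
      exact hS _
  | endPass => exact ⟨h2, by simp⟩

end Encoding

/-! #### The rules -/

section Rules

abbrev inRange : Expr := .lt (.reg 100) (2 * .reg 0)
abbrev typE : Expr := .cell 3 (.reg 100)
abbrev slotE : Expr := .cell 8 (.cell 2 (.reg 100))
abbrev headE : Expr := .reg 101 % 6
abbrev labE : Expr := .reg 102 % .reg 3
abbrev nbE : Expr := .cell 9 (.reg 100 * .reg 3 + labE)
-- In the guards, conjunction is a product of values `0` and `1`, negation is subtraction from `1`,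
-- and a weak inequality is a strict one with the right side increased by `1`.
def okE (x y p : Expr) : Expr := .lt (x + .eq p 1) (y + 1) * .lt y (.reg 5 + 1)

def dropRule (d : ℕ) (x y : Expr) : Rule where
  code := 0
  guard := inRange * .eq headE (.lit d) * okE x (.reg 109) (.reg 111)
  upd
    | 1 => .reg 101 / 6
    | 7 => x
    | 8 => y
    | i => .reg (100 + i)

def dropEvRule (d : ℕ) (x : Expr) : Rule where
  code := 0
  guard := inRange * .eq headE (.lit d) * .eq typE 0 * .eq labE slotE * okE x (.reg 109) (.reg 111)
  upd
    | 1 => .reg 101 / 6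
    | 2 => .reg 102 / .reg 3
    | 7 => x
    | 8 => x
    | i => .reg (100 + i)

/-- The parameter `p` is the phase forbidden to neighbours of the new vertex: `2` for introductions,
`0` for removals. -/
def keepRule (d p : ℕ) (x y : Expr) : Rule where
  code := 1
  guard := inRange * .eq headE (.lit d) * (1 - .eq typE 0 * .eq labE slotE) *
    (1 - .lt 0 nbE * .eq (.reg 111) (.lit p)) * okE x y (.reg 111)
  upd
    | 1 => .reg 101 / 6
    | 2 => .reg 102 / .reg 3
    | 3 => .reg 103 + .reg 104 * .lit d
    | 4 => .reg 104 * 6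
    | 5 => .reg 105 + .reg 106 * labE
    | 6 => .reg 106 * .reg 3
    | 7 => x
    | 8 => x
    | 9 => y
    | 10 => y
    | i => .reg (100 + i)

def emitRule (r d : ℕ) (x y : Expr) : Rule where
  code := r
  guard := inRange * okE (.reg 107) x (.reg 111)
  upd
    | 3 => .reg 103 + .reg 104 * .lit d
    | 4 => .reg 104 * 6
    | 9 => x
    | 10 => y
    | i => .reg (100 + i)

def emitEvRule (r d p : ℕ) (x : Expr) : Rule where
  code := r
  guard := inRange * .eq typE 1 * .eq (.reg 111) (.lit p) * okE (.reg 107) x (.reg 111 + 1)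
  upd
    | 3 => .reg 103 + .reg 104 * .lit d
    | 4 => .reg 104 * 6
    | 5 => .reg 105 + .reg 106 * slotE
    | 6 => .reg 106 * .reg 3
    | 9 => x
    | 10 => x
    | 11 => .reg 111 + 1
    | i => .reg (100 + i)

def endRule : Rule where
  code := 7
  guard := inRange * .eq (.reg 101) 0 * .eq (.reg 111) (2 * typE)
  upd
    | 0 => .reg 100 + 1
    | 1 => .reg 103
    | 2 => .reg 105
    | 4 => 1
    | 6 => 1
    | _ => 0

def rules : List Rule :=
  [dropRule 1 (.reg 107 + 1) (.reg 108), dropRule 2 (.reg 107 - 1) (.reg 108),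
    dropRule 3 (.reg 108) (.reg 107),
    dropEvRule 4 (.reg 107 + 1), dropEvRule 5 (.reg 107 - 1),
    keepRule 4 2 (.reg 107 + 1) (.reg 109 + 1), keepRule 5 0 (.reg 107 - 1) (.reg 109 - 1),
    emitRule 2 1 (.reg 109 + 1) (.reg 110), emitRule 3 2 (.reg 109 - 1) (.reg 110),
    emitRule 4 3 (.reg 110) (.reg 109),
    emitEvRule 5 4 0 (.reg 109 + 1), emitEvRule 6 5 1 (.reg 109 - 1), endRule]

@[simp] theorem put_mem (z : State) (c : Conf) : (put z c).mem = z.mem := rfl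

variable {z : State} {a a' : AConf} {c' : Conf} {r : ℕ}

theorem put_enc (S : ℕ) (a : AConf) :
    (put z (enc S a)).reg 100 = a.j ∧ (put z (enc S a)).reg 101 = digits a.old ∧
    (put z (enc S a)).reg 102 = slots S a.old ∧ (put z (enc S a)).reg 103 = digits a.new ∧
    (put z (enc S a)).reg 104 = 6 ^ a.new.length ∧ (put z (enc S a)).reg 105 = slots S a.new ∧
    (put z (enc S a)).reg 106 = S ^ events a.new ∧ (put z (enc S a)).reg 107 = a.co.1 ∧
    (put z (enc S a)).reg 108 = a.co.2 ∧ (put z (enc S a)).reg 109 = a.cn.1 ∧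
    (put z (enc S a)).reg 110 = a.cn.2 ∧ (put z (enc S a)).reg 111 = a.ph ∧
    (put z (enc S a)).reg 0 = z.reg 0 ∧ (put z (enc S a)).reg 3 = z.reg 3 ∧
    (put z (enc S a)).reg 5 = z.reg 5 := by
  simp [put, enc]

theorem conf_ext {c c' : Conf} (h0 : c 0 = c' 0) (h1 : c 1 = c' 1) (h2 : c 2 = c' 2)
    (h3 : c 3 = c' 3) (h4 : c 4 = c' 4) (h5 : c 5 = c' 5) (h6 : c 6 = c' 6) (h7 : c 7 = c' 7)
    (h8 : c 8 = c' 8) (h9 : c 9 = c' 9) (h10 : c 10 = c' 10) (h11 : c 11 = c' 11)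
    (h : ∀ i, 12 ≤ i → c i = c' i) : c = c' := by
  funext i
  by_cases hi : 12 ≤ i
  · exact h i hi
  · interval_cases i <;> assumption

theorem cand_eq_enc {ρ : Rule} {S : ℕ}
    (h : let s := put z (enc S a)
      (ρ.upd 0).eval s = a'.j ∧ (ρ.upd 1).eval s = digits a'.old ∧
      (ρ.upd 2).eval s = slots S a'.old ∧ (ρ.upd 3).eval s = digits a'.new ∧
      (ρ.upd 4).eval s = 6 ^ a'.new.length ∧ (ρ.upd 5).eval s = slots S a'.new ∧
      (ρ.upd 6).eval s = S ^ events a'.new ∧ (ρ.upd 7).eval s = a'.co.1 ∧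
      (ρ.upd 8).eval s = a'.co.2 ∧ (ρ.upd 9).eval s = a'.cn.1 ∧
      (ρ.upd 10).eval s = a'.cn.2 ∧ (ρ.upd 11).eval s = a'.ph) :
    ρ.cand z (enc S a) = enc S a' := by
  obtain ⟨h0, h1, h2, h3, h4, h5, h6, h7, h8, h9, h10, h11⟩ := h
  apply conf_ext <;> try (simp only [Rule.cand, enc]; assumption)
  intro i hi
  obtain ⟨i, rfl⟩ := Nat.exists_eq_add_of_le' hi
  simp [Rule.cand, enc]

theorem ite_ne_zero_iff (p : Prop) [Decidable p] : (if p then 1 else 0 : ℕ) ≠ 0 ↔ p := by simp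

theorem eval_okE {s : State} {x y p : Expr} : (okE x y p).eval s ≠ 0 ↔
    x.eval s + act (p.eval s) ≤ y.eval s ∧ y.eval s ≤ s.reg 5 := by
  simp only [okE, act, eval_mul, mul_ne_zero_iff, eval_lt, ite_ne_zero_iff, eval_add, eval_eq, eval_one,
    eval_reg, Nat.lt_succ_iff]
  rfl

theorem digit_inj {t t' : Tok} (ht : t.tag = none) (h : digit t' = digit t) : t' = t := by
  match t, t' with
  | .inc, .inc | .inc, .dec | .inc, .swap | .inc, .ev true _ | .inc, .ev false _
  | .dec, .inc | .dec, .dec | .dec, .swap | .dec, .ev true _ | .dec, .ev false _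
  | .swap, .inc | .swap, .dec | .swap, .swap | .swap, .ev true _ | .swap, .ev false _ =>
    simp [digit] at h ⊢
  | .ev _ _, _ => simp [Tok.tag] at ht

theorem digit_ev_inj {t' : Tok} {b : Bool} {d s₀ : ℕ} (hd : digit (.ev b s₀) = d)
    (h : digit t' = d) : ∃ s, t' = .ev b s := by
  subst hd
  match b, t' with
  | true, .inc | true, .dec | true, .swap | true, .ev true _ | true, .ev false _
  | false, .inc | false, .dec | false, .swap | false, .ev true _ | false, .ev false _ =>
    simp [digit] at h ⊢

/-- The expressions `x` and `y` compute the cursor after the letter `t`, from the cursor in the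
registers `i` and `i + 1`. -/
def Computes (t : Tok) (i : ℕ) (x y : Expr) : Prop :=
  ∀ s : State, (x.eval s, y.eval s) = t.app (s.reg i, s.reg (i + 1))

/-- This and the similar statements below identify each rule with one kind of move. That rules are
moves makes the result of the search trustworthy; that moves are rules makes the search exhaustive.
-/
theorem drop_iff {t : Tok} (ht : t.tag = none) {d : ℕ} (hd : digit t = d) {x y : Expr}
    (hxy : Computes t 107 x y) (a : AConf) :
    SStep z (dropRule d x y) (enc (z.reg 3) a) c' ↔
      ∃ w, a.old = t :: w ∧ AStep (envOf z) 0 a ⟨a.j, w, a.new, t.app a.co, a.cn, a.ph⟩ ∧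
        c' = enc (z.reg 3) ⟨a.j, w, a.new, t.app a.co, a.cn, a.ph⟩ ∧ Valid z c' := by
  have hne := one_le_digit t
  have hlt := digit_lt t
  obtain ⟨e0, e1, e2, e3, e4, e5, e6, e7, e8, e9, e10, e11, r0, r3, r5⟩ := put_enc (z := z) (z.reg 3) a
  have hxy := hxy (put z (enc (z.reg 3) a))
  have hg : (dropRule d x y).guard.eval (put z (enc (z.reg 3) a)) ≠ 0 ↔
      ∃ w, a.old = t :: w ∧ a.j < 2 * z.reg 0 ∧ (t.app a.co).1 + act a.ph ≤ a.cn.1 ∧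
        a.cn.1 ≤ z.reg 5 := by
    simp only [dropRule, eval_mul, mul_ne_zero_iff, eval_okE, eval_lt, eval_eq, ite_ne_zero_iff,
      eval_reg, eval_mod, eval_lit, eval_six, eval_two, e0, e1, e7, e8, e9, e11, r0, r5,
      Prod.ext_iff] at hxy ⊢
    rw [hxy.1]
    constructor
    · rintro ⟨⟨h1, h2⟩, h3, h4⟩
      obtain ⟨t', w, k1, k2, k3⟩ := cons_of_digits h2 (by omega)
      exact ⟨w, by rw [k1, digit_inj ht (k2.trans hd.symm)], h1, h3, h4⟩
    · rintro ⟨w, h0, h1, h3, h4⟩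
      exact ⟨⟨h1, by rw [h0, digits]; omega⟩, h3, h4⟩
  have key : ∀ w, a.old = t :: w → (dropRule d x y).cand z (enc (z.reg 3) a) =
      enc (z.reg 3) ⟨a.j, w, a.new, t.app a.co, a.cn, a.ph⟩ := by
    intro w hw
    apply cand_eq_enc
    have hsl : slots (z.reg 3) (t :: w) = slots (z.reg 3) w := by
      cases t <;> simp [Tok.tag, slots] at ht ⊢
    simp only [dropRule, eval_reg, eval_div, eval_six, Nat.reduceAdd, e0, e1, e2, e3, e4, e5, e6, e7,
      e8, e9, e10, e11, hw, digits, hsl, true_and, and_true, Prod.ext_iff] at hxy ⊢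
    exact ⟨by omega, hxy⟩
  rw [SStep, hg]
  constructor
  · rintro ⟨⟨w, h0, h1, h2, h3⟩, rfl, hv⟩
    refine ⟨w, h0, ?_, key w h0, hv⟩
    obtain ⟨j, old, new, co, cn, ph⟩ := a
    simp only at h0; subst h0
    exact .drop t h1 (by rintro b s rfl; simp [Tok.tag] at ht) ⟨h2, h3⟩
  · rintro ⟨w, h0, h1, rfl, hv⟩
    obtain ⟨j, old, new, co, cn, ph⟩ := a
    simp only at h0; subst h0
    refine ⟨⟨w, rfl, ?_⟩, (key w rfl).symm, hv⟩
    generalize hb : (⟨j, w, new, t.app co, cn, ph⟩ : AConf) = b at h1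
    cases h1 with
    | drop t hj _ ok => exact ⟨hj, ok⟩
    | emit r t hj ht => simp at ht
    | emitEv r b hj hT hr => simp at hr

theorem dropEv_iff {b : Bool} {d : ℕ} (hd : ∀ s, digit (.ev b s) = d) {x : Expr}
    (hx : ∀ s, Computes (.ev b s) 107 x x) (a : AConf) (ha : SlotsBelow (z.reg 3) a) :
    SStep z (dropEvRule d x) (enc (z.reg 3) a) c' ↔
      ∃ w s, a.old = .ev b s :: w ∧
        AStep (envOf z) 0 a ⟨a.j, w, a.new, (Tok.ev b s).app a.co, a.cn, a.ph⟩ ∧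
        c' = enc (z.reg 3) ⟨a.j, w, a.new, (Tok.ev b s).app a.co, a.cn, a.ph⟩ ∧ Valid z c' := by
  have hne := one_le_digit (.ev b 0)
  have hlt := digit_lt (.ev b 0)
  rw [hd] at hne hlt
  obtain ⟨e0, e1, e2, e3, e4, e5, e6, e7, e8, e9, e10, e11, r0, r3, r5⟩ := put_enc (z := z) (z.reg 3) a
  have hxy := fun s => hx s (put z (enc (z.reg 3) a))
  have hlab : ∀ s w, a.old = .ev b s :: w → slots (z.reg 3) a.old % z.reg 3 = s := by
    intro s w h
    rw [h, slots, Nat.add_mul_mod_self_left, Nat.mod_eq_of_lt (ha.1 b s (by simp [h]))]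
  have hg : (dropEvRule d x).guard.eval (put z (enc (z.reg 3) a)) ≠ 0 ↔
      ∃ w s, a.old = .ev b s :: w ∧ a.j < 2 * z.reg 0 ∧ ((envOf z).typ a.j = 0 ∧
        s = (envOf z).slot a.j) ∧ ((Tok.ev b s).app a.co).1 + act a.ph ≤ a.cn.1 ∧
        a.cn.1 ≤ z.reg 5 := by
    simp only [dropEvRule, eval_mul, mul_ne_zero_iff, eval_okE, eval_lt, eval_eq, ite_ne_zero_iff,
      eval_reg, eval_mod, eval_lit, eval_six, eval_two, eval_cell, eval_zero, put_mem,
      e0, e1, e2, e7, e8, e9, e11, r0, r3, r5, Prod.ext_iff] at hxy ⊢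
    constructor
    · rintro ⟨⟨⟨⟨h1, h2⟩, h5⟩, h6⟩, h3, h4⟩
      obtain ⟨t', w, k1, k2, k3⟩ := cons_of_digits h2 (by omega)
      obtain ⟨s, rfl⟩ := digit_ev_inj (hd 0) k2
      rw [(hxy s).1] at h3
      rw [hlab s w k1] at h6
      exact ⟨w, s, k1, h1, ⟨h5, h6⟩, h3, h4⟩
    · rintro ⟨w, s, h0, h1, ⟨h2, h5⟩, h3, h4⟩
      refine ⟨⟨⟨⟨h1, by rw [h0, digits, hd]; omega⟩, h2⟩, (hlab s w h0).trans h5⟩, ?_, h4⟩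
      rw [(hxy s).1]; exact h3
  have key : ∀ w s, a.old = .ev b s :: w → (dropEvRule d x).cand z (enc (z.reg 3) a) =
      enc (z.reg 3) ⟨a.j, w, a.new, (Tok.ev b s).app a.co, a.cn, a.ph⟩ := by
    intro w s hw
    apply cand_eq_enc
    have hxy := hxy s
    have hs := ha.1 b s (by simp [hw])
    simp only [dropEvRule, eval_reg, eval_div, eval_six, Nat.reduceAdd, e0, e1, e2, e3, e4, e5, e6,
      e7, e8, e9, e10, e11, r3, hw, digits, slots, hd, true_and, and_true, Prod.ext_iff] at hxy ⊢
    refine ⟨by omega, ?_, hxy⟩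
    rw [Nat.add_mul_div_left _ _ (by omega), Nat.div_eq_of_lt hs, zero_add]
  rw [SStep, hg]
  constructor
  · rintro ⟨⟨w, s, h0, h1, h4, h2, h3⟩, rfl, hv⟩
    refine ⟨w, s, h0, ?_, key w s h0, hv⟩
    obtain ⟨j, old, new, co, cn, ph⟩ := a
    simp only at h0; subst h0
    exact .drop _ h1 (by rintro b' s' h; cases h; exact h4) ⟨h2, h3⟩
  · rintro ⟨w, s, h0, h1, rfl, hv⟩
    obtain ⟨j, old, new, co, cn, ph⟩ := a
    simp only at h0; subst h0
    refine ⟨⟨w, s, rfl, ?_⟩, (key w s rfl).symm, hv⟩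
    generalize hb : (⟨j, w, new, (Tok.ev b s).app co, cn, ph⟩ : AConf) = b at h1
    cases h1 with
    | drop t hj ht ok => exact ⟨hj, ht _ _ rfl, ok⟩
    | emit r t hj ht => simp at ht
    | emitEv r b hj hT hr => simp at hr

theorem keep_iff {b : Bool} {d p : ℕ} (hd : ∀ s, digit (.ev b s) = d) (hp : p = if b then 2 else 0)
    {x y : Expr} (hx : ∀ s, Computes (.ev b s) 107 x x) (hy : ∀ s, Computes (.ev b s) 109 y y)
    (a : AConf) (ha : SlotsBelow (z.reg 3) a) :
    SStep z (keepRule d p x y) (enc (z.reg 3) a) c' ↔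
      ∃ w s, a.old = .ev b s :: w ∧
        AStep (envOf z) 1 a ⟨a.j, w, a.new ++ [.ev b s], (Tok.ev b s).app a.co,
          (Tok.ev b s).app a.cn, a.ph⟩ ∧
        c' = enc (z.reg 3) ⟨a.j, w, a.new ++ [.ev b s], (Tok.ev b s).app a.co,
          (Tok.ev b s).app a.cn, a.ph⟩ ∧ Valid z c' := by
  have hne := one_le_digit (.ev b 0)
  have hlt := digit_lt (.ev b 0)
  rw [hd] at hne hlt
  obtain ⟨e0, e1, e2, e3, e4, e5, e6, e7, e8, e9, e10, e11, r0, r3, r5⟩ := put_enc (z := z) (z.reg 3) a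
  have hxy := fun s => hx s (put z (enc (z.reg 3) a))
  have hyy := fun s => hy s (put z (enc (z.reg 3) a))
  have hlab : ∀ s w, a.old = .ev b s :: w → slots (z.reg 3) a.old % z.reg 3 = s := by
    intro s w h
    rw [h, slots, Nat.add_mul_mod_self_left, Nat.mod_eq_of_lt (ha.1 b s (by simp [h]))]
  have hsub : ∀ p q : Prop, ∀ [Decidable p] [Decidable q],
      1 - (if p then 1 else 0) * (if q then 1 else 0) ≠ 0 ↔ ¬ (p ∧ q) := by
    intro p q _ _; by_cases p <;> by_cases q <;> simp [*]
  have hg : (keepRule d p x y).guard.eval (put z (enc (z.reg 3) a)) ≠ 0 ↔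
      ∃ w s, a.old = .ev b s :: w ∧ a.j < 2 * z.reg 0 ∧ ¬ ((envOf z).typ a.j = 0 ∧
        s = (envOf z).slot a.j) ∧ ((envOf z).nb a.j s ≠ 0 → a.ph ≠ p) ∧
        ((Tok.ev b s).app a.co).1 + act a.ph ≤ ((Tok.ev b s).app a.cn).1 ∧
        ((Tok.ev b s).app a.cn).1 ≤ z.reg 5 := by
    simp only [keepRule, eval_mul, mul_ne_zero_iff, eval_okE, eval_lt, eval_eq, ite_ne_zero_iff,
      eval_reg, eval_mod, eval_lit, eval_six, eval_two, eval_cell, eval_zero, put_mem, eval_sub,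
      eval_one, eval_add, hsub,
      e0, e1, e2, e7, e8, e9, e10, e11, r0, r3, r5, Prod.ext_iff, Nat.reduceAdd] at hxy hyy ⊢
    constructor
    · rintro ⟨⟨⟨⟨h1, h2⟩, h5⟩, h6⟩, h3, h4⟩
      obtain ⟨t', w, k1, k2, k3⟩ := cons_of_digits h2 (by omega)
      obtain ⟨s, rfl⟩ := digit_ev_inj (hd 0) k2
      rw [(hxy s).1, (hyy s).1] at h3
      rw [(hyy s).1] at h4
      rw [hlab s w k1] at h5 h6
      exact ⟨w, s, k1, h1, h5, fun h7 h8 => h6 ⟨Nat.pos_of_ne_zero h7, h8⟩, h3, h4⟩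
    · rintro ⟨w, s, h0, h1, h5, h6, h3, h4⟩
      rw [(hxy s).1, (hyy s).1, hlab s w h0]
      exact ⟨⟨⟨⟨h1, by rw [h0, digits, hd]; omega⟩, h5⟩, fun h => h6 (Nat.pos_iff_ne_zero.1 h.1) h.2⟩,
        h3, h4⟩
  have key : ∀ w s, a.old = .ev b s :: w → (keepRule d p x y).cand z (enc (z.reg 3) a) =
      enc (z.reg 3) ⟨a.j, w, a.new ++ [.ev b s], (Tok.ev b s).app a.co,
        (Tok.ev b s).app a.cn, a.ph⟩ := by
    intro w s hw
    apply cand_eq_enc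
    have hxy := hxy s
    have hyy := hyy s
    have hs := ha.1 b s (by simp [hw])
    have hl := hlab s w hw
    simp only [hw, slots] at hl
    simp only [keepRule, eval_reg, eval_div, eval_six, eval_add, eval_mul, eval_mod, eval_lit,
      Nat.reduceAdd, e0, e1, e2, e3, e4, e5, e6, slots_append_ev, events_append_ev, digits_append,
      e7, e8, e9, e10, e11, r3, hw, hl, digits, slots, hd, true_and, and_true, Prod.ext_iff,
      List.length_append, List.length_singleton, pow_succ] at hxy hyy ⊢
    refine ⟨by omega, ?_, hxy.1, hxy.2, hyy⟩
    rw [Nat.add_mul_div_left _ _ (by omega), Nat.div_eq_of_lt hs, zero_add]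
  rw [SStep, hg]
  constructor
  · rintro ⟨⟨w, s, h0, h1, h4, h5, h2, h3⟩, rfl, hv⟩
    refine ⟨w, s, h0, ?_, key w s h0, hv⟩
    obtain ⟨j, old, new, co, cn, ph⟩ := a
    simp only at h0; subst h0
    refine .keep b s h1 h4 (fun h => ⟨?_, ?_⟩) ⟨h2, h3⟩
    · rintro rfl; simpa [hp] using h5 h
    · rintro rfl; simpa [hp] using h5 h
  · rintro ⟨w, s, h0, h1, rfl, hv⟩
    obtain ⟨j, old, new, co, cn, ph⟩ := a
    simp only at h0; subst h0
    refine ⟨⟨w, s, rfl, ?_⟩, (key w s rfl).symm, hv⟩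
    generalize hb : (⟨j, w, new ++ [.ev b s], (Tok.ev b s).app co, (Tok.ev b s).app cn, ph⟩ : AConf)
      = a' at h1
    cases h1 with
    | keep b s hj hs hnb ok =>
      refine ⟨hj, hs, fun h => ?_, ok⟩
      subst hp
      cases b
      · simpa using (hnb h).2
      · simpa using (hnb h).1
    | emit r t hj ht => simp at ht
    | emitEv r b hj hT hr => simp at hr

theorem emit_iff {r d : ℕ} {t : Tok} (ht : (r = 2 ∧ t = .inc) ∨ (r = 3 ∧ t = .dec) ∨ (r = 4 ∧ t = .swap))
    (hd : digit t = d) {x y : Expr} (hxy : Computes t 109 x y) (a : AConf) :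
    SStep z (emitRule r d x y) (enc (z.reg 3) a) c' ↔
      AStep (envOf z) r a ⟨a.j, a.old, a.new ++ [t], a.co, t.app a.cn, a.ph⟩ ∧
        c' = enc (z.reg 3) ⟨a.j, a.old, a.new ++ [t], a.co, t.app a.cn, a.ph⟩ ∧ Valid z c' := by
  have htag : t.tag = none := by rcases ht with ⟨_, rfl⟩ | ⟨_, rfl⟩ | ⟨_, rfl⟩ <;> rfl
  obtain ⟨e0, e1, e2, e3, e4, e5, e6, e7, e8, e9, e10, e11, r0, r3, r5⟩ := put_enc (z := z) (z.reg 3) a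
  have hxy := hxy (put z (enc (z.reg 3) a))
  have hg : (emitRule r d x y).guard.eval (put z (enc (z.reg 3) a)) ≠ 0 ↔
      a.j < 2 * z.reg 0 ∧ a.co.1 + act a.ph ≤ (t.app a.cn).1 ∧ (t.app a.cn).1 ≤ z.reg 5 := by
    simp only [emitRule, eval_mul, mul_ne_zero_iff, eval_okE, eval_lt, ite_ne_zero_iff,
      eval_reg, eval_two, e0, e7, e9, e10, e11, r0, r5, Prod.ext_iff, Nat.reduceAdd] at hxy ⊢
    rw [hxy.1]
  have key : (emitRule r d x y).cand z (enc (z.reg 3) a) =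
      enc (z.reg 3) ⟨a.j, a.old, a.new ++ [t], a.co, t.app a.cn, a.ph⟩ := by
    apply cand_eq_enc
    simp only [emitRule, eval_reg, eval_add, eval_mul, eval_six, eval_lit, Nat.reduceAdd, e0, e1, e2,
      e3, e4, e5, e6, e7, e8, e9, e10, e11, digits_append, slots_append _ _ htag,
      events_append _ htag, hd, List.length_append, List.length_singleton, pow_succ, true_and,
      and_true, Prod.ext_iff] at hxy ⊢
    exact hxy
  rw [SStep, hg, key]
  obtain ⟨j, old, new, co, cn, ph⟩ := a
  constructor
  · rintro ⟨⟨h1, h2, h3⟩, rfl, hv⟩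
    exact ⟨.emit r t h1 ht ⟨h2, h3⟩, rfl, hv⟩
  · rintro ⟨h1, rfl, hv⟩
    refine ⟨?_, rfl, hv⟩
    generalize hb : (⟨j, old, new ++ [t], co, t.app cn, ph⟩ : AConf) = a' at h1
    cases h1 with
    | emit r t' hj ht' ok =>
      obtain rfl : t = t' := by simp at hb; exact hb.1
      exact ⟨hj, ok⟩
    | emitEv r b hj hT hr => omega
    | drop | keep | endPass => simp at ht

theorem emitEv_iff {r d p : ℕ} {b : Bool} (hr : (r = 5 ∧ b = true ∧ p = 0) ∨ (r = 6 ∧ b = false ∧ p = 1))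
    (hd : ∀ s, digit (.ev b s) = d) {x : Expr} (hx : ∀ s, Computes (.ev b s) 109 x x) (a : AConf) :
    SStep z (emitEvRule r d p x) (enc (z.reg 3) a) c' ↔
      AStep (envOf z) r a ⟨a.j, a.old, a.new ++ [.ev b ((envOf z).slot a.j)], a.co,
        (Tok.ev b ((envOf z).slot a.j)).app a.cn, a.ph + 1⟩ ∧
        c' = enc (z.reg 3) ⟨a.j, a.old, a.new ++ [.ev b ((envOf z).slot a.j)], a.co,
          (Tok.ev b ((envOf z).slot a.j)).app a.cn, a.ph + 1⟩ ∧ Valid z c' := by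
  obtain ⟨e0, e1, e2, e3, e4, e5, e6, e7, e8, e9, e10, e11, r0, r3, r5⟩ := put_enc (z := z) (z.reg 3) a
  have hsl : z.mem 8 (z.mem 2 a.j) = (envOf z).slot a.j := rfl
  have htyp : z.mem 3 a.j = (envOf z).typ a.j := rfl
  generalize hs : (envOf z).slot a.j = s at *
  have hxy := hx s (put z (enc (z.reg 3) a))
  have hg : (emitEvRule r d p x).guard.eval (put z (enc (z.reg 3) a)) ≠ 0 ↔
      a.j < 2 * z.reg 0 ∧ (envOf z).typ a.j = 1 ∧ a.ph = p ∧
      a.co.1 + act (a.ph + 1) ≤ ((Tok.ev b s).app a.cn).1 ∧ ((Tok.ev b s).app a.cn).1 ≤ z.reg 5 := by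
    simp only [emitEvRule, eval_mul, mul_ne_zero_iff, eval_okE, eval_lt, ite_ne_zero_iff, eval_eq,
      eval_reg, eval_two, eval_lit, eval_one, eval_add, eval_cell, put_mem, htyp, e0, e7, e9, e10,
      e11, r0, r5, Prod.ext_iff, Nat.reduceAdd, and_assoc] at hxy ⊢
    rw [hxy.1]
  have key : (emitEvRule r d p x).cand z (enc (z.reg 3) a) =
      enc (z.reg 3) ⟨a.j, a.old, a.new ++ [.ev b s], a.co, (Tok.ev b s).app a.cn, a.ph + 1⟩ := by
    apply cand_eq_enc
    simp only [emitEvRule, eval_reg, eval_add, eval_mul, eval_six, eval_lit, Nat.reduceAdd, e0, e1,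
      e2, e3, e4, e5, e6, e7, e8, e9, e10, e11, r3, digits_append, slots_append_ev, hsl, eval_cell,
      events_append_ev, hd, List.length_append, List.length_singleton, pow_succ, true_and, put_mem,
      and_true, Prod.ext_iff, eval_one] at hxy ⊢
    exact hxy
  rw [SStep, hg, key]
  obtain ⟨j, old, new, co, cn, ph⟩ := a
  constructor
  · rintro ⟨⟨h1, h2, h4, h5, h3⟩, rfl, hv⟩
    refine ⟨?_, rfl, hv⟩
    subst hs
    refine .emitEv r b h1 h2 ?_ ⟨h5, h3⟩
    simp only at h4
    subst h4
    exact hr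
  · rintro ⟨h1, rfl, hv⟩
    refine ⟨?_, rfl, hv⟩
    generalize hb : (⟨j, old, new ++ [.ev b s], co, (Tok.ev b s).app cn, ph + 1⟩ : AConf) = a' at h1
    cases h1 with
    | emitEv r b' hj hT hr' ok =>
      obtain rfl : b = b' := by simp at hb; exact hb.1.1
      subst hs
      refine ⟨hj, hT, ?_, ok⟩
      change ph = p
      omega
    | drop | keep | emit | endPass => omega

theorem end_iff (a : AConf) :
    SStep z endRule (enc (z.reg 3) a) c' ↔
      AStep (envOf z) 7 a ⟨a.j + 1, a.new, [], (0, 0), (0, 0), 0⟩ ∧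
        c' = enc (z.reg 3) ⟨a.j + 1, a.new, [], (0, 0), (0, 0), 0⟩ ∧ Valid z c' := by
  obtain ⟨e0, e1, e2, e3, e4, e5, e6, e7, e8, e9, e10, e11, r0, r3, r5⟩ := put_enc (z := z) (z.reg 3) a
  have htyp : z.mem 3 a.j = (envOf z).typ a.j := rfl
  have hg : endRule.guard.eval (put z (enc (z.reg 3) a)) ≠ 0 ↔
      a.j < 2 * z.reg 0 ∧ a.old = [] ∧ a.ph = 2 * (envOf z).typ a.j := by
    simp only [endRule, eval_mul, mul_ne_zero_iff, eval_lt, ite_ne_zero_iff, eval_eq,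
      eval_reg, eval_two, eval_zero, eval_cell, put_mem, htyp, e0, e1, e11, r0, digits_eq_zero,
      and_assoc]
  have key : endRule.cand z (enc (z.reg 3) a) =
      enc (z.reg 3) ⟨a.j + 1, a.new, [], (0, 0), (0, 0), 0⟩ := by
    apply cand_eq_enc
    simp [endRule, e0, e3, e5, digits, slots, events]
  rw [SStep, hg, key]
  obtain ⟨j, old, new, co, cn, ph⟩ := a
  constructor
  · rintro ⟨⟨h1, h2, h3⟩, rfl, hv⟩
    simp only at h2
    subst h2
    exact ⟨.endPass h1 h3, rfl, hv⟩
  · rintro ⟨h1, rfl, hv⟩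
    refine ⟨?_, rfl, hv⟩
    generalize hb : (⟨j + 1, new, [], (0, 0), (0, 0), 0⟩ : AConf) = a' at h1
    cases h1 with
    | endPass hj hph => exact ⟨hj, rfl, hph⟩
    | emit r t hj ht => simp at ht
    | emitEv r b hj hT hr => simp at hr

theorem AStep.of_sstep {ρ : Rule} (hρ : ρ ∈ rules) (ha : SlotsBelow (z.reg 3) a)
    (h : SStep z ρ (enc (z.reg 3) a) c') :
    ∃ a', AStep (envOf z) ρ.code a a' ∧ c' = enc (z.reg 3) a' := by
  simp only [rules, List.mem_cons, List.not_mem_nil, or_false] at hρ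
  rcases hρ with rfl | rfl | rfl | rfl | rfl | rfl | rfl | rfl | rfl | rfl | rfl | rfl | rfl
  · obtain ⟨w, -, h1, h2, -⟩ := (drop_iff (t := .inc) rfl rfl (fun s => rfl) a).1 h
    exact ⟨_, h1, h2⟩
  · obtain ⟨w, -, h1, h2, -⟩ := (drop_iff (t := .dec) rfl rfl (fun s => rfl) a).1 h
    exact ⟨_, h1, h2⟩
  · obtain ⟨w, -, h1, h2, -⟩ := (drop_iff (t := .swap) rfl rfl (fun s => rfl) a).1 h
    exact ⟨_, h1, h2⟩
  · obtain ⟨w, s, -, h1, h2, -⟩ := (dropEv_iff (b := true) (fun s => rfl) (fun _ s => rfl) a ha).1 h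
    exact ⟨_, h1, h2⟩
  · obtain ⟨w, s, -, h1, h2, -⟩ := (dropEv_iff (b := false) (fun s => rfl) (fun _ s => rfl) a ha).1 h
    exact ⟨_, h1, h2⟩
  · obtain ⟨w, s, -, h1, h2, -⟩ :=
      (keep_iff (b := true) (fun s => rfl) rfl (fun _ s => rfl) (fun _ s => rfl) a ha).1 h
    exact ⟨_, h1, h2⟩
  · obtain ⟨w, s, -, h1, h2, -⟩ :=
      (keep_iff (b := false) (fun s => rfl) rfl (fun _ s => rfl) (fun _ s => rfl) a ha).1 h
    exact ⟨_, h1, h2⟩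
  · obtain ⟨h1, h2, -⟩ := (emit_iff (t := .inc) (by simp) rfl (fun s => rfl) a).1 h
    exact ⟨_, h1, h2⟩
  · obtain ⟨h1, h2, -⟩ := (emit_iff (t := .dec) (by simp) rfl (fun s => rfl) a).1 h
    exact ⟨_, h1, h2⟩
  · obtain ⟨h1, h2, -⟩ := (emit_iff (t := .swap) (by simp) rfl (fun s => rfl) a).1 h
    exact ⟨_, h1, h2⟩
  · obtain ⟨h1, h2, -⟩ :=
      (emitEv_iff (b := true) (by simp) (fun s => rfl) (fun _ s => rfl) a).1 h
    exact ⟨_, h1, h2⟩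
  · obtain ⟨h1, h2, -⟩ :=
      (emitEv_iff (b := false) (by simp) (fun s => rfl) (fun _ s => rfl) a).1 h
    exact ⟨_, h1, h2⟩
  · obtain ⟨h1, h2, -⟩ := (end_iff a).1 h
    exact ⟨_, h1, h2⟩

/-- The restriction to valid targets is harmless, since the accepting runs constructed for
completeness stay within the limits (`Valid.of_fit`). -/
theorem AStep.sstep (ha : SlotsBelow (z.reg 3) a) (h : AStep (envOf z) r a a')
    (hv : Valid z (enc (z.reg 3) a')) :
    ∃ ρ ∈ rules, SStep z ρ (enc (z.reg 3) a) (enc (z.reg 3) a') := by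
  have h0 := h
  cases h with
  | drop t hj ht ok =>
    match t with
    | .inc => exact ⟨dropRule 1 (.reg 107 + 1) (.reg 108), .head _,
        (drop_iff (t := .inc) rfl rfl (fun s => rfl) _).2 ⟨_, rfl, h0, rfl, hv⟩⟩
    | .dec => exact ⟨dropRule 2 (.reg 107 - 1) (.reg 108), .tail _ (.head _),
        (drop_iff (t := .dec) rfl rfl (fun s => rfl) _).2 ⟨_, rfl, h0, rfl, hv⟩⟩
    | .swap => exact ⟨dropRule 3 (.reg 108) (.reg 107), .tail _ (.tail _ (.head _)),
        (drop_iff (t := .swap) rfl rfl (fun s => rfl) _).2 ⟨_, rfl, h0, rfl, hv⟩⟩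
    | .ev true s => exact ⟨dropEvRule 4 (.reg 107 + 1), .tail _ (.tail _ (.tail _ (.head _))),
        (dropEv_iff (b := true) (fun s => rfl) (fun _ s => rfl) _ ha).2 ⟨_, _, rfl, h0, rfl, hv⟩⟩
    | .ev false s => exact ⟨dropEvRule 5 (.reg 107 - 1), .tail _ (.tail _ (.tail _ (.tail _ (.head _)))),
        (dropEv_iff (b := false) (fun s => rfl) (fun _ s => rfl) _ ha).2 ⟨_, _, rfl, h0, rfl, hv⟩⟩
  | keep b s hj hs hnb ok =>
    cases b with
    | true => exact ⟨keepRule 4 2 (.reg 107 + 1) (.reg 109 + 1), by simp [rules],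
        (keep_iff (b := true) (fun s => rfl) rfl (fun _ s => rfl) (fun _ s => rfl) _ ha).2
          ⟨_, _, rfl, h0, rfl, hv⟩⟩
    | false => exact ⟨keepRule 5 0 (.reg 107 - 1) (.reg 109 - 1), by simp [rules],
        (keep_iff (b := false) (fun s => rfl) rfl (fun _ s => rfl) (fun _ s => rfl) _ ha).2
          ⟨_, _, rfl, h0, rfl, hv⟩⟩
  | emit r t hj ht ok =>
    rcases ht with ⟨rfl, rfl⟩ | ⟨rfl, rfl⟩ | ⟨rfl, rfl⟩
    · exact ⟨emitRule 2 1 (.reg 109 + 1) (.reg 110), by simp [rules],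
        (emit_iff (t := .inc) (by simp) rfl (fun s => rfl) _).2 ⟨h0, rfl, hv⟩⟩
    · exact ⟨emitRule 3 2 (.reg 109 - 1) (.reg 110), by simp [rules],
        (emit_iff (t := .dec) (by simp) rfl (fun s => rfl) _).2 ⟨h0, rfl, hv⟩⟩
    · exact ⟨emitRule 4 3 (.reg 110) (.reg 109), by simp [rules],
        (emit_iff (t := .swap) (by simp) rfl (fun s => rfl) _).2 ⟨h0, rfl, hv⟩⟩
  | emitEv r b hj hT hr ok =>
    rcases hr with ⟨rfl, rfl, rfl⟩ | ⟨rfl, rfl, rfl⟩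
    · exact ⟨emitEvRule 5 4 0 (.reg 109 + 1), by simp [rules],
        (emitEv_iff (b := true) (by simp) (fun s => rfl) (fun _ s => rfl) _).2 ⟨h0, rfl, hv⟩⟩
    · exact ⟨emitEvRule 6 5 1 (.reg 109 - 1), by simp [rules],
        (emitEv_iff (b := false) (by simp) (fun s => rfl) (fun _ s => rfl) _).2 ⟨h0, rfl, hv⟩⟩
  | endPass hj hph =>
    exact ⟨endRule, by simp [rules], (end_iff _).2 ⟨h0, rfl, hv⟩⟩

end Rules

end RAM

/-! ### Exhaustive search -/

namespace RAM

/-- The expression reads only the fields of the configuration and the fixed data. -/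
def Expr.over : Expr → Bool
  | .lit _ => true
  | .reg i => i == 0 || i == 3 || i == 4 || i == 5 || (100 ≤ i && i < 112)
  | .cell a e => (a == 2 || a == 3 || a == 8 || a == 9) && e.over
  | .op _ a b => a.over && b.over

/-- The state `s` contains the fixed data `z`. -/
structure Agree (z s : State) : Prop where
  reg : ∀ i, i = 0 ∨ i = 3 ∨ i = 4 ∨ i = 5 → s.reg i = z.reg i
  mem : ∀ a, a = 2 ∨ a = 3 ∨ a = 8 ∨ a = 9 → s.mem a = z.mem a

def Loaded (c : Conf) (s : State) : Prop := ∀ i < 12, s.reg (100 + i) = c i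

/-- Such expressions read only the fixed data and the loaded configuration, on which the working
state and the hypothetical one agree. -/
theorem Expr.eval_put {z s : State} {c : Conf} (h : Agree z s) (hc : Loaded c s) {e : Expr}
    (he : e.over) : e.eval s = e.eval (put z c) := by
  induction e with
  | lit m => rfl
  | reg i =>
    simp only [Expr.over, Bool.or_eq_true, Bool.and_eq_true, beq_iff_eq, decide_eq_true_eq] at he
    by_cases hi : 100 ≤ i ∧ i < 112
    · have := hc (i - 100) (by omega)
      simp only [Expr.eval, put, if_pos hi]
      rwa [Nat.add_sub_cancel' hi.1] at this
    · simp only [Expr.eval, put, if_neg hi]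
      exact h.reg i (by tauto)
  | cell a e ih =>
    simp only [Expr.over, Bool.or_eq_true, Bool.and_eq_true, beq_iff_eq] at he
    simp only [Expr.eval, put_mem, ih he.2, h.mem a (by tauto)]
  | op o a b iha ihb =>
    simp only [Expr.over, Bool.and_eq_true] at he
    simp only [Expr.eval, iha he.1, ihb he.2]

/-! #### Building blocks -/

/-- The candidate is built in the registers from `120` on, because later fields still refer to the
old configuration. -/
def assign (f : ℕ → Expr) : ℕ → Program
  | 0 => .skip
  | m + 1 => .seq (assign f m) (.setReg (120 + m) (f m))

def load : ℕ → Program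
  | 0 => .skip
  | m + 1 => .seq (load m) (.setReg (100 + m) (.cell (40 + m) (.reg 60)))

def store : ℕ → Program
  | 0 => .skip
  | m + 1 => .seq (store m) (.setCell (40 + m) (.reg 61) (.reg (120 + m)))

def validE : ℕ → Expr
  | 0 => .lt (.reg 120) (2 * .reg 0 + 1)
  | m + 1 => validE m * .lt (.reg (121 + m)) (.reg 4)

def codeE : ℕ → Expr
  | 0 => .reg 120
  | m + 1 => codeE m * .reg 4 + .reg (121 + m)

/-- The number of a configuration. -/
def code (M : ℕ) (c : Conf) : ℕ → ℕ
  | 0 => c 0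
  | m + 1 => code M c m * M + c (m + 1)

/-- The arrays `40, …, 51` hold the fields of the queued configurations, `15` the index of the
predecessor and `16` the kind of move; `14` marks the codes already met. -/
def push (r : ℕ) : Program :=
  .seq (.setCell 14 (.reg 63) 1) (.seq (store 12) (.seq (.setCell 15 (.reg 61) (.reg 60))
    (.seq (.setCell 16 (.reg 61) (.lit r)) (.setReg 61 (.reg 61 + 1)))))

def visit (r : ℕ) : Program :=
  .cond (validE 11) (.seq (.setReg 63 (codeE 11)) (.cond (.cell 14 (.reg 63)) .skip (push r))) .skip

def tryRule (ρ : Rule) : Program :=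
  .cond ρ.guard (.seq (assign ρ.upd 12) (visit ρ.code)) .skip

def tryAll : List Rule → Program
  | [] => .skip
  | ρ :: l => .seq (tryRule ρ) (tryAll l)

/-- Registers `60` and `61` are the head and the tail of the queue. Register `62` is one more than
the index of an accepting configuration, `0` meaning that none has been found. -/
def expand : Program :=
  .seq (load 12) (.seq (.cond (.eq (.reg 100) (2 * .reg 0)) (.setReg 62 (.reg 60 + 1)) .skip)
    (.seq (tryAll rules) (.setReg 60 (.reg 60 + 1))))

/-- The initial configuration. -/
def initE : ℕ → Expr
  | 4 => 1
  | 6 => 1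
  | _ => 0

def initConf : Conf
  | 4 => 1
  | 6 => 1
  | _ => 0

theorem eval_initE (s : State) (i : ℕ) : (initE i).eval s = initConf i := by
  unfold initE initConf
  split <;> rfl

def start : Program :=
  .seq (.setReg 60 0) (.seq (.setReg 61 0) (.seq (.setReg 62 0) (.seq (assign initE 12) (visit 0))))

def search : Program := .seq start (.loop (.lt (.reg 60) (.reg 61)) expand)

/-- The cost bound `100` is the reason for the power `X₀ ^ 100` in `Limits`. As the rules are an
explicit list, evaluation suffices. -/
theorem rules_ok : ∀ ρ ∈ rules, ρ.guard.over = true ∧ ρ.code ≤ 7 ∧ ∀ i < 12, (ρ.upd i).over = true ∧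
    (ρ.upd i).linear = true ∧ (ρ.upd i).deg ≤ regDeg (120 + i) ∧ (ρ.upd i).cost ≤ 100 := by
  decide +kernel

section

variable {n X₀ X W : ℕ} {z s : State} {c c' c₀ : Conf} {Q : State → Prop}

theorem eval_validE (hs : Agree z s) (hc : ∀ i < 12, s.reg (120 + i) = c i)
    (h0 : ∀ i, 12 ≤ i → c i = 0) : (validE 11).eval s ≠ 0 ↔ Valid z c := by
  have key : ∀ m ≤ 11, (validE m).eval s ≠ 0 ↔
      c 0 < 2 * z.reg 0 + 1 ∧ ∀ i < m, c (i + 1) < z.reg 4 := by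
    intro m hm
    induction m with
    | zero =>
      have := hc 0 (by omega)
      simp only [Nat.add_zero] at this
      simp [validE, this, hs.reg]
    | succ m ih =>
      have := hc (m + 1) (by omega)
      rw [show 120 + (m + 1) = 121 + m by omega] at this
      simp only [validE, eval_mul, mul_ne_zero_iff, ih (by omega), eval_lt, ite_ne_zero_iff, eval_reg,
        this, hs.reg 4 (by simp), Nat.lt_succ_iff_lt_or_eq, and_assoc]
      refine and_congr_right fun _ => ⟨fun h i hi => ?_, fun h => ⟨fun i hi => h i (.inl hi), h m (.inr rfl)⟩⟩
      rcases hi with hi | rfl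
      · exact h.1 i hi
      · exact h.2
  rw [key 11 le_rfl]
  exact ⟨fun h => ⟨h.1, h.2, h0⟩, fun h => ⟨h.1, h.2⟩⟩

theorem eval_codeE (hs : Agree z s) (hc : ∀ i < 12, s.reg (120 + i) = c i) :
    (codeE 11).eval s = code (z.reg 4) c 11 := by
  have key : ∀ m ≤ 11, (codeE m).eval s = code (z.reg 4) c m := by
    intro m hm
    induction m with
    | zero => exact hc 0 (by omega)
    | succ m ih =>
      have := hc (m + 1) (by omega)
      rw [show 120 + (m + 1) = 121 + m by omega] at this
      simp only [codeE, code, eval_mul, eval_add, ih (by omega), eval_reg, this, hs.reg 4 (by simp)]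
  exact key 11 le_rfl

theorem Valid.code_lt (h : Valid z c) : code (z.reg 4) c 11 < (2 * z.reg 0 + 1) * z.reg 4 ^ 11 := by
  have key : ∀ m ≤ 11, code (z.reg 4) c m < (2 * z.reg 0 + 1) * z.reg 4 ^ m := by
    intro m hm
    induction m with
    | zero => simpa [code] using h.zero
    | succ m ih =>
      have ih := ih (by omega)
      have h1 := h.succ m (by omega)
      calc code (z.reg 4) c m * z.reg 4 + c (m + 1) < code (z.reg 4) c m * z.reg 4 + z.reg 4 := by omega
        _ = (code (z.reg 4) c m + 1) * z.reg 4 := by ring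
        _ ≤ ((2 * z.reg 0 + 1) * z.reg 4 ^ m) * z.reg 4 := Nat.mul_le_mul_right _ ih
        _ = _ := by ring
  exact key 11 le_rfl

/-- The code is a numeral in base `z.reg 4`, whose last eleven digits lie below the base; the
leading digit may be of any size. So a mark identifies a configuration. -/
theorem Valid.code_inj (h : Valid z c) (h' : Valid z c')
    (he : code (z.reg 4) c 11 = code (z.reg 4) c' 11) : c = c' := by
  have key : ∀ m ≤ 11, code (z.reg 4) c m = code (z.reg 4) c' m → ∀ i ≤ m, c i = c' i := by
    intro m hm he
    induction m with
    | zero => intro i hi; obtain rfl : i = 0 := by omega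
              exact he
    | succ m ih =>
      have h1 := h.succ m (by omega)
      have h2 := h'.succ m (by omega)
      simp only [code] at he
      have h3 : c (m + 1) = c' (m + 1) := by
        have := congrArg (· % z.reg 4) he
        simpa [Nat.mul_add_mod_self_right, Nat.mod_eq_of_lt h1, Nat.mod_eq_of_lt h2] using this
      intro i hi
      rcases Nat.lt_succ_iff_lt_or_eq.1 (Nat.lt_succ_of_le hi) with hi | rfl
      · refine ih (by omega) ?_ i (by omega)
        rw [h3] at he
        exact Nat.eq_of_mul_eq_mul_right (by omega) (Nat.add_right_cancel he)
      · exact h3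
  funext i
  by_cases hi : i ≤ 11
  · exact key 11 le_rfl he i hi
  · rw [h.rest i (by omega), h'.rest i (by omega)]

theorem eval_lt_ne_zero {a b : Expr} : (Expr.lt a b).eval s ≠ 0 ↔ a.eval s < b.eval s := by
  rw [eval_lt, ite_ne_zero_iff]

theorem eval_lt_eq_zero {a b : Expr} : (Expr.lt a b).eval s = 0 ↔ ¬ a.eval s < b.eval s := by
  rw [← eval_lt_ne_zero, not_not]

theorem eval_eq_ne_zero {a b : Expr} : (Expr.eq a b).eval s ≠ 0 ↔ a.eval s = b.eval s := by
  rw [eval_eq, ite_ne_zero_iff]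

theorem eval_eq_eq_zero {a b : Expr} : (Expr.eq a b).eval s = 0 ↔ ¬ a.eval s = b.eval s := by
  rw [← eval_eq_ne_zero, not_not]

theorem wp_seq {p q : Program} (h : wp n X p (wp n X q Q) s) : wp n X (.seq p q) Q s := h

theorem wp_assign {f : ℕ → Expr} {m : ℕ} (hs : Agree z s) (hc : Loaded c s)
    (hf : ∀ i < m, (f i).over = true)
    (hb : ∀ i < m, (f i).eval (put z c) ≤ n ^ regDeg (120 + i) * X)
    (hQ : ∀ s' : State, s'.mem = s.mem → (∀ i < m, s'.reg (120 + i) = (f i).eval (put z c)) →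
      (∀ i, i < 120 ∨ 120 + m ≤ i → s'.reg i = s.reg i) → Q s') : wp n X (assign f m) Q s := by
  induction m generalizing Q with
  | zero => exact hQ s rfl (by simp) fun _ _ => rfl
  | succ m ih =>
    refine ih (fun i hi => hf i (by omega)) (fun i hi => hb i (by omega)) fun s' h1 h2 h3 => ?_
    have he : (f m).eval s' = (f m).eval (put z c) := by
      refine Expr.eval_put ⟨fun i hi => ?_, fun a ha => ?_⟩ (fun i hi => ?_) (hf m (by omega))
      · rw [h3 i (by omega)]; exact hs.reg i hi
      · rw [h1]; exact hs.mem a ha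
      · rw [h3 _ (by omega)]; exact hc i hi
    refine ⟨he ▸ hb m (by omega), hQ _ h1 (fun i hi => ?_) fun i hi => ?_⟩
    · by_cases him : i = m
      · subst him; simpa using he
      · simp only [ne_eq, Nat.add_left_cancel_iff, him, not_false_eq_true, Function.update_of_ne]
        exact h2 i (by omega)
    · simp only [Function.update_of_ne (show i ≠ 120 + m by omega)]
      exact h3 i (by omega)

theorem wp_load {m : ℕ} (hm : m ≤ 12) (hb : ∀ i < m, c i ≤ n ^ regDeg (100 + i) * X)
    (hc : ∀ i < m, s.mem (40 + i) (s.reg 60) = c i)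
    (hQ : ∀ s' : State, s'.mem = s.mem → (∀ i < m, s'.reg (100 + i) = c i) →
      (∀ i, i < 100 ∨ 112 ≤ i → s'.reg i = s.reg i) → Q s') : wp n X (load m) Q s := by
  induction m generalizing Q with
  | zero => exact hQ s rfl (by simp) fun _ _ => rfl
  | succ m ih =>
    refine ih (by omega) (fun i hi => hb i (by omega)) (fun i hi => hc i (by omega)) fun s' h1 h2 h3 => ?_
    have he : (Expr.cell (40 + m) (.reg 60)).eval s' = c m := by
      rw [eval_cell, eval_reg, h1, h3 60 (by omega)]; exact hc m (by omega)
    refine ⟨he ▸ hb m (by omega), hQ _ h1 (fun i hi => ?_) fun i hi => ?_⟩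
    · by_cases him : i = m
      · subst him; simpa using he
      · simp only [ne_eq, Nat.add_left_cancel_iff, him, not_false_eq_true, Function.update_of_ne]
        exact h2 i (by omega)
    · simp only [Function.update_of_ne (show i ≠ 100 + m by omega)]
      exact h3 i (by omega)

theorem wp_store {m : ℕ} (hb : ∀ i < m, s.reg (120 + i) ≤ n ^ memDeg (40 + i) * X)
    (hQ : ∀ s' : State, s'.reg = s.reg → (∀ i < m, s'.mem (40 + i) =
      Function.update (s.mem (40 + i)) (s.reg 61) (s.reg (120 + i))) →
      (∀ a, a < 40 ∨ 40 + m ≤ a → s'.mem a = s.mem a) → Q s') : wp n X (store m) Q s := by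
  induction m generalizing Q with
  | zero => exact hQ s rfl (by simp) fun _ _ => rfl
  | succ m ih =>
    refine ih (fun i hi => hb i (by omega)) fun s' h1 h2 h3 => ?_
    refine ⟨by rw [eval_reg, h1]; exact hb m (by omega), hQ _ h1 (fun i hi => ?_) fun i hi => ?_⟩
    · by_cases him : i = m
      · subst him; simp [h1, h3]
      · simp only [ne_eq, Nat.add_left_cancel_iff, him, not_false_eq_true, Function.update_of_ne]
        exact h2 i (by omega)
    · simp only
      rw [Function.update_of_ne (by omega)]
      exact h3 i (by omega)

/-! #### The queue -/

/-- The queue holds the list `q` of configurations, reachable from `c₀`. -/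
structure Queue (z : State) (c₀ : Conf) (s : State) (q : List Conf) : Prop where
  agree : Agree z s
  tail : s.reg 61 = q.length
  field : ∀ i c, q[i]? = some c → ∀ f < 12, s.mem (40 + f) i = c f
  nodup : q.Nodup
  valid : ∀ c ∈ q, Valid z c
  mark : ∀ m, s.mem 14 m ≠ 0 ↔ ∃ c ∈ q, code (z.reg 4) c 11 = m
  first : ∀ c, q[0]? = some c → c = c₀
  pred : ∀ i c, q[i + 1]? = some c → ∃ ρ ∈ rules, s.mem 16 (i + 1) = ρ.code ∧
    s.mem 15 (i + 1) ≤ i ∧ ∃ c', q[s.mem 15 (i + 1)]? = some c' ∧ SStep z ρ c' c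

theorem length_le_of_valid {q : List Conf} (h : q.Nodup) (hv : ∀ c ∈ q, Valid z c) :
    q.length ≤ (2 * z.reg 0 + 1) * z.reg 4 ^ 11 := by
  have h1 : (q.map fun c => code (z.reg 4) c 11).Nodup :=
    h.map_on fun c hc c' hc' he => (hv c hc).code_inj (hv c' hc') he
  have h2 := (h1.subperm (l₂ := List.range ((2 * z.reg 0 + 1) * z.reg 4 ^ 11)) fun m hm => by
    obtain ⟨c, hc, rfl⟩ := List.mem_map.1 hm
    exact List.mem_range.2 (hv c hc).code_lt).length_le
  simpa using h2

/-- The bounds of the search. -/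
structure Limits (n X₀ X : ℕ) (z : State) : Prop where
  one_le : 1 ≤ n
  le_X₀ : 16 ≤ X₀
  le_X : X₀ ^ 100 ≤ X
  reg_zero : z.reg 0 = n
  reg : ∀ i, z.reg i ≤ n ^ regDeg i * X₀
  mem : ∀ a i, z.mem a i ≤ n ^ memDeg a * X₀

theorem Limits.count_le (h : Limits n X₀ X z) : (2 * z.reg 0 + 1) * z.reg 4 ^ 11 ≤ n * X := by
  have h4 : z.reg 4 ≤ X₀ := by simpa [regDeg] using h.reg 4
  have h16 := h.le_X₀
  rw [h.reg_zero]
  calc (2 * n + 1) * z.reg 4 ^ 11 ≤ (n * X₀) * X₀ ^ 11 :=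
        Nat.mul_le_mul (by have := h.one_le; nlinarith) (Nat.pow_le_pow_left h4 11)
    _ = n * X₀ ^ 12 := by ring
    _ ≤ n * X₀ ^ 100 := Nat.mul_le_mul_left _ (Nat.pow_le_pow_right (by omega) (by omega))
    _ ≤ _ := Nat.mul_le_mul_left _ h.le_X

theorem Limits.X₀_le (h : Limits n X₀ X z) : X₀ ≤ X :=
  (Nat.le_self_pow (by omega) X₀).trans h.le_X

theorem Limits.conf_le (h : Limits n X₀ X z) (hc : Valid z c) {i d : ℕ} (hd : i = 0 → d = 1) :
    c i ≤ n ^ d * X₀ := by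
  have h4 : z.reg 4 ≤ X₀ := by simpa [regDeg] using h.reg 4
  have h1 := h.one_le
  have h2 := h.le_X₀
  have hpos : 1 ≤ n ^ d := Nat.one_le_pow _ _ h1
  rcases Nat.eq_zero_or_pos i with rfl | hi
  · have := hc.zero
    rw [h.reg_zero] at this
    rw [hd rfl, pow_one]
    nlinarith
  · obtain ⟨j, rfl⟩ : ∃ j, i = j + 1 := ⟨i - 1, by omega⟩
    by_cases hj : j < 11
    · have := hc.succ j hj
      nlinarith
    · rw [hc.rest _ (by omega)]; exact Nat.zero_le _

/-- A candidate is computed before its validity is tested, so its fields may leave the limits. This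
is why the working state is granted the larger bound `X`. -/
theorem Limits.eval_le (h : Limits n X₀ X z) (hc : Valid z c) {e : Expr} (he : e.linear = true) {d : ℕ}
    (hd : e.deg ≤ d) (hcost : e.cost ≤ 100) : e.eval (put z c) ≤ n ^ d * X := by
  have h16 := h.le_X₀
  have h1 := e.eval_le h.one_le h.le_X₀ (s := put z c) ?_ h.mem he
  · refine h1.trans (Nat.mul_le_mul (Nat.pow_le_pow_right h.one_le hd) ?_)
    exact (Nat.pow_le_pow_right (by omega) hcost).trans h.le_X
  · intro i
    simp only [put]
    split_ifs with hi
    · refine h.conf_le hc fun h0 => ?_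
      obtain rfl : i = 100 := by omega
      rfl
    · exact h.reg i

theorem Agree.congr (h : Agree z s) {s' : State} (hr : ∀ i < 60, s'.reg i = s.reg i)
    (hm : ∀ a < 10, s'.mem a = s.mem a) : Agree z s' where
  reg i hi := (hr i (by omega)).trans (h.reg i hi)
  mem a ha := (hm a (by omega)).trans (h.mem a ha)

theorem Queue.congr {q : List Conf} (h : Queue z c₀ s q) {s' : State}
    (hr : ∀ i < 60, s'.reg i = s.reg i) (hr' : s'.reg 61 = s.reg 61) (hm : s'.mem = s.mem) :
    Queue z c₀ s' q where
  agree := h.agree.congr hr fun a _ => by rw [hm]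
  tail := hr'.trans h.tail
  field := by rw [hm]; exact h.field
  nodup := h.nodup
  valid := h.valid
  mark := by rw [hm]; exact h.mark
  first := h.first
  pred := by rw [hm]; exact h.pred

/-- The predecessor of a new entry is the head of the queue, which lies strictly before it; thus
chains of predecessors end at the initial configuration. -/
theorem Queue.push {q : List Conf} (h : Queue z c₀ s q) {s' : State} {r : ℕ}
    (hr : ∀ i < 60, s'.reg i = s.reg i) (hr' : s'.reg 61 = s.reg 61 + 1)
    (hm : ∀ a < 10, s'.mem a = s.mem a)
    (h14 : s'.mem 14 = Function.update (s.mem 14) (code (z.reg 4) c 11) 1)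
    (h15 : s'.mem 15 = Function.update (s.mem 15) (s.reg 61) (s.reg 60))
    (h16 : s'.mem 16 = Function.update (s.mem 16) (s.reg 61) r)
    (hf : ∀ f < 12, s'.mem (40 + f) = Function.update (s.mem (40 + f)) (s.reg 61) (c f))
    (hv : Valid z c) (hc : s.mem 14 (code (z.reg 4) c 11) = 0)
    (hnew : q = [] ∧ c = c₀ ∨ s.reg 60 < q.length ∧ ∃ ρ ∈ rules, ρ.code = r ∧
      ∃ c', q[s.reg 60]? = some c' ∧ SStep z ρ c' c) :
    Queue z c₀ s' (q ++ [c]) := by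
  have hcq : c ∉ q := fun hmem => (h.mark _).2 ⟨c, hmem, rfl⟩ hc
  have hget : ∀ i c', (q ++ [c])[i]? = some c' → q[i]? = some c' ∧ i ≠ q.length ∨
      i = q.length ∧ c' = c := by
    intro i c' hi
    rcases lt_trichotomy i q.length with hlt | rfl | hgt
    · rw [List.getElem?_append_left hlt] at hi; exact .inl ⟨hi, by omega⟩
    · simp at hi; exact .inr ⟨rfl, hi.symm⟩
    · rw [List.getElem?_eq_none (by simp; omega)] at hi; simp at hi
  refine ⟨h.agree.congr hr hm, by simp [hr', h.tail], fun i c' hi f hf' => ?_, ?_, ?_, fun m => ?_,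
    fun c' hc' => ?_, fun i c' hi => ?_⟩
  · rw [hf f hf']
    rcases hget i c' hi with ⟨h1, h2⟩ | ⟨rfl, rfl⟩
    · rw [Function.update_of_ne (by rw [h.tail]; exact h2)]; exact h.field i c' h1 f hf'
    · rw [h.tail, Function.update_self]
  · rw [List.nodup_append]
    exact ⟨h.nodup, by simp, by rintro a ha b hb rfl; simp at hb; exact hcq (hb ▸ ha)⟩
  · intro c' hc'
    rcases List.mem_append.1 hc' with h1 | h1
    · exact h.valid _ h1
    · simp at h1; rwa [h1]
  · rw [h14]
    by_cases hm' : m = code (z.reg 4) c 11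
    · subst hm'; simp
    · rw [Function.update_of_ne hm', h.mark]
      refine ⟨fun ⟨c', h1, h2⟩ => ⟨c', by simp [h1], h2⟩, fun ⟨c', h1, h2⟩ => ?_⟩
      rcases List.mem_append.1 h1 with h1 | h1
      · exact ⟨c', h1, h2⟩
      · simp at h1; subst h1; exact absurd h2.symm hm'
  · rcases hget 0 c' hc' with ⟨h1, -⟩ | ⟨h1, rfl⟩
    · exact h.first c' h1
    · rcases hnew with h2 | h2
      · exact h2.2
      · omega
  · rcases hget _ c' hi with ⟨h1, h2⟩ | ⟨h1, rfl⟩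
    · obtain ⟨ρ, k1, k2, k3, c'', k4, k5⟩ := h.pred i c' h1
      rw [h15, h16, h.tail, Function.update_of_ne h2, Function.update_of_ne h2]
      refine ⟨ρ, k1, k2, k3, c'', ?_, k5⟩
      rw [List.getElem?_append_left, k4]
      exact (List.getElem?_eq_some_iff.1 k4).1
    · rcases hnew with h2 | ⟨h2, ρ, k1, k2, c'', k4, k5⟩
      · rw [h2.1] at h1; simp at h1
      · rw [h15, h16, h.tail, h1, Function.update_self, Function.update_self]
        refine ⟨ρ, k1, k2.symm, by omega, c'', ?_, k5⟩
        rw [List.getElem?_append_left h2, k4]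

theorem wp_visit (hL : Limits n X₀ X z) {q : List Conf} (hq : Queue z c₀ s q)
    (hhead : s.reg 60 ≤ q.length)
    (hc : ∀ i < 12, s.reg (120 + i) = c i) (h0 : ∀ i, 12 ≤ i → c i = 0) {r : ℕ} (hr : r ≤ 7)
    (hnew : Valid z c → q = [] ∧ c = c₀ ∨ s.reg 60 < q.length ∧ ∃ ρ ∈ rules, ρ.code = r ∧
      ∃ c', q[s.reg 60]? = some c' ∧ SStep z ρ c' c)
    (hQ : ∀ s' q', Queue z c₀ s' q' → q <+: q' → (Valid z c → c ∈ q') →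
      (∀ i, i ≠ 61 → i ≠ 63 → s'.reg i = s.reg i) → Q s') : wp n X (visit r) Q s := by
  have h16 := hL.le_X₀
  have hX := hL.X₀_le
  have hcount := hL.count_le
  have hXpos : ∀ d, X ≤ n ^ d * X := fun d => Nat.le_mul_of_pos_left _ (Nat.pow_pos hL.one_le)
  refine ⟨fun hv => ?_, fun hv => ?_⟩
  · have hv := (eval_validE hq.agree hc h0).1 hv
    have hcode : (codeE 11).eval s = code (z.reg 4) c 11 := eval_codeE hq.agree hc
    refine ⟨?_, fun hm => ?_, fun hm => ?_⟩
    · rw [hcode]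
      have := hv.code_lt
      simpa [regDeg] using this.le.trans hcount
    · simp only [eval_cell, eval_reg, Function.update_self, hcode] at hm
      obtain ⟨c', h1, h2⟩ := (hq.mark _).1 hm
      refine hQ _ q (hq.congr (fun i hi => ?_) ?_ rfl) List.prefix_rfl
        (fun _ => (hq.valid _ h1).code_inj hv h2 ▸ h1) fun i h1 h2 => ?_
      · simp only [Function.update_of_ne (show i ≠ 63 by omega)]
      · simp
      · simp only [Function.update_of_ne h2]
    · simp only [eval_cell, eval_reg, Function.update_self, hcode] at hm
      -- The count of valid configurations includes the one about to be appended, so the increased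
      -- tail still fits its register.
      have hle : q.length + 1 ≤ n * X := by
        have hcq : c ∉ q := fun hmem => (hq.mark _).2 ⟨c, hmem, rfl⟩ hm
        have := length_le_of_valid (z := z) (q := c :: q) (List.nodup_cons.2 ⟨hcq, hq.nodup⟩)
          (by simpa [hv] using hq.valid)
        simp only [List.length_cons] at this
        omega
      refine ⟨by rw [eval_one]; exact le_trans (by omega) (hXpos _), ?_⟩
      refine wp_store (fun i hi => ?_) fun s' k1 k2 k3 => ?_
      · simp only [Function.update_of_ne (show 120 + i ≠ 63 by omega), hc i hi]
        refine (hL.conf_le hv fun h => ?_).trans (Nat.mul_le_mul_left _ hX)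
        subst h; rfl
      · simp only [ne_eq, Nat.reduceEqDiff, not_false_eq_true,
          Function.update_of_ne, eval_reg, hcode, Function.update_self, eval_one] at k1 k2 k3
        refine ⟨?_, ?_, ?_, ?_⟩
        · simp only [eval_reg, k1]
          simp [memDeg]; omega
        · simp only [eval_lit]
          exact le_trans (by omega) (hXpos _)
        · simp [k1, regDeg, hq.tail, hle]
        · refine hQ _ (q ++ [c]) (hq.push (r := r) (fun i hi => ?_) ?_ (fun a ha => ?_) ?_ ?_ ?_ (fun f hf => ?_) hv hm
            (hnew hv)) (List.prefix_append _ _) (fun _ => by simp) fun i hi1 hi2 => ?_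
          · simp [k1, show i ≠ 61 by omega, show i ≠ 63 by omega]
          · simp [k1]
          · simp only [Function.update_of_ne (show a ≠ 15 by omega),
              Function.update_of_ne (show a ≠ 16 by omega)]
            rw [k3 a (by omega), Function.update_of_ne (by omega)]
          · simp [k3]
          · simp [k1, k3]
          · simp [k1, k3]
          · simp only [Function.update_of_ne (show 40 + f ≠ 15 by omega),
              Function.update_of_ne (show 40 + f ≠ 16 by omega)]
            rw [k2 f hf, Function.update_of_ne (by omega), Function.update_of_ne (by omega), hc f hf]
          · simp [k1, hi1, hi2]
  · refine hQ s q hq List.prefix_rfl (fun h => ?_) fun _ _ _ => rfl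
    exact absurd hv ((eval_validE hq.agree hc h0).2 h)

theorem wp_tryRule (hL : Limits n X₀ X z) {q : List Conf} (hq : Queue z c₀ s q)
    (hc : Loaded c s) (hhead : q[s.reg 60]? = some c) {ρ : Rule} (hρ : ρ ∈ rules)
    (hQ : ∀ s' q', Queue z c₀ s' q' → q <+: q' → (∀ c', SStep z ρ c c' → c' ∈ q') →
      (∀ i, i < 120 → i ≠ 61 → i ≠ 63 → s'.reg i = s.reg i) → Q s') : wp n X (tryRule ρ) Q s := by
  obtain ⟨h1, h2, h3⟩ := rules_ok ρ hρ
  have hlt : s.reg 60 < q.length := (List.getElem?_eq_some_iff.1 hhead).1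
  have hcv : Valid z c := hq.valid c (List.mem_of_getElem? hhead)
  have hg := Expr.eval_put hq.agree hc h1
  refine ⟨fun h => ?_, fun h => ?_⟩
  · rw [hg] at h
    refine wp_assign (z := z) (c := c) hq.agree hc (fun i hi => (h3 i hi).1)
      (fun i hi => hL.eval_le hcv (h3 i hi).2.1 (h3 i hi).2.2.1 (h3 i hi).2.2.2) fun s' k1 k2 k3 => ?_
    have hq' : Queue z c₀ s' q := hq.congr (fun i hi => k3 i (by omega)) (k3 _ (by omega)) k1
    have h60 := k3 60 (by omega)
    refine wp_visit hL hq' (c := ρ.cand z c) (by rw [h60]; omega) (fun i hi => ?_) (fun i hi => ?_) h2 (fun hv => ?_)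
      fun s'' q' m1 m2 m3 m4 => ?_
    · rw [k2 i hi, Rule.cand, if_pos hi]
    · rw [Rule.cand, if_neg (by omega)]
    · rw [h60]
      exact .inr ⟨hlt, ρ, hρ, rfl, c, hhead, h, rfl, hv⟩
    · refine hQ s'' q' m1 m2 (fun c' hc' => ?_) fun i i1 i2 i3 => ?_
      · obtain ⟨-, rfl, hv⟩ := hc'
        exact m3 hv
      · rw [m4 i i2 i3, k3 i (by omega)]
  · exact hQ s q hq List.prefix_rfl (fun c' hc' => absurd (hg ▸ h) hc'.1) fun _ _ _ _ => rfl

theorem wp_tryAll (hL : Limits n X₀ X z) {l : List Rule} (hl : ∀ ρ ∈ l, ρ ∈ rules) {q : List Conf}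
    (hq : Queue z c₀ s q) (hc : Loaded c s) (hhead : q[s.reg 60]? = some c)
    (hQ : ∀ s' q', Queue z c₀ s' q' → q <+: q' → (∀ ρ ∈ l, ∀ c', SStep z ρ c c' → c' ∈ q') →
      (∀ i, i < 120 → i ≠ 61 → i ≠ 63 → s'.reg i = s.reg i) → Q s') : wp n X (tryAll l) Q s := by
  induction l generalizing s q with
  | nil => exact hQ s q hq List.prefix_rfl (by simp) fun _ _ _ _ => rfl
  | cons ρ l ih =>
    refine wp_tryRule hL hq hc hhead (hl ρ (by simp)) fun s' q' h1 h2 h3 h4 => ?_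
    have h60 : s'.reg 60 = s.reg 60 := h4 60 (by omega) (by omega) (by omega)
    refine ih (fun ρ hρ => hl ρ (by simp [hρ])) h1
      (fun i hi => (h4 _ (by omega) (by omega) (by omega)).trans (hc i hi)) ?_
      fun s'' q'' k1 k2 k3 k4 => hQ s'' q'' k1 (h2.trans k2) ?_ fun i i1 i2 i3 => ?_
    · rw [h60]
      obtain ⟨w, rfl⟩ := h2
      rw [List.getElem?_append_left (List.getElem?_eq_some_iff.1 hhead).1, hhead]
    · intro ρ' hρ' c' hc'
      rcases List.mem_cons.1 hρ' with rfl | hρ'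
      · exact k2.subset (h3 c' hc')
      · exact k3 ρ' hρ' c' hc'
    · rw [k4 i i1 i2 i3, h4 i i1 i2 i3]

/-- The invariant of the search: `h` configurations have been expanded. -/
structure Searching (z : State) (c₀ : Conf) (s : State) (q : List Conf) : Prop where
  queue : Queue z c₀ s q
  head : s.reg 60 ≤ q.length
  closed : ∀ i < s.reg 60, ∀ c, q[i]? = some c → ∀ ρ ∈ rules, ∀ c', SStep z ρ c c' → c' ∈ q
  found : s.reg 62 = 0 → ∀ i < s.reg 60, ∀ c, q[i]? = some c → c 0 ≠ 2 * z.reg 0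
  accept : ∀ f, s.reg 62 = f + 1 → ∃ c, q[f]? = some c ∧ c 0 = 2 * z.reg 0
  init : Valid z c₀ → c₀ ∈ q

theorem wp_expand (hL : Limits n X₀ X z) {q : List Conf} (hs : Searching z c₀ s q)
    (hlt : s.reg 60 < s.reg 61) :
    wp n X expand (fun s' => s'.reg 60 = s.reg 60 + 1 ∧ ∃ q', Searching z c₀ s' q') s := by
  have hq := hs.queue
  rw [hq.tail] at hlt
  have hX := hL.X₀_le
  have hlen := (length_le_of_valid hq.nodup hq.valid).trans hL.count_le
  obtain ⟨c, hc⟩ : ∃ c, q[s.reg 60]? = some c := ⟨_, List.getElem?_eq_getElem hlt⟩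
  have hcv : Valid z c := hq.valid c (List.mem_of_getElem? hc)
  refine wp_seq (wp_load (c := c) le_rfl (fun i hi => ?_) (fun i hi => hq.field _ _ hc i hi) fun s₁ k1 k2 k3 => wp_seq ?_)
  · refine (hL.conf_le hcv fun h => ?_).trans (Nat.mul_le_mul_left _ hX)
    subst h; rfl
  have hq₁ : Queue z c₀ s₁ q := hq.congr (fun i hi => k3 i (by omega)) (k3 _ (by omega)) k1
  -- the state after the test for acceptance
  have main : ∀ s₂ : State, s₂.mem = s₁.mem → (∀ i, i ≠ 62 → s₂.reg i = s₁.reg i) →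
      s₂.reg 62 = (if c 0 = 2 * z.reg 0 then s.reg 60 + 1 else s.reg 62) →
      wp n X (.seq (tryAll rules) (.setReg 60 (.reg 60 + 1)))
        (fun s' => s'.reg 60 = s.reg 60 + 1 ∧ ∃ q', Searching z c₀ s' q') s₂ := by
    intro s₂ m1 m2 m3
    have h60 : s₂.reg 60 = s.reg 60 := (m2 60 (by omega)).trans (k3 60 (by omega))
    refine wp_seq (wp_tryAll (l := rules) hL (fun ρ hρ => hρ) (q := q) (c := c)
      (hq₁.congr (fun i hi => m2 i (by omega)) (m2 61 (by omega)) m1)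
      (fun i hi => (m2 _ (by omega)).trans (k2 i hi)) (by rw [h60, hc]) fun s' q' h1 h2 h3 h4 => ?_)
    have h60' : s'.reg 60 = s.reg 60 := (h4 60 (by omega) (by omega) (by omega)).trans h60
    have h62 := (h4 62 (by omega) (by omega) (by omega)).trans m3
    have hle := h2.length_le
    have hpre : ∀ (i : ℕ) (c' : Conf), i ≤ s.reg 60 → q'[i]? = some c' → q[i]? = some c' := by
      intro i c' hi hic
      obtain ⟨w, rfl⟩ := h2
      rwa [List.getElem?_append_left (by omega)] at hic
    have hup : ∀ (i : ℕ) (c' : Conf), q[i]? = some c' → q'[i]? = some c' := by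
      intro i c' hic
      obtain ⟨w, rfl⟩ := h2
      rw [List.getElem?_append_left (List.getElem?_eq_some_iff.1 hic).1, hic]
    refine ⟨?_, ?_, q', h1.congr (fun i hi => ?_) ?_ rfl, ?_, ?_, ?_, ?_, fun hv => h2.subset (hs.init hv)⟩
    · simp [h60', regDeg]; omega
    · simp [h60']
    · simp only [Function.update_of_ne (show i ≠ 60 by omega)]
    · simp
    · simp [h60']; omega
    · intro i hi c' hic ρ hρ c'' hstep
      simp [h60'] at hi
      have hic' := hpre i c' (by omega) hic
      rcases Nat.lt_or_eq_of_le hi with hi | rfl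
      · exact h2.subset (hs.closed i hi c' hic' ρ hρ c'' hstep)
      · rw [hc] at hic'
        cases hic'
        exact h3 ρ hρ c'' hstep
    · intro h0 i hi c' hic
      simp [h60'] at hi
      have hic' := hpre i c' (by omega) hic
      simp only [ne_eq, Nat.reduceEqDiff, not_false_eq_true, Function.update_of_ne, h62] at h0
      split_ifs at h0 with hacc
      rcases Nat.lt_or_eq_of_le hi with hi | rfl
      · exact hs.found h0 i hi c' hic'
      · rw [hc] at hic'
        cases hic'
        exact hacc
    · intro f hf
      simp only [ne_eq, Nat.reduceEqDiff, not_false_eq_true, Function.update_of_ne, h62] at hf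
      split_ifs at hf with hacc
      · obtain rfl : f = s.reg 60 := by omega
        exact ⟨c, hup _ _ hc, hacc⟩
      · obtain ⟨c', h5, h6⟩ := hs.accept f hf
        exact ⟨c', hup _ _ h5, h6⟩
  have hc0 : s₁.reg 100 = c 0 := k2 0 (by omega)
  have hn : s₁.reg 0 = z.reg 0 := hq₁.agree.reg 0 (by simp)
  have h60 := k3 60 (by omega)
  have hev : (Expr.eq (.reg 100) (2 * .reg 0)).eval s₁ = if c 0 = 2 * z.reg 0 then 1 else 0 := by
    simp [hc0, hn]
  refine ⟨fun h => ⟨?_, ?_⟩, fun h => ?_⟩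
  · simp [h60, regDeg]; omega
  · rw [hev, ite_ne_zero_iff] at h
    refine main _ rfl (fun i hi => ?_) ?_
    · simp only [Function.update_of_ne hi]
    · simp [h, h60]
  · rw [hev] at h
    refine main _ rfl (fun i hi => rfl) ?_
    rw [if_neg (by simpa using h)]
    exact k3 62 (by omega)

theorem Limits.roomy (hL : Limits n X₀ X z) (hW : n * X ^ 200 ≤ W) : Roomy n X W :=
  ⟨hL.one_le, hL.le_X₀.trans hL.X₀_le, hW⟩

theorem wp_start (hL : Limits n X₀ X z) (hs : Agree z s) (hmark : ∀ m, s.mem 14 m = 0) :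
    wp n X start (fun s' => ∃ q, Searching z initConf s' q) s := by
  have h16 := hL.le_X₀
  have hX := hL.X₀_le
  have hXpos : ∀ d, X ≤ n ^ d * X := fun d => Nat.le_mul_of_pos_left _ (Nat.pow_pos hL.one_le)
  refine ⟨Nat.zero_le _, Nat.zero_le _, Nat.zero_le _, ?_⟩
  refine wp_seq (wp_assign (z := z) (c := fun i => s.reg (100 + i))
    (hs.congr (fun i hi => ?_) fun _ _ => rfl) (fun i hi => ?_) ?_
    (fun i hi => ?_) fun s₁ h1 h2 h3 => ?_)
  · simp [show i ≠ 60 by omega, show i ≠ 61 by omega, show i ≠ 62 by omega]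
  · simp [show 100 + i ≠ 60 by omega, show 100 + i ≠ 61 by omega, show 100 + i ≠ 62 by omega]
  · decide
  · rw [eval_initE]
    refine le_trans ?_ (hXpos _)
    unfold initConf
    split <;> omega
  have h60 := h3 60 (by omega)
  have h61 := h3 61 (by omega)
  have h62 := h3 62 (by omega)
  simp only [ne_eq, Nat.reduceEqDiff, not_false_eq_true, Function.update_of_ne, Function.update_self,
    eval_zero] at h60 h61 h62
  have hq : Queue z initConf s₁ [] := by
    refine ⟨hs.congr (fun i hi => ?_) fun a _ => by rw [h1], by simp [h61], by simp, by simp, by simp,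
      by simp [h1, hmark], by simp, by simp⟩
    rw [h3 i (by omega)]
    simp [show i ≠ 60 by omega, show i ≠ 61 by omega, show i ≠ 62 by omega]
  refine wp_visit hL hq (c := initConf) (by simp [h60]) (fun i hi => ?_) (fun i hi => ?_) (by omega)
    (fun _ => .inl ⟨rfl, rfl⟩) fun s' q' k1 k2 k3 k4 => ⟨q', k1, ?_, ?_, ?_, ?_, k3⟩
  · rw [h2 i hi, eval_initE]
  · unfold initConf; split <;> omega
  all_goals
    simp only [k4 60 (by omega) (by omega), k4 62 (by omega) (by omega), h60, h62]
    simp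

/-- The search, from a state without marks. -/
theorem runs_search (hL : Limits n X₀ X z) (hW : n * X ^ 200 ≤ W) (hs : Agree z s)
    (hmark : ∀ m, s.mem 14 m = 0) :
    Runs n X W search s (1000 + ((2 * z.reg 0 + 1) * z.reg 4 ^ 11) * 5000) fun s' =>
      ∃ q, Searching z initConf s' q ∧ s'.reg 60 = q.length := by
  have hR := hL.roomy hW
  have hcost : expand.cost + 4 ≤ 5000 := by decide +kernel
  have hstart : start.cost + 4 ≤ 1000 := by decide +kernel
  refine Runs.mono (Q := fun s' => ∃ q, Searching z initConf s' q ∧ s'.reg 60 = q.length)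
    (Runs.seq (T₂ := (2 * z.reg 0 + 1) * z.reg 4 ^ 11 * 5000 + 4)
      ((Runs.of_wp hR (by decide +kernel) (wp_start hL hs hmark)).mono le_rfl fun s₁ _ _ h => ?_))
    (by omega) fun _ _ _ h => h
  refine (Runs.loop hR (by decide +kernel) (fun s' => ∃ q, Searching z initConf s' q)
    -- Every round advances the head by one, and the head never passes the number of valid
    -- configurations.
    (fun s' => ((2 * z.reg 0 + 1) * z.reg 4 ^ 11 - s'.reg 60) * 5000) h ?_).mono ?_ ?_
  · rintro s₂ _ _ ⟨q, hq⟩ hlt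
    rw [eval_lt_ne_zero] at hlt
    simp only [eval_reg] at hlt
    refine ⟨_, (Runs.of_wp hR (by decide +kernel) (wp_expand hL hq hlt)).mono le_rfl ?_⟩
    rintro s₃ _ _ ⟨h1, h2⟩
    refine ⟨h2, ?_⟩
    have h3 := length_le_of_valid hq.queue.nodup hq.queue.valid
    rw [hq.queue.tail] at hlt
    rw [h1]
    simp only [Expr.cost]
    omega
  · simp only [Expr.cost]
    have : (2 * z.reg 0 + 1) * z.reg 4 ^ 11 - s₁.reg 60 ≤ (2 * z.reg 0 + 1) * z.reg 4 ^ 11 :=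
      Nat.sub_le _ _
    omega
  · rintro s₂ _ _ ⟨⟨q, hq⟩, h0⟩
    refine ⟨q, hq, ?_⟩
    have h1 := hq.head
    have h2 := hq.queue.tail
    rw [eval_lt_eq_zero] at h0
    simp only [eval_reg] at h0
    omega

open Relation in
/-- A search without success has seen everything reachable. -/
theorem Searching.not_reachable {q : List Conf} (h : Searching z c₀ s q) (hall : s.reg 60 = q.length)
    (h0 : Valid z c₀) (hf : s.reg 62 = 0) {c : Conf}
    (hc : ReflTransGen (fun c c' => ∃ ρ ∈ rules, SStep z ρ c c') c₀ c) : c 0 ≠ 2 * z.reg 0 := by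
  have hmem : c ∈ q := by
    induction hc with
    | refl => exact h.init h0
    | tail _ hstep ih =>
      obtain ⟨ρ, hρ, hs⟩ := hstep
      obtain ⟨i, hi⟩ := List.mem_iff_getElem?.1 ih
      exact h.closed i (by rw [hall]; exact (List.getElem?_eq_some_iff.1 hi).1) _ hi ρ hρ _ hs
  obtain ⟨i, hi⟩ := List.mem_iff_getElem?.1 hmem
  exact h.found hf i (by rw [hall]; exact (List.getElem?_eq_some_iff.1 hi).1) c hi

end

end RAM

/-! ### Preparations -/

namespace RAM

section

variable {n X W : ℕ} {s : State}

theorem Roomy.le_mul (h : Roomy n X W) (d : ℕ) : X ≤ n ^ d * X :=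
  Nat.le_mul_of_pos_left _ (Nat.pow_pos h.one_le)

/-- Copy the path decomposition, and find the size of the largest bag. -/
def scanBody : Program :=
  .seq (.setCell 5 (.reg 64) (.cell 2 (.reg 64))) (.seq (.setCell 6 (.reg 64) (.cell 3 (.reg 64)))
    (.seq (.setCell 7 (.reg 64) (.cell 4 (.reg 64)))
      (.seq (.cond (.lt (.reg 2) (.cell 4 (.reg 64))) (.setReg 2 (.cell 4 (.reg 64))) .skip)
        (.setReg 64 (.reg 64 + 1)))))

def scan : Program := .loop (.lt (.reg 64) (2 * .reg 0)) scanBody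

theorem runs_scan (hR : Roomy n X W) (h0 : s.reg 0 = n) (h64 : s.reg 64 = 0) (h2 : s.reg 2 = 0) :
    Runs n X W scan s (200 * n + 100) fun s' =>
      (∀ i < 2 * n, s'.mem 5 i = s.mem 2 i ∧ s'.mem 6 i = s.mem 3 i ∧ s'.mem 7 i = s.mem 4 i ∧
        s.mem 4 i ≤ s'.reg 2) ∧ (s'.reg 2 = 0 ∨ ∃ i < 2 * n, s.mem 4 i = s'.reg 2) := by
  have h16 := hR.le_X
  have hn := hR.one_le
  refine (Runs.loop hR (by decide) (fun s' => s'.reg 64 ≤ 2 * n ∧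
    (∀ i < s'.reg 64, s'.mem 5 i = s.mem 2 i ∧ s'.mem 6 i = s.mem 3 i ∧ s'.mem 7 i = s.mem 4 i ∧
        s.mem 4 i ≤ s'.reg 2) ∧ (s'.reg 2 = 0 ∨ ∃ i < 2 * n, s.mem 4 i = s'.reg 2))
    (fun s' => (2 * n - s'.reg 64) * 80) ?_ ?_).mono ?_ ?_
  · simp [h64, h2]
  · rintro s₁ hB hF ⟨i1, i2, i3⟩ hlt
    have f0 : s₁.reg 0 = n := (hF.reg 0 rfl).trans h0
    have f2 := hF.mem 2 rfl
    have f3 := hF.mem 3 rfl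
    have f4 := hF.mem 4 rfl
    rw [eval_lt_ne_zero] at hlt
    simp only [eval_reg, eval_mul, eval_two, f0] at hlt
    have b2 := hB.mem 2 (s₁.reg 64)
    have b3 := hB.mem 3 (s₁.reg 64)
    have b4 := hB.mem 4 (s₁.reg 64)
    have b64 : s₁.reg 64 + 1 ≤ n * X := by nlinarith
    refine ⟨_, (Runs.of_wp (Q := fun s' => s'.reg 64 = s₁.reg 64 + 1 ∧
      s'.mem 5 = Function.update (s₁.mem 5) (s₁.reg 64) (s.mem 2 (s₁.reg 64)) ∧
      s'.mem 6 = Function.update (s₁.mem 6) (s₁.reg 64) (s.mem 3 (s₁.reg 64)) ∧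
      s'.mem 7 = Function.update (s₁.mem 7) (s₁.reg 64) (s.mem 4 (s₁.reg 64)) ∧
      s'.reg 2 = max (s₁.reg 2) (s.mem 4 (s₁.reg 64))) hR (by decide) ?_).mono le_rfl ?_⟩
    · simp only [memDeg] at b2 b3 b4
      refine ⟨by simpa [memDeg] using b2, by simpa [memDeg] using b3, by simpa [memDeg] using b4, ?_, ?_⟩
      · intro hc
        rw [eval_lt_ne_zero] at hc
        simp [f4] at hc
        refine ⟨by simpa [regDeg] using b4, by simpa [regDeg] using b64, ?_⟩
        simp [f2, f3, f4, max_eq_right hc.le]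
      · intro hc
        rw [eval_lt_eq_zero] at hc
        simp [f4] at hc
        refine ⟨by simpa [regDeg] using b64, ?_⟩
        simp [f2, f3, f4, hc]
    · rintro s₂ - - ⟨k1, k2, k3, k4, k5⟩
      refine ⟨⟨by omega, fun i hi => ?_, ?_⟩, ?_⟩
      · rw [k1] at hi
        rw [k2, k3, k4, k5]
        by_cases hi' : i = s₁.reg 64
        · subst hi'; simp
        · have := i2 i (by omega)
          simp only [Function.update_of_ne hi']
          exact ⟨this.1, this.2.1, this.2.2.1, this.2.2.2.trans (le_max_left _ _)⟩
      · rw [k5]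
        rcases le_total (s₁.reg 2) (s.mem 4 (s₁.reg 64)) with h | h
        · rw [max_eq_right h]; exact .inr ⟨_, hlt, rfl⟩
        · rw [max_eq_left h]; exact i3
      · have : scanBody.cost + 10 ≤ 80 := by decide
        simp only [Expr.cost]
        rw [k1]
        show _ + scanBody.cost + _ + 1 ≤ _
        have : (Expr.lt (Expr.reg 64) (2 * Expr.reg 0)).cost ≤ 5 := by decide
        simp only [Expr.cost] at this
        omega
  · rw [h64]
    have : (Expr.lt (Expr.reg 64) (2 * Expr.reg 0)).cost ≤ 5 := by decide
    omega
  · rintro s₁ hF - ⟨⟨i1, i2, i3⟩, hlt⟩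
    rw [eval_lt_eq_zero] at hlt
    simp only [eval_reg, eval_mul, eval_two, hF.reg 0 rfl, h0] at hlt
    exact ⟨fun i hi => i2 i (by omega), i3⟩

/-- Multiply register `4` by a power, the exponent being in register `6`. -/
def power (e : Expr) : Program :=
  .loop (.lt 0 (.reg 6)) (.seq (.setReg 4 (.reg 4 * e)) (.setReg 6 (.reg 6 - 1)))

/-- The product of the accumulator and the remaining power is invariant, so all intermediate values
are bounded by the final one. -/
theorem runs_power (hR : Roomy n X W) {e : Expr} (he : (Expr.reg 4 * e).tame) (hcost : e.cost = 1)
    {b : ℕ} (hb : 1 ≤ b)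
    (heval : ∀ s' : State, (∀ i, i ≠ 4 → i ≠ 6 → s'.reg i = s.reg i) → e.eval s' = b)
    (hX : s.reg 4 * b ^ s.reg 6 ≤ X) :
    Runs n X W (power e) s (s.reg 6 * 20 + 10) fun s' => s'.reg 4 = s.reg 4 * b ^ s.reg 6 := by
  refine (Runs.loop hR (by decide) (fun s' => s'.reg 4 * b ^ s'.reg 6 = s.reg 4 * b ^ s.reg 6)
    (fun s' => s'.reg 6 * 20) rfl ?_).mono ?_ ?_
  · rintro s₁ hB hF h1 hlt
    rw [eval_lt_ne_zero] at hlt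
    simp only [eval_reg, eval_zero] at hlt
    have he1 : e.eval s₁ = b := heval s₁ fun i h4 h6 => hF.reg i (by
      simp [Program.writesReg, h4, h6])
    obtain ⟨d, hd⟩ : ∃ d, s₁.reg 6 = d + 1 := ⟨s₁.reg 6 - 1, by omega⟩
    have b6 := hB.reg 6
    have hpos : 1 ≤ b ^ d := Nat.one_le_pow _ _ hb
    rw [hd] at h1
    refine ⟨_, (Runs.of_wp (Q := fun s' => s'.reg 4 = s₁.reg 4 * b ∧ s'.reg 6 = d) hR
      (by simp [Program.tame, he]; decide) ?_).mono le_rfl ?_⟩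
    · refine ⟨?_, ?_, ?_, ?_⟩
      · simp only [eval_mul, eval_reg, he1, regDeg]
        calc s₁.reg 4 * b ≤ s₁.reg 4 * b * b ^ d := Nat.le_mul_of_pos_right _ hpos
          _ = s₁.reg 4 * b ^ (d + 1) := by ring
          _ ≤ X := h1.trans_le hX
          _ ≤ _ := hR.le_mul _
      · simp; omega
      · simp [he1]
      · simp [hd]
    · rintro s₂ - - ⟨k1, k2⟩
      rw [k1, k2, hd]
      refine ⟨by rw [← h1]; ring, ?_⟩
      have h1 : (Expr.reg 4 * e).cost = e.cost + 2 := by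
        show 1 + e.cost + 1 = _; omega
      have h2 : (Expr.reg 6 - 1).cost = 3 := rfl
      have h3 : (Expr.lt 0 (.reg 6)).cost = 3 := rfl
      simp only [Program.cost, h1, h2, h3]
      omega
  · have h3 : (Expr.lt 0 (.reg 6)).cost = 3 := rfl
    omega
  · rintro s₁ - - ⟨h1, h2⟩
    rw [eval_lt_eq_zero] at h2
    simp only [eval_reg, eval_zero, not_lt, Nat.le_zero] at h2
    simpa [h2] using h1

/-- The length of the words. -/
def wordLength (m k : ℕ) : ℕ := (2 * m + 1) * (6 * (k + 1) + 5)

/-- A bound for the fields of the configurations. -/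
def fieldBound (m k : ℕ) : ℕ := 6 ^ (wordLength m k + 1) * (m + 1) ^ (2 * m + 1)

/-- Compute the parameters of the search. -/
def parameters : Program :=
  .seq (.seq (.setReg 3 (.reg 2 + 1)) (.seq (.setReg 5 (.reg 1 + 1)) (.seq (.setReg 4 1)
    (.setReg 6 ((2 * .reg 2 + 1) * (6 * .reg 5 + .lit 5) + 1)))))
    (.seq (power 6) (.seq (.setReg 6 (2 * .reg 2 + 1)) (power (.reg 3))))

theorem runs_parameters (hR : Roomy n X W) {m k : ℕ} (hm : s.reg 2 = m) (hk : s.reg 1 = k)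
    (hm1 : 1 ≤ m) (hX : fieldBound m k ≤ X) :
    Runs n X W parameters s (X * 40 + 200) fun s' => s'.reg 3 = m + 1 ∧ s'.reg 5 = k + 1 ∧
      s'.reg 4 = fieldBound m k := by
  have h16 := hR.le_X
  -- The exponents themselves lie below the powers computed, so the loop counters fit and the time
  -- is linear in `X`.
  have hL : wordLength m k + 1 < 6 ^ (wordLength m k + 1) := Nat.lt_pow_self (by omega)
  have hp6 : 1 ≤ 6 ^ (wordLength m k + 1) := by omega
  have hpm : 1 ≤ (m + 1) ^ (2 * m + 1) := Nat.one_le_pow _ _ (by omega)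
  have hle1 : 6 ^ (wordLength m k + 1) ≤ X :=
    (Nat.le_mul_of_pos_right _ hpm).trans hX
  have hle2 : (m + 1) ^ (2 * m + 1) ≤ X := (Nat.le_mul_of_pos_left _ hp6).trans hX
  have hle3 : 2 * m + 1 < (m + 1) ^ (2 * m + 1) := Nat.lt_pow_self (by omega)
  have hk' : k + 1 ≤ wordLength m k := by unfold wordLength; nlinarith
  refine (Runs.seq (Runs.mono (Runs.of_wp (Q := fun s' => s'.reg 3 = m + 1 ∧ s'.reg 5 = k + 1 ∧
      s'.reg 4 = 1 ∧ s'.reg 6 = wordLength m k + 1 ∧ s'.reg 2 = m) hR (by decide) ?_)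
      (le_refl _) fun s₁ _ _ h1 =>
      Runs.seq (T₁ := (wordLength m k + 1) * 20 + 10) (T₂ := 10 + ((2 * m + 1) * 20 + 10))
        (Runs.mono (runs_power hR (e := 6) (b := 6) (by decide) rfl (by omega) (fun _ _ => rfl) ?_)
          ?_ fun s₂ hF _ h2 => Runs.seq (Runs.mono (Runs.of_wp
            (Q := fun s' => s'.reg 3 = m + 1 ∧ s'.reg 5 = k + 1 ∧
              s'.reg 4 = 6 ^ (wordLength m k + 1) ∧ s'.reg 6 = 2 * m + 1) hR (by decide) ?_) ?_
            fun s₃ _ _ h3 => (Runs.mono (runs_power hR (e := .reg 3) (b := m + 1) (by decide) rfl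
              (by omega) ?_ ?_) ?_ ?_))))).mono ?_ fun _ _ _ h => h
  · simp only [wp, eval_add, eval_mul, eval_reg, eval_one, eval_two, eval_six, eval_lit]
    simp [regDeg, hm, hk, wordLength] at *
    omega
  · rw [h1.2.2.1, h1.2.2.2.1, one_mul]; exact hle1
  · rw [h1.2.2.2.1]
  · have e2 := hF.reg 2 rfl
    have e3 := hF.reg 3 rfl
    have e5 := hF.reg 5 rfl
    simp only [wp, eval_add, eval_mul, eval_reg, eval_one, eval_two]
    rw [h1.2.2.1, h1.2.2.2.1] at h2
    simp [regDeg, e2, e3, e5, h1, h2]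
    omega
  · decide
  · exact fun s' h => (h 3 (by omega) (by omega)).trans h3.1
  · rw [h3.2.2.1, h3.2.2.2]; exact hX
  · rw [h3.2.2.2]
  · intro s₄ hF' _ h4
    rw [hF'.reg 3 rfl, hF'.reg 5 rfl, h4, h3.2.2.1, h3.2.2.2]
    exact ⟨h3.1, h3.2.1, rfl⟩
  · have : ∀ c, c ≤ 100 → c + ((wordLength m k + 1) * 20 + 10 + (10 + ((2 * m + 1) * 20 + 10)))
        ≤ X * 40 + 200 := by omega
    exact this _ (by decide)

end

end RAM

section Slots

variable {n : ℕ} {G : SimpleGraph (Fin n)} {P : List (Node n)}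

/-- Entry `i` of the list of free slots. -/
def free (F : ℕ → ℕ) (i : ℕ) : ℕ := if F i = 0 then i + 1 else F i

/-- After `j` nodes: `w` is the size of the bag, `sl` gives the slots, `F` the free slots, and `N`
the adjacencies between slots and introduced vertices. -/
structure Slots (G : SimpleGraph (Fin n)) (P : List (Node n)) (m j w : ℕ) (sl F N : ℕ → ℕ) :
    Prop where
  card : w = (bag P j).card
  zero : ∀ u, u ∉ seen P j → sl u = 0
  pos : ∀ u ∈ seen P j, 1 ≤ sl u
  le : ∀ x, sl x ≤ m
  inj : ∀ i ≤ j, ∀ u ∈ bag P i, ∀ v ∈ bag P i, sl u = sl v → u = v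
  free_le : ∀ i, w ≤ i → i < m → 1 ≤ free F i ∧ free F i ≤ m
  free_inj : ∀ i i', w ≤ i → i < m → w ≤ i' → i' < m → free F i = free F i' → i = i'
  free_ne : ∀ i, w ≤ i → i < m → ∀ u ∈ bag P j, sl u ≠ free F i
  nb : ∀ i < j, ∀ v, P[i]? = some (v, true) → ∀ u ∈ bag P i,
    (N (i * (m + 1) + sl u) ≠ 0 ↔ G.Adj u v)
  nb_zero : ∀ i < j, ∀ v, P[i]? = some (v, false) → ∀ u ∈ bag P i, N (i * (m + 1) + sl u) = 0
  rest : ∀ x, j * (m + 1) ≤ x → N x = 0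

/-- An entry `0` of the free list stands for "never written" and means slot `i + 1`. So an array of
zeros already lists all slots `1, …, m`, without initialisation. -/
theorem Slots.start (G : SimpleGraph (Fin n)) (P : List (Node n)) (m : ℕ) {sl F N : ℕ → ℕ}
    (hsl : ∀ x, sl x = 0) (hF : ∀ x, F x = 0) (hN : ∀ x, N x = 0) : Slots G P m 0 0 sl F N where
  card := by simp [bag]
  zero u _ := hsl u
  pos u hu := by simp [seen] at hu
  le x := by simp [hsl]
  inj i hi u hu := by
    obtain rfl : i = 0 := by omega
    simp [bag] at hu
  free_le i _ hi := by simp [free, hF]; omega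
  free_inj i i' _ _ _ _ h := by simpa [free, hF] using h
  free_ne i _ _ u hu := by simp [bag] at hu
  nb i hi := by omega
  nb_zero i hi := by omega
  rest x _ := hN x

theorem seen_mono {i j : ℕ} (hij : i ≤ j) {u : Fin n} (h : u ∈ seen P i) : u ∈ seen P j :=
  (List.take_sublist_take_left hij).subset h

/-- Neighbours not yet seen have slot `0` and mark a column which no bag vertex uses. Neighbours
already seen are still in the bag by `mem_bag_of_adj`, where slots are injective, so marks of other
columns are correct. -/
theorem Slots.intro {m j w : ℕ} {sl F N N' : ℕ → ℕ} (hP : IsPathDecomposition G P)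
    (h : Slots G P m j w sl F N) {v : Fin n} (hv : P[j]? = some (v, true))
    (hm : (bag P (j + 1)).card ≤ m)
    (hN : ∀ x, N' x ≠ 0 ↔ N x ≠ 0 ∨ ∃ u, G.Adj u v ∧ x = j * (m + 1) + sl u) :
    Slots G P m (j + 1) (w + 1) (Function.update sl v (free F w)) F N' := by
  have hns := not_mem_seen_of_intro hP hv
  have hbag : bag P (j + 1) = insert v (bag P j) := by simp [bag_succ P j _ hv, Node.apply]
  have hvb : ∀ i ≤ j, v ∉ bag P i := fun i hi hc => hns (seen_mono hi (bag_subset_seen hc))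
  have hcard : (bag P (j + 1)).card = w + 1 := by
    rw [hbag, Finset.card_insert_of_notMem (hvb j le_rfl), h.card]
  have hw : w < m := by omega
  have hne : ∀ u : Fin n, u ≠ v → (u : ℕ) ≠ v := fun u hu hc => hu (Fin.ext hc)
  have hup : ∀ u : Fin n, u ≠ v → Function.update sl v (free F w) u = sl u := fun u hu => by
    rw [Function.update_of_ne (hne u hu)]
  have hsame : ∀ i ≤ j, ∀ u ∈ bag P i, Function.update sl v (free F w) u = sl u := by
    intro i hi u hu
    exact hup u (by rintro rfl; exact hvb i hi hu)
  have hrow : ∀ i < j, ∀ x y, x ≤ m → i * (m + 1) + x ≠ j * (m + 1) + y := by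
    intro i hi x y hx he
    have : (i + 1) * (m + 1) ≤ j * (m + 1) := Nat.mul_le_mul_right _ hi
    rw [add_mul] at this
    omega
  have hN' : ∀ i < j, ∀ x ≤ m, N' (i * (m + 1) + x) ≠ 0 ↔ N (i * (m + 1) + x) ≠ 0 := by
    intro i hi x hx
    rw [hN]
    exact ⟨fun hc => hc.resolve_right fun ⟨u, _, hu⟩ => hrow i hi x _ hx hu, .inl⟩
  refine ⟨hcard.symm, fun u hu => ?_, fun u hu => ?_, fun x => ?_, fun i hi a ha b hb hab => ?_,
    fun i hi => h.free_le i (by omega), fun i i' h1 h2 h3 => h.free_inj i i' (by omega) h2 (by omega),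
    fun i h1 h2 u hu => ?_, fun i hi x hx u hu => ?_, fun i hi x hx u hu => ?_, fun x hx => ?_⟩
  · rw [seen_succ_of_intro hv] at hu
    push Not at hu
    rw [hup u hu.1, h.zero u hu.2]
  · rw [seen_succ_of_intro hv] at hu
    by_cases huv : u = v
    · subst huv; simpa using (h.free_le w le_rfl hw).1
    · rw [hup u huv]; exact h.pos u (hu.resolve_left huv)
  · by_cases hx : x = v
    · subst hx; simpa using (h.free_le w le_rfl hw).2
    · rw [Function.update_of_ne hx]; exact h.le x
  · rcases Nat.lt_or_eq_of_le hi with hi | rfl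
    · rw [hsame i (by omega) a ha, hsame i (by omega) b hb] at hab
      exact h.inj i (by omega) a ha b hb hab
    · rw [hbag, Finset.mem_insert] at ha hb
      rcases ha with rfl | ha <;> rcases hb with rfl | hb
      · rfl
      · rw [Function.update_self, hsame j le_rfl b hb] at hab
        exact absurd hab.symm (h.free_ne w le_rfl hw b hb)
      · rw [Function.update_self, hsame j le_rfl a ha] at hab
        exact absurd hab (h.free_ne w le_rfl hw a ha)
      · rw [hsame j le_rfl a ha, hsame j le_rfl b hb] at hab
        exact h.inj j le_rfl a ha b hb hab
  · rw [hbag, Finset.mem_insert] at hu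
    rcases hu with rfl | hu
    · rw [Function.update_self]
      intro hc
      have := h.free_inj w i le_rfl hw (by omega) h2 hc
      omega
    · rw [hsame j le_rfl u hu]
      exact h.free_ne i (by omega) h2 u hu
  · rw [hsame i (by omega) u hu]
    rcases Nat.lt_or_eq_of_le (Nat.le_of_lt_succ hi) with hi | rfl
    · rw [hN' i hi _ (h.le _)]; exact h.nb i hi x hx u hu
    · rw [hv] at hx
      cases hx
      rw [hN]
      constructor
      · rintro (hc | ⟨u', h1, h2⟩)
        · exact absurd (h.rest _ (by omega)) hc
        · have h3 : sl u = sl u' := by omega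
          have h4 := h.pos u (bag_subset_seen hu)
          have h5 : u' ∈ seen P i := by
            by_contra hc
            rw [h.zero u' hc] at h3
            omega
          rwa [h.inj i le_rfl u hu u' (mem_bag_of_adj hP hv h5 h1) h3]
      · exact fun hadj => .inr ⟨u, hadj, rfl⟩
  · rw [hsame i (by omega) u hu]
    rcases Nat.lt_or_eq_of_le (Nat.le_of_lt_succ hi) with hi | rfl
    · have := (hN' i hi _ (h.le u)).not
      simp only [ne_eq, not_not] at this
      exact this.2 (h.nb_zero i hi x hx u hu)
    · rw [hv] at hx
      simp at hx
  · by_contra hc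
    have hx' : j * (m + 1) + (m + 1) ≤ x := by rwa [add_mul, one_mul] at hx
    rcases (hN x).1 hc with h1 | ⟨u, -, rfl⟩
    · exact h1 (h.rest x (by omega))
    · have := h.le u
      omega

/-- The slot of `v` is released onto the free list at position `w - 1`; it differs from the other
free slots because `v` was in the bag. The entry of `v` itself is kept, since the search looks up
the slots later. -/
theorem Slots.forget {m j w : ℕ} {sl F N : ℕ → ℕ} (hP : IsPathDecomposition G P)
    (h : Slots G P m j w sl F N) {v : Fin n} (hv : P[j]? = some (v, false)) :
    Slots G P m (j + 1) (w - 1) sl (Function.update F (w - 1) (sl v)) N := by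
  have hvb := mem_bag_of_forget hP hv
  have hbag : bag P (j + 1) = (bag P j).erase v := by simp [bag_succ P j _ hv, Node.apply]
  have hw : 1 ≤ w := by rw [h.card]; exact Finset.card_pos.2 ⟨v, hvb⟩
  have hpos := h.pos v (bag_subset_seen hvb)
  have hfree : ∀ i, i ≠ w - 1 → free (Function.update F (w - 1) (sl v)) i = free F i := by
    intro i hi; simp [free, hi]
  have hfree' : free (Function.update F (w - 1) (sl v)) (w - 1) = sl v := by
    simp [free]; omega
  refine ⟨by rw [hbag, Finset.card_erase_of_mem hvb, h.card], fun u hu => ?_, fun u hu => ?_, h.le,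
    fun i hi a ha b hb hab => ?_, fun i h1 h2 => ?_, fun i i' h1 h2 h3 h4 he => ?_,
    fun i h1 h2 u hu => ?_, fun i hi x hx u hu => ?_, fun i hi x hx u hu => ?_,
    fun x hx => h.rest x (by rw [add_mul] at hx; omega)⟩
  · rw [seen_succ_of_forget hv] at hu; exact h.zero u hu
  · rw [seen_succ_of_forget hv] at hu; exact h.pos u hu
  · rcases Nat.lt_or_eq_of_le hi with hi | rfl
    · exact h.inj i (by omega) a ha b hb hab
    · rw [hbag] at ha hb
      exact h.inj j le_rfl a (Finset.mem_of_mem_erase ha) b (Finset.mem_of_mem_erase hb) hab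
  · by_cases hi : i = w - 1
    · rw [hi, hfree']; exact ⟨hpos, h.le _⟩
    · rw [hfree i hi]; exact h.free_le i (by omega) h2
  · by_cases hi : i = w - 1 <;> by_cases hi' : i' = w - 1
    · omega
    · rw [hi, hfree', hfree i' hi'] at he
      exact absurd he (h.free_ne i' (by omega) h4 v hvb)
    · rw [hi', hfree', hfree i hi] at he
      exact absurd he.symm (h.free_ne i (by omega) h2 v hvb)
    · rw [hfree i hi, hfree i' hi'] at he
      exact h.free_inj i i' (by omega) h2 (by omega) h4 he
  · rw [hbag, Finset.mem_erase] at hu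
    by_cases hi : i = w - 1
    · rw [hi, hfree']
      exact fun hc => hu.1 (h.inj j le_rfl u hu.2 v hvb hc)
    · rw [hfree i hi]; exact h.free_ne i (by omega) h2 u hu.2
  · rcases Nat.lt_or_eq_of_le (Nat.le_of_lt_succ hi) with hi | rfl
    · exact h.nb i hi x hx u hu
    · rw [hv] at hx; simp at hx
  · rcases Nat.lt_or_eq_of_le (Nat.le_of_lt_succ hi) with hi | rfl
    · exact h.nb_zero i hi x hx u hu
    · exact h.rest _ (by omega)

end Slots

/-! ### The adjacency lists and the slots -/

section Input

variable {n : ℕ} (nbrs : Fin n → List (Fin n))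

theorem startArray_getD {v : ℕ} (hv : v ≤ n) :
    (startArray nbrs).getD v 0 = ((List.ofFn nbrs).take v).flatten.length := by
  have : v < n + 1 := by omega
  simp [startArray, List.getD_eq_getElem?_getD, this]

theorem startArray_succ (v : Fin n) :
    (startArray nbrs).getD (v + 1) 0 = (startArray nbrs).getD v 0 + (nbrs v).length := by
  rw [startArray_getD nbrs (by omega), startArray_getD nbrs (by omega), List.take_add_one]
  simp

theorem adjacencyArray_eq :
    adjacencyArray nbrs = (List.ofFn nbrs).flatten.map Fin.val := by
  simp only [adjacencyArray, List.bind_eq_flatMap, List.pure_def, List.map_id']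
  exact (List.map_eq_flatMap ..).symm

theorem adjacencyArray_getD (v : Fin n) (i : ℕ) (hi : i < (nbrs v).length) :
    (adjacencyArray nbrs).getD ((startArray nbrs).getD v 0 + i) 0 = (nbrs v)[i] := by
  have h1 : (List.ofFn nbrs)[(v : ℕ)]? = some (nbrs v) := by simp
  have h2 : ∀ A B C : List ℕ, i < B.length → (A ++ (B ++ C)).getD (A.length + i) 0 = B.getD i 0 := by
    intro A B C h
    rw [List.getD_append_right _ _ _ _ (by omega), Nat.add_sub_cancel_left, List.getD_append _ _ _ _ h]
  rw [startArray_getD nbrs (by omega), adjacencyArray_eq]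
  conv_lhs => rw [take_drop_of_getElem? h1]
  rw [List.flatten_append, List.flatten_cons, List.map_append, List.map_append]
  have h3 := h2 (((List.ofFn nbrs).take v).flatten.map Fin.val)
    ((nbrs v).map Fin.val) (((List.ofFn nbrs).drop (v + 1)).flatten.map Fin.val)
    (by simpa using hi)
  rw [List.length_map] at h3
  have h4 : ((List.take (↑v) (List.take (↑v) (List.ofFn nbrs) ++
      nbrs v :: List.drop (↑v + 1) (List.ofFn nbrs)))) = List.take v (List.ofFn nbrs) := by
    rw [← take_drop_of_getElem? h1]
  simp only [h4, h3]
  simp [List.getD_eq_getElem?_getD, hi]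

/-- Charge each edge to the end introduced later: the other end is then in the bag, so a vertex is
charged at most `m` times. Every edge appears in two lists. -/
theorem sum_length_le {G : SimpleGraph (Fin n)} {P : List (Node n)} {m : ℕ}
    (hA : IsAdjacencyLists G nbrs) (hP : IsPathDecomposition G P) (hm : ∀ j, (bag P j).card ≤ m) :
    ∑ v, (nbrs v).length ≤ 2 * (n * m) := by
  classical
  have hex : ∀ v : Fin n, ∃ j : ℕ, P[j]? = some (v, true) := by
    intro v
    have h : (v, true) ∈ P := (mem_nodesOf.1 (by rw [hP.nodesOf_eq]; simp : (v, true) ∈ nodesOf P v)).1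
    exact List.mem_iff_getElem?.1 h
  choose pos hpos using hex
  have hle : ∀ u v : Fin n, pos u < pos v → u ∈ seen P (pos v) := by
    intro u v huv
    refine seen_mono (i := pos u + 1) huv ?_
    rw [seen_succ_of_intro (hpos u)]; exact .inl rfl
  have hsub : ∀ v : Fin n, (nbrs v).length ≤
      (bag P (pos v)).card + (Finset.univ.filter fun u => v ∈ bag P (pos u)).card := by
    intro v
    rw [← List.toFinset_card_of_nodup (hA v).1]
    refine (Finset.card_le_card ?_).trans (Finset.card_union_le _ _)
    intro u hu
    rw [List.mem_toFinset, (hA v).2] at hu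
    rw [Finset.mem_union, Finset.mem_filter]
    rcases lt_trichotomy (pos u) (pos v) with h | h | h
    · exact .inl (mem_bag_of_adj hP (hpos v) (hle u v h) hu.symm)
    · have := hpos u
      rw [h, hpos v] at this
      cases this
      exact absurd hu (G.irrefl)
    · exact .inr ⟨Finset.mem_univ _, mem_bag_of_adj hP (hpos u) (hle v u h) hu⟩
  have hdouble : ∑ v : Fin n, (Finset.univ.filter fun u => v ∈ bag P (pos u)).card =
      ∑ u : Fin n, (bag P (pos u)).card := by
    simp only [Finset.card_filter]
    rw [Finset.sum_comm]
    simp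
  calc ∑ v, (nbrs v).length ≤ ∑ v : Fin n, ((bag P (pos v)).card +
        (Finset.univ.filter fun u => v ∈ bag P (pos u)).card) := Finset.sum_le_sum fun v _ => hsub v
    _ = 2 * ∑ u : Fin n, (bag P (pos u)).card := by
      rw [Finset.sum_add_distrib, hdouble]; ring
    _ ≤ 2 * ∑ _u : Fin n, m := by gcongr; exact hm _
    _ = _ := by simp

end Input

/-! ### The program that assigns slots and tabulates adjacencies. -/

namespace RAM

section

variable {n X W m : ℕ} {s : State} {G : SimpleGraph (Fin n)} {P : List (Node n)}

/-- The input data in a state. -/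
structure Stored (nbrs : Fin n → List (Fin n)) (P : List (Node n)) (s : State) : Prop where
  start : ∀ v : Fin n, s.mem 0 (v + 1) = s.mem 0 v + (nbrs v).length
  adj : ∀ (v : Fin n) (i : ℕ) (hi : i < (nbrs v).length), s.mem 1 (s.mem 0 v + i) = (nbrs v)[i]
  node : ∀ j x, P[j]? = some x → s.mem 2 j = x.1 ∧ s.mem 3 j = if x.2 then 1 else 0

theorem Runs.of_bdd {p : Program} {T : ℕ} {Q : State → Prop} (h : Bdd n X s → Runs n X W p s T Q) :
    Runs n X W p s T Q := fun hB => h hB hB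

theorem Stored.congr {nbrs : Fin n → List (Fin n)} (h : Stored nbrs P s) {s' : State}
    (hm : ∀ a < 4, s'.mem a = s.mem a) : Stored nbrs P s' := by
  refine ⟨?_, ?_, ?_⟩
  · rw [hm 0 (by omega)]; exact h.start
  · rw [hm 0 (by omega), hm 1 (by omega)]; exact h.adj
  · rw [hm 2 (by omega), hm 3 (by omega)]; exact h.node

def neighbours : Program :=
  .seq (.setReg 66 (.cell 0 (.reg 65))) (.loop (.lt (.reg 66) (.cell 0 (.reg 65 + 1)))
    (.seq (.setCell 9 (.reg 64 * .reg 3 + .cell 8 (.cell 1 (.reg 66))) 1)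
      (.setReg 66 (.reg 66 + 1))))

def freeSlot : Expr := .cell 10 (.reg 7) + .eq (.cell 10 (.reg 7)) 0 * (.reg 7 + 1)

def assignSlots : Program :=
  .loop (.lt (.reg 64) (2 * .reg 0)) (.seq (.setReg 65 (.cell 2 (.reg 64)))
    (.seq (.cond (.cell 3 (.reg 64))
      (.seq neighbours (.seq (.setCell 8 (.reg 65) freeSlot) (.setReg 7 (.reg 7 + 1))))
      (.seq (.setReg 7 (.reg 7 - 1)) (.setCell 10 (.reg 7) (.cell 8 (.reg 65)))))
      (.setReg 64 (.reg 64 + 1))))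

theorem eval_freeSlot : freeSlot.eval s = free (s.mem 10) (s.reg 7) := by
  simp only [freeSlot, eval_add, eval_cell, eval_reg, eval_mul, eval_eq, eval_zero, eval_one, free]
  split_ifs with h <;> simp [h]

theorem runs_neighbours (hR : Roomy n X W) {nbrs : Fin n → List (Fin n)} (h : Stored nbrs P s)
    {v : Fin n} (hv : s.reg 65 = v) :
    Runs n X W neighbours s ((nbrs v).length * 60 + 20) fun s' => ∀ x, s'.mem 9 x ≠ 0 ↔
      s.mem 9 x ≠ 0 ∨ ∃ u ∈ nbrs v, x = s.reg 64 * s.reg 3 + s.mem 8 u := by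
  have h16 := hR.le_X
  refine Runs.of_bdd fun hB₀ => ?_
  refine (Runs.seq (T₁ := 5) (T₂ := (nbrs v).length * 60 + 15) (Runs.mono (Runs.of_wp
    (Q := fun s' => s' = ⟨Function.update s.reg 66 (s.mem 0 v), s.mem⟩) hR (by decide) ?_)
    (by decide) fun s₁ hF hB h1 => ?_)).mono ?_ fun _ _ _ h => h
  · have := hB₀.mem 0 v
    refine ⟨?_, ?_⟩
    · simpa [hv, regDeg, memDeg] using this
    · simp [hv]
  · refine (Runs.loop hR (by decide) (fun s' => ∃ i ≤ (nbrs v).length, s'.reg 66 = s.mem 0 v + i ∧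
      ∀ x, s'.mem 9 x ≠ 0 ↔ s.mem 9 x ≠ 0 ∨ ∃ u ∈ (nbrs v).take i, x = s.reg 64 * s.reg 3 + s.mem 8 u)
      (fun s' => (s.mem 0 (v + 1) - s'.reg 66) * 60) ⟨0, Nat.zero_le _, by simp [h1], by simp [h1]⟩ ?_).mono ?_ ?_
    · rintro s₂ hB₂ hF₂ ⟨i, hi, k1, k2⟩ hlt
      have e65 : s₂.reg 65 = v := by rw [hF₂.reg 65 rfl, h1]; simpa using hv
      have e64 : s₂.reg 64 = s.reg 64 := by rw [hF₂.reg 64 rfl, h1]; simp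
      have e3 : s₂.reg 3 = s.reg 3 := by rw [hF₂.reg 3 rfl, h1]; simp
      have m0 : s₂.mem 0 = s.mem 0 := by rw [hF₂.mem 0 rfl, h1]
      have m1 : s₂.mem 1 = s.mem 1 := by rw [hF₂.mem 1 rfl, h1]
      have m8 : s₂.mem 8 = s.mem 8 := by rw [hF₂.mem 8 rfl, h1]
      rw [eval_lt_ne_zero] at hlt
      simp only [eval_reg, eval_cell, eval_add, eval_one, e65, m0, h.start v, k1] at hlt
      have hi' : i < (nbrs v).length := by omega
      have b0 := hB₂.mem 0 (v + 1)
      rw [m0, h.start v] at b0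
      simp only [memDeg] at b0
      have hadj := h.adj v i hi'
      refine ⟨_, (Runs.of_wp (Q := fun s' => s'.reg 66 = s.mem 0 v + (i + 1) ∧
        s'.mem 9 = Function.update (s₂.mem 9) (s.reg 64 * s.reg 3 + s.mem 8 ((nbrs v)[i] : Fin n)) 1)
        hR (by decide) ?_).mono (le_refl _) ?_⟩
      · refine ⟨?_, ?_, ?_⟩
        on_goal 1 => exact le_trans (by simp; omega) (hR.le_mul _)
        · simp [regDeg, k1] at b0 ⊢; omega
        · simp [k1, e64, e3, m8, m1, hadj, add_assoc]
      · rintro s₃ - - ⟨j1, j2⟩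
        refine ⟨⟨i + 1, hi', j1, fun x => ?_⟩, ?_⟩
        · rw [j2, List.take_add_one, List.getElem?_eq_getElem hi']
          by_cases hx : x = s.reg 64 * s.reg 3 + s.mem 8 ((nbrs v)[i] : Fin n)
          · rw [hx, Function.update_self]
            simp only [ne_eq, one_ne_zero, not_false_eq_true, true_iff]
            exact .inr ⟨_, List.mem_append_right _ (by simp), rfl⟩
          · rw [Function.update_of_ne hx, k2]
            refine or_congr_right ⟨fun ⟨u, hu, hux⟩ => ⟨u, List.mem_append_left _ hu, hux⟩, ?_⟩
            rintro ⟨u, hu, hux⟩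
            rcases List.mem_append.1 hu with hu | hu
            · exact ⟨u, hu, hux⟩
            · simp at hu; subst hu; exact absurd hux hx
        · have c1 : (Program.seq (.setCell 9 (.reg 64 * .reg 3 + .cell 8 (.cell 1 (.reg 66))) 1)
              (.setReg 66 (.reg 66 + 1))).cost ≤ 20 := by decide
          have c2 : (Expr.lt (.reg 66) (.cell 0 (.reg 65 + 1))).cost ≤ 10 := by decide
          rw [j1, k1, h.start v]
          omega
    · have c2 : (Expr.lt (.reg 66) (.cell 0 (.reg 65 + 1))).cost ≤ 10 := by decide
      rw [h1]
      simp only [Function.update_self, h.start v]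
      omega
    · rintro s₂ hF₂ - ⟨⟨i, hi, k1, k2⟩, hlt⟩
      have e65 : s₂.reg 65 = v := by rw [hF₂.reg 65 rfl, h1]; simpa using hv
      have m0 : s₂.mem 0 = s.mem 0 := by rw [hF₂.mem 0 rfl, h1]
      rw [eval_lt_eq_zero] at hlt
      simp only [eval_reg, eval_cell, eval_add, eval_one, e65, m0, h.start v, k1] at hlt
      rwa [List.take_of_length_le (by omega)] at k2
  · omega

open Classical in
/-- The total length of the adjacency lists not read yet. -/
noncomputable def remaining (nbrs : Fin n → List (Fin n)) (P : List (Node n)) (j : ℕ) : ℕ :=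
  ∑ v ∈ Finset.univ.filter (fun v => v ∉ seen P j), (nbrs v).length

theorem remaining_intro (hP : IsPathDecomposition G P) (nbrs : Fin n → List (Fin n)) {j : ℕ}
    {v : Fin n} (hv : P[j]? = some (v, true)) :
    remaining nbrs P j = remaining nbrs P (j + 1) + (nbrs v).length := by
  classical
  have : Finset.univ.filter (fun u => u ∉ seen P (j + 1)) =
      (Finset.univ.filter (fun u => u ∉ seen P j)).erase v := by
    ext u; simp [seen_succ_of_intro hv]
  unfold remaining
  rw [this, Finset.sum_erase_add]
  simpa using not_mem_seen_of_intro hP hv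

theorem remaining_forget (nbrs : Fin n → List (Fin n)) {j : ℕ}
    {v : Fin n} (hv : P[j]? = some (v, false)) : remaining nbrs P (j + 1) = remaining nbrs P j := by
  have : ∀ u, u ∈ seen P (j + 1) ↔ u ∈ seen P j := seen_succ_of_forget hv
  refine Finset.sum_congr ?_ fun _ _ => rfl
  ext u
  simp [this u]

theorem remaining_le (nbrs : Fin n → List (Fin n)) (j : ℕ) :
    remaining nbrs P j ≤ ∑ v, (nbrs v).length :=
  Finset.sum_le_sum_of_subset (Finset.subset_univ _)

/-- Each adjacency list is read once, when its vertex is introduced. So the potential counts the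
nodes left and the total length of the lists not yet read. -/
theorem runs_assignSlots (hR : Roomy n X W) {nbrs : Fin n → List (Fin n)} (h : Stored nbrs P s)
    (hA : IsAdjacencyLists G nbrs) (hP : IsPathDecomposition G P) (hm : ∀ j, (bag P j).card ≤ m)
    (hmX : m ≤ X) (h0 : s.reg 0 = n) (h3 : s.reg 3 = m + 1) (h64 : s.reg 64 = 0) (h7 : s.reg 7 = 0)
    (h8 : ∀ x, s.mem 8 x = 0) (h9 : ∀ x, s.mem 9 x = 0) (h10 : ∀ x, s.mem 10 x = 0) :
    Runs n X W assignSlots s ((2 * n) * 200 + (∑ v, (nbrs v).length) * 60 + 10) fun s' =>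
      Slots G P m (2 * n) (s'.reg 7) (s'.mem 8) (s'.mem 10) (s'.mem 9) := by
  have h16 := hR.le_X
  have hn := hR.one_le
  have hlen := length_pathDecomposition hP
  refine (Runs.loop hR (by decide) (fun s' => s'.reg 64 ≤ 2 * n ∧
      Slots G P m (s'.reg 64) (s'.reg 7) (s'.mem 8) (s'.mem 10) (s'.mem 9))
    (fun s' => (2 * n - s'.reg 64) * 200 + remaining nbrs P (s'.reg 64) * 60) ?_ ?_).mono ?_ ?_
  · rw [h64, h7]; exact ⟨by omega, Slots.start G P m h8 h10 h9⟩
  · rintro s₁ hB hF ⟨k1, k2⟩ hlt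
    rw [eval_lt_ne_zero] at hlt
    simp only [eval_reg, eval_mul, eval_two, (hF.reg 0 rfl).trans h0] at hlt
    have e3 := (hF.reg 3 rfl).trans h3
    have hst : Stored nbrs P s₁ := h.congr fun a ha => hF.mem a (by
      interval_cases a <;> rfl)
    obtain ⟨⟨v, b⟩, hx⟩ : ∃ x, P[s₁.reg 64]? = some x := ⟨_, List.getElem?_eq_getElem (by omega)⟩
    obtain ⟨n1, n2⟩ := hst.node _ _ hx
    simp only at n1 n2
    have b64 : s₁.reg 64 + 1 ≤ n * X := by nlinarith
    have hvn : (v : ℕ) ≤ n * X := by have := v.2; nlinarith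
    have hbody : ∃ T, Runs n X W (.cond (.cell 3 (.reg 64))
      (.seq neighbours (.seq (.setCell 8 (.reg 65) freeSlot) (.setReg 7 (.reg 7 + 1))))
      (.seq (.setReg 7 (.reg 7 - 1)) (.setCell 10 (.reg 7) (.cell 8 (.reg 65)))))
      ⟨Function.update s₁.reg 65 v, s₁.mem⟩ T fun s₂ =>
        Slots G P m (s₁.reg 64 + 1) (s₂.reg 7) (s₂.mem 8) (s₂.mem 10) (s₂.mem 9) ∧
        remaining nbrs P (s₁.reg 64 + 1) * 60 + T ≤ remaining nbrs P (s₁.reg 64) * 60 + 80 := by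
      cases b with
      | true =>
        have hw : s₁.reg 7 + 1 ≤ m := by
          rw [k2.card]
          have := hm (s₁.reg 64 + 1)
          rwa [bag_succ P _ _ hx, Node.apply, if_pos rfl, Finset.card_insert_of_notMem
            fun hc => not_mem_seen_of_intro hP hx (bag_subset_seen hc)] at this
        have hst' : Stored nbrs P ⟨Function.update s₁.reg 65 v, s₁.mem⟩ := hst.congr fun _ _ => rfl
        refine ⟨3 + ((nbrs v).length * 60 + 20 + 30), (Runs.cond hR (by decide) (fun _ =>
          Runs.seq (T₁ := (nbrs v).length * 60 + 20) (T₂ := 30) ((runs_neighbours hR hst'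
            (v := v) (by simp)).mono le_rfl fun s₂ hF₂ _ h2 => (Runs.of_wp hR (by decide)
            (Q := fun s' => s'.reg 7 = s₂.reg 7 + 1 ∧ s'.mem 8 = Function.update (s₂.mem 8) (s₂.reg 65)
              (free (s₂.mem 10) (s₂.reg 7)) ∧ s'.mem 10 = s₂.mem 10 ∧ s'.mem 9 = s₂.mem 9)
              ?_).mono (by decide) fun s₃ _ _ h3 => ?_))
          fun hc => ?_).mono le_rfl fun _ _ _ h => h⟩
        · have e7 : s₂.reg 7 = s₁.reg 7 := (hF₂.reg 7 rfl).trans (by simp)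
          have e10 : s₂.mem 10 = s₁.mem 10 := hF₂.mem 10 rfl
          refine ⟨?_, ?_, ?_⟩
          · rw [eval_freeSlot, e7, e10]
            have := (k2.free_le (s₁.reg 7) le_rfl (by omega)).2
            exact le_trans (by omega) (hR.le_mul _)
          · refine le_trans ?_ (hR.le_mul _)
            simp [e7]; omega
          · simp [eval_freeSlot]
        · have e7 : s₂.reg 7 = s₁.reg 7 := (hF₂.reg 7 rfl).trans (by simp)
          have e65 : s₂.reg 65 = v := (hF₂.reg 65 rfl).trans (by simp)
          have e10 : s₂.mem 10 = s₁.mem 10 := hF₂.mem 10 rfl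
          have e8 : s₂.mem 8 = s₁.mem 8 := hF₂.mem 8 rfl
          rw [h3.1, h3.2.1, h3.2.2.1, h3.2.2.2, e7, e65, e10, e8]
          refine ⟨k2.intro hP hx (hm _) fun x => ?_, ?_⟩
          · rw [h2]
            simp only [(hA v).2, e3, ne_eq, Function.update_of_ne (show (64 : ℕ) ≠ 65 by omega),
              Function.update_of_ne (show (3 : ℕ) ≠ 65 by omega), G.adj_comm v]
          · have := remaining_intro hP nbrs hx
            omega
        · simp [n2] at hc
      | false =>
        have hw : 1 ≤ s₁.reg 7 := by
          rw [k2.card]; exact Finset.card_pos.2 ⟨v, mem_bag_of_forget hP hx⟩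
        refine ⟨3 + 30, (Runs.cond hR (by decide) (fun hc => ?_) (fun _ =>
          (Runs.of_wp hR (by decide)
            (Q := fun s' => s'.reg 7 = s₁.reg 7 - 1 ∧ s'.mem 8 = s₁.mem 8 ∧
              s'.mem 10 = Function.update (s₁.mem 10) (s₁.reg 7 - 1) (s₁.mem 8 v) ∧
              s'.mem 9 = s₁.mem 9)
              ?_).mono (by decide) fun s₃ _ _ h3 => ?_)).mono le_rfl fun _ _ _ h => h⟩
        · simp [n2] at hc
        · refine ⟨?_, ?_, ?_⟩
          · have := hB.reg 7
            simp [regDeg] at this ⊢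
            omega
          · refine le_trans ?_ (hR.le_mul _)
            have := k2.le v
            simp; omega
          · simp
        · rw [h3.1, h3.2.1, h3.2.2.1, h3.2.2.2]
          refine ⟨k2.forget hP hx, ?_⟩
          have := remaining_forget nbrs hx
          omega
    obtain ⟨T, hT⟩ := hbody
    refine ⟨4 + (T + 4), (Runs.seq (T₁ := 4) (T₂ := T + 4) (Runs.mono (Runs.of_wp
      (Q := fun s' => s' = ⟨Function.update s₁.reg 65 v, s₁.mem⟩) hR (by decide) ?_) (by decide) ?_))⟩
    · refine ⟨?_, ?_⟩
      · simp [n1, regDeg, hvn]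
      · simp [n1]
    · rintro s₂ - - rfl
      refine Runs.seq (T₁ := T) (T₂ := 4) (hT.mono le_rfl fun s₃ hF₃ _ h3 => ?_)
      have e64 : s₃.reg 64 = s₁.reg 64 := (hF₃.reg 64 rfl).trans (by simp)
      refine (Runs.of_wp hR (by decide) (Q := fun s' => s'.reg 64 = s₁.reg 64 + 1 ∧
        s'.reg 7 = s₃.reg 7 ∧ s'.mem = s₃.mem) ?_).mono (by decide) ?_
      · refine ⟨?_, ?_⟩
        · simp [e64, regDeg, b64]
        · simp [e64]
      · rintro s₄ - - ⟨j1, j2, j3⟩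
        rw [j1, j2, j3]
        refine ⟨⟨by omega, h3.1⟩, ?_⟩
        have h32 := h3.2
        have c2 : (Expr.lt (Expr.reg 64) (2 * Expr.reg 0)).cost ≤ 10 := by decide
        omega
  · have c2 : (Expr.lt (Expr.reg 64) (2 * Expr.reg 0)).cost ≤ 9 := by decide
    have := remaining_le (P := P) nbrs 0
    rw [h64]
    omega
  · rintro s₁ hF - ⟨⟨k1, k2⟩, hlt⟩
    rw [eval_lt_eq_zero] at hlt
    simp only [eval_reg, eval_mul, eval_two, (hF.reg 0 rfl).trans h0] at hlt
    rwa [show s₁.reg 64 = 2 * n by omega] at k2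

end

end RAM

/-! ### Linked lists -/

section Linked

/-- Starting from `a`, the pointers `nx` lead through the list. -/
def Seg (nx : ℕ → ℕ) : ℕ → List ℕ → Prop
  | _, [] => True
  | a, b :: l => nx a = b ∧ Seg nx b l

theorem seg_append {nx : ℕ → ℕ} {a : ℕ} {A B : List ℕ} :
    Seg nx a (A ++ B) ↔ Seg nx a A ∧ Seg nx (A.getLastD a) B := by
  induction A generalizing a with
  | nil => simp [Seg]
  | cons x A ih => simp only [List.cons_append, Seg, ih, and_assoc, List.getLastD_cons]

theorem Seg.congr {nx nx' : ℕ → ℕ} {a : ℕ} {A : List ℕ} (h : Seg nx a A)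
    (hx : ∀ x ∈ (a :: A).dropLast, nx' x = nx x) : Seg nx' a A := by
  induction A generalizing a with
  | nil => trivial
  | cons b A ih =>
    refine ⟨(hx a (by simp)).trans h.1, ih h.2 fun x hx' => hx x ?_⟩
    rw [List.dropLast_cons_of_ne_nil (by simp)]
    exact List.mem_cons_of_mem _ hx'

theorem getLastD_mem (a : ℕ) (A : List ℕ) : A.getLastD a ∈ a :: A := by
  induction A generalizing a with
  | nil => simp
  | cons b A ih => rw [List.getLastD_cons]; exact List.mem_cons_of_mem _ (ih b)

theorem getLastD_notMem {a : ℕ} {A : List ℕ} (h : (a :: A).Nodup) :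
    A.getLastD a ∉ (a :: A).dropLast := by
  induction A generalizing a with
  | nil => simp
  | cons b A ih =>
    rw [List.getLastD_cons, List.dropLast_cons_of_ne_nil (by simp), List.mem_cons, not_or]
    refine ⟨fun he => ?_, ih h.of_cons⟩
    have := getLastD_mem b A
    rw [he] at this
    exact (List.nodup_cons.1 h).1 this

/-- The identifier `0` serves both as the head of the list and as its end marker, so that inserting
after the last element of `A` needs no special case for empty `A`. -/
theorem Seg.insert {nx : ℕ → ℕ} {A B : List ℕ} {f : ℕ} (h : Seg nx 0 (A ++ B ++ [0]))
    (hnd : (0 :: (A ++ B)).Nodup) (hf : f ∉ 0 :: (A ++ B)) :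
    Seg (Function.update (Function.update nx f (nx (A.getLastD 0))) (A.getLastD 0) f) 0
      (A ++ f :: B ++ [0]) := by
  have hndA : (0 :: A).Nodup := hnd.sublist (by simp)
  have hmemA := getLastD_mem 0 A
  have hfA : f ≠ A.getLastD 0 := by
    rintro rfl
    rw [← List.cons_append] at hf
    exact hf (List.mem_append_left _ hmemA)
  rw [List.append_assoc, seg_append] at h
  rw [List.append_assoc, seg_append]
  refine ⟨h.1.congr fun x hx => ?_, by simp, ?_⟩
  · have h1 : x ≠ A.getLastD 0 := fun hc => getLastD_notMem hndA (hc ▸ hx)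
    have h2 : x ≠ f := by
      rintro rfl
      rw [← List.cons_append] at hf
      exact hf (List.mem_append_left _ (List.dropLast_subset _ hx))
    rw [Function.update_of_ne h1, Function.update_of_ne h2]
  · rcases hB : B ++ [0] with _ | ⟨b, B'⟩
    · simp at hB
    · have hsrc : (b :: B').dropLast = B := by rw [← hB]; simp
      rw [hB] at h
      change Seg _ f (B ++ [0])
      rw [hB]
      refine ⟨?_, h.2.2.congr fun x hx => ?_⟩
      · rw [Function.update_of_ne hfA, Function.update_self]; exact h.2.1
      · rw [hsrc] at hx
        have h1 : x ≠ A.getLastD 0 := by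
          rintro rfl
          rw [← List.cons_append] at hnd
          exact (List.nodup_append.1 hnd).2.2 _ hmemA _ hx rfl
        have h2 : x ≠ f := by
          rintro rfl
          exact hf (by simp [hx])
        rw [Function.update_of_ne h1, Function.update_of_ne h2]

theorem Seg.remove {nx : ℕ → ℕ} {A B : List ℕ} {e : ℕ} (h : Seg nx 0 (A ++ e :: B ++ [0]))
    (hnd : (0 :: (A ++ e :: B)).Nodup) :
    nx (A.getLastD 0) = e ∧ Seg (Function.update nx (A.getLastD 0) (nx e)) 0 (A ++ B ++ [0]) := by
  have hndA : (0 :: A).Nodup := hnd.sublist (by simp)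
  have hmemA := getLastD_mem 0 A
  rw [List.append_assoc, seg_append] at h
  rw [List.append_assoc, seg_append]
  refine ⟨h.2.1, h.1.congr fun x hx => ?_, ?_⟩
  · have h1 : x ≠ A.getLastD 0 := fun hc => getLastD_notMem hndA (hc ▸ hx)
    rw [Function.update_of_ne h1]
  · have h2 := h.2.2
    rw [List.append_eq] at h2
    rcases hB : B ++ [0] with _ | ⟨b, B'⟩
    · simp at hB
    · have hsrc : (b :: B').dropLast = B := by rw [← hB]; simp
      rw [hB] at h2
      refine ⟨by rw [Function.update_self]; exact h2.1, h2.2.congr fun x hx => ?_⟩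
      rw [hsrc] at hx
      have h1 : x ≠ A.getLastD 0 := by
        rintro rfl
        rw [← List.cons_append] at hnd
        exact (List.nodup_append.1 hnd).2.2 _ hmemA _ (List.mem_cons_of_mem _ hx) rfl
      rw [Function.update_of_ne h1]

variable {n : ℕ}

abbrev ids (D : List (Entry n)) : List ℕ := D.map Entry.id

/-- The identifiers of the entries which carry a letter. -/
abbrev keptIds (D : List (Entry n)) : List ℕ := (D.filter fun e => e.tok.isSome).map Entry.id

theorem keptIds_sublist (D : List (Entry n)) : (keptIds D).Sublist (ids D) :=
  List.filter_sublist.map _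

theorem keptIds_eq_nil {D : List (Entry n)} (h : toks D = []) : keptIds D = [] := by
  have : ∀ e ∈ D, e.tok = none := by simpa [toks, List.filterMap_eq_nil_iff] using h
  simpa [keptIds, List.filter_eq_nil_iff] using this

def labelCode : Option (Node n) → ℕ
  | none => 0
  | some (v, true) => 2 * v + 1
  | some (v, false) => 2 * v + 2

/-- The list of events `D₁ ++ D₂` is stored, the position being between the two parts. -/
structure Linked (D₁ D₂ : List (Entry n)) (s : RAM.State) : Prop where
  nodup : (0 :: ids (D₁ ++ D₂)).Nodup
  pos : 1 ≤ s.reg 70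
  lt : ∀ e ∈ D₁ ++ D₂, e.id < s.reg 70
  next : Seg (s.mem 11) 0 (ids (D₁ ++ D₂) ++ [0])
  kept : Seg (s.mem 12) 0 (keptIds (D₁ ++ D₂) ++ [0])
  last : s.reg 71 = (ids D₁).getLastD 0
  lastKept : s.reg 72 = (keptIds D₁).getLastD 0
  label : ∀ e ∈ D₁ ++ D₂, s.mem 13 e.id = labelCode e.lab

/-! ### Carrying out a move on the linked list in constant time. -/

namespace RAM

/-- Reading a letter passes over all letterless entries before it, and these may be many. The second
thread (array `12`) links only the entries that carry letters and so leads to the right one at once;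
dropping the letter unlinks the entry from this thread alone. -/
def moveStep : Program :=
  .seq (.setReg 75 (.cell 12 (.reg 72))) (.seq (.setReg 71 (.reg 75))
    (.cond (.reg 74) (.setReg 72 (.reg 75)) (.setCell 12 (.reg 72) (.cell 12 (.reg 75)))))

def endStep : Program := .seq (.setReg 71 0) (.seq (.setReg 72 0) (.setReg 73 (.reg 73 + 1)))

def labelE : Expr :=
  .eq (.reg 74) (.lit 5) * (2 * .cell 2 (.reg 73) + 1) +
    .eq (.reg 74) 6 * (2 * .cell 2 (.reg 73) + 2)

theorem eval_labelE (s : State) : labelE.eval s = if s.reg 74 = 5 then 2 * s.mem 2 (s.reg 73) + 1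
    else if s.reg 74 = 6 then 2 * s.mem 2 (s.reg 73) + 2 else 0 := by
  by_cases h5 : s.reg 74 = 5
  · simp [labelE, h5]
  · by_cases h6 : s.reg 74 = 6
    · simp [labelE, h6]
    · simp [labelE, h5, h6]

def emitStep : Program :=
  .seq (.setCell 11 (.reg 70) (.cell 11 (.reg 71))) (.seq (.setCell 11 (.reg 71) (.reg 70))
    (.seq (.setCell 12 (.reg 70) (.cell 12 (.reg 72))) (.seq (.setCell 12 (.reg 72) (.reg 70))
    (.seq (.setCell 13 (.reg 70) labelE) (.seq (.setReg 71 (.reg 70)) (.seq (.setReg 72 (.reg 70))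
    (.setReg 70 (.reg 70 + 1))))))))

/-- Carry out the move with the number in register `74`. -/
def listStep : Program :=
  .cond (.lt (.reg 74) 2) moveStep (.cond (.eq (.reg 74) (.lit 7)) endStep emitStep)

variable {X : ℕ} {s : State} {D₁ D₂ D₁' D₂' : List (Entry n)} {v : Fin n} {r : ℕ}

/-- The specification of `listStep`. -/
def AfterStep (s : State) (r : ℕ) (D₁ D₂ : List (Entry n)) (s' : State) : Prop :=
  Linked D₁ D₂ s' ∧ s'.reg 73 = (if r = 7 then s.reg 73 + 1 else s.reg 73) ∧
    s'.reg 70 ≤ s.reg 70 + 1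

/-- A freshly written entry always carries a letter, so it is inserted into both threads, with the
unused identifier in register `70`. -/
theorem wp_emitStep (hB : Bdd n X s) (h : Linked D₁ D₂ s) (h70 : s.reg 70 + 1 ≤ n * X)
    {e : Entry n} (he : e.id = s.reg 70) (htok : e.tok ≠ none) (hr : r ≠ 7)
    (hlab : labelE.eval s = labelCode e.lab) (hle : labelCode e.lab ≤ n * X) :
    wp n X emitStep (AfterStep s r (D₁ ++ [e]) D₂) s := by
  have hfresh : s.reg 70 ∉ 0 :: ids (D₁ ++ D₂) := by
    intro hc
    rcases List.mem_cons.1 hc with hc | hc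
    · have := h.pos; omega
    · obtain ⟨x, hx, hx'⟩ := List.mem_map.1 hc
      have := h.lt x hx; omega
  have hk : keptIds [e] = [s.reg 70] := by
    have : e.tok.isSome := Option.isSome_iff_ne_none.2 htok
    simp [keptIds, this, he]
  have hfresh' : s.reg 70 ∉ 0 :: (keptIds D₁ ++ keptIds D₂) := by
    refine fun hc => hfresh ?_
    rcases List.mem_cons.1 hc with hc | hc
    · rw [hc]; simp
    · rw [← List.map_append, ← List.filter_append] at hc
      exact List.mem_cons_of_mem _ ((keptIds_sublist _).subset hc)
  have hnd : (0 :: (keptIds D₁ ++ keptIds D₂)).Nodup := by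
    rw [← List.map_append, ← List.filter_append]
    exact h.nodup.sublist ((keptIds_sublist _).cons_cons 0)
  have b11 := hB.mem 11
  have b12 := hB.mem 12
  simp only [memDeg] at b11 b12
  have e1 := h.next
  have e2 := h.kept
  simp only [ids, List.map_append] at e1
  simp only [keptIds, List.filter_append, List.map_append] at e2
  have k1 := e1.insert (by simpa using h.nodup) (by simpa using hfresh)
  have k2 := e2.insert hnd hfresh'
  have h71 := h.last
  have h72 := h.lastKept
  have hne : ∀ x ∈ D₁ ++ D₂, x.id ≠ s.reg 70 := fun x hx => (h.lt x hx).ne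
  simp only [emitStep, wp]
  refine ⟨by simpa [memDeg] using b11 _, by simp [memDeg]; omega, by simpa [memDeg] using b12 _,
    by simp [memDeg]; omega, ?_, by simp [regDeg]; omega, by simp [regDeg]; omega,
    by simp [regDeg]; omega, ⟨?_, ?_, ?_, ?_, ?_, ?_, ?_, ?_⟩, ?_, ?_⟩
  · rw [eval_labelE] at hlab ⊢
    simpa [memDeg, hlab] using hle
  · have : ids (D₁ ++ [e] ++ D₂) = ids D₁ ++ s.reg 70 :: ids D₂ := by simp [he]
    rw [this, ← List.cons_append]
    have h1 := h.nodup
    simp only [ids, List.map_append] at h1 hfresh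
    rw [← List.cons_append] at h1 hfresh
    exact List.nodup_middle.2 (List.nodup_cons.2 ⟨hfresh, h1⟩)
  · simp
  · intro x hx
    simp only [Function.update_self, eval_add, eval_reg, eval_one, ne_eq, Nat.reduceEqDiff,
      not_false_eq_true, Function.update_of_ne]
    have : x ∈ D₁ ++ D₂ ∨ x = e := by
      simp only [List.mem_append, List.mem_singleton] at hx ⊢; tauto
    rcases this with hx | rfl
    · have := h.lt x hx; omega
    · omega
  · have : ids (D₁ ++ [e] ++ D₂) = ids D₁ ++ s.reg 70 :: ids D₂ := by simp [he]
    rw [this]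
    simpa [h71] using k1
  · have : keptIds (D₁ ++ [e] ++ D₂) = keptIds D₁ ++ s.reg 70 :: keptIds D₂ := by
      have := hk
      simp only [keptIds] at this
      simp only [keptIds, List.filter_append, List.map_append, this]
      simp
    rw [this]
    simpa [h72] using k2
  · simp [he]
  · have := hk
    simp only [keptIds] at this
    simp only [keptIds, List.filter_append, List.map_append, this]
    simp
  · intro x hx
    have : x ∈ D₁ ++ D₂ ∨ x = e := by
      simp only [List.mem_append, List.mem_singleton] at hx ⊢; tauto
    rw [eval_labelE] at hlab
    rcases this with hx | rfl
    · simpa [hne x hx] using h.label x hx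
    · simpa [he, eval_labelE] using hlab
  · simp [hr]
  · simp

theorem wp_listStep (hB : Bdd n X s) (h : Linked D₁ D₂ s) (h70 : s.reg 70 + 1 ≤ n * X)
    (h73 : s.reg 73 + 1 ≤ n * X) (hX : 2 ≤ X) (h74 : s.reg 74 = r) (hv : s.mem 2 (s.reg 73) = v)
    (hD : DStep v (s.reg 70) r D₁ D₂ D₁' D₂') :
    wp n X listStep (AfterStep s r D₁' D₂') s := by
  have hvn := v.2
  have b12 := hB.mem 12
  simp only [memDeg] at b12
  -- The skipped entries are absent from the second thread, so the successor of the last kept entry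
  -- of `D₁` is the entry whose letter is read.
  have move : ∀ (pre post : List (Entry n)) (e : Entry n), D₂ = pre ++ e :: post → toks pre = [] →
      e.tok ≠ none → s.mem 12 (s.reg 72) = e.id ∧ Seg (Function.update (s.mem 12) (s.reg 72)
        (s.mem 12 e.id)) 0 (keptIds D₁ ++ keptIds post ++ [0]) := by
    rintro pre post e rfl hpre he
    have he' : e.tok.isSome := Option.isSome_iff_ne_none.2 he
    have hk : keptIds (D₁ ++ (pre ++ e :: post)) = keptIds D₁ ++ e.id :: keptIds post := by
      have := keptIds_eq_nil hpre
      simp only [keptIds] at this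
      simp [keptIds, List.filter_append, this, he']
    have h1 := h.kept
    have h2 : (0 :: keptIds (D₁ ++ (pre ++ e :: post))).Nodup :=
      h.nodup.sublist ((keptIds_sublist _).cons_cons 0)
    rw [hk] at h1 h2
    have h3 := h1.remove h2
    rw [← h.lastKept] at h3
    exact h3
  refine ⟨fun hlt => ?_, fun hlt => ⟨fun heq => ?_, fun heq => ?_⟩⟩
  · rw [eval_lt_ne_zero] at hlt
    simp only [eval_reg, h74, eval_two] at hlt
    cases hD with
    | drop _ pre _ e hpre he =>
      obtain ⟨m1, m2⟩ := move pre D₂' e rfl hpre he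
      refine ⟨by simpa [regDeg] using b12 _, by simpa [regDeg] using b12 _, fun hc => ?_, fun _ => ⟨?_, ?_⟩⟩
      · simp [h74] at hc
      · simpa [memDeg] using b12 _
      · have hids : ids (D₁ ++ pre ++ [⟨e.id, e.lab, none⟩] ++ D₂') = ids (D₁ ++ (pre ++ e :: D₂')) := by
          simp
        have hkp : keptIds pre = [] := keptIds_eq_nil hpre
        have hlab : ∀ x ∈ D₁ ++ pre ++ [⟨e.id, e.lab, none⟩] ++ D₂',
            ∃ y ∈ D₁ ++ (pre ++ e :: D₂'), y.id = x.id ∧ y.lab = x.lab := by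
          intro x hx
          simp only [List.mem_append, List.mem_singleton] at hx
          rcases hx with ((hx | hx) | rfl) | hx
          · exact ⟨x, by simp [hx], rfl, rfl⟩
          · exact ⟨x, by simp [hx], rfl, rfl⟩
          · exact ⟨e, by simp, rfl, rfl⟩
          · exact ⟨x, by simp [hx], rfl, rfl⟩
        refine ⟨⟨by rw [hids]; exact h.nodup, by simpa using h.pos, fun x hx => ?_, ?_, ?_, ?_, ?_,
          fun x hx => ?_⟩, by simp, by simp⟩
        · obtain ⟨y, k1, k2, -⟩ := hlab x hx
          simpa [k2] using h.lt y k1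
        · rw [hids]; simpa using h.next
        · have : keptIds (D₁ ++ pre ++ [⟨e.id, e.lab, none⟩] ++ D₂') =
              keptIds D₁ ++ keptIds D₂' := by
            simp only [keptIds] at hkp
            simp [keptIds, List.filter_append, hkp]
          rw [this]
          simpa [m1] using m2
        · simp [m1]
        · have : keptIds (D₁ ++ pre ++ [⟨e.id, e.lab, none⟩]) = keptIds D₁ := by
            simp only [keptIds] at hkp
            simp [keptIds, List.filter_append, hkp]
          rw [this]
          simpa using h.lastKept
        · obtain ⟨y, k1, k2, k3⟩ := hlab x hx
          simpa [← k2, ← k3] using h.label y k1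
    | keep _ pre _ e hpre he =>
      obtain ⟨m1, m2⟩ := move pre D₂' e rfl hpre he
      have he' : e.tok.isSome := Option.isSome_iff_ne_none.2 he
      refine ⟨by simpa [regDeg] using b12 _, by simpa [regDeg] using b12 _, fun _ => ⟨?_, ?_⟩, fun hc => ?_⟩
      · simpa [regDeg] using b12 _
      · have hD : D₁ ++ pre ++ [e] ++ D₂' = D₁ ++ (pre ++ e :: D₂') := by simp
        refine ⟨⟨by rw [hD]; exact h.nodup, by simpa using h.pos, fun x hx => ?_, ?_, ?_, ?_, ?_,
          fun x hx => ?_⟩, by simp, by simp⟩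
        · rw [hD] at hx; simpa using h.lt x hx
        · rw [hD]; simpa using h.next
        · rw [hD]; simpa using h.kept
        · simp [m1]
        · simp [keptIds, List.filter_append, m1, he']
        · rw [hD] at hx; simpa using h.label x hx
      · simp [h74] at hc
    | emit _ _ _ t hr => omega
    | emitEv _ _ _ b t hr => omega
    | endPass => omega
  · rw [eval_eq_ne_zero] at heq
    simp only [eval_reg, h74, eval_lit] at heq
    subst heq
    cases hD with
    | emit _ _ _ t hr => omega
    | emitEv _ _ _ b t hr => omega
    | endPass =>
      refine ⟨Nat.zero_le _, Nat.zero_le _, by simpa [regDeg] using h73, ⟨?_, ?_, ?_, ?_, ?_, ?_, ?_, ?_⟩, ?_, ?_⟩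
      · exact h.nodup
      · simpa using h.pos
      · simpa using h.lt
      · exact h.next
      · exact h.kept
      · simp
      · simp
      · simpa using h.label
      · simp
      · simp
  · rw [eval_eq_eq_zero] at heq
    rw [eval_lt_eq_zero] at hlt
    simp only [eval_reg, h74, eval_lit, eval_two] at heq hlt
    cases hD with
    | drop => omega
    | keep => omega
    | endPass => omega
    | emit _ _ _ t hr =>
      refine wp_emitStep hB h h70 rfl (by simp) heq ?_ (Nat.zero_le _)
      have h5 : r ≠ 5 := by omega
      have h6 : r ≠ 6 := by omega
      simp [eval_labelE, h74, h5, h6, labelCode]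
    | emitEv _ _ _ b t hr =>
      rcases hr with ⟨rfl, rfl⟩ | ⟨rfl, rfl⟩
      · refine wp_emitStep hB h h70 rfl (by simp) heq ?_ ?_
        · simp [eval_labelE, h74, labelCode, hv]
        · simp only [labelCode]; nlinarith
      · refine wp_emitStep hB h h70 rfl (by simp) heq ?_ ?_
        · simp [eval_labelE, h74, labelCode, hv]
        · simp only [labelCode]; nlinarith

end RAM

end Linked

/-! ### Constructing the output -/

namespace RAM

section

variable {n X₀ X W : ℕ} {z s : State}

/-- A sequence of moves. -/
def Trace (z : State) : Conf → List Rule → Conf → Prop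
  | c, [], c' => c = c'
  | c, ρ :: l, c' => ρ ∈ rules ∧ ∃ d, SStep z ρ c d ∧ Trace z d l c'

/-- Follow the predecessors, starting from the accepting configuration. -/
def backtrace : Program :=
  .seq (.seq (.setReg 68 (.reg 62 - 1)) (.setReg 69 0)) (.loop (.lt 0 (.reg 68))
    (.seq (.setCell 17 (.reg 69) (.cell 16 (.reg 68)))
      (.seq (.setReg 68 (.cell 15 (.reg 68))) (.setReg 69 (.reg 69 + 1)))))

/-- Predecessors have smaller indices, so at most `f` steps are needed. The moves are recorded last
one first, and `forward` reads the array downwards. -/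
theorem runs_backtrace (hR : Roomy n X W) {q : List Conf} {c₀ c : Conf} (hq : Queue z c₀ s q) {f : ℕ}
    (hf : s.reg 62 = f + 1) (hc : q[f]? = some c) (hlen : f + 1 ≤ n * X) :
    Runs n X W backtrace s (f * 30 + 30) fun s' => ∃ l : List Rule, Trace z c₀ l c ∧
      s'.reg 69 = l.length ∧ l.length ≤ f ∧ s'.Holds 17 (l.map Rule.code).reverse := by
  have h16 := hR.le_X
  refine (Runs.seq (T₁ := 10) (T₂ := f * 30 + 10) (Runs.mono (Runs.of_wp
    (Q := fun s' => s'.reg 68 = f ∧ s'.reg 69 = 0) hR (by decide) ?_) (by decide)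
    fun s₁ hF _ h1 => ?_)).mono (by omega) fun _ _ _ h => h
  · refine ⟨?_, ?_, ?_⟩
    · simp [hf, regDeg]; omega
    · simp
    · simp [hf]
  · have c1 : (Expr.lt 0 (.reg 68)).cost = 3 := rfl
    refine (Runs.loop hR (by decide) (fun s' => ∃ (l : List Rule) (d : Conf), q[s'.reg 68]? = some d ∧
      Trace z d l c ∧ s'.reg 69 = l.length ∧ s'.reg 68 + l.length ≤ f ∧
      s'.Holds 17 (l.map Rule.code).reverse) (fun s' => s'.reg 68 * 30) ?_ ?_).mono ?_ ?_
    · refine ⟨[], c, by rw [h1.1]; exact hc, rfl, h1.2, by simp [h1.1], fun i hi => by simp at hi⟩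
    · rintro s₂ hB₂ hF₂ ⟨l, d, k1, k2, k3, k4, k5⟩ hlt
      rw [eval_lt_ne_zero] at hlt
      simp only [eval_reg, eval_zero] at hlt
      obtain ⟨i, hi⟩ : ∃ i, s₂.reg 68 = i + 1 := ⟨s₂.reg 68 - 1, by omega⟩
      rw [hi] at k1 k4
      obtain ⟨ρ, hρ, p1, p2, d', p3, p4⟩ := hq.pred i d k1
      have m15 : s₂.mem 15 = s.mem 15 := (hF₂.mem 15 rfl).trans (hF.mem 15 rfl)
      have m16 : s₂.mem 16 = s.mem 16 := (hF₂.mem 16 rfl).trans (hF.mem 16 rfl)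
      have hρ7 := (rules_ok ρ hρ).2.1
      refine ⟨_, (Runs.of_wp (Q := fun s' => s'.reg 68 = s.mem 15 (i + 1) ∧
        s'.reg 69 = l.length + 1 ∧ s'.mem 17 = Function.update (s₂.mem 17) l.length ρ.code)
        hR (by decide) ?_).mono (show _ ≤ 20 by decide) ?_⟩
      · refine ⟨?_, ?_, ?_, ?_⟩
        · simp only [eval_cell, eval_reg, hi, m16, p1]
          exact le_trans (by omega) (hR.le_mul _)
        · simp [hi, m15, regDeg]; omega
        · simp [k3, regDeg]; omega
        · simp [hi, m15, m16, p1, k3]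
      · rintro s₃ - - ⟨j1, j2, j3⟩
        refine ⟨⟨ρ :: l, d', by rw [j1]; exact p3, ⟨hρ, d, p4, k2⟩, j2, by simp; omega, ?_⟩, by omega⟩
        intro x hx
        simp only [List.length_reverse, List.length_map, List.length_cons] at hx
        rw [j3, List.map_cons, List.reverse_cons]
        by_cases hxl : x = l.length
        · subst hxl
          simp [List.getD_eq_getElem?_getD]
        · rw [Function.update_of_ne hxl, k5 x (by simp; omega),
            List.getD_append _ _ _ _ (by simp; omega)]
    · omega
    · rintro s₂ hF₂ - ⟨⟨l, d, k1, k2, k3, k4, k5⟩, h0⟩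
      rw [eval_lt_eq_zero] at h0
      simp only [eval_reg, eval_zero, not_lt, Nat.le_zero] at h0
      rw [h0] at k1
      obtain rfl := hq.first d k1
      exact ⟨l, k2, k3, by omega, k5⟩

/-- Repeat the moves on the list of events. -/
def forward : Program :=
  .seq (.seq (.setReg 70 1) (.seq (.setReg 71 0) (.seq (.setReg 72 0) (.setReg 73 0))))
    (.loop (.lt 0 (.reg 69)) (.seq (.seq (.setReg 69 (.reg 69 - 1)) (.setReg 74 (.cell 17 (.reg 69))))
      listStep))

variable {G : SimpleGraph (Fin n)} {P : List (Node n)} {sl : Fin n → ℕ}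

theorem enc_init (S : ℕ) : enc S ⟨0, [], [], (0, 0), (0, 0), 0⟩ = initConf := by
  apply conf_ext <;> try rfl
  intro i hi
  obtain ⟨i, rfl⟩ := Nat.exists_eq_add_of_le' hi
  rfl

/-- The effect of a move on the list depends only on its code and the present vertex, so the program
does not recompute configurations. The configuration, the remaining rules and the two lists appear
only in the invariant. -/
theorem runs_forward (hR : Roomy n X W) (hP : IsPathDecomposition G P)
    (hE : Compat G P sl (envOf z)) (hS : ∀ v, z.mem 8 v < z.reg 3)
    (hnode : ∀ (j : ℕ) x, P[j]? = some x → s.mem 2 j = x.1)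
    (h0 : ∀ a ∈ [11, 12, 13], ∀ i, s.mem a i = 0)
    {l : List Rule} {c : Conf} (hl : Trace z initConf l c) (h69 : s.reg 69 = l.length)
    (hlen : l.length + 2 ≤ n * X) (hh : s.Holds 17 (l.map Rule.code).reverse) :
    Runs n X W forward s (l.length * 100 + 30) fun s' => ∃ a D₁ D₂,
      Sound G P sl (envOf z) a D₁ D₂ ∧ Linked D₁ D₂ s' ∧ c = enc (z.reg 3) a ∧
      (D₁ ++ D₂).length ≤ l.length + 1 := by
  have h16 := hR.le_X
  have hn := hR.one_le
  have hPl := length_pathDecomposition hP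
  have hN : (envOf z).N = 2 * n := hE.N.trans hPl
  refine (Runs.seq (T₁ := 20) (T₂ := l.length * 100 + 10) (Runs.mono (Runs.of_wp
    (Q := fun s' => s'.reg 70 = 1 ∧ s'.reg 71 = 0 ∧ s'.reg 72 = 0 ∧ s'.reg 73 = 0) hR (by decide) ?_)
    (by decide) fun s₁ hF _ h1 => ?_)).mono (by omega) fun _ _ _ h => h
  · refine ⟨?_, ?_, ?_, ?_, ?_⟩
    · have := hR.le_mul (regDeg 70)
      simp only [eval_one]; omega
    · simp
    · simp
    · simp
    · simp
  · have c1 : (Expr.lt 0 (.reg 69)).cost = 3 := rfl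
    refine (Runs.loop hR (by decide) (fun s' => ∃ (r : List Rule) (a : AConf) (D₁ D₂ : List (Entry n)),
      Trace z (enc (z.reg 3) a) r c ∧ SlotsBelow (z.reg 3) a ∧ Sound G P sl (envOf z) a D₁ D₂ ∧
      Linked D₁ D₂ s' ∧ s'.reg 69 = r.length ∧ s'.Holds 17 (r.map Rule.code).reverse ∧
      s'.reg 73 = a.j ∧ s'.reg 70 + r.length ≤ l.length + 1)
      (fun s' => s'.reg 69 * 100) ?_ ?_).mono ?_ ?_
    · refine ⟨l, ⟨0, [], [], (0, 0), (0, 0), 0⟩, [], [], by rw [enc_init]; exact hl, ⟨by simp, by simp⟩,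
        Sound.init, ⟨by simp, by omega, by simp, ?_, ?_, h1.2.1, h1.2.2.1, by simp⟩,
        (hF.reg 69 rfl).trans h69, ?_, h1.2.2.2, by omega⟩
      · rw [hF.mem 11 rfl]; exact ⟨h0 11 (by simp) 0, trivial⟩
      · rw [hF.mem 12 rfl]; exact ⟨h0 12 (by simp) 0, trivial⟩
      · intro i hi; rw [hF.mem 17 rfl]; exact hh i hi
    · rintro s₂ hB₂ hF₂ ⟨r, a, D₁, D₂, k1, k2, k3, k4, k5, k6, k7, k8⟩ hlt
      rw [eval_lt_ne_zero] at hlt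
      simp only [eval_reg, eval_zero] at hlt
      match r, k1 with
      | [], _ => simp at k5; omega
      | ρ :: r, ⟨hρ, d, hstep, htr⟩ =>
        obtain ⟨a', ha, rfl⟩ := AStep.of_sstep hρ k2 hstep
        have hj : a.j < 2 * n ∧ a'.j = if ρ.code = 7 then a.j + 1 else a.j := by
          rw [← hN]
          generalize ρ.code = r at ha
          cases ha with
          | drop t hj => exact ⟨hj, by simp⟩
          | keep b s hj => exact ⟨hj, by simp⟩
          | emit r t hj ht => exact ⟨hj, by rw [if_neg (by omega)]⟩
          | emitEv r b hj hT hr => exact ⟨hj, by rw [if_neg (by omega)]⟩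
          | endPass hj => exact ⟨hj, by simp⟩
        obtain ⟨x, hx⟩ : ∃ x, P[a.j]? = some x := ⟨_, List.getElem?_eq_getElem (by omega)⟩
        obtain ⟨D₁', D₂', hD, hs'⟩ := k3.step hP hE ha (s₂.reg 70) hx
        have m2 : s₂.mem 2 = s.mem 2 := (hF₂.mem 2 rfl).trans (hF.mem 2 rfl)
        simp only [List.length_cons] at k5 k8
        have h17 : s₂.mem 17 r.length = ρ.code := by
          have := k6 r.length (by simp)
          rw [this]
          simp [List.getD_eq_getElem?_getD]
        have hρ7 := (rules_ok ρ hρ).2.1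
        let s₃ : State := ⟨Function.update (Function.update s₂.reg 69 r.length) 74 ρ.code, s₂.mem⟩
        have hL₃ : Linked D₁ D₂ s₃ := by
          refine ⟨k4.nodup, ?_, ?_, k4.next, k4.kept, ?_, ?_, k4.label⟩
          · simpa [s₃] using k4.pos
          · simpa [s₃] using k4.lt
          · simpa [s₃] using k4.last
          · simpa [s₃] using k4.lastKept
        have h70 : s₃.reg 70 = s₂.reg 70 := by simp [s₃]
        have h73 : s₃.reg 73 = a.j := by simpa [s₃] using k7
        refine ⟨_, (Runs.seq (T₁ := 10) (T₂ := 80) ((Runs.of_wp (Q := fun s' => s' = s₃) hR (by decide)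
          ?_).mono (by decide) ?_)).mono (Q := fun s' => s'.reg 69 = r.length ∧
            AfterStep s₃ ρ.code D₁' D₂' s' ∧ s'.mem 17 = s₂.mem 17) (le_refl _) ?_⟩
        · refine ⟨?_, ?_, ?_⟩
          · have := hB₂.reg 69
            simp only [eval_sub, eval_reg, eval_one]; omega
          · have := hR.le_mul (regDeg 74)
            simp [k5, h17]; omega
          · simp [s₃, k5, h17]
        · rintro _ - hB₃ rfl
          refine (Runs.of_wp hR (by decide) (wp_listStep hB₃ hL₃ (X := X) (r := ρ.code) (v := x.1)
            (by rw [h70]; omega) (by rw [h73]; nlinarith) (by omega) (by simp [s₃])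
            (by rw [h73]; show s₂.mem 2 a.j = _; rw [m2]; exact hnode _ _ hx)
            (by rw [h70]; exact hD))).mono (by decide) fun s₄ hF₄ _ h4 => ⟨?_, h4, hF₄.mem 17 rfl⟩
          rw [hF₄.reg 69 rfl]
          simp [s₃]
        · rintro s₄ - - ⟨e69, ⟨j1, j2, j3⟩, m17⟩
          rw [h70] at j3
          rw [h73] at j2
          refine ⟨⟨r, a', D₁', D₂', htr, k2.step hS ha, hs', j1, e69, fun i hi => ?_, ?_, by omega⟩, ?_⟩
          · simp only [List.length_reverse, List.length_map] at hi
            rw [m17, k6 i (by simp; omega), List.map_cons, List.reverse_cons,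
              List.getD_append _ _ _ _ (by simp; omega)]
          · rw [j2, hj.2]
          · rw [e69, k5]; omega
    · have := hF.reg 69 rfl
      omega
    · rintro s₂ hF₂ - ⟨⟨r, a, D₁, D₂, k1, k2, k3, k4, k5, k6, k7, k8⟩, h0⟩
      rw [eval_lt_eq_zero] at h0
      simp only [eval_reg, eval_zero, not_lt, Nat.le_zero] at h0
      obtain rfl : r = [] := List.length_eq_zero_iff.1 (k5.symm.trans h0)
      refine ⟨a, D₁, D₂, k3, k4, k1.symm, ?_⟩
      -- The identifiers are distinct and below the fresh one, which grows by at most one per move.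
      have h1 : (ids (D₁ ++ D₂)).length ≤ s₂.reg 70 := by
        have := ((k4.nodup.of_cons).subperm (l₂ := List.range (s₂.reg 70)) fun m hm => by
          obtain ⟨e, he, rfl⟩ := List.mem_map.1 hm
          exact List.mem_range.2 (k4.lt e he)).length_le
        simpa using this
      simp only [List.length_map, List.length_nil] at h1 k8
      omega

/-- Write the node with the code in register `77` at position `reg 76`; register `8` contains the
size of the bag. -/
def writeNode : Program :=
  .seq (.setCell 5 (.reg 76) ((.reg 77 - 1) / 2)) (.seq (.setCell 6 (.reg 76) (.reg 77 % 2))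
    (.seq (.setReg 8 (.reg 8 + .reg 77 % 2 - (1 - .reg 77 % 2))) (.seq (.setCell 7 (.reg 76) (.reg 8))
      (.setReg 76 (.reg 76 + 1)))))

/-- Go through the list of events, and write the path decomposition. -/
def writeList : Program :=
  .seq (.seq (.setReg 75 (.cell 11 0)) (.seq (.setReg 76 0) (.setReg 8 0)))
    (.loop (.reg 75) (.seq (.setReg 77 (.cell 13 (.reg 75)))
      (.seq (.cond (.reg 77) writeNode .skip) (.setReg 75 (.cell 11 (.reg 75))))))

/-- The first `i` nodes of `P` have been written. -/
structure Written (P : List (Node n)) (i : ℕ) (s : State) : Prop where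
  vertex : ∀ j < i, s.mem 5 j = (vertexArray P).getD j 0
  type : ∀ j < i, s.mem 6 j = (typeArray P).getD j 0
  size : ∀ j < i, s.mem 7 j = (bag P (j + 1)).card
  index : s.reg 76 = i
  card : s.reg 8 = (bag P i).card

theorem Written.outputs (h : Written P P.length s) : Outputs s P := by
  refine ⟨fun j hj => h.vertex j (by simpa [vertexArray] using hj),
    fun j hj => h.type j (by simpa [typeArray] using hj), fun j hj => ?_⟩
  have hj' : j < P.length := by simpa [sizeArray] using hj
  rw [h.size j hj']
  simp [sizeArray, List.getD_eq_getElem?_getD, hj']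

theorem wp_writeNode (hP : IsPathDecomposition G P) (hR : Roomy n X W) {K : ℕ}
    (hK : ∀ i, (bag P i).card ≤ K) (hKX : K ≤ X) {i : ℕ} (h : Written P i s) {x : Node n}
    (hx : P[i]? = some x) (h77 : s.reg 77 = labelCode (some x)) :
    wp n X writeNode (fun s' => Written P (i + 1) s' ∧ s'.mem 11 = s.mem 11 ∧ s'.mem 13 = s.mem 13 ∧
      s'.reg 75 = s.reg 75) s := by
  have h16 := hR.le_X
  have hn := hR.one_le
  obtain ⟨v, b⟩ := x
  have hi : i < 2 * n := by
    rw [← length_pathDecomposition hP]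
    exact (List.getElem?_eq_some_iff.1 hx).1
  have hv := v.2
  -- The codes are `2 v + 1` for an introduction and `2 v + 2` for a removal, so the parity gives
  -- the type.
  have h1 : (s.reg 77 - 1) / 2 = v ∧ s.reg 77 % 2 = if b then 1 else 0 := by
    rw [h77]
    cases b <;> simp only [labelCode]
    · exact ⟨by omega, by simp⟩
    · exact ⟨by omega, by simp; try omega⟩
  have hcard : s.reg 8 + s.reg 77 % 2 - (1 - s.reg 77 % 2) = (bag P (i + 1)).card := by
    rw [h1.2, h.card, bag_succ P _ _ hx, Node.apply]
    cases b
    · simp [Finset.card_erase_of_mem (mem_bag_of_forget hP hx)]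
    · simp [Finset.card_insert_of_notMem fun hc => not_mem_seen_of_intro hP hx (bag_subset_seen hc)]
  have hcK := hK (i + 1)
  have hsucc : ∀ (m f : ℕ → ℕ) (y : ℕ), (∀ j < i, m j = f j) → y = f i →
      ∀ j < i + 1, Function.update m i y j = f j := by
    intro m f y hm hy j hj
    by_cases hji : j = i
    · subst hji; simpa using hy
    · rw [Function.update_of_ne hji]; exact hm j (by omega)
  refine ⟨?_, ?_, ?_, ?_, ?_, ⟨?_, ?_, ?_, ?_, ?_⟩, ?_, ?_, ?_⟩
  · have := hR.le_mul (memDeg 5)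
    show (s.reg 77 - 1) / 2 ≤ _
    rw [h1.1]
    simp only [memDeg]
    simp; nlinarith
  · show s.reg 77 % 2 ≤ _
    exact le_trans (by omega) (hR.le_mul _)
  · show s.reg 8 + s.reg 77 % 2 - (1 - s.reg 77 % 2) ≤ _
    rw [hcard]
    exact (hcK.trans hKX).trans (hR.le_mul _)
  · simp [hcard, memDeg]
    omega
  · simp [h.index, regDeg]; nlinarith
  · have := hsucc (s.mem 5) (fun j => (vertexArray P).getD j 0) v h.vertex
      (by simp [vertexArray, List.getD_eq_getElem?_getD, hx])
    simpa [h.index, h1.1] using this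
  · have := hsucc (s.mem 6) (fun j => (typeArray P).getD j 0) (if b then 1 else 0) h.type
      (by simp [typeArray, List.getD_eq_getElem?_getD, hx])
    simpa [h.index, h1.2] using this
  · have := hsucc (s.mem 7) (fun j => (bag P (j + 1)).card) _ h.size rfl
    simpa [h.index, hcard] using this
  · simp [h.index]
  · simp [hcard]
  · simp
  · simp
  · simp

/-- Progress is measured by the position of the current identifier in the list; for the end marker
`0`, which is no identifier, `idxOf` is the length of the list. -/
theorem runs_writeList (hR : Roomy n X W) {D : List (Entry n)} (hL : Linked [] D s)
    (hP : IsPathDecomposition G (labs D)) {K : ℕ} (hK : ∀ i, (bag (labs D) i).card ≤ K)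
    (hKX : K ≤ X) :
    Runs n X W writeList s (D.length * 80 + 30) fun s' => Outputs s' (labs D) := by
  have h16 := hR.le_X
  have hnd : (ids D).Nodup := by have := hL.nodup; simp at this; exact this.2
  have h0 : 0 ∉ ids D := by have := (List.nodup_cons.1 hL.nodup).1; simpa using this
  refine Runs.of_bdd fun hB => ?_
  refine (Runs.seq (T₁ := 20) (T₂ := D.length * 80 + 10) (Runs.mono (Runs.of_wp
    (Q := fun s' => s'.reg 75 = s.mem 11 0 ∧ s'.reg 76 = 0 ∧ s'.reg 8 = 0) hR (by decide) ?_)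
    (by decide) fun s₁ hF _ h1 => ?_)).mono (by omega) fun _ _ _ h => h
  · refine ⟨?_, ?_, ?_, ?_⟩
    · simpa [memDeg, regDeg] using hB.mem 11 0
    · simp
    · simp
    · simp
  · have c1 : (Expr.reg 75).cost = 1 := rfl
    refine (Runs.loop hR (by decide) (fun s' => ∃ A B, D = A ++ B ∧ s'.reg 75 = (ids B).headD 0 ∧
      Written (labs D) (labs A).length s')
      (fun s' => (D.length - (ids D).idxOf (s'.reg 75)) * 80) ?_ ?_).mono ?_ ?_
    · refine ⟨[], D, rfl, ?_, ⟨by simp, by simp, by simp, h1.2.1, by simp [h1.2.2, bag]⟩⟩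
      rw [h1.1]
      have := hL.next
      cases D with
      | nil => simpa [Seg] using this
      | cons e D => simpa [Seg] using this.1
    · rintro s₂ hB₂ hF₂ ⟨A, B, rfl, k1, k2⟩ hlt
      have m11 : s₂.mem 11 = s.mem 11 := (hF₂.mem 11 rfl).trans (hF.mem 11 rfl)
      have m13 : s₂.mem 13 = s.mem 13 := (hF₂.mem 13 rfl).trans (hF.mem 13 rfl)
      match B with
      | [] => exact absurd k1 hlt
      | e :: B =>
        have k1 : s₂.reg 75 = e.id := k1
        have hnext : s.mem 11 e.id = (ids B).headD 0 := by
          have := hL.next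
          simp only [List.nil_append, ids, List.map_append, List.map_cons, List.append_assoc] at this
          have := (seg_append.1 this).2.2
          cases B with
          | nil => exact this.1
          | cons e' B => exact this.1
        have hlab : s.mem 13 e.id = labelCode e.lab := hL.label e (by simp)
        have b13 := hB₂.mem 13 e.id
        have b11 := hB₂.mem 11 e.id
        simp only [memDeg] at b13 b11
        have hpot : (ids (A ++ e :: B)).idxOf e.id = A.length ∧
            (ids (A ++ e :: B)).idxOf ((ids B).headD 0) = A.length + 1 := by
          simp only [ids, List.map_append, List.map_cons] at hnd h0 ⊢
          have hA : ∀ x ∈ e.id :: List.map Entry.id B, x ∉ List.map Entry.id A :=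
            fun x hx hc => (List.nodup_append.1 hnd).2.2 x hc x hx rfl
          refine ⟨?_, ?_⟩
          · rw [List.idxOf_append_of_notMem (hA _ (by simp))]; simp
          · cases B with
            | nil =>
              simp only [List.map_nil, List.headD_nil]
              rw [List.idxOf_eq_length (by simpa using h0)]
              simp
            | cons e' B =>
              have hne : e.id ≠ e'.id := by
                have := (List.nodup_append.1 hnd).2.1
                intro hc; simp [hc] at this
              rw [List.map_cons, List.headD_cons, List.idxOf_append_of_notMem (hA _ (by simp)),
                List.idxOf_cons_ne _ hne]
              simp
        have hwr : ∀ i s', (∀ r, r = 8 ∨ r = 76 → s'.reg r = s₂.reg r) → s'.mem = s₂.mem →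
            Written (labs (A ++ e :: B)) i s₂ → Written (labs (A ++ e :: B)) i s' := by
          rintro i s' hr hm ⟨w1, w2, w3, w4, w5⟩
          rw [← hm] at w1 w2 w3
          exact ⟨w1, w2, w3, (hr 76 (by simp)).trans w4, (hr 8 (by simp)).trans w5⟩
        refine ⟨_, (Runs.of_wp (Q := fun s' => s'.reg 75 = (ids B).headD 0 ∧
          Written (labs (A ++ e :: B)) (labs (A ++ [e])).length s') hR (by decide) ?_).mono
          (show _ ≤ 70 by decide) ?_⟩
        · refine wp_seq ⟨?_, wp_seq ⟨fun hc => ?_, fun hc => ?_⟩⟩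
          · simpa [k1, regDeg] using b13
          · have h77 : s₂.mem 13 (s₂.reg 75) = labelCode e.lab := by rw [k1, m13, hlab]
            simp only [eval_reg, eval_cell, h77, Function.update_self] at hc
            rcases hx : e.lab with _ | x
            · rw [hx] at hc; exact absurd rfl hc
            have hget : (labs (A ++ e :: B))[(labs A).length]? = some x := by
              simp [labs, hx]
            have hlen : (labs (A ++ [e])).length = (labs A).length + 1 := by simp [labs, hx]
            have hw := hwr _ ⟨Function.update s₂.reg 77 ((Expr.cell 13 (.reg 75)).eval s₂), s₂.mem⟩
              (by rintro r (rfl | rfl) <;> simp) rfl k2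
            refine wp_seq ((wp_writeNode hP hR hK hKX hw hget (by simp [h77, hx])).mono ?_)
            · rintro s₃ ⟨w, w1, w2, w3⟩
              refine ⟨?_, ?_, ?_⟩
              · simp [w1, w3, k1, regDeg]; simpa using b11
              · simp [w1, w3, k1, m11, hnext]
              · rw [hlen]
                exact ⟨w.vertex, w.type, w.size, by simpa using w.index, by simpa using w.card⟩
          · have h77 : s₂.mem 13 (s₂.reg 75) = labelCode e.lab := by rw [k1, m13, hlab]
            simp only [eval_reg, eval_cell, h77, Function.update_self] at hc
            have hx : e.lab = none := by
              rcases hx : e.lab with _ | ⟨v, b⟩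
              · rfl
              · rw [hx] at hc; cases b <;> simp [labelCode] at hc
            have hlen : (labs (A ++ [e])).length = (labs A).length := by simp [labs, hx]
            refine ⟨?_, ?_, ?_⟩
            · simpa [k1, regDeg] using b11
            · simp [k1, m11, hnext]
            · rw [hlen]
              refine hwr _ _ ?_ rfl k2
              rintro r (rfl | rfl) <;> simp
        · rintro s₃ - - ⟨j1, j2⟩
          refine ⟨⟨A ++ [e], B, by simp, j1, j2⟩, ?_⟩
          rw [k1, j1, hpot.1, hpot.2]
          simp only [List.length_append, List.length_cons]
          omega
    · have : D.length - (ids D).idxOf (s₁.reg 75) ≤ D.length := Nat.sub_le _ _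
      omega
    · rintro s₂ - - ⟨⟨A, B, h1, k1, k2⟩, h0'⟩
      rw [eval_reg] at h0'
      have : B = [] := by
        cases B with
        | nil => rfl
        | cons e B =>
          rw [h0'] at k1
          refine absurd ?_ h0
          rw [h1]
          have : (0 : ℕ) = e.id := k1
          simp [← this]
      subst this
      rw [List.append_nil] at h1
      subst h1
      exact k2.outputs

/-- Construct the output after the search. -/
def answer : Program :=
  .cond (.reg 62) (.seq backtrace (.seq forward (.seq writeList (.setReg 0 1)))) (.setReg 0 0)

end

end RAM

/-! ### The decision procedure -/

theorem card_bag_le {n : ℕ} (P : List (Node n)) (j : ℕ) : (bag P j).card ≤ width P + 1 := by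
  have h : bag P j = bag P (min j P.length) := by
    rcases le_total j P.length with h | h
    · rw [min_eq_left h]
    · rw [min_eq_right h, bag, bag, List.take_of_length_le h, List.take_length]
  have := Finset.le_sup (f := fun j => (bag P j).card)
    (Finset.mem_range.2 (show min j P.length < P.length + 1 by omega))
  rw [h, width]
  omega

theorem exists_width_le {n k : ℕ} {G : SimpleGraph (Fin n)} {P : List (Node n)}
    (hP : IsPathDecomposition G P) (h : pathWidth G ≤ k) :
    ∃ Q : List (Node n), IsPathDecomposition G Q ∧ width Q ≤ k := by
  obtain ⟨Q, hQ, hw⟩ := Nat.sInf_mem (s := {w : ℕ | ∃ P : List (Node n),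
    IsPathDecomposition G P ∧ width P = w}) ⟨_, P, hP, rfl⟩
  exact ⟨Q, hQ, hw.trans_le h⟩

theorem pathWidth_le {n k : ℕ} {G : SimpleGraph (Fin n)} {P : List (Node n)}
    (hP : IsPathDecomposition G P) (h : width P ≤ k) : pathWidth G ≤ k :=
  le_trans (Nat.sInf_le (show width P ∈ _ from ⟨P, hP, rfl⟩)) h

namespace RAM

section

variable {n m k X₀ X W : ℕ} {z s : State} {G : SimpleGraph (Fin n)} {nbrs : Fin n → List (Fin n)}
  {P : List (Node n)} {sl : Fin n → ℕ}

/-- Each factor of `fieldBound` has an exponent one larger than needed, so every field is strictly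
smaller: words and their length powers by the first factor, slot numerals and their powers by the
second. -/
theorem Valid.of_fit (h3 : z.reg 3 = m + 1) (h4 : z.reg 4 = fieldBound m k) (h5 : z.reg 5 = k + 1)
    {a : AConf} (h : Fit (envOf z) (wordLength m k) (2 * m) (m + 1) a) :
    Valid z (enc (z.reg 3) a) := by
  have hp : ∀ {d : ℕ}, d ≤ wordLength m k → 6 ^ d < fieldBound m k := fun {d} hd => by
    calc 6 ^ d < 6 ^ (wordLength m k + 1) := Nat.pow_lt_pow_right (by omega) (by omega)
      _ ≤ _ := Nat.le_mul_of_pos_right _ (by positivity)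
  have hq : ∀ {d : ℕ}, d ≤ 2 * m → (m + 1) ^ d < fieldBound m k := fun {d} hd => by
    have h1 : (m + 1) ^ d ≤ (m + 1) ^ (2 * m + 1) := Nat.pow_le_pow_right (by omega) (by omega)
    have h2 : 1 < 6 ^ (wordLength m k + 1) := Nat.one_lt_pow (by omega) (by omega)
    calc (m + 1) ^ d ≤ (m + 1) ^ (2 * m + 1) := h1
      _ < _ := by rw [fieldBound]; exact lt_mul_of_one_lt_left (by positivity) h2
  have hK : ∀ {d : ℕ}, d ≤ (envOf z).K → d < fieldBound m k := fun {d} hd => by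
    have : d ≤ wordLength m k := by
      simp only [envOf, h5] at hd
      rw [wordLength]; nlinarith
    exact (Nat.lt_pow_self (by omega)).trans (hp this)
  obtain ⟨hj, ⟨o1, o2, o3⟩, ⟨n1, n2, n3⟩, hco, hcn, hph⟩ := h
  have hN : a.j ≤ 2 * z.reg 0 := hj
  refine ⟨Nat.lt_succ_of_le hN, ?_, ?_⟩
  · rw [h4, h3]
    intro i hi
    interval_cases i
    · exact (digits_lt _).trans (hp o1)
    · exact (slots_lt o3).trans (hq (by rw [events_eq]; exact o2))
    · exact (digits_lt _).trans (hp n1)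
    · exact hp n1
    · exact (slots_lt n3).trans (hq (by rw [events_eq]; exact n2))
    · exact hq (by rw [events_eq]; exact n2)
    · exact hK hco.1
    · exact hK hco.2
    · exact hK hcn.1
    · exact hK hcn.2
    · have := hp (d := 1) (by rw [wordLength]; nlinarith)
      show a.ph < _
      omega
  · intro i hi
    obtain ⟨i, rfl⟩ := Nat.exists_eq_add_of_le' hi
    rfl

/-- If there is a path decomposition of small width, then an accepting configuration is reachable. -/
theorem exists_accepting_conf (hP : IsPathDecomposition G P) (hE : Compat G P sl (envOf z))
    (hm : ∀ j, (bag P j).card ≤ m) (hsl : ∀ u, sl u < m + 1) (hS : ∀ v, z.mem 8 v < m + 1)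
    (h3 : z.reg 3 = m + 1) (h4 : z.reg 4 = fieldBound m k) (h5 : z.reg 5 = k + 1)
    {Q : List (Node n)} (hQ : IsPathDecomposition G Q) (hk : width Q ≤ k) :
    Valid z initConf ∧ ∃ c, Relation.ReflTransGen (fun c c' => ∃ ρ ∈ rules, SStep z ρ c c') initConf c ∧
      c 0 = 2 * z.reg 0 := by
  have hinit : Fit (envOf z) (wordLength m k) (2 * m) (m + 1) ⟨0, [], [], (0, 0), (0, 0), 0⟩ :=
    ⟨Nat.zero_le _, ⟨by simp, by simp, by simp⟩, ⟨by simp, by simp, by simp⟩, by simp, by simp, by simp⟩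
  refine ⟨by rw [← enc_init (z.reg 3)]; exact Valid.of_fit h3 h4 h5 hinit, ?_⟩
  obtain ⟨w, hw⟩ := exists_accepting_run (E := envOf z) hP hE hQ
    (fun i => (card_bag_le Q i).trans (by simp only [envOf, h5]; omega)) hm hsl
    (L := wordLength m k) (by simp [envOf, h5, wordLength])
  suffices ∀ a, Relation.ReflTransGen (Move (envOf z) (wordLength m k) (2 * m) (m + 1))
      ⟨0, [], [], (0, 0), (0, 0), 0⟩ a → SlotsBelow (z.reg 3) a ∧
      Relation.ReflTransGen (fun c c' => ∃ ρ ∈ rules, SStep z ρ c c') initConf (enc (z.reg 3) a) from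
    ⟨_, (this _ hw).2, rfl⟩
  intro a ha
  induction ha with
  | refl => exact ⟨⟨by simp, by simp⟩, by rw [enc_init]⟩
  | tail _ hstep ih =>
    obtain ⟨r, hr, hf⟩ := hstep
    exact ⟨ih.1.step (by rwa [h3]) hr, ih.2.tail (AStep.sstep ih.1 hr (Valid.of_fit h3 h4 h5 hf))⟩

theorem runs_answer (hR : Roomy n X W) (hP : IsPathDecomposition G P)
    (hE : Compat G P sl (envOf z)) (hS : ∀ v, z.mem 8 v < z.reg 3)
    (hX : (2 * z.reg 0 + 1) * z.reg 4 ^ 11 + 1 ≤ n * X) (h5 : z.reg 5 = k + 1) (hk : k + 1 ≤ X)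
    {q : List Conf} (hs : Searching z initConf s q)
    (hnode : ∀ (j : ℕ) x, P[j]? = some x → s.mem 2 j = x.1)
    (h0 : ∀ a ∈ [11, 12, 13], ∀ i, s.mem a i = 0) :
    Runs n X W answer s ((2 * z.reg 0 + 1) * z.reg 4 ^ 11 * 250 + 300) fun s' =>
      s.reg 62 = 0 ∧ s'.reg 0 = 0 ∨ s'.reg 0 = 1 ∧
        ∃ P' : List (Node n), IsPathDecomposition G P' ∧ width P' ≤ k ∧ Outputs s' P' := by
  have h16 := hR.le_X
  have hn := hR.one_le
  have hlen := length_le_of_valid hs.queue.nodup hs.queue.valid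
  generalize (2 * z.reg 0 + 1) * z.reg 4 ^ 11 = N at *
  refine (Runs.cond (T := N * 250 + 290) hR (by decide) (fun hf => ?_) fun hf => ?_).mono
    (by have : (Expr.reg 62).cost = 1 := rfl; omega) fun _ _ _ h => h
  · obtain ⟨f, hf⟩ := Nat.exists_eq_succ_of_ne_zero hf
    obtain ⟨c, hc, hcz⟩ := hs.accept f hf
    have hfq : f < q.length := (List.getElem?_eq_some_iff.1 hc).1
    refine (Runs.seq (T₁ := N * 30 + 30) (T₂ := N * 220 + 200) (Runs.mono
      (runs_backtrace hR hs.queue hf hc (by omega)) (by omega)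
      fun s₁ hF₁ _ ⟨l, t1, t2, t3, t4⟩ => ?_)).mono (by omega) fun _ _ _ h => h
    refine (Runs.seq (T₁ := N * 100 + 30) (T₂ := N * 80 + 120) (Runs.mono
      (runs_forward hR hP hE hS ?_ ?_ t1 t2 (by omega) t4) (by omega)
      fun s₂ hF₂ _ ⟨a, D₁, D₂, u1, u2, u3, u4⟩ => ?_)).mono (by omega) fun _ _ _ h => h
    · rw [hF₁.mem 2 rfl]; exact hnode
    · intro a ha
      simp only [List.mem_cons, List.not_mem_nil, or_false] at ha
      rcases ha with rfl | rfl | rfl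
      · rw [hF₁.mem 11 rfl]; exact h0 11 (by simp)
      · rw [hF₁.mem 12 rfl]; exact h0 12 (by simp)
      · rw [hF₁.mem 13 rfl]; exact h0 13 (by simp)
    have haj : a.j = (envOf z).N := by
      have : c 0 = a.j := by rw [u3]; rfl
      rw [← this, hcz]; rfl
    obtain ⟨rfl, hD, hw⟩ := u1.isPathDecomposition hP hE haj
    have hw : width (labs D₂) ≤ k := by simpa [envOf, h5] using hw
    simp only [List.nil_append] at u4
    refine (Runs.seq (T₁ := N * 80 + 110) (T₂ := 10) (Runs.mono
      (runs_writeList hR u2 hD (K := k + 1) (fun i => (card_bag_le _ i).trans (by omega)) hk)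
      (by omega) fun s₃ _ _ h3 => ?_)).mono (by omega) fun _ _ _ h => h
    refine (Runs.of_wp hR (by decide) ?_).mono (by decide) fun _ _ _ h => h
    refine ⟨?_, .inr ⟨by simp, _, hD, hw, h3⟩⟩
    have := hR.le_mul (regDeg 0)
    simp only [eval_one]; omega
  · refine (Runs.of_wp hR (by decide) ?_).mono (le_trans (by decide : _ ≤ 10) (by omega))
      fun _ _ _ h => h
    exact ⟨by simp, .inl ⟨hf, by simp⟩⟩

/-- The preparations are run under the small bound `X₀`, and this is remembered afterwards, because
the search needs its fixed data bounded by `X₀` while working under `X`. -/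
theorem Runs.widen {p : Program} {T : ℕ} {Q : State → Prop} (h : Runs n X₀ W p s T Q) (hX : X₀ ≤ X)
    (hB : Bdd n X₀ s) : Runs n X W p s T fun s' => Bdd n X₀ s' ∧ Q s' := by
  intro _
  obtain ⟨t, s', h1, h2, h3, h4, h5⟩ := h hB
  exact ⟨t, s', h1, h2, ⟨fun i => (h3.reg i).trans (Nat.mul_le_mul_left _ hX),
    fun a i => (h3.mem a i).trans (Nat.mul_le_mul_left _ hX)⟩, h4, h3, h5⟩

/-- Decide whether the path-width is at most `k`, where `k` is less than the given width. -/
def decideProgram : Program :=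
  .seq (.seq parameters (.seq (.setReg 64 0) assignSlots)) (.seq search answer)

/-- The correct output, for the bound `k`. -/
def Correct (G : SimpleGraph (Fin n)) (k : ℕ) (s : State) : Prop :=
  (pathWidth G ≤ k → s.reg 0 = 1 ∧
    ∃ P' : List (Node n), IsPathDecomposition G P' ∧ width P' ≤ k ∧ Outputs s P') ∧
  (¬ pathWidth G ≤ k → s.reg 0 = 0)

theorem le_fieldBound (m k : ℕ) : m + 1 ≤ fieldBound m k ∧ k + 2 ≤ fieldBound m k := by
  have h2 : 1 ≤ 6 ^ (wordLength m k + 1) := Nat.one_le_pow _ _ (by omega)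
  have h1 : 1 ≤ (m + 1) ^ (2 * m + 1) := Nat.one_le_pow _ _ (by omega)
  refine ⟨(Nat.le_self_pow (by omega) _).trans (Nat.le_mul_of_pos_left _ h2), ?_⟩
  have : wordLength m k + 1 < 6 ^ (wordLength m k + 1) := Nat.lt_pow_self (by omega)
  have hk : k + 2 ≤ wordLength m k + 1 := by rw [wordLength]; nlinarith
  exact (hk.trans this.le).trans (Nat.le_mul_of_pos_right _ h1)

/-- Three scales occur: `X₀` bounds the parameters, `X = X₀ ^ 100` the candidates of the search, and
`n * X ^ 200` everything arising inside an expression. There are at most `n * X` configurations, and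
each takes constant time in the search and in the construction of the output. -/
theorem runs_decide (hn : 1 ≤ n) (h16 : 16 ≤ X₀) (hX : X₀ ^ 100 = X) (hW : n * X ^ 200 ≤ W)
    (hB : Bdd n X₀ s) (h : Stored nbrs P s)
    (hA : IsAdjacencyLists G nbrs) (hP : IsPathDecomposition G P) (hm : ∀ j, (bag P j).card ≤ m)
    (hm1 : 1 ≤ m) (hX₀ : fieldBound m k ≤ X₀)
    (hr0 : s.reg 0 = n) (hr1 : s.reg 1 = k) (hr2 : s.reg 2 = m) (hr7 : s.reg 7 = 0)
    (h0 : ∀ a, 8 ≤ a → ∀ i, s.mem a i = 0) :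
    Runs n X W decideProgram s (n * X * 7000) (Correct G k) := by
  have hle : X₀ ≤ X := hX ▸ Nat.le_self_pow (by omega) X₀
  have hR₀ : Roomy n X₀ W := ⟨hn, h16, le_trans (Nat.mul_le_mul_left _
    (Nat.pow_le_pow_left hle 200)) hW⟩
  have hR : Roomy n X W := ⟨hn, by omega, hW⟩
  have hPl := length_pathDecomposition hP
  obtain ⟨hmX, hkX⟩ := le_fieldBound m k
  have hsum := sum_length_le nbrs hA hP hm
  have hbig : n * X₀ ^ 12 ≤ n * X :=
    Nat.mul_le_mul_left _ (hX ▸ Nat.pow_le_pow_right (by omega) (by omega))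
  have hpre : Runs n X₀ W (.seq parameters (.seq (.setReg 64 0) assignSlots)) s
      (X₀ * 40 + 230 + n * 400 + n * m * 120) fun s' => s'.reg 0 = n ∧ s'.reg 3 = m + 1 ∧
        s'.reg 4 = fieldBound m k ∧ s'.reg 5 = k + 1 ∧
        Slots G P m (2 * n) (s'.reg 7) (s'.mem 8) (s'.mem 10) (s'.mem 9) := by
    refine (Runs.seq (T₁ := X₀ * 40 + 200) (T₂ := 30 + n * 400 + n * m * 120) (Runs.mono
      (runs_parameters hR₀ hr2 hr1 hm1 hX₀) le_rfl fun s₁ hF₁ _ ⟨a1, a2, a3⟩ => ?_)).mono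
      (by omega) fun _ _ _ h => h
    refine (Runs.seq (T₁ := 10) (T₂ := 20 + n * 400 + n * m * 120) (Runs.mono (Runs.of_wp
      (Q := fun s' => s'.reg 64 = 0) hR₀ (by decide) ?_) (by decide)
      fun s₂ hF₂ _ b1 => ?_)).mono (by omega) fun _ _ _ h => h
    · exact ⟨by simp, by simp⟩
    refine (runs_assignSlots hR₀ (h.congr fun a ha => ?_) hA hP hm (by omega) ?_ ?_ b1 ?_
      ?_ ?_ ?_).mono ?_ fun s₃ hF₃ _ hsl => ⟨?_, ?_, ?_, ?_, hsl⟩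
    · interval_cases a
      · exact (hF₂.mem 0 rfl).trans (hF₁.mem 0 rfl)
      · exact (hF₂.mem 1 rfl).trans (hF₁.mem 1 rfl)
      · exact (hF₂.mem 2 rfl).trans (hF₁.mem 2 rfl)
      · exact (hF₂.mem 3 rfl).trans (hF₁.mem 3 rfl)
    · rw [hF₂.reg 0 rfl, hF₁.reg 0 rfl, hr0]
    · rw [hF₂.reg 3 rfl, a1]
    · rw [hF₂.reg 7 rfl, hF₁.reg 7 rfl, hr7]
    · rw [hF₂.mem 8 rfl, hF₁.mem 8 rfl]; exact h0 8 (by omega)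
    · rw [hF₂.mem 9 rfl, hF₁.mem 9 rfl]; exact h0 9 (by omega)
    · rw [hF₂.mem 10 rfl, hF₁.mem 10 rfl]; exact h0 10 (by omega)
    · nlinarith
    · rw [hF₃.reg 0 rfl, hF₂.reg 0 rfl, hF₁.reg 0 rfl, hr0]
    · rw [hF₃.reg 3 rfl, hF₂.reg 3 rfl, a1]
    · rw [hF₃.reg 4 rfl, hF₂.reg 4 rfl, a3]
    · rw [hF₃.reg 5 rfl, hF₂.reg 5 rfl, a2]
  have hpow : (2 * n + 1) * fieldBound m k ^ 11 + 1 ≤ n * X₀ ^ 12 := by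
    have h1 : fieldBound m k ^ 11 ≤ X₀ ^ 11 := Nat.pow_le_pow_left hX₀ 11
    have h2 : 1 ≤ X₀ ^ 11 := Nat.one_le_pow _ _ (by omega)
    calc (2 * n + 1) * fieldBound m k ^ 11 + 1 ≤ (3 * n) * X₀ ^ 11 + n * X₀ ^ 11 :=
          Nat.add_le_add (Nat.mul_le_mul (by omega) h1) (Nat.mul_pos hn h2)
      _ = n * (4 * X₀ ^ 11) := by ring
      _ ≤ n * (X₀ * X₀ ^ 11) := by gcongr; omega
      _ = n * X₀ ^ 12 := by ring
  have hsmall : X₀ * 40 + 230 + n * 400 + n * m * 120 + 1500 ≤ n * X₀ ^ 12 := by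
    have h1 : X₀ * 40 + 230 + n * 400 + n * m * 120 + 1500 ≤ n * (X₀ * 2290) := by
      have e1 : X₀ * 40 ≤ n * X₀ * 40 := by nlinarith
      have e2 : n * 1 ≤ n * X₀ := Nat.mul_le_mul_left _ (by omega)
      have e3 : n * m ≤ n * X₀ := Nat.mul_le_mul_left _ (by omega)
      nlinarith
    refine h1.trans (Nat.mul_le_mul_left _ ?_)
    rw [pow_succ', pow_succ]
    refine Nat.mul_le_mul_left _ ?_
    have := Nat.pow_le_pow_left h16 10
    nlinarith
  generalize X₀ ^ 12 = Y at hpow hsmall hbig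
  refine (Runs.seq (T₁ := n * Y) (T₂ := n * X * 6000) (Runs.mono
    (hpre.widen hle hB) (by omega) fun s₁ hF₁ _ ⟨hB₁, b0, b3, b4, b5, hsl⟩ => ?_)).mono (by omega)
    fun _ _ _ h => h
  -- The fixed data of the search; the irrelevant registers and arrays are set to zero, so that the
  -- bounds of `Limits` hold for them trivially.
  obtain ⟨z, hz⟩ : ∃ z : State, z = ⟨fun i => if i = 0 ∨ i = 3 ∨ i = 4 ∨ i = 5 then s₁.reg i else 0,
    fun a => if a = 2 ∨ a = 3 ∨ a = 8 ∨ a = 9 then s₁.mem a else fun _ => 0⟩ := ⟨_, rfl⟩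
  have hag : Agree z s₁ := by
    subst hz
    exact ⟨fun i hi => by simp [hi], fun a ha => by simp [ha]⟩
  have z0 : z.reg 0 = n := by rw [← hag.reg 0 (by omega), b0]
  have z3 : z.reg 3 = m + 1 := by rw [← hag.reg 3 (by omega), b3]
  have z4 : z.reg 4 = fieldBound m k := by rw [← hag.reg 4 (by omega), b4]
  have z5 : z.reg 5 = k + 1 := by rw [← hag.reg 5 (by omega), b5]
  have m2 := hag.mem 2 (by omega)
  have m3 := hag.mem 3 (by omega)
  have m8 := hag.mem 8 (by omega)
  have m9 := hag.mem 9 (by omega)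
  have hlim : Limits n X₀ X z := by
    refine ⟨hn, h16, hX.le, z0, fun i => ?_, fun a i => ?_⟩
    · rw [hz]; dsimp only; split_ifs
      · exact hB₁.reg i
      · exact Nat.zero_le _
    · rw [hz]; dsimp only; split_ifs
      · exact hB₁.mem a i
      · exact Nat.zero_le _
  have hS : ∀ v, z.mem 8 v < m + 1 := fun v => by rw [← m8]; have := hsl.le v; omega
  have hnode : ∀ j x, P[j]? = some x → s₁.mem 2 j = x.1 ∧ s₁.mem 3 j = if x.2 then 1 else 0 := by
    rw [hF₁.mem 2 rfl, hF₁.mem 3 rfl]; exact h.node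
  have hlt : ∀ {j : ℕ} {x : Node n}, P[j]? = some x → j < 2 * n := fun hx => by
    rw [← hPl]; exact (List.getElem?_eq_some_iff.1 hx).1
  have hE : Compat G P (fun u => z.mem 8 u) (envOf z) := by
    refine ⟨by simp [envOf, z0, hPl], ?_, ?_, ?_, ?_, ?_⟩
    · intro j x hx
      show z.mem 3 j = _
      rw [← m3, (hnode j x hx).2]
    · intro j x hx
      show z.mem 8 (z.mem 2 j) = _
      rw [← m2, (hnode j x hx).1]
    · intro j v hx u hu
      show z.mem 9 (j * z.reg 3 + z.mem 8 u) ≠ 0 ↔ _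
      rw [z3, ← m9, ← m8]
      exact hsl.nb j (hlt hx) v hx u hu
    · intro j v hx u hu
      show z.mem 9 (j * z.reg 3 + z.mem 8 u) = 0
      rw [z3, ← m9, ← m8]
      exact hsl.nb_zero j (hlt hx) v hx u hu
    · intro j u hu v hv he
      rw [← m8] at he
      rcases le_total j (2 * n) with hj | hj
      · exact hsl.inj j hj u hu v hv he
      · have hb : bag P j = bag P (2 * n) := by
          rw [← hPl] at hj ⊢
          rw [bag, bag, List.take_of_length_le hj, List.take_length]
        rw [hb] at hu hv
        exact hsl.inj _ le_rfl u hu v hv he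
  have hcount : (2 * z.reg 0 + 1) * z.reg 4 ^ 11 + 1 ≤ n * Y := by rw [z0, z4]; exact hpow
  have hT : n * X * 5000 + (n * X * 250 + 300) ≤ n * X * 6000 := by
    have : X ≤ n * X := Nat.le_mul_of_pos_left _ hn
    linarith
  refine (Runs.seq (T₁ := n * X * 5000) (T₂ := n * X * 250 + 300) (Runs.mono
    (runs_search hlim hW hag ?_) (by linarith) fun s₂ hF₂ _ ⟨q, hq, hall⟩ => ?_)).mono hT
    fun _ _ _ h => h
  · rw [hF₁.mem 14 rfl]; exact h0 14 (by omega)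
  refine (runs_answer hR hP hE (by rwa [z3]) (hcount.trans hbig) z5 (by linarith) hq ?_ ?_).mono
    (by linarith) fun s₃ _ _ h3 => ?_
  · intro j x hx
    rw [hq.queue.agree.mem 2 (by omega), ← m2]
    exact (hnode j x hx).1
  · intro a ha
    simp only [List.mem_cons, List.not_mem_nil, or_false] at ha
    rcases ha with rfl | rfl | rfl
    · rw [hF₂.mem 11 (by decide +kernel), hF₁.mem 11 rfl]; exact h0 11 (by omega)
    · rw [hF₂.mem 12 (by decide +kernel), hF₁.mem 12 rfl]; exact h0 12 (by omega)
    · rw [hF₂.mem 13 (by decide +kernel), hF₁.mem 13 rfl]; exact h0 13 (by omega)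
  · rcases h3 with ⟨h62, h3⟩ | ⟨h3, P', hP', hw, ho⟩
    · refine ⟨fun hpw => ?_, fun _ => h3⟩
      obtain ⟨Q, hQ, hQw⟩ := exists_width_le hP hpw
      obtain ⟨hv, c, hc, hc0⟩ := exists_accepting_conf hP hE hm (fun u => hS u) hS z3 z4 z5 hQ hQw
      exact absurd hc0 (hq.not_reachable hall hv h62 hc)
    · exact ⟨fun _ => ⟨h3, P', hP', hw, ho⟩, fun hpw => absurd (pathWidth_le hP' hw) hpw⟩

end

end RAM

/-! ### Programs which do not use a register -/

namespace RAM

def State.withReg (s : State) (i v : ℕ) : State := ⟨Function.update s.reg i v, s.mem⟩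

def Expr.avoids (i : ℕ) : Expr → Bool
  | .lit _ => true
  | .reg j => j != i
  | .cell _ e => e.avoids i
  | .op _ a b => a.avoids i && b.avoids i

def Program.avoids (i : ℕ) : Program → Bool
  | .skip => true
  | .setReg j e => j != i && e.avoids i
  | .setCell _ e e' => e.avoids i && e'.avoids i
  | .seq p q => p.avoids i && q.avoids i
  | .cond e p q => e.avoids i && p.avoids i && q.avoids i
  | .loop e p => e.avoids i && p.avoids i

variable {W i : ℕ}

theorem Expr.eval_withReg {e : Expr} (he : e.avoids i) (s : State) (v : ℕ) :
    e.eval (s.withReg i v) = e.eval s := by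
  induction e with
  | lit c => rfl
  | reg j => simp only [Expr.avoids, bne_iff_ne] at he; simp [Expr.eval, State.withReg, he]
  | cell a e ih => simp only [Expr.eval, ih he]; rfl
  | op o a b iha ihb =>
    simp only [Expr.avoids, Bool.and_eq_true] at he
    simp only [Expr.eval, iha he.1, ihb he.2]

theorem Expr.Fits.withReg {e : Expr} {s : State} (h : e.Fits W s) (he : e.avoids i) (v : ℕ) :
    e.Fits W (s.withReg i v) := by
  induction e with
  | lit c => exact h
  | reg j =>
    have := Expr.eval_withReg he s v
    simp only [Expr.eval] at this
    simpa only [Expr.Fits, this] using h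
  | cell a e ih => exact ⟨ih h.1 he, by rw [Expr.eval_withReg (e := e) he]; exact h.2⟩
  | op o a b iha ihb =>
    have he' := he
    simp only [Expr.avoids, Bool.and_eq_true] at he
    exact ⟨iha h.1 he.1, ihb h.2.1 he.2, by
      rw [Expr.eval_withReg he.1, Expr.eval_withReg he.2]; exact h.2.2⟩

/-- Needed since `k` may exceed every bound in terms of `n` and `ℓ`: the first phase does not touch
register `1`, so it is analysed with `0` there and the true value is put back afterwards. -/
theorem Exec.withReg {p : Program} {s s' : State} {t : ℕ} (h : Exec W p s t s') (hp : p.avoids i)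
    (v : ℕ) : Exec W p (s.withReg i v) t (s'.withReg i v) := by
  induction h with
  | skip s => exact .skip _
  | setReg s j e he =>
    simp only [Program.avoids, Bool.and_eq_true, bne_iff_ne] at hp
    have := Exec.setReg (s.withReg i v) j e (he.withReg hp.2 v)
    rw [Expr.eval_withReg hp.2] at this
    convert this using 1
    simp only [State.withReg]
    rw [Function.update_comm hp.1]
  | setCell s a idx e hi he =>
    simp only [Program.avoids, Bool.and_eq_true] at hp
    have := Exec.setCell (s.withReg i v) a idx e (hi.withReg hp.1 v) (he.withReg hp.2 v)
    rwa [Expr.eval_withReg hp.1, Expr.eval_withReg hp.2] at this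
  | seq _ _ ih₁ ih₂ =>
    simp only [Program.avoids, Bool.and_eq_true] at hp
    exact .seq (ih₁ hp.1) (ih₂ hp.2)
  | condTrue he h0 _ ih =>
    simp only [Program.avoids, Bool.and_eq_true] at hp
    exact .condTrue (he.withReg hp.1.1 v) (by rwa [Expr.eval_withReg hp.1.1]) (ih hp.1.2)
  | condFalse he h0 _ ih =>
    simp only [Program.avoids, Bool.and_eq_true] at hp
    exact .condFalse (he.withReg hp.1.1 v) (by rwa [Expr.eval_withReg hp.1.1]) (ih hp.2)
  | loopTrue he h0 _ _ ih₁ ih₂ =>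
    have hp' := hp
    simp only [Program.avoids, Bool.and_eq_true] at hp
    exact .loopTrue (he.withReg hp.1 v) (by rwa [Expr.eval_withReg hp.1]) (ih₁ hp.2) (ih₂ hp')
  | loopFalse he h0 =>
    simp only [Program.avoids, Bool.and_eq_true] at hp
    exact .loopFalse (he.withReg hp.1 v) (by rwa [Expr.eval_withReg hp.1])

end RAM

/-! ### The input -/

section

variable {n k ℓ : ℕ} {G : SimpleGraph (Fin n)} {nbrs : Fin n → List (Fin n)} {P : List (Node n)}

theorem exists_one_le_card_bag (hn : 1 ≤ n) (hP : IsPathDecomposition G P) :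
    ∃ j < P.length, 1 ≤ (bag P (j + 1)).card := by
  have h : ((⟨0, hn⟩, true) : Node n) ∈ P :=
    (mem_nodesOf.1 (by rw [hP.nodesOf_eq]; simp : _ ∈ nodesOf P (⟨0, hn⟩ : Fin n))).1
  obtain ⟨j, hj⟩ := List.mem_iff_getElem?.1 h
  refine ⟨j, (List.getElem?_eq_some_iff.1 hj).1, Finset.card_pos.2 ⟨⟨0, hn⟩, ?_⟩⟩
  rw [bag_succ P _ _ hj, Node.apply]
  simp

theorem sizeArray_getD {j : ℕ} (hj : j < P.length) : (sizeArray P).getD j 0 = (bag P (j + 1)).card := by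
  simp [sizeArray, List.getD_eq_getElem?_getD, hj]

theorem eq_width_add_one (hn : 1 ≤ n) (hP : IsPathDecomposition G P) {m : ℕ}
    (h1 : ∀ j < P.length, (bag P (j + 1)).card ≤ m)
    (h2 : m = 0 ∨ ∃ j < P.length, (bag P (j + 1)).card = m) : m = width P + 1 := by
  obtain ⟨j, hj, hj1⟩ := exists_one_le_card_bag hn hP
  have hm := hj1.trans (h1 j hj)
  obtain ⟨i, hi, rfl⟩ := h2.resolve_left (by omega)
  refine le_antisymm (card_bag_le P _) ?_
  have : (Finset.range (P.length + 1)).sup (fun j => (bag P j).card) ≤ (bag P (i + 1)).card := by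
    refine Finset.sup_le fun j hj => ?_
    rcases j with _ | j
    · simp [bag]
    · exact h1 j (by simpa using hj)
  rw [width]
  omega

theorem getD_le {l : List ℕ} {b : ℕ} (h : ∀ x ∈ l, x ≤ b) (i : ℕ) : l.getD i 0 ≤ b := by
  rw [List.getD_eq_getElem?_getD]
  rcases hx : l[i]? with _ | x
  · simp
  · exact h x (List.mem_of_getElem? hx)

theorem startArray_le (hA : IsAdjacencyLists G nbrs) (hP : IsPathDecomposition G P)
    (x : ℕ) (hx : x ∈ startArray nbrs) : x ≤ 2 * (n * (width P + 1)) := by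
  obtain ⟨v, -, rfl⟩ := List.mem_map.1 hx
  refine le_trans ((List.take_sublist v _).flatten.length_le) ?_
  refine le_trans (le_of_eq ?_) (sum_length_le nbrs hA hP (card_bag_le P))
  simp [List.length_flatten, List.map_ofFn, List.sum_ofFn]

/-- The largest entries are positions in the concatenated adjacency lists, at most `2 * n * (width P
+ 1)`; the rest of the constant provides the required `16 ≤ X`. -/
theorem bdd_inputState (hn : 1 ≤ n) (hA : IsAdjacencyLists G nbrs) (hP : IsPathDecomposition G P) :
    RAM.Bdd n (18 + 2 * width P) (inputState nbrs 0 P) := by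
  refine ⟨fun i => ?_, fun a i => ?_⟩
  · match i with
    | 0 =>
      show n ≤ n ^ 1 * _
      rw [pow_one]
      exact Nat.le_mul_of_pos_right _ (by omega)
    | 1 => exact Nat.zero_le _
    | i + 2 => exact Nat.zero_le _
  · match a with
    | 0 =>
      refine getD_le (fun x hx => (startArray_le hA hP x hx).trans ?_) i
      show _ ≤ n ^ 1 * _
      rw [pow_one]
      nlinarith
    | 1 =>
      refine getD_le (fun x hx => ?_) i
      rw [adjacencyArray_eq] at hx
      obtain ⟨v, -, rfl⟩ := List.mem_map.1 hx
      show _ ≤ n ^ 1 * _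
      rw [pow_one]
      exact v.2.le.trans (Nat.le_mul_of_pos_right _ (by omega))
    | 2 =>
      refine getD_le (fun x hx => ?_) i
      obtain ⟨v, -, rfl⟩ := List.mem_map.1 hx
      show _ ≤ n ^ 1 * _
      rw [pow_one]
      exact v.1.2.le.trans (Nat.le_mul_of_pos_right _ (by omega))
    | 3 =>
      refine getD_le (fun x hx => ?_) i
      obtain ⟨v, -, rfl⟩ := List.mem_map.1 hx
      show _ ≤ n ^ 0 * _
      rw [pow_zero, one_mul]
      split_ifs <;> omega
    | 4 =>
      refine getD_le (fun x hx => ?_) i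
      obtain ⟨j, -, rfl⟩ := List.mem_map.1 hx
      have := card_bag_le P (j + 1)
      show _ ≤ n ^ 0 * _
      rw [pow_zero, one_mul]
      omega
    | a + 5 => exact Nat.zero_le _

theorem stored_inputState : RAM.Stored nbrs P (inputState nbrs k P) where
  start v := startArray_succ nbrs v
  adj v i hi := adjacencyArray_getD nbrs v i hi
  node j x hx := by
    refine ⟨?_, ?_⟩
    · show (vertexArray P).getD j 0 = _
      simp [vertexArray, List.getD_eq_getElem?_getD, hx]
    · show (typeArray P).getD j 0 = _
      simp [typeArray, List.getD_eq_getElem?_getD, hx]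

end

/-! ### The bounds -/

/-- The hypothesis on `ℓ` enters here: it gives `log (ℓ + 2) ≤ 2 + c + c * k`, whence the factor for
the slots is `2 ^ O(ℓ k + ℓ)` like the one for the letters. As `k < ℓ` forces `ℓ ≥ 1`, constants are
absorbed into multiples of `ℓ`. -/
theorem fieldBound_le {c k ℓ : ℕ} (hk : k < ℓ) (hℓ : ℓ ≤ c * 2 ^ (c * k)) :
    RAM.fieldBound (ℓ + 1) k ≤ 2 ^ ((90 + 5 * c) * (ℓ * k) + (178 + 5 * c) * ℓ) := by
  have h1 : 6 ^ (RAM.wordLength (ℓ + 1) k + 1) ≤ 2 ^ (3 * (RAM.wordLength (ℓ + 1) k + 1)) := by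
    rw [pow_mul]
    exact Nat.pow_le_pow_left (by norm_num) _
  have h2 : ℓ + 1 + 1 ≤ 2 ^ (2 + c + c * k) := by
    have hc : c ≤ 2 ^ c := Nat.lt_two_pow_self.le
    calc ℓ + 1 + 1 ≤ 4 * ℓ := by omega
      _ ≤ 4 * (2 ^ c * 2 ^ (c * k)) := Nat.mul_le_mul_left _ (hℓ.trans (Nat.mul_le_mul_right _ hc))
      _ = _ := by rw [pow_add, pow_add]; ring
  calc RAM.fieldBound (ℓ + 1) k
      ≤ 2 ^ (3 * (RAM.wordLength (ℓ + 1) k + 1)) * (2 ^ (2 + c + c * k)) ^ (2 * (ℓ + 1) + 1) :=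
        Nat.mul_le_mul h1 (Nat.pow_le_pow_left h2 _)
    _ = 2 ^ (3 * (RAM.wordLength (ℓ + 1) k + 1) + (2 + c + c * k) * (2 * (ℓ + 1) + 1)) := by
        rw [← pow_mul, ← pow_add]
    _ ≤ _ := by
        refine Nat.pow_le_pow_right (by norm_num) ?_
        rw [RAM.wordLength]
        have e1 : 2 * (ℓ + 1) + 1 ≤ 5 * ℓ := by omega
        calc 3 * ((2 * (ℓ + 1) + 1) * (6 * (k + 1) + 5) + 1) + (2 + c + c * k) * (2 * (ℓ + 1) + 1)
            ≤ 3 * ((5 * ℓ) * (6 * (k + 1) + 5) + ℓ) + (2 + c + c * k) * (5 * ℓ) := by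
              gcongr; omega
          _ = _ := by ring

/-- The exponents contain terms linear in `ℓ`. For `k ≥ 1` these are at most a multiple of `ℓ * k`;
for `k = 0` the hypothesis gives `ℓ ≤ c`. A fixed power of `2 ^ (D * (ℓ * k) + D)` has again the
required form. -/
theorem exists_bound (c e : ℕ) : ∃ C, ∀ k ℓ : ℕ, ℓ ≤ c * 2 ^ (c * k) →
    (18 + 2 * ℓ) ^ e ≤ C * 2 ^ (C * (ℓ * k)) ∧
    (k < ℓ → (18 + 2 * ℓ + RAM.fieldBound (ℓ + 1) k) ^ e ≤ C * 2 ^ (C * (ℓ * k))) := by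
  -- With `ℓ ≤ ℓ * k + c`, the exponent to be bounded is at most `(269 + 10 * c) * (ℓ * k) + (6 +
  -- 179 * c + 5 * c ^ 2)`.
  obtain ⟨D, hD⟩ : ∃ D, D = 300 + 200 * c + 5 * c ^ 2 := ⟨_, rfl⟩
  have key : ∀ x k ℓ, x ≤ 2 ^ (D * (ℓ * k) + D) →
      x ^ e ≤ (2 ^ (D * e) + D * e) * 2 ^ ((2 ^ (D * e) + D * e) * (ℓ * k)) := by
    intro x k ℓ hx
    calc x ^ e ≤ (2 ^ (D * (ℓ * k) + D)) ^ e := Nat.pow_le_pow_left hx e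
      _ = 2 ^ (D * e) * 2 ^ ((D * e) * (ℓ * k)) := by rw [← pow_mul, ← pow_add]; congr 1; ring
      _ ≤ _ := Nat.mul_le_mul (Nat.le_add_right _ _)
          (Nat.pow_le_pow_right (by norm_num) (Nat.mul_le_mul_right _ (Nat.le_add_left _ _)))
  refine ⟨2 ^ (D * e) + D * e, fun k ℓ hℓ => ?_⟩
  have hlin : ℓ ≤ ℓ * k + c := by
    rcases Nat.eq_zero_or_pos k with rfl | hk
    · simpa using hℓ
    · exact (Nat.le_mul_of_pos_right ℓ hk).trans (Nat.le_add_right _ _)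
  have hy : 0 ≤ c * (ℓ * k) ∧ 0 ≤ c ^ 2 * (ℓ * k) := ⟨Nat.zero_le _, Nat.zero_le _⟩
  have hx : 18 + 2 * ℓ ≤ 2 ^ (5 + ℓ) := by
    have : ℓ < 2 ^ ℓ := Nat.lt_two_pow_self
    rw [pow_add]; omega
  refine ⟨key _ k ℓ (hx.trans (Nat.pow_le_pow_right (by norm_num) ?_)), fun hk => key _ k ℓ ?_⟩
  · rw [hD]
    generalize ℓ * k = y at hlin hy ⊢
    obtain ⟨y1, y2⟩ := hy
    nlinarith
  · have h1 := fieldBound_le hk hℓ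
    obtain ⟨E, hE⟩ : ∃ E, E = (90 + 5 * c) * (ℓ * k) + (178 + 5 * c) * ℓ := ⟨_, rfl⟩
    rw [← hE] at h1
    have h2 : 5 + ℓ + E + 1 ≤ D * (ℓ * k) + D := by
      have : (179 + 5 * c) * ℓ ≤ (179 + 5 * c) * (ℓ * k + c) := Nat.mul_le_mul_left _ hlin
      rw [hE, hD]
      generalize ℓ * k = y at this hy ⊢
      obtain ⟨y1, y2⟩ := hy
      nlinarith
    refine le_trans ?_ (Nat.pow_le_pow_right (by norm_num) h2)
    have h3 : 2 ^ (5 + ℓ) ≤ 2 ^ (5 + ℓ + E) := Nat.pow_le_pow_right (by norm_num) (by omega)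
    have h4 : 2 ^ E ≤ 2 ^ (5 + ℓ + E) := Nat.pow_le_pow_right (by norm_num) (by omega)
    rw [pow_succ]
    omega

namespace RAM

/-- The complete program: the given path decomposition is copied to the output, and if its width
exceeds `k`, a better one is sought. -/
def pathWidthProgram : Program :=
  .seq scan (.cond (.lt (.reg 1) (.reg 2 - 1)) decideProgram (.setReg 0 1))

theorem exec_pathWidthProgram {n k W : ℕ} {G : SimpleGraph (Fin n)} {nbrs : Fin n → List (Fin n)}
    {P : List (Node n)} (hn : 1 ≤ n) (hA : IsAdjacencyLists G nbrs) (hP : IsPathDecomposition G P)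
    {X₁ X₀ : ℕ} (hX₁ : X₁ = 18 + 2 * width P) (hX₀ : X₀ = X₁ + fieldBound (width P + 1) k)
    (hW₁ : n * X₁ ^ 200 ≤ W) (hW : k < width P → n * (X₀ ^ 100) ^ 200 ≤ W) :
    ∃ t s, Exec (W + k) pathWidthProgram (inputState nbrs k P) t s ∧ t ≤ W ∧ Correct G k s := by
  have hPl := length_pathDecomposition hP
  have hB := bdd_inputState (nbrs := nbrs) hn hA hP
  rw [← hX₁] at hB
  have hR₁ : Roomy n X₁ (W + k) := ⟨hn, by omega, by omega⟩
  obtain ⟨t, s, he, ht, hBs, hF, hs1, hs2⟩ := runs_scan hR₁ (s := inputState nbrs 0 P) rfl rfl rfl hB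
  have h2 : s.reg 2 = width P + 1 := by
    refine eq_width_add_one hn hP (fun j hj => ?_) (hs2.imp_right fun ⟨j, hj, h⟩ => ⟨j, ?_, ?_⟩)
    · rw [← sizeArray_getD hj]; exact (hs1 j (by omega)).2.2.2
    · omega
    · rw [← sizeArray_getD (by omega)]; exact h
  have hinput : inputState nbrs k P = (inputState nbrs 0 P).withReg 1 k := by
    simp only [inputState, State.withReg, State.mk.injEq, and_true]
    funext i
    match i with
    | 0 => rfl
    | 1 => rfl
    | i + 2 => rfl
  have he' := he.withReg (i := 1) (by decide) k
  rw [← hinput] at he'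
  -- The word size `n * X ^ 200` leaves ample room for the running time, which is already below `n *
  -- X ^ 5`.
  have hlarge : ∀ X, 16 ≤ X → n * X ^ 200 ≤ W → 200 * n + 200 + n * X * 7000 ≤ W := by
    intro X hX h
    refine le_trans ?_ h
    have h1 : X ^ 5 ≤ X ^ 200 := Nat.pow_le_pow_right (by omega) (by norm_num)
    have h2 : 16 ^ 4 ≤ X ^ 4 := Nat.pow_le_pow_left hX 4
    calc 200 * n + 200 + n * X * 7000 ≤ n * (X * 16 ^ 4) := by nlinarith
      _ ≤ n * (X * X ^ 4) := by gcongr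
      _ = n * X ^ 5 := by ring
      _ ≤ _ := Nat.mul_le_mul_left _ h1
  have hsmall := hlarge X₁ (by omega) hW₁
  have hXW : X₁ ≤ W := by nlinarith
  -- The comparison with `k` is checked by hand, since `k` itself obeys no bound other than the
  -- allowance `+ k` in the word size.
  have hfit : (Expr.lt (.reg 1) (.reg 2 - 1)).Fits (W + k) (s.withReg 1 k) := by
    have : s.reg 2 ≤ W + k := by omega
    refine ⟨?_, ⟨?_, ?_, ?_⟩, ?_⟩
    · simp [Expr.Fits, State.withReg]
    · simpa [Expr.Fits, State.withReg] using this
    · show 1 ≤ _; omega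
    · show s.reg 2 - 1 ≤ _; omega
    · simp only [Op.eval]; split_ifs <;> omega
  have heval : (Expr.lt (.reg 1) (.reg 2 - 1)).eval (s.withReg 1 k) = if k < width P then 1 else 0 := by
    show (if k < s.reg 2 - 1 then 1 else 0) = _
    rw [h2]; rfl
  have hcost : (Expr.lt (.reg 1) (.reg 2 - 1)).cost = 5 := rfl
  by_cases hk : k < width P
  · have hR : n * (X₀ ^ 100) ^ 200 ≤ W + k := (hW hk).trans (by omega)
    have hX₁₀ : X₁ ≤ X₀ := by omega
    have hr : ∀ i, 1 < i → scan.writesReg i = false → (s.withReg 1 k).reg i = 0 := by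
      intro i hi hw
      have : s.reg i = 0 := by
        rw [hF.reg i hw]
        match i with
        | i + 2 => rfl
      simpa [State.withReg, show i ≠ 1 by omega] using this
    -- In this branch `k` is less than the width of `P`, so register `1` is bounded like all others.
    have hB₀ : Bdd n X₀ (s.withReg 1 k) := by
      refine ⟨fun i => ?_, fun a i => (hBs.mem a i).trans (Nat.mul_le_mul_left _ hX₁₀)⟩
      by_cases hi : i = 1
      · subst hi
        simp only [State.withReg, Function.update_self]
        show k ≤ n ^ 0 * X₀
        rw [pow_zero, one_mul]; omega
      · simp only [State.withReg, Function.update_of_ne hi]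
        exact (hBs.reg i).trans (Nat.mul_le_mul_left _ hX₁₀)
    have hst : Stored nbrs P (s.withReg 1 k) := by
      refine (stored_inputState (nbrs := nbrs) (k := 0)).congr fun a ha => ?_
      show s.mem a = _
      interval_cases a
      · exact hF.mem 0 rfl
      · exact hF.mem 1 rfl
      · exact hF.mem 2 rfl
      · exact hF.mem 3 rfl
    have hzero : ∀ a, 8 ≤ a → ∀ i, (s.withReg 1 k).mem a i = 0 := by
      intro a ha i
      show s.mem a i = 0
      rw [hF.mem a (by simp [scan, scanBody, Program.writesMem]; omega)]
      match a, ha with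
      | a + 5, _ => rfl
    have hrun := runs_decide (m := width P + 1) (k := k) hn (by omega) rfl hR hB₀ hst hA hP
      (card_bag_le P) (by omega) (by omega) ((hF.reg 0 rfl).trans rfl)
      (by simp [State.withReg]) (by simpa [State.withReg] using h2) (hr 7 (by omega) rfl) hzero
    have hX₀₁ : X₀ ≤ X₀ ^ 100 := Nat.le_self_pow (by norm_num) X₀
    have htime := hlarge (X₀ ^ 100) (by linarith) (hW hk)
    have hBX : Bdd n (X₀ ^ 100) (s.withReg 1 k) :=
      ⟨fun i => (hB₀.reg i).trans (Nat.mul_le_mul_left _ hX₀₁),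
        fun a i => (hB₀.mem a i).trans (Nat.mul_le_mul_left _ hX₀₁)⟩
    obtain ⟨t₁, s₁, he₁, ht₁, -, -, hc⟩ := hrun hBX
    exact ⟨_, s₁, .seq he' (.condTrue hfit (by rw [heval, if_pos hk]; exact one_ne_zero) he₁),
      by rw [hcost]; linarith, hc⟩
  · refine ⟨_, _, .seq he' (.condFalse hfit (by rw [heval, if_neg hk]) (.setReg _ 0 1 ?_)), ?_, ?_⟩
    · show 1 ≤ _; omega
    · have : (1 : Expr).cost = 1 := rfl
      rw [hcost, this]; nlinarith
    · refine ⟨fun _ => ⟨rfl, P, hP, by omega, ?_, ?_, ?_⟩,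
        fun h => absurd (pathWidth_le hP (by omega)) h⟩
      · intro i hi
        exact (hs1 i (by rw [← hPl]; simpa [vertexArray] using hi)).1
      · intro i hi
        exact (hs1 i (by rw [← hPl]; simpa [typeArray] using hi)).2.1
      · intro i hi
        exact (hs1 i (by rw [← hPl]; simpa [sizeArray] using hi)).2.2.1

end RAM

theorem theorem1 :
    ∃ prog : RAM.Program, ∀ c : ℕ, ∃ C : ℕ,
      ∀ (n k ℓ : ℕ) (G : SimpleGraph (Fin n)) (nbrs : Fin n → List (Fin n)) (P : List (Node n)),
        1 ≤ n → IsAdjacencyLists G nbrs → IsPathDecomposition G P → width P = ℓ →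
        ℓ ≤ c * 2 ^ (c * k) →
        ∃ (t : ℕ) (s : RAM.State),
          RAM.Exec (timeBound C ℓ k n + k) prog (inputState nbrs k P) t s ∧
          t ≤ timeBound C ℓ k n ∧
          (pathWidth G ≤ k → s.reg 0 = 1 ∧
            ∃ P' : List (Node n), IsPathDecomposition G P' ∧ width P' ≤ k ∧ Outputs s P') ∧
          (¬ pathWidth G ≤ k → s.reg 0 = 0) := by
  refine ⟨RAM.pathWidthProgram, fun c => ?_⟩
  -- The exponent combines the cost of a rule's expressions, at most `100`, with that of arbitrary
  -- tame expressions, at most `200`.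
  obtain ⟨C, hC⟩ := exists_bound c (100 * 200)
  refine ⟨C, fun n k ℓ G nbrs P hn hA hP hw hℓ => ?_⟩
  subst hw
  obtain ⟨h1, h2⟩ := hC k _ hℓ
  refine RAM.exec_pathWidthProgram hn hA hP rfl rfl ?_ fun hk => ?_
  · rw [timeBound, mul_comm]
    exact Nat.mul_le_mul_right _ ((Nat.pow_le_pow_right (by omega) (by norm_num)).trans h1)
  · rw [timeBound, mul_comm, ← pow_mul]
    exact Nat.mul_le_mul_right _ (h2 hk)
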